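/- Let $p$ be a prime and let $K$ be a perfectoid field of characteristic $p$, with ring of integers $K^\circ$. For $n \ge 0$ let $\mathbb{P}^{n}$ be projective space over $K$ as an adic space (the rigid analytic variety), glued from the $n+1$ closed unit polydisks $\mathrm{Spa}(A_i, A_i^\circ)$, $A_i = K\langle T_a/T_i : a \ne i\rangle$, and let $\mathbb{P}^{n,\mathrm{perf}}$ be projectivoid space over $K$, glued in the same way from the perfectoid polydisks with $A_i = K\langle (T_a/T_i)^{1/p^\infty} : a \neq i\rangle$. Each of the two carries the line bundle $\mathcal{O}(1)$ with its global sections $T_0, \dots, T_n$. Let $X$ be a perfectoid space over $K$, and consider pairs $(\mathcal{L}; s_0, \dots, s_n)$ of a line bundle $\mathcal{L}$ on $X$ and global sections $s_0, \dots, s_n$ that generate $\mathcal{L}$, up to isomorphisms of line bundles that match the sections. Then $$\varphi \mapsto (\varphi^*\mathcal{O}(1);\ \varphi^*T_0, \dots, \varphi^*T_n)$$ defines a bijection from the set of morphisms $X \to \mathbb{P}^{n,\mathrm{perf}}$ over $K$ onto the set of isomorphism classes of such pairs, and the same formula defines a bijection from the set of morphisms $X \to \mathbb{P}^{n}$ over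 $K$ onto the same set. Both bijections are natural in $X$. Hence a morphism $X \to \mathbb{P}^{n,\mathrm{perf}}$ over $K$ is equivalent to a line bundle on $X$ with $n+1$ generating global sections, and equivalently to a morphism $X \to \mathbb{P}^n$ over $K$. -/

import Mathlib

open CategoryTheory Opposite TopologicalSpace Topology AlgebraicGeometry
open scoped NNReal
set_option linter.unusedSectionVars false
universe u

namespace AddMonoidAlgebra
variable {K : Type*} [NormedField K] [IsUltrametricDist K] {M : Type*} [AddCommMonoid M]

/-- The Gauss norm `max ‖f_m‖` of a finite sum `∑ f_m X^m`. -/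
noncomputable def gauss (f : AddMonoidAlgebra K M) : ℝ≥0 :=
  f.coeff.support.sup fun m => ‖f.coeff m‖₊

theorem gauss_le_iff (f : AddMonoidAlgebra K M) (C : ℝ≥0) :
    f.gauss ≤ C ↔ ∀ m, ‖f.coeff m‖₊ ≤ C := by
  rw [gauss, Finset.sup_le_iff]
  refine ⟨fun h m => ?_, fun h m _ => h m⟩
  by_cases hm : m ∈ f.coeff.support
  · exact h m hm
  · rw [Finsupp.notMem_support_iff.1 hm]; simp

theorem le_gauss (f : AddMonoidAlgebra K M) (m : M) : ‖f.coeff m‖₊ ≤ f.gauss :=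
  (gauss_le_iff f _).1 le_rfl m

theorem gauss_add_le (f g : AddMonoidAlgebra K M) : (f + g).gauss ≤ f.gauss + g.gauss := by
  rw [gauss_le_iff]
  intro m
  exact (nnnorm_add_le _ _).trans (add_le_add (le_gauss f m) (le_gauss g m))

theorem gauss_mul_le (f g : AddMonoidAlgebra K M) : (f * g).gauss ≤ f.gauss * g.gauss := by
  classical
  rw [gauss_le_iff]
  intro m
  rw [coeff_mul]
  refine IsUltrametricDist.nnnorm_sum_le_of_forall_le fun a _ =>
    IsUltrametricDist.nnnorm_sum_le_of_forall_le fun b _ => ?_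
  dsimp only
  split_ifs
  · rw [nnnorm_mul]
    exact mul_le_mul' (le_gauss f a) (le_gauss g b)
  · simp

noncomputable instance : NormedCommRing (AddMonoidAlgebra K M) :=
  { (RingNorm.toNormedRing
      { toFun := fun f : AddMonoidAlgebra K M => (f.gauss : ℝ)
        map_zero' := by simp [gauss]
        add_le' := fun f g => by exact_mod_cast gauss_add_le f g
        neg' := fun f => by simp [gauss]
        mul_le' := fun f g => by exact_mod_cast gauss_mul_le f g
        eq_zero_of_map_eq_zero' := fun f hf => by
          have h : f.gauss = 0 := by exact_mod_cast hf
          ext m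
          simpa [h] using le_gauss f m }) with
    mul_comm := mul_comm }

noncomputable instance : NormedAlgebra K (AddMonoidAlgebra K M) where
  norm_smul_le a f := by
    change ((a • f).gauss : ℝ) ≤ ‖a‖ * (f.gauss : ℝ)
    have : (a • f).gauss ≤ ‖a‖₊ * f.gauss := by
      rw [gauss_le_iff]
      intro m
      simpa using mul_le_mul_right (le_gauss f m) ‖a‖₊
    exact_mod_cast this

end AddMonoidAlgebra

section Bounded
variable {A : Type*} [CommRing A] [TopologicalSpace A]

/-- Boundedness of a subset of a topological ring. -/
def IsBoundedSubset (S : Set A) : Prop :=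
  ∀ U ∈ 𝓝 (0 : A), ∃ V ∈ 𝓝 (0 : A), ∀ v ∈ V, ∀ s ∈ S, v * s ∈ U

/-- `a` is power-bounded: its set of powers is bounded. -/
def IsPowerBounded (a : A) : Prop :=
  IsBoundedSubset (Set.range fun k : ℕ => a ^ k)

end Bounded

/-- A point of `Spa(A, S)`: an equivalence class of valuations of `A` (recorded by the relation
`|a(x)| ≤ |b(x)|`) that is continuous and at most `1` on `S`. -/
structure SpaPoint (A : Type u) [CommRing A] [TopologicalSpace A] (S : Set A) where
  rel : ValuativeRel A
  isOpen_lt : ∀ γ : @ValuativeRel.ValueGroupWithZero A _ rel,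
    IsOpen {a : A | @ValuativeRel.valuation A _ rel a < γ}
  le_one : ∀ a ∈ S, rel.vle a 1

/-- The data `(t₁, …, tₘ; g)` of a rational subset `{x : |tᵢ(x)| ≤ |g(x)| ≠ 0 for all i}`, with
`t₁, …, tₘ` generating the unit ideal. -/
structure RationalDatum (A : Type u) [CommRing A] where
  T : Finset A
  g : A
  span_eq_top : Ideal.span (T : Set A) = ⊤

namespace SpaPoint
variable {A : Type u} [CommRing A] [TopologicalSpace A] {S : Set A} (x : SpaPoint A S)

/-- The valuation of `A` defined by a point. -/
noncomputable def v : Valuation A (@ValuativeRel.ValueGroupWithZero A _ x.rel) :=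
  @ValuativeRel.valuation A _ x.rel

theorem v_le_iff (a b : A) : x.v a ≤ x.v b ↔ x.rel.vle a b :=
  letI := x.rel
  (Valuation.Compatible.vle_iff_le (v := ValuativeRel.valuation A) a b).symm

/-- The residue field of a point. -/
def ResidueField : Type u := FractionRing (A ⧸ x.v.supp)

noncomputable instance : Field x.ResidueField :=
  inferInstanceAs (Field (FractionRing (A ⧸ x.v.supp)))

noncomputable instance : Algebra (A ⧸ x.v.supp) x.ResidueField :=
  inferInstanceAs (Algebra (A ⧸ x.v.supp) (FractionRing (A ⧸ x.v.supp)))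

instance : IsFractionRing (A ⧸ x.v.supp) x.ResidueField :=
  inferInstanceAs (IsFractionRing (A ⧸ x.v.supp) (FractionRing (A ⧸ x.v.supp)))

/-- The map from `A` to the residue field of a point. -/
noncomputable def toResidue : A →+* x.ResidueField :=
  (algebraMap (A ⧸ x.v.supp) x.ResidueField).comp (Ideal.Quotient.mk _)

theorem le_primeCompl : nonZeroDivisors (A ⧸ x.v.supp) ≤ (x.v.onQuot le_rfl).supp.primeCompl := by
  intro a ha h
  have h0 : a ∈ (x.v.onQuot le_rfl).supp := h
  rw [Valuation.supp_quot_supp] at h0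
  exact nonZeroDivisors.ne_zero ha h0

/-- The valuation of the residue field of a point. -/
noncomputable def residueValuation :
    Valuation x.ResidueField (@ValuativeRel.ValueGroupWithZero A _ x.rel) :=
  (x.v.onQuot le_rfl).extendToLocalization x.le_primeCompl x.ResidueField

theorem residueValuation_toResidue (a : A) : x.residueValuation (x.toResidue a) = x.v a :=
  Valuation.extendToLocalization_apply_map_apply _ _ _ _

noncomputable instance : Valued x.ResidueField (@ValuativeRel.ValueGroupWithZero A _ x.rel) :=
  Valued.mk' x.residueValuation

instance : NonarchimedeanRing x.ResidueField :=
  x.residueValuation.subgroups_basis.nonarchimedean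

theorem mem_nhds_zero_iff (s : Set x.ResidueField) : s ∈ 𝓝 (0 : x.ResidueField) ↔
    ∃ γ : (MonoidWithZeroHom.ValueGroup₀ (.ofClass x.residueValuation))ˣ,
      {a | x.residueValuation a < MonoidWithZeroHom.ValueGroup₀.embedding γ.1} ⊆ s := by
  rw [Valued.mem_nhds_zero]
  simp only [Valuation.restrict_lt_iff_lt_embedding]
  rfl

/-- The completed residue field of a point. -/
abbrev CompletedResidueField : Type u := UniformSpace.Completion x.ResidueField

theorem continuous_toResidue [IsTopologicalRing A] : Continuous x.toResidue := by
  refine continuous_of_continuousAt_zero x.toResidue fun s hs => ?_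
  rw [map_zero, mem_nhds_zero_iff] at hs
  obtain ⟨γ, hγ⟩ := hs
  refine Filter.mem_map.2 <| Filter.mem_of_superset ((x.isOpen_lt (MonoidWithZeroHom.ValueGroup₀.embedding γ.1)).mem_nhds
    ?_) fun a ha => hγ ?_
  · change x.v 0 < _
    rw [map_zero, zero_lt_iff, map_ne_zero]
    exact γ.ne_zero
  · change x.residueValuation (x.toResidue a) < _
    rw [residueValuation_toResidue]
    exact ha

theorem isPowerBounded_of_le_one (a : x.ResidueField) (ha : x.residueValuation a ≤ 1) :
    IsPowerBounded a := by
  intro U hU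
  rw [mem_nhds_zero_iff] at hU
  obtain ⟨γ, hγ⟩ := hU
  refine ⟨_, (x.mem_nhds_zero_iff _).2 ⟨γ, subset_rfl⟩, ?_⟩
  rintro b hb _ ⟨k, rfl⟩
  refine hγ ?_
  change x.residueValuation (b * a ^ k) < _
  rw [map_mul, map_pow]
  exact (mul_le_of_le_one_right' (pow_le_one₀ zero_le ha)).trans_lt hb

end SpaPoint

namespace RationalDatum
variable {A : Type u} [CommRing A] [TopologicalSpace A] (D : RationalDatum A)

/-- The rational subset of `Spa(A, S)` given by a rational datum. -/
def set (S : Set A) : Set (SpaPoint A S) :=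
  {x | ∀ t ∈ D.T, x.rel.vle t D.g}

/-- The ring `A[1/g]`. -/
def Loc : Type u := Localization.Away D.g

noncomputable instance : CommRing D.Loc := inferInstanceAs (CommRing (Localization.Away D.g))

noncomputable instance : Algebra A D.Loc :=
  inferInstanceAs (Algebra A (Localization.Away D.g))

instance : IsLocalization.Away D.g D.Loc :=
  inferInstanceAs (IsLocalization.Away D.g (Localization.Away D.g))

/-- The fraction `t / g` in `A[1/g]`. -/
noncomputable def frac (t : A) : D.Loc :=
  IsLocalization.mk' D.Loc t (⟨D.g, Submonoid.mem_powers _⟩ : Submonoid.powers D.g)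

/-- The non-archimedean ring topologies on `A[1/g]` for which `A → A[1/g]` is continuous and the
fractions `t / g` are power-bounded. -/
def topologies : Set (TopologicalSpace D.Loc) :=
  {τ | @NonarchimedeanRing D.Loc _ τ ∧ Continuous[_, τ] (algebraMap A D.Loc) ∧
    ∀ t ∈ D.T, @IsPowerBounded D.Loc _ τ (D.frac t)}

/-- The localization topology on `A(T/g) = A[1/g]`: the finest non-archimedean ring topology for
which `A → A[1/g]` is continuous and the fractions `t / g` are power-bounded. -/
@[reducible]
def locTopology : TopologicalSpace D.Loc := sInf D.topologies

theorem isTopologicalRing_loc : @IsTopologicalRing D.Loc D.locTopology _ := by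
  let := D.locTopology
  have h1 : ContinuousAdd D.Loc :=
    continuousAdd_sInf fun τ hτ => letI := τ; haveI := hτ.1.1; inferInstance
  have h2 : ContinuousMul D.Loc :=
    continuousMul_sInf fun τ hτ => letI := τ; haveI := hτ.1.1; inferInstance
  have h3 : ContinuousNeg D.Loc :=
    continuousNeg_sInf fun τ hτ => letI := τ; haveI := hτ.1.1; inferInstance
  exact { }

noncomputable instance : UniformSpace D.Loc :=
  letI := D.locTopology
  haveI := D.isTopologicalRing_loc
  IsTopologicalAddGroup.rightUniformSpace D.Loc

instance : IsTopologicalRing D.Loc := D.isTopologicalRing_loc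

instance : IsUniformAddGroup D.Loc :=
  letI := D.locTopology
  haveI := D.isTopologicalRing_loc
  isUniformAddGroup_of_addCommGroup

theorem continuous_algebraMap : Continuous (algebraMap A D.Loc) :=
  continuous_sInf_rng.2 fun _ hτ => hτ.2.1

theorem frac_mul (t : A) : D.frac t * algebraMap A D.Loc D.g = algebraMap A D.Loc t :=
  IsLocalization.mk'_spec D.Loc t _

theorem isUnit_g : IsUnit (algebraMap A D.Loc D.g) :=
  IsLocalization.Away.algebraMap_isUnit D.g

/-- The universal property of the localization topology. -/
theorem continuous_of_isPowerBounded {B : Type*} [CommRing B] [TopologicalSpace B]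
    [NonarchimedeanRing B] (f : D.Loc →+* B) (hf : Continuous (f.comp (algebraMap A D.Loc)))
    (hT : ∀ t ∈ D.T, IsPowerBounded (f (D.frac t))) : Continuous f := by
  let τ : TopologicalSpace D.Loc := TopologicalSpace.induced f inferInstance
  have hτ : τ ∈ D.topologies := by
    have hc : Continuous[τ, _] f := continuous_induced_dom
    refine ⟨?_, ?_, ?_⟩
    · have h1 : @ContinuousMul D.Loc τ _ := continuousMul_induced f
      have h2 : @IsTopologicalAddGroup D.Loc τ _ := topologicalAddGroup_induced f
      refine @NonarchimedeanRing.mk D.Loc _ τ { } fun U hU => ?_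
      rw [nhds_induced, map_zero] at hU
      obtain ⟨W, hW, hWU⟩ := hU
      obtain ⟨V, hV⟩ := NonarchimedeanRing.is_nonarchimedean W hW
      exact ⟨@OpenAddSubgroup.comap D.Loc _ τ B _ _ f.toAddMonoidHom hc V,
        fun a ha => hWU (hV ha)⟩
    · exact continuous_induced_rng.2 hf
    · intro t ht U hU
      rw [nhds_induced, map_zero] at hU
      obtain ⟨W, hW, hWU⟩ := hU
      obtain ⟨V, hV, h⟩ := hT t ht W hW
      refine ⟨f ⁻¹' V, ?_, ?_⟩
      · rw [nhds_induced, map_zero]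
        exact Filter.preimage_mem_comap hV
      · rintro v hv _ ⟨k, rfl⟩
        refine hWU ?_
        change f (v * _ ^ k) ∈ W
        rw [map_mul, map_pow]
        exact h _ hv _ ⟨k, rfl⟩
  exact continuous_sInf_dom hτ continuous_induced_dom

/-- The ring `A⟨T/g⟩`, the completion of `A(T/g)`. -/
abbrev Completed : Type u := UniformSpace.Completion D.Loc

/-- The structure map `A → A⟨T/g⟩`. -/
noncomputable def toCompleted : A →+* D.Completed :=
  UniformSpace.Completion.coeRingHom.comp (algebraMap A D.Loc)

theorem continuous_toCompleted : Continuous D.toCompleted :=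
  (UniformSpace.Completion.continuous_coe _).comp D.continuous_algebraMap

end RationalDatum

namespace RationalDatum
variable {A : Type u} [CommRing A] [TopologicalSpace A] (D : RationalDatum A)

theorem v_g_ne_zero {S : Set A} {x : SpaPoint A S} (hx : x ∈ D.set S) : x.v D.g ≠ 0 := by
  intro h
  have hT : ∀ t ∈ D.T, x.v t = 0 := fun t ht =>
    le_antisymm (h ▸ (x.v_le_iff t D.g).2 (hx t ht)) zero_le
  have h1 : Ideal.span (D.T : Set A) ≤ x.v.supp := Ideal.span_le.2 fun t ht => hT t ht
  rw [D.span_eq_top] at h1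
  have h2 : x.v 1 = 0 := h1 (Submodule.mem_top (x := (1 : A)))
  simp at h2

/-- The map `A[1/g] → κ(x)` for a point `x` of the rational subset. -/
noncomputable def locToResidue {S : Set A} {x : SpaPoint A S} (hx : x ∈ D.set S) :
    D.Loc →+* x.ResidueField :=
  IsLocalization.Away.lift D.g (g := x.toResidue) <| by
    refine isUnit_iff_ne_zero.2 fun h => D.v_g_ne_zero hx ?_
    rw [← x.residueValuation_toResidue, h, map_zero]

theorem locToResidue_algebraMap {S : Set A} {x : SpaPoint A S} (hx : x ∈ D.set S) (a : A) :
    D.locToResidue hx (algebraMap A D.Loc a) = x.toResidue a :=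
  IsLocalization.Away.lift_eq _ _ _

theorem continuous_locToResidue [IsTopologicalRing A] {S : Set A} {x : SpaPoint A S}
    (hx : x ∈ D.set S) : Continuous (D.locToResidue hx) := by
  refine D.continuous_of_isPowerBounded _ ?_ fun t ht => x.isPowerBounded_of_le_one _ ?_
  · refine x.continuous_toResidue.congr fun a => ?_
    exact (D.locToResidue_algebraMap hx a).symm
  · have h := congrArg (fun a => x.residueValuation (D.locToResidue hx a)) (D.frac_mul t)
    simp only [map_mul, locToResidue_algebraMap, x.residueValuation_toResidue] at h
    have h0 := D.v_g_ne_zero hx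
    have h1 : x.v t ≤ x.v D.g := (x.v_le_iff t D.g).2 (hx t ht)
    rw [← h] at h1
    exact le_of_mul_le_mul_right (by simpa using h1) (zero_lt_iff.2 h0)

/-- Evaluation `A⟨T/g⟩ → κ̂(x)` at a point `x` of the rational subset. -/
noncomputable def eval [IsTopologicalRing A] {S : Set A} {x : SpaPoint A S} (hx : x ∈ D.set S) :
    D.Completed →+* x.CompletedResidueField :=
  UniformSpace.Completion.mapRingHom (D.locToResidue hx) (D.continuous_locToResidue hx)

theorem eval_toCompleted [IsTopologicalRing A] {S : Set A} {x : SpaPoint A S} (hx : x ∈ D.set S)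
    (a : A) : D.eval hx (D.toCompleted a) = (x.toResidue a : x.CompletedResidueField) := by
  rw [eval, toCompleted, RingHom.comp_apply]
  refine (UniformSpace.Completion.mapRingHom_coe (D.continuous_locToResidue hx) _).trans ?_
  rw [locToResidue_algebraMap]

/-- `A⟨T/g⟩ → A⟨T'/gh⟩` when `T'` contains all `th` with `t ∈ T`. -/
noncomputable def locMap {D E : RationalDatum A} {h : A} (hg : E.g = D.g * h) : D.Loc →+* E.Loc :=
  IsLocalization.Away.lift D.g (g := algebraMap A E.Loc) <|
    isUnit_of_dvd_unit (map_dvd _ (hg ▸ dvd_mul_right D.g h)) E.isUnit_g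

theorem locMap_algebraMap {D E : RationalDatum A} {h : A} (hg : E.g = D.g * h) (a : A) :
    locMap hg (algebraMap A D.Loc a) = algebraMap A E.Loc a :=
  IsLocalization.Away.lift_eq _ _ _

theorem locMap_frac {D E : RationalDatum A} {h : A} (hg : E.g = D.g * h) (t : A) :
    locMap hg (D.frac t) = E.frac (t * h) := by
  refine E.isUnit_g.mul_left_injective ?_
  dsimp only
  rw [frac_mul, ← locMap_algebraMap hg, hg, map_mul, map_mul, ← mul_assoc, ← map_mul, frac_mul,
    locMap_algebraMap, locMap_algebraMap, map_mul]

theorem continuous_locMap {D E : RationalDatum A} {h : A} (hg : E.g = D.g * h)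
    (hT : ∀ t ∈ D.T, t * h ∈ E.T) : Continuous (locMap hg : D.Loc →+* E.Loc) := by
  refine continuous_sInf_rng.2 fun τ hτ => ?_
  have := hτ.1
  refine D.continuous_of_isPowerBounded _ ?_ fun t ht => ?_
  · exact hτ.2.1.congr fun a => (locMap_algebraMap hg a).symm
  · rw [locMap_frac]
    exact hτ.2.2 _ (hT t ht)

/-- The restriction map `A⟨T/g⟩ → A⟨T'/gh⟩` when `T'` contains all `th` with `t ∈ T`. -/
noncomputable def completedMap {D E : RationalDatum A} {h : A} (hg : E.g = D.g * h)
    (hT : ∀ t ∈ D.T, t * h ∈ E.T) : D.Completed →+* E.Completed :=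
  UniformSpace.Completion.mapRingHom (locMap hg) (continuous_locMap hg hT)

theorem continuous_completedMap {D E : RationalDatum A} {h : A} (hg : E.g = D.g * h)
    (hT : ∀ t ∈ D.T, t * h ∈ E.T) : Continuous (completedMap hg hT) :=
  UniformSpace.Completion.continuous_map

theorem completedMap_toCompleted {D E : RationalDatum A} {h : A} (hg : E.g = D.g * h)
    (hT : ∀ t ∈ D.T, t * h ∈ E.T) (a : A) :
    completedMap hg hT (D.toCompleted a) = E.toCompleted a := by
  refine (UniformSpace.Completion.mapRingHom_coe (continuous_locMap hg hT) _).trans ?_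
  rw [locMap_algebraMap]
  rfl

theorem eval_completedMap [IsTopologicalRing A] {D E : RationalDatum A} {h : A}
    (hg : E.g = D.g * h) (hT : ∀ t ∈ D.T, t * h ∈ E.T) {S : Set A} {x : SpaPoint A S}
    (hD : x ∈ D.set S) (hE : x ∈ E.set S) (f : D.Completed) :
    E.eval hE (completedMap hg hT f) = D.eval hD f := by
  induction f using UniformSpace.Completion.induction_on with
  | hp =>
    exact isClosed_eq (UniformSpace.Completion.continuous_map.comp
      UniformSpace.Completion.continuous_map) UniformSpace.Completion.continuous_map
  | ih f =>
    refine (congrArg _ (UniformSpace.Completion.mapRingHom_coe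
      (continuous_locMap hg hT) f)).trans ?_
    refine (UniformSpace.Completion.mapRingHom_coe (E.continuous_locToResidue hE) _).trans ?_
    refine Eq.trans ?_ (UniformSpace.Completion.mapRingHom_coe
      (D.continuous_locToResidue hD) f).symm
    refine congrArg _ ?_
    have : (E.locToResidue hE).comp (locMap hg) = D.locToResidue hD := by
      refine IsLocalization.ringHom_ext (Submonoid.powers D.g) (RingHom.ext fun a => ?_)
      simp [locMap_algebraMap, locToResidue_algebraMap]
    exact congrArg (fun F => F f) this

open Classical in
/-- The intersection of two rational subsets. -/
noncomputable def inter (D E : RationalDatum A) : RationalDatum A where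
  T := Finset.image₂ (· * ·) (insert D.g D.T) (insert E.g E.T)
  g := D.g * E.g
  span_eq_top := by
    rw [Finset.coe_image₂, Set.image2_mul, ← Ideal.span_mul_span']
    have h (F : RationalDatum A) : Ideal.span ((insert F.g F.T : Finset A) : Set A) = ⊤ := by
      rw [eq_top_iff, ← F.span_eq_top]
      exact Ideal.span_mono (by simp)
    rw [h, h, Ideal.top_mul]

theorem inter_set (D E : RationalDatum A) (S : Set A) :
    (D.inter E).set S = D.set S ∩ E.set S := by
  classical
  ext x
  constructor
  · intro hx
    have h0 := v_g_ne_zero _ hx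
    change x.v (D.g * E.g) ≠ 0 at h0
    rw [map_mul] at h0
    have h : ∀ s ∈ insert D.g D.T, ∀ t ∈ insert E.g E.T, x.v s * x.v t ≤ x.v D.g * x.v E.g := by
      intro s hs t ht
      rw [← map_mul, ← map_mul]
      exact (x.v_le_iff _ _).2 (hx _ (Finset.mem_image₂_of_mem hs ht))
    refine ⟨fun t ht => (x.v_le_iff _ _).1 ?_, fun t ht => (x.v_le_iff _ _).1 ?_⟩
    · exact le_of_mul_le_mul_right (h t (Finset.mem_insert_of_mem ht) _ (Finset.mem_insert_self _ _))
        (zero_lt_iff.2 (right_ne_zero_of_mul h0))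
    · exact le_of_mul_le_mul_left (h _ (Finset.mem_insert_self _ _) t (Finset.mem_insert_of_mem ht))
        (zero_lt_iff.2 (left_ne_zero_of_mul h0))
  · rintro ⟨hD, hE⟩ t ht
    obtain ⟨a, ha, b, hb, rfl⟩ := Finset.mem_image₂.1 ht
    rw [← x.v_le_iff]
    change x.v (a * b) ≤ x.v (D.g * E.g)
    rw [map_mul, map_mul]
    refine mul_le_mul' ?_ ?_
    · rcases Finset.mem_insert.1 ha with rfl | ha
      · exact le_rfl
      · exact (x.v_le_iff _ _).2 (hD a ha)
    · rcases Finset.mem_insert.1 hb with rfl | hb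
      · exact le_rfl
      · exact (x.v_le_iff _ _).2 (hE b hb)

/-- The rational subset which is the whole space. -/
def univ (A : Type u) [CommRing A] : RationalDatum A where
  T := {1}
  g := 1
  span_eq_top := by simp

theorem univ_set (S : Set A) : (univ A).set S = Set.univ := by
  refine Set.eq_univ_of_forall fun x t ht => ?_
  rw [Finset.mem_singleton.1 ht, ← x.v_le_iff]
  exact le_rfl

end RationalDatum

/-- The topology of `Spa(A, S)` is generated by the rational subsets. -/
instance {A : Type u} [CommRing A] [TopologicalSpace A] {S : Set A} :
    TopologicalSpace (SpaPoint A S) :=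
  TopologicalSpace.generateFrom (Set.range fun D : RationalDatum A => D.set S)

theorem SpaPoint.exists_rational {A : Type u} [CommRing A] [TopologicalSpace A] {S : Set A}
    {U : Set (SpaPoint A S)} (hU : IsOpen U) {x : SpaPoint A S} (hx : x ∈ U) :
    ∃ D : RationalDatum A, x ∈ D.set S ∧ D.set S ⊆ U := by
  induction hU with
  | basic s hs => obtain ⟨D, rfl⟩ := hs; exact ⟨D, hx, subset_rfl⟩
  | univ => exact ⟨.univ A, by simp [RationalDatum.univ_set], Set.subset_univ _⟩
  | inter s t _ _ hs ht =>
    obtain ⟨D, hD, hDs⟩ := hs hx.1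
    obtain ⟨E, hE, hEt⟩ := ht hx.2
    refine ⟨D.inter E, ?_, ?_⟩ <;> rw [RationalDatum.inter_set]
    · exact ⟨hD, hE⟩
    · exact Set.inter_subset_inter hDs hEt
  | sUnion s _ hs =>
    obtain ⟨t, ht, hxt⟩ := hx
    obtain ⟨D, hD, hDt⟩ := hs t ht hxt
    exact ⟨D, hD, hDt.trans (Set.subset_sUnion_of_mem ht)⟩

/-- A topological space over a non-archimedean field `K` with a presheaf of topological rings and,
at every point `x`, an equivalence class of valuations of the stalk. The latter is recorded by
compatible valuative relations `|f(x)| ≤ |g(x)|` on the rings of sections over the neighbourhoods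
of `x`. The structure over `Spa(K, K°)` is a continuous ring map from `K` to the global sections
which sends `K°` to functions that are bounded by `1`. -/
structure PreAdicSpace (K : Type u) [NormedField K] extends
    PresheafedSpace.{u, u + 1, u} TopCommRingCat.{u} where
  val : ∀ (U : Opens carrier) (x : carrier), x ∈ U → ValuativeRel (presheaf.obj (op U))
  val_res : ∀ {U V : Opens carrier} (i : V ⟶ U) (x : carrier) (hx : x ∈ V)
    (f g : presheaf.obj (op U)),
    (val V x hx).vle (presheaf.map i.op f) (presheaf.map i.op g) ↔
      (val U x (i.le hx)).vle f g
  base : K →+* presheaf.obj (op ⊤)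
  continuous_base : Continuous base
  base_le_one : ∀ a : K, ‖a‖ ≤ 1 → ∀ x, (val ⊤ x trivial).vle (base a) 1

/-- Morphisms over `K`: continuous maps together with continuous ring maps on sections that are
compatible with restrictions, with the valuations and with the maps from `K`. -/
@[ext]
structure PreAdicSpace.Hom {K : Type u} [NormedField K] (X Y : PreAdicSpace K) where
  hom : X.toPresheafedSpace ⟶ Y.toPresheafedSpace
  val_iff : ∀ (U : Opens Y.carrier) (x : X.carrier) (hx : hom.base x ∈ U)
    (f g : Y.presheaf.obj (op U)),
    (X.val ((Opens.map hom.base).obj U) x hx).vle (hom.c.app (op U) f) (hom.c.app (op U) g) ↔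
      (Y.val U (hom.base x) hx).vle f g
  map_base : ∀ a : K, hom.c.app (op ⊤) (Y.base a) = X.base a

/-- Composition of morphisms. -/
def PreAdicSpace.Hom.comp {K : Type u} [NormedField K] {X Y Z : PreAdicSpace K}
    (φ : PreAdicSpace.Hom X Y) (ψ : PreAdicSpace.Hom Y Z) : PreAdicSpace.Hom X Z where
  hom := φ.hom ≫ ψ.hom
  val_iff U x hx f g :=
    (φ.val_iff ((Opens.map ψ.hom.base).obj U) x hx _ _).trans (ψ.val_iff U _ hx f g)
  map_base a := (congrArg _ (ψ.map_base a)).trans (φ.map_base a)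

/-- Charts `Spa(Aᵢ, Sᵢ)` over `K`, with an equivalence relation that tells which of their points
are glued, and relations `a = c / b` with `a ∈ Aⱼ` and `b, c ∈ Aᵢ` that describe the change of
coordinates on the overlap of the charts `i` and `j`. -/
structure GluingData (K : Type u) [NormedField K] where
  ι : Type
  A : ι → Type u
  [ring : ∀ i, CommRing (A i)]
  [top : ∀ i, TopologicalSpace (A i)]
  [topRing : ∀ i, IsTopologicalRing (A i)]
  [alg : ∀ i, Algebra K (A i)]
  continuous_algebraMap : ∀ i, Continuous (algebraMap K (A i))
  S : ∀ i, Set (A i)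
  algebraMap_mem : ∀ i (a : K), ‖a‖ ≤ 1 → algebraMap K (A i) a ∈ S i
  glue : Setoid (Σ i, SpaPoint (A i) (S i))
  coordChange : ∀ i j, Set (A j × A i × A i)
  coordChange_self : ∀ i, ∀ t ∈ coordChange i i, t.1 * t.2.1 = t.2.2

namespace GluingData
variable {K : Type u} [NormedField K] (G : GluingData K)

attribute [instance] ring top topRing alg

/-- The space obtained by gluing, with the quotient topology. -/
def Points : Type u := Quotient G.glue

instance : TopologicalSpace G.Points := inferInstanceAs (TopologicalSpace (Quotient G.glue))

/-- The rational subsets of the charts. -/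
abbrev Rational : Type u := Σ i, RationalDatum (G.A i)

variable {G}

/-- A rational subset of a chart as a subset of the glued space. -/
def Rational.image (a : G.Rational) : Set G.Points :=
  {y | ∃ x ∈ a.2.set (G.S a.1), (Quotient.mk G.glue ⟨a.1, x⟩ : G.Points) = y}

/-- The completed ring of a rational subset of a chart. -/
abbrev Rational.ring (a : G.Rational) : Type u := a.2.Completed

/-- `ρ` is a restriction map from the rational subset `b` of the chart `j` to the rational
subset `a` of the chart `i`: a continuous map of `K`-algebras which changes coordinates as
prescribed. -/
structure IsRestriction (a b : G.Rational) (ρ : b.ring →+* a.ring) : Prop where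
  continuous : Continuous ρ
  map_algebraMap : ∀ k : K, ρ (b.2.toCompleted (algebraMap K _ k)) =
    a.2.toCompleted (algebraMap K _ k)
  map_coord : ∀ t ∈ G.coordChange a.1 b.1,
    ρ (b.2.toCompleted t.1) * a.2.toCompleted t.2.1 = a.2.toCompleted t.2.2

/-- The rational subsets of the charts that are contained in `U`. -/
abbrev RationalIn (U : Opens G.Points) : Type u := {a : G.Rational // a.image ⊆ U}

variable (G)


/-- Families `(f_a)`, `a` running through the rational subsets of the charts in `U`, with
`f_b|_a * c i j = f_a` whenever `a ⊆ b`, where `a` lies in the chart `i` and `b` in the chart `j`: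
the sections over `U` of the line bundle with the cocycle `c`. -/
def twisted (c : ∀ i, G.ι → G.A i) (U : Opens G.Points) :
    AddSubgroup (∀ a : RationalIn U, a.1.ring) where
  carrier := {f | ∀ a b : RationalIn U, a.1.image ⊆ b.1.image → ∀ ρ, IsRestriction a.1 b.1 ρ →
    ρ (f b) * a.1.2.toCompleted (c a.1.1 b.1.1) = f a}
  zero_mem' a b _ ρ _ := by simp
  add_mem' hf hg a b h ρ hρ := by
    rw [Pi.add_apply, Pi.add_apply, map_add, add_mul, hf a b h ρ hρ, hg a b h ρ hρ]
  neg_mem' hf a b h ρ hρ := by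
    rw [Pi.neg_apply, Pi.neg_apply, map_neg, neg_mul, hf a b h ρ hρ]

/-- The functions on `U`: the projective limit of the rings of the rational subsets of the charts
that are contained in `U`. -/
def sections (U : Opens G.Points) : Subring (∀ a : RationalIn U, a.1.ring) where
  carrier := {f | ∀ a b : RationalIn U, a.1.image ⊆ b.1.image → ∀ ρ, IsRestriction a.1 b.1 ρ →
    ρ (f b) = f a}
  zero_mem' a b _ ρ _ := by simp
  one_mem' a b _ ρ _ := by simp
  add_mem' hf hg a b h ρ hρ := by
    rw [Pi.add_apply, Pi.add_apply, map_add, hf a b h ρ hρ, hg a b h ρ hρ]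
  mul_mem' hf hg a b h ρ hρ := by
    rw [Pi.mul_apply, Pi.mul_apply, map_mul, hf a b h ρ hρ, hg a b h ρ hρ]
  neg_mem' hf a b h ρ hρ := by
    rw [Pi.neg_apply, Pi.neg_apply, map_neg, hf a b h ρ hρ]

variable {G}

/-- Restriction of functions. -/
def res {U V : Opens G.Points} (h : V ≤ U) : G.sections U →+* G.sections V where
  toFun f := ⟨fun a => f.1 ⟨a.1, a.2.trans h⟩,
    fun a b hab ρ hρ => f.2 ⟨a.1, a.2.trans h⟩ ⟨b.1, b.2.trans h⟩ hab ρ hρ⟩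
  map_zero' := rfl
  map_one' := rfl
  map_add' _ _ := rfl
  map_mul' _ _ := rfl

theorem continuous_res {U V : Opens G.Points} (h : V ≤ U) : Continuous (res h) :=
  Continuous.subtype_mk
    (continuous_pi fun a => (continuous_apply (⟨a.1, a.2.trans h⟩ : RationalIn U)).comp
      continuous_subtype_val) _

variable (G)

/-- The constant functions. -/
noncomputable def const : K →+* G.sections ⊤ where
  toFun k := ⟨fun a => a.1.2.toCompleted (algebraMap K _ k), fun _ _ _ _ hρ => hρ.map_algebraMap k⟩
  map_zero' := Subtype.ext (funext fun a => by simp)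
  map_one' := Subtype.ext (funext fun a => by simp)
  map_add' _ _ := Subtype.ext (funext fun a => by simp)
  map_mul' _ _ := Subtype.ext (funext fun a => by simp)

theorem continuous_const : Continuous G.const :=
  Continuous.subtype_mk (continuous_pi fun a =>
    a.1.2.continuous_toCompleted.comp (G.continuous_algebraMap _)) _

variable {G}

/-- A chart containing the given point, and the point in this chart. -/
noncomputable def rep (y : G.Points) : Σ i, SpaPoint (G.A i) (G.S i) := Quotient.out y

theorem mk_rep (y : G.Points) : (Quotient.mk G.glue (rep y) : G.Points) = y := Quotient.out_eq y

theorem continuous_chart (i : G.ι) :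
    Continuous fun x : SpaPoint (G.A i) (G.S i) => (Quotient.mk G.glue ⟨i, x⟩ : G.Points) :=
  continuous_quotient_mk'.comp continuous_sigmaMk

theorem exists_rational {U : Opens G.Points} {y : G.Points} (hy : y ∈ U) :
    ∃ D : RationalDatum (G.A (rep y).1), (rep y).2 ∈ D.set (G.S _) ∧
      Rational.image (G := G) ⟨_, D⟩ ⊆ U := by
  obtain ⟨D, hD, h⟩ := SpaPoint.exists_rational (U.isOpen.preimage (continuous_chart (rep y).1))
    (x := (rep y).2) (by
      change (Quotient.mk G.glue (rep y) : G.Points) ∈ U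
      rwa [mk_rep])
  refine ⟨D, hD, ?_⟩
  rintro _ ⟨x, hx, rfl⟩
  exact h hx

theorem isRestriction_completedMap {i : G.ι} {D E : RationalDatum (G.A i)} {h : G.A i}
    (hg : E.g = D.g * h) (hT : ∀ t ∈ D.T, t * h ∈ E.T) :
    IsRestriction (G := G) ⟨i, E⟩ ⟨i, D⟩ (RationalDatum.completedMap hg hT) where
  continuous := RationalDatum.continuous_completedMap hg hT
  map_algebraMap _ := RationalDatum.completedMap_toCompleted hg hT _
  map_coord t ht := by
    rw [RationalDatum.completedMap_toCompleted, ← map_mul, G.coordChange_self i t ht]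

/-- The component of a function at a rational subset of a chart. -/
def component {U : Opens G.Points} (a : RationalIn U) : G.sections U →+* a.1.ring where
  toFun f := f.1 a
  map_zero' := rfl
  map_one' := rfl
  map_add' _ _ := rfl
  map_mul' _ _ := rfl

/-- The value of a function at a point, in the completed residue field. -/
noncomputable def evalAt {U : Opens G.Points} {y : G.Points} (hy : y ∈ U) :
    G.sections U →+* (rep y).2.CompletedResidueField :=
  ((exists_rational hy).choose.eval (exists_rational hy).choose_spec.1).comp
    (component ⟨⟨(rep y).1, (exists_rational hy).choose⟩, (exists_rational hy).choose_spec.2⟩)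

theorem evalAt_eq {U : Opens G.Points} {y : G.Points} (hy : y ∈ U) (D : RationalDatum (G.A (rep y).1))
    (hD : (rep y).2 ∈ D.set (G.S _)) (hDU : Rational.image (G := G) ⟨_, D⟩ ⊆ U)
    (f : G.sections U) : evalAt hy f = D.eval hD (f.1 ⟨⟨_, D⟩, hDU⟩) := by
  classical
  obtain ⟨hE, hEU⟩ := (exists_rational hy).choose_spec
  change (exists_rational hy).choose.eval hE (f.1 ⟨⟨_, (exists_rational hy).choose⟩, hEU⟩) = _
  generalize (exists_rational hy).choose = E at hE hEU
  have hI : (rep y).2 ∈ (D.inter E).set (G.S _) := by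
    rw [RationalDatum.inter_set]
    exact ⟨hD, hE⟩
  have h1 : Rational.image (G := G) ⟨_, D.inter E⟩ ⊆ Rational.image (G := G) ⟨_, D⟩ := by
    rintro _ ⟨x, hx, rfl⟩
    rw [RationalDatum.inter_set] at hx
    exact ⟨x, hx.1, rfl⟩
  have h2 : Rational.image (G := G) ⟨_, D.inter E⟩ ⊆ Rational.image (G := G) ⟨_, E⟩ := by
    rintro _ ⟨x, hx, rfl⟩
    rw [RationalDatum.inter_set] at hx
    exact ⟨x, hx.2, rfl⟩
  have hT1 : ∀ t ∈ D.T, t * E.g ∈ (D.inter E).T := fun t ht =>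
    Finset.mem_image₂_of_mem (Finset.mem_insert_of_mem ht) (Finset.mem_insert_self _ _)
  have hT2 : ∀ t ∈ E.T, t * D.g ∈ (D.inter E).T := fun t ht => by
    rw [mul_comm]
    exact Finset.mem_image₂_of_mem (Finset.mem_insert_self _ _) (Finset.mem_insert_of_mem ht)
  have e1 := f.2 ⟨⟨_, D.inter E⟩, h1.trans hDU⟩ ⟨⟨_, D⟩, hDU⟩ h1 _
    (isRestriction_completedMap (G := G) (D := D) (E := D.inter E) rfl hT1)
  have e2 := f.2 ⟨⟨_, D.inter E⟩, h1.trans hDU⟩ ⟨⟨_, E⟩, hEU⟩ h2 _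
    (isRestriction_completedMap (G := G) (D := E) (E := D.inter E) (mul_comm _ _) hT2)
  rw [← RationalDatum.eval_completedMap (E := D.inter E) rfl hT1 hD hI,
    ← RationalDatum.eval_completedMap (E := D.inter E) (mul_comm _ _) hT2 hE hI]
  exact congrArg _ (e2.trans e1.symm)

theorem evalAt_res {U V : Opens G.Points} (h : V ≤ U) {y : G.Points} (hy : y ∈ V)
    (f : G.sections U) : evalAt hy (res h f) = evalAt (h hy) f := by
  obtain ⟨D, hD, hDV⟩ := exists_rational hy
  rw [evalAt_eq hy D hD hDV, evalAt_eq (h hy) D hD (hDV.trans h)]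
  rfl

/-- The valuation of the functions on `U` at a point of `U`. -/
@[reducible]
noncomputable def valAt {U : Opens G.Points} {y : G.Points} (hy : y ∈ U) :
    ValuativeRel (G.sections U) :=
  ValuativeRel.ofValuation
    ((Valued.v : Valuation (rep y).2.CompletedResidueField _).comap (evalAt hy))

theorem valAt_res {U V : Opens G.Points} (h : V ≤ U) {y : G.Points} (hy : y ∈ V)
    (f g : G.sections U) :
    (valAt hy).vle (res h f) (res h g) ↔ (valAt (h hy)).vle f g := by
  change Valued.v (evalAt hy (res h f)) ≤ Valued.v (evalAt hy (res h g)) ↔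
    Valued.v (evalAt (h hy) f) ≤ Valued.v (evalAt (h hy) g)
  rw [evalAt_res, evalAt_res]

theorem valAt_const (a : K) (ha : ‖a‖ ≤ 1) (y : G.Points) :
    (valAt (U := ⊤) (y := y) trivial).vle (G.const a) 1 := by
  change Valued.v (evalAt (U := ⊤) trivial (G.const a)) ≤ Valued.v (evalAt (U := ⊤) trivial 1)
  obtain ⟨D, hD, hDV⟩ := exists_rational (G := G) (U := ⊤) (y := y) trivial
  rw [map_one, map_one, evalAt_eq (U := ⊤) trivial D hD hDV]
  refine (congrArg _ (D.eval_toCompleted hD (algebraMap K _ a))).trans_le ?_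
  rw [Valued.valuedCompletion_apply]
  refine ((rep y).2.residueValuation_toResidue _).trans_le ?_
  rw [← map_one (rep y).2.v, SpaPoint.v_le_iff]
  exact (rep y).2.le_one _ (G.algebraMap_mem _ a ha)

variable (G)

/-- The structure presheaf of the glued space. -/
noncomputable def structurePresheaf : (TopCat.of G.Points).Presheaf TopCommRingCat.{u} where
  obj U := TopCommRingCat.of (G.sections U.unop)
  map i := ⟨res i.unop.le, continuous_res _⟩
  map_id _ := rfl
  map_comp _ _ := rfl

/-- The space obtained by gluing the charts. -/
noncomputable def space : PreAdicSpace K where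
  carrier := TopCat.of G.Points
  presheaf := G.structurePresheaf
  val _ _ hy := valAt hy
  val_res i _ hy f g := valAt_res i.le hy f g
  base := G.const
  continuous_base := G.continuous_const
  base_le_one a ha y := valAt_const a ha y

end GluingData

/-- The gluing data with the single chart `Spa(A, S)`. -/
def GluingData.single {K : Type u} [NormedField K] (A : Type u) [CommRing A] [TopologicalSpace A]
    [IsTopologicalRing A] [Algebra K A] (hA : Continuous (algebraMap K A)) (S : Set A)
    (hS : ∀ a : K, ‖a‖ ≤ 1 → algebraMap K A a ∈ S) : GluingData K where
  ι := Unit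
  A _ := A
  continuous_algebraMap _ := hA
  S _ := S
  algebraMap_mem _ := hS
  glue := ⊥
  coordChange _ _ := Set.range fun a : A => (a, 1, a)
  coordChange_self := by
    rintro _ _ ⟨a, rfl⟩
    exact mul_one a

/-- `K` is a perfectoid field with residue characteristic `p`. -/
structure IsPerfectoidField (p : ℕ) (K : Type u) [NormedField K] : Prop where
  ultrametric : IsUltrametricDist K
  complete : CompleteSpace K
  norm_p_lt_one : ‖(p : K)‖ < 1
  nondiscrete : ∀ r : ℝ, r < 1 → ∃ x : K, r < ‖x‖ ∧ ‖x‖ < 1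
  frobenius : ∀ x : K, ‖x‖ ≤ 1 → ∃ y : K, ‖x - y ^ p‖ ≤ ‖(p : K)‖

/-- A perfectoid affinoid `K`-algebra `(R, R⁺)` over `(K, K°)`: a complete topological
`K`-algebra `R` such that `R°` is open and bounded and the Frobenius of `R°/ϖ` is surjective,
with an open and integrally closed subring `R⁺ ⊆ R°`. -/
structure PerfectoidAffinoidAlgebra (p : ℕ) (K : Type u) [NormedField K] where
  R : Type u
  [ring : CommRing R]
  [unif : UniformSpace R]
  [unifGroup : IsUniformAddGroup R]
  [nonarch : NonarchimedeanRing R]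
  [complete : CompleteSpace R]
  [t2 : T2Space R]
  [alg : Algebra K R]
  continuous_algebraMap : Continuous (algebraMap K R)
  isOpen_powerBounded : IsOpen {a : R | IsPowerBounded a}
  isBounded_powerBounded : IsBoundedSubset {a : R | IsPowerBounded a}
  frobenius : ∃ ϖ : K, ϖ ≠ 0 ∧ ‖(p : K)‖ ≤ ‖ϖ‖ ∧ ‖ϖ‖ < 1 ∧
    ∀ a : R, IsPowerBounded a → ∃ b c : R, IsPowerBounded b ∧ IsPowerBounded c ∧
      a = b ^ p + algebraMap K R ϖ * c
  plus : Subring R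
  isOpen_plus : IsOpen (plus : Set R)
  isPowerBounded_of_mem_plus : ∀ a ∈ plus, IsPowerBounded a
  mem_plus_of_isIntegral : ∀ a : R, IsIntegral plus a → a ∈ plus
  algebraMap_mem_plus : ∀ a : K, ‖a‖ ≤ 1 → algebraMap K R a ∈ plus

attribute [instance] PerfectoidAffinoidAlgebra.ring PerfectoidAffinoidAlgebra.unif
  PerfectoidAffinoidAlgebra.unifGroup PerfectoidAffinoidAlgebra.nonarch
  PerfectoidAffinoidAlgebra.alg

/-- The space `Spa(R, R⁺)` over `K` with its structure presheaf. -/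
noncomputable def PerfectoidAffinoidAlgebra.spa {p : ℕ} {K : Type u} [NormedField K]
    (P : PerfectoidAffinoidAlgebra p K) : PreAdicSpace K :=
  (GluingData.single P.R P.continuous_algebraMap (P.plus : Set P.R) P.algebraMap_mem_plus).space

/-- A perfectoid space over `K`: its structure presheaf is a sheaf of topological rings, and it
is covered by open subspaces of the form `Spa(R, R⁺)` with `(R, R⁺)` perfectoid. -/
structure PerfectoidSpace (p : ℕ) (K : Type u) [NormedField K] extends PreAdicSpace K where
  isSheaf : presheaf.IsSheaf
  exists_chart : ∀ x : carrier, ∃ (P : PerfectoidAffinoidAlgebra p K)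
    (j : PreAdicSpace.Hom P.spa toPreAdicSpace),
    PresheafedSpace.IsOpenImmersion j.hom ∧ x ∈ Set.range j.hom.base

namespace ProjectiveSpace
variable (K : Type u) [NormedField K] [IsUltrametricDist K] (n : ℕ)
  (E : Type) [AddCommMonoid E]

/-- The completion `K⟨X_a^e : a ≠ i, e ∈ E⟩` for the Gauss norm of the algebra of finite sums of
monomials with exponents in `E`. It is the Tate algebra in `n` variables if `E = ℕ`, and the
perfectoid Tate algebra if `E = ℤ[1/p]_{≥0}`. -/
abbrev Chart (i : Fin (n + 1)) : Type u :=
  UniformSpace.Completion (AddMonoidAlgebra K ({a : Fin (n + 1) // a ≠ i} → E))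

variable {n E}

/-- Dehomogenization `T_a^e ↦ (T_a / T_i)^e`. -/
noncomputable def dehom (i : Fin (n + 1)) :
    AddMonoidAlgebra K (Fin (n + 1) → E) →+* Chart K n E i :=
  UniformSpace.Completion.coeRingHom.comp
    (AddMonoidAlgebra.mapDomainRingHom K
      ({ toFun := fun m a => m a.1, map_zero' := rfl, map_add' := fun _ _ => rfl } :
        (Fin (n + 1) → E) →+ ({a : Fin (n + 1) // a ≠ i} → E)))

/-- The monomial `T_a^e`. -/
noncomputable def monomial (a : Fin (n + 1)) (e : E) : AddMonoidAlgebra K (Fin (n + 1) → E) :=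
  AddMonoidAlgebra.single (Pi.single a e) 1

variable {K} in
/-- `F` is homogeneous of degree `d`. -/
def IsHomogeneous (F : AddMonoidAlgebra K (Fin (n + 1) → E)) (d : E) : Prop :=
  ∀ m ∈ F.coeff.support, ∑ a, m a = d

theorem dehom_monomial_self (i : Fin (n + 1)) (e : E) : dehom K i (monomial K i e) = 1 := by
  classical
  have h : (fun b : {a : Fin (n + 1) // a ≠ i} => (Pi.single i e : Fin (n + 1) → E) b.1) = 0 :=
    funext fun b => Pi.single_eq_of_ne (M := fun _ => E) b.2 e
  have h1 : AddMonoidAlgebra.mapDomain (R := K)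
      (fun (m : Fin (n + 1) → E) (b : {a : Fin (n + 1) // a ≠ i}) => m b.1) (monomial K i e) = 1 := by
    rw [monomial, AddMonoidAlgebra.mapDomain_single, h]
    rfl
  exact (congrArg _ h1).trans (UniformSpace.Completion.coe_one _)

theorem isPowerBounded_algebraMap (i : Fin (n + 1)) (a : K) (ha : ‖a‖ ≤ 1) :
    IsPowerBounded (algebraMap K (Chart K n E i) a) := by
  intro U hU
  obtain ⟨ε, hε, h⟩ := Metric.mem_nhds_iff.1 hU
  refine ⟨Metric.ball 0 ε, Metric.ball_mem_nhds _ hε, ?_⟩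
  rintro v hv _ ⟨k, rfl⟩
  refine h ?_
  dsimp only
  rw [mem_ball_zero_iff] at hv ⊢
  rw [← map_pow, mul_comm, ← Algebra.smul_def]
  refine (norm_smul_le _ _).trans_lt (lt_of_le_of_lt ?_ hv)
  rw [norm_pow]
  exact mul_le_of_le_one_left (norm_nonneg _) (pow_le_one₀ (norm_nonneg _) ha)

variable (n E)

/-- Projective space is glued from the polydisks `Spa(Aᵢ, Aᵢ°)` with coordinates `T_a / T_i`.
Two points are glued if their valuations agree on the fractions `F / G` with `F` and `G`
homogeneous of the same degree; the change of coordinates from the chart `j` to the chart `i` is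
`(T_a / T_j)^e = (T_a / T_i)^e / (T_j / T_i)^e`. -/
noncomputable def gluingData : GluingData K where
  ι := Fin (n + 1)
  A i := Chart K n E i
  continuous_algebraMap i := algebraMapCLM K (Chart K n E i) |>.continuous
  S i := {f | IsPowerBounded f}
  algebraMap_mem i a ha := isPowerBounded_algebraMap K i a ha
  glue :=
    { r := fun x y => ∀ (d : E) (F G : AddMonoidAlgebra K (Fin (n + 1) → E)),
        IsHomogeneous F d → IsHomogeneous G d →
          (x.2.rel.vle (dehom K x.1 F) (dehom K x.1 G) ↔
            y.2.rel.vle (dehom K y.1 F) (dehom K y.1 G))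
      iseqv :=
        { refl := fun _ _ _ _ _ _ => Iff.rfl
          symm := fun h d F G hF hG => (h d F G hF hG).symm
          trans := fun h h' d F G hF hG => (h d F G hF hG).trans (h' d F G hF hG) } }
  coordChange i j := Set.range fun t : Fin (n + 1) × E =>
    (dehom K j (monomial K t.1 t.2), dehom K i (monomial K j t.2), dehom K i (monomial K t.1 t.2))
  coordChange_self := by
    rintro i _ ⟨t, rfl⟩
    change _ * dehom K i (monomial K i t.2) = _
    rw [dehom_monomial_self, mul_one]

end ProjectiveSpace

namespace PreAdicSpace
variable {K : Type u} [NormedField K]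

/-- The structure presheaf as a presheaf of rings. -/
noncomputable abbrev ringPresheaf (X : PreAdicSpace K) : (Opens X.carrier)ᵒᵖ ⥤ RingCat.{u} :=
  X.presheaf ⋙ forget₂ TopCommRingCat CommRingCat ⋙ forget₂ CommRingCat RingCat

/-- Pushforward of presheaves of modules along a morphism. -/
noncomputable def pushforward {X Y : PreAdicSpace K} (φ : Hom X Y) :
    PresheafOfModules.{u} X.ringPresheaf ⥤ PresheafOfModules.{u} Y.ringPresheaf :=
  PresheafOfModules.pushforward (F := Opens.map φ.hom.base)
    (Functor.whiskerRight φ.hom.c (forget₂ TopCommRingCat CommRingCat ⋙ forget₂ CommRingCat RingCat))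

/-- A presheaf of modules with `n + 1` global sections. -/
structure ModuleWithSections (n : ℕ) (X : PreAdicSpace K) where
  M : PresheafOfModules.{u} X.ringPresheaf
  s : Fin (n + 1) → M.obj (op ⊤)

/-- A sheaf of modules `L`, locally free of rank one, with `n + 1` global sections which
generate it. -/
structure GeneratedLineBundle (n : ℕ) (X : PreAdicSpace K) extends ModuleWithSections n X where
  isSheaf : TopCat.Presheaf.IsSheaf M.presheaf
  locallyFree : ∀ x : X.carrier, ∃ U : Opens X.carrier, x ∈ U ∧ ∃ e : M.obj (op U),
    ∀ (V : Opens X.carrier) (i : V ⟶ U), Function.Bijective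
      fun a : X.ringPresheaf.obj (op V) => (a • (M.map i.op e : M.obj (op V)) : M.obj (op V))
  generated : ∀ (U : Opens X.carrier) (m : M.obj (op U)), ∀ x ∈ U,
    ∃ (V : Opens X.carrier) (i : V ⟶ U), x ∈ V ∧ ∃ a : Fin (n + 1) → X.ringPresheaf.obj (op V),
      (M.map i.op m : M.obj (op V)) =
        ∑ j, (a j • (M.map (homOfLE (le_top : V ≤ ⊤)).op (s j) : M.obj (op V)) : M.obj (op V))

/-- Two line bundles with generating sections are isomorphic. -/
instance GeneratedLineBundle.setoid (n : ℕ) (X : PreAdicSpace K) :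
    Setoid (GeneratedLineBundle n X) where
  r L L' := ∃ f : L.M ≅ L'.M, ∀ j, f.hom.app (op ⊤) (L.s j) = L'.s j
  iseqv :=
    { refl := fun L => ⟨Iso.refl _, fun _ => rfl⟩
      symm := by
        rintro L L' ⟨f, hf⟩
        refine ⟨f.symm, fun j => ?_⟩
        rw [← hf j]
        exact congrArg (fun g => PresheafOfModules.Hom.app g (op ⊤) (L.s j)) f.hom_inv_id
      trans := by
        rintro L L' L'' ⟨f, hf⟩ ⟨g, hg⟩
        refine ⟨f ≪≫ g, fun j => ?_⟩
        rw [← hg j, ← hf j]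
        rfl }

/-- The isomorphism classes of line bundles on `X` with `n + 1` generating global sections. -/
def LineBundleClasses (n : ℕ) (X : PreAdicSpace K) : Type (u + 1) :=
  Quotient (GeneratedLineBundle.setoid n X)

/-- The isomorphism class of a line bundle with generating sections. -/
def LineBundleClasses.mk {n : ℕ} {X : PreAdicSpace K} (L : GeneratedLineBundle n X) :
    LineBundleClasses n X :=
  Quotient.mk (GeneratedLineBundle.setoid n X) L

/-- The sheaf of modules `M` with its sections is the pullback of `N` with its sections along `φ`:
there is a map `N ⟶ φ_* M` which matches the sections and is universal among the maps from `N` to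
pushforwards of sheaves of modules, that is, `Hom(M, M') = Hom(N, φ_* M')`. -/
def IsPullback {n : ℕ} {X Y : PreAdicSpace K} (φ : Hom X Y) (N : ModuleWithSections n Y)
    (M : ModuleWithSections n X) : Prop :=
  TopCat.Presheaf.IsSheaf M.M.presheaf ∧ ∃ η : N.M ⟶ (pushforward φ).obj M.M,
    (∀ M' : PresheafOfModules.{u} X.ringPresheaf, TopCat.Presheaf.IsSheaf M'.presheaf →
      Function.Bijective fun f : M.M ⟶ M' => η ≫ (pushforward φ).map f) ∧
    ∀ j, η.app (op ⊤) (N.s j) = M.s j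

end PreAdicSpace

namespace GluingData
variable {K : Type u} [NormedField K] (G : GluingData K)

noncomputable instance (c : ∀ i, G.ι → G.A i) (U : Opens G.Points) : SMul (G.sections U) (G.twisted c U) where
  smul f h := ⟨fun a => f.1 a * h.1 a, fun a b hab ρ hρ => by
    rw [map_mul, mul_assoc, f.2 a b hab ρ hρ, h.2 a b hab ρ hρ]⟩

noncomputable instance twistedModuleStructure (c : ∀ i, G.ι → G.A i) (U : Opens G.Points) :
    Module (G.sections U) (G.twisted c U) where
  one_smul h := Subtype.ext (funext fun a => one_mul (h.1 a))
  mul_smul f g h := Subtype.ext (funext fun a => mul_assoc (f.1 a) (g.1 a) (h.1 a))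
  smul_zero f := Subtype.ext (funext fun a => mul_zero (f.1 a))
  smul_add f g h := Subtype.ext (funext fun a => mul_add (f.1 a) (g.1 a) (h.1 a))
  add_smul f g h := Subtype.ext (funext fun a => add_mul (f.1 a) (g.1 a) (h.1 a))
  zero_smul h := Subtype.ext (funext fun a => zero_mul (h.1 a))

/-- The sections over `U` of the module given by a cocycle. -/
noncomputable def twistedObj (c : ∀ i, G.ι → G.A i) (U : (Opens G.space.carrier)ᵒᵖ) :
    ModuleCat.{u} (G.space.ringPresheaf.obj U) :=
  @ModuleCat.of (G.space.ringPresheaf.obj U) _ (G.twisted c U.unop) _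
    (G.twistedModuleStructure c U.unop)

/-- The presheaf of modules on the glued space given by the cocycle `c`. -/
noncomputable def twistedModule (c : ∀ i, G.ι → G.A i) :
    PresheafOfModules.{u} G.space.ringPresheaf where
  obj U := G.twistedObj c U
  map {U V} i := ModuleCat.ofHom (X := G.twistedObj c U)
    (Y := (ModuleCat.restrictScalars (G.space.ringPresheaf.map i).hom).obj (G.twistedObj c V))
    { toFun := fun h : G.twisted c U.unop => (⟨fun a => h.1 ⟨a.1, a.2.trans i.unop.le⟩,
        fun a b hab ρ hρ =>
          h.2 ⟨a.1, a.2.trans i.unop.le⟩ ⟨b.1, b.2.trans i.unop.le⟩ hab ρ hρ⟩ :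
            G.twisted c V.unop)
      map_add' := fun _ _ => rfl
      map_smul' := fun _ _ => rfl }
  map_id _ := rfl
  map_comp _ _ := rfl

/-- A global section of the module given by a cocycle. -/
noncomputable def twistedSection {c : ∀ i, G.ι → G.A i} (h : G.twisted c ⊤) :
    (G.twistedModule c).obj (op ⊤) :=
  h

end GluingData

namespace ProjectiveSpace
variable (K : Type u) [NormedField K] [IsUltrametricDist K] (n : ℕ)
  (E : Type) [AddCommMonoid E]

/-- Projective space over `K`, with the exponents of the coordinates in `E`. -/
noncomputable def space : PreAdicSpace K := (gluingData K n E).space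

variable {n E} in
theorem map_dehom {r t : (gluingData K n E).Rational} {ρ : t.ring →+* r.ring}
    (hρ : GluingData.IsRestriction r t ρ) (a : Fin (n + 1)) (e : E) :
    ρ (t.2.toCompleted (dehom K t.1 (monomial K a e))) *
      r.2.toCompleted (dehom K r.1 (monomial K t.1 e)) =
        r.2.toCompleted (dehom K r.1 (monomial K a e)) :=
  hρ.map_coord (dehom K t.1 (monomial K a e), dehom K r.1 (monomial K t.1 e),
    dehom K r.1 (monomial K a e)) ⟨(a, e), rfl⟩

variable {E} in
/-- The section `T_a` of `O(1)`. With respect to the generator `T_i` over the chart `i` it is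
`T_a / T_i`. -/
noncomputable def coord (one : E) (a : Fin (n + 1)) :
    (gluingData K n E).twisted (fun i j => dehom K i (monomial K j one)) ⊤ :=
  ⟨fun r => r.1.2.toCompleted (dehom K r.1.1 (monomial K a one)),
    fun _ _ _ _ hρ => map_dehom K hρ a one⟩

variable {E} in
/-- The line bundle `O(1)`, with the global sections `T_0, …, T_n`. With respect to the generators
`T_i` over the charts `i`, it is given by the cocycle `T_j / T_i`. -/
noncomputable def O1 (one : E) : PreAdicSpace.ModuleWithSections n (space K n E) where
  M := (gluingData K n E).twistedModule fun i j => dehom K i (monomial K j one)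
  s a := (gluingData K n E).twistedSection (coord K n one a)

end ProjectiveSpace

/-- The monoid `ℤ[1/p]_{≥0}`. -/
def PerfExponents (p : ℕ) : AddSubmonoid ℚ≥0 :=
  AddSubmonoid.closure (Set.range fun m : ℕ => 1 / (p : ℚ≥0) ^ m)

/-- The exponent `1` in `ℤ[1/p]_{≥0}`. -/
def PerfExponents.one (p : ℕ) : PerfExponents p :=
  ⟨1, AddSubmonoid.subset_closure ⟨0, by simp⟩⟩

/-- Classical projective space `ℙⁿ` over `K` as an adic space. -/
noncomputable def RigidProjectiveSpace (K : Type u) [NormedField K] [IsUltrametricDist K] (n : ℕ) :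
    PreAdicSpace K :=
  ProjectiveSpace.space K n ℕ

/-- Projectivoid space `ℙ^{n,perf}` over `K`. -/
noncomputable def ProjectivoidSpace (p : ℕ) (K : Type u) [NormedField K] [IsUltrametricDist K]
    (n : ℕ) : PreAdicSpace K :=
  ProjectiveSpace.space K n (PerfExponents p)

/-- The line bundle `O(1)` on `ℙⁿ` with the sections `T_0, …, T_n`. -/
noncomputable def RigidProjectiveSpace.O1 (K : Type u) [NormedField K] [IsUltrametricDist K]
    (n : ℕ) : PreAdicSpace.ModuleWithSections n (RigidProjectiveSpace K n) :=
  ProjectiveSpace.O1 K n (1 : ℕ)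

/-- The line bundle `O(1)` on `ℙ^{n,perf}` with the sections `T_0, …, T_n`. -/
noncomputable def ProjectivoidSpace.O1 (p : ℕ) (K : Type u) [NormedField K] [IsUltrametricDist K]
    (n : ℕ) : PreAdicSpace.ModuleWithSections n (ProjectivoidSpace p K n) :=
  ProjectiveSpace.O1 K n (PerfExponents.one p)

/-!
Morphisms from a perfectoid space `X` of characteristic `p` to either of the two projective spaces,
and line bundles on `X` with `n + 1` generating sections, are the same kind of data: homogeneous
coordinates, which are functions `f_{ij}` on the members `U_i` of an open cover of `X` which behave
like `T_j / T_i`, that is, `|f_{ij}| ≤ 1`, `f_{ii} = 1` and `f_{jk} f_{ij} = f_{ik}` (`ProjData`).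

The two targets are treated at once. Both are `ProjectiveSpace.space K n E`, where `E` is the monoid
of the exponents of the variables, `ℕ` or the non-negative elements of `ℤ[1/p]`. A homomorphism from
the ring of the chart `i` to a complete ring `B` is a continuous homomorphism from `K` with a system
of powers in `B`, indexed by `E`, for each `T_a / T_i`, whose products are bounded. If the Frobenius
of `B` is bijective, such a system is determined by its value at the exponent `1`, whichever of the
two monoids `E` is (`PerfExponents.hasUniquePowers`). This is why the two sets of morphisms agree.
The functions on a small open subset of `X` form such a ring: a localization of a perfectoid ring of
characteristic `p` is again perfect (`RationalDatum.isPerfectTate_completed`), and a family of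
`p`-th roots on rational subsets is compatible because `p`-th roots are unique.

The gluing rests on two facts about a complete Tate ring. They concern the continuous valuations
which are at most `1` on power-bounded elements: an element which vanishes at none of them is a unit
(`exists_rel_of_not_isUnit`), and an element which is at most `1` at all of them is power-bounded
(`exists_rel_of_not_isPowerBounded`). Applied to rational localizations of the charts, they give the
change of coordinates on the subset `|T_j / T_i| ≥ 1` of the chart `i` (`exists_coordChange`), and
so the openness of the images of rational subsets and the restriction maps between them. Applied to
small open subsets of `X`, they show that functions without zeros are units and, as a perfect Tate
ring is uniform, that the functions which are at most `1` form a bounded set (`IsFunctionRing`).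
Hence homogeneous coordinates on `X` extend to homomorphisms from the charts and from their rational
localizations. The values at the points of `X` define a continuous map, the homomorphisms glue, and
every system of homogeneous coordinates comes from exactly one morphism
(`ProjData.exists_isRealizedBy`, `ProjData.IsRealizedBy.unique`).

On the side of line bundles, near every point one of the generating sections, say `s_i`, is largest;
it is a basis there, and the quotients `s_j / s_i` are homogeneous coordinates
(`GeneratedLineBundle.exists_projData`). A morphism `φ` has these homogeneous coordinates if and
only if `s_j = φ^*(T_j / T_i) s_i` on the preimage of the chart `i`
(`isCompatible_iff_isRealizedBy`), and this holds if and only if the line bundle is a pullback of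
`O(1)` with its sections. For the latter, semilinear maps to a sheaf are given by compatible images
of local bases (`SemilinearMap.exists_of_basis`), and a semilinear map which takes local bases to
local bases has the universal property of the pullback (`SemilinearMap.bijective_comp`). Every
morphism has such a line bundle, glued from its homogeneous coordinates (`ProjData.lineBundle`). So
the class of the pullback of `O(1)` is a bijection from morphisms to isomorphism classes
(`bijective_pullbackClass`), and naturality holds because the relation `s_j = φ^*(T_j / T_i) s_i`
can be pulled back (`IsCompatible.comp`).
-/


/-! ### Bounded sets and power-bounded elements -/

section Boundedness
variable {B : Type*} [CommRing B] [TopologicalSpace B]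

theorem IsBoundedSubset.mono {S T : Set B} (h : IsBoundedSubset T) (hST : S ⊆ T) :
    IsBoundedSubset S := by
  intro U hU
  obtain ⟨V, hV, H⟩ := h U hU
  exact ⟨V, hV, fun v hv s hs => H v hv s (hST hs)⟩

theorem IsBoundedSubset.mul {S T R : Set B} (hS : IsBoundedSubset S) (hT : IsBoundedSubset T)
    (hR : ∀ r ∈ R, ∃ s ∈ S, ∃ t ∈ T, s * t = r) : IsBoundedSubset R := by
  intro U hU
  obtain ⟨V, hV, H⟩ := hT U hU
  obtain ⟨W, hW, H'⟩ := hS V hV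
  refine ⟨W, hW, fun w hw r hr => ?_⟩
  obtain ⟨s, hs, t, ht, rfl⟩ := hR r hr
  rw [← mul_assoc]
  exact H _ (H' w hw s hs) t ht

theorem IsBoundedSubset.union {S T : Set B} (hS : IsBoundedSubset S) (hT : IsBoundedSubset T) :
    IsBoundedSubset (S ∪ T) := by
  intro U hU
  obtain ⟨V, hV, H⟩ := hS U hU
  obtain ⟨W, hW, H'⟩ := hT U hU
  refine ⟨V ∩ W, Filter.inter_mem hV hW, fun v hv s hs => ?_⟩
  rcases hs with hs | hs
  · exact H v hv.1 s hs
  · exact H' v hv.2 s hs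

theorem IsBoundedSubset.singleton [ContinuousMul B] (b : B) : IsBoundedSubset ({b} : Set B) := by
  intro U hU
  have hc : ContinuousAt (fun v : B => v * b) 0 := (continuous_mul_const b).continuousAt
  refine ⟨_, hc (by simpa using hU), fun v hv s hs => ?_⟩
  rw [Set.mem_singleton_iff.1 hs]
  exact hv

theorem isPowerBounded_iff_powers (a : B) :
    IsPowerBounded a ↔ IsBoundedSubset (Submonoid.powers a : Set B) := by
  rw [Submonoid.coe_powers]; rfl

theorem isPowerBounded_of_mem {M : Submonoid B} (hM : IsBoundedSubset (M : Set B)) {a : B}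
    (ha : a ∈ M) : IsPowerBounded a := by
  rw [isPowerBounded_iff_powers]
  exact hM.mono (Submonoid.powers_le.2 ha)

theorem IsBoundedSubset.sup {M N : Submonoid B} (hM : IsBoundedSubset (M : Set B))
    (hN : IsBoundedSubset (N : Set B)) : IsBoundedSubset ((M ⊔ N : Submonoid B) : Set B) :=
  hM.mul hN fun _ hr => by
    obtain ⟨s, hs, t, ht, h⟩ := Submonoid.mem_sup.1 hr
    exact ⟨s, hs, t, ht, h⟩

theorem isBoundedSubset_closure_finset (T : Finset B) (hT : ∀ t ∈ T, IsPowerBounded t)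
    {M : Submonoid B} (hM : IsBoundedSubset (M : Set B)) :
    IsBoundedSubset ((M ⊔ Submonoid.closure (T : Set B) : Submonoid B) : Set B) := by
  classical
  induction T using Finset.induction_on with
  | empty => simpa using hM
  | insert a T ha ih =>
    have h1 := ih fun t ht => hT t (Finset.mem_insert_of_mem ht)
    have h2 := h1.sup ((isPowerBounded_iff_powers a).1 (hT a (Finset.mem_insert_self _ _)))
    refine h2.mono ?_
    rw [Finset.coe_insert, Set.insert_eq, Submonoid.closure_union, ← Submonoid.powers_eq_closure]
    exact (by rw [sup_assoc, sup_comm (Submonoid.powers a)] :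
      M ⊔ (Submonoid.powers a ⊔ Submonoid.closure (T : Set B)) =
        M ⊔ Submonoid.closure (T : Set B) ⊔ Submonoid.powers a).le

variable [NonarchimedeanRing B]

theorem IsBoundedSubset.addSubgroup_closure {S : Set B} (hS : IsBoundedSubset S) :
    IsBoundedSubset (AddSubgroup.closure S : Set B) := by
  intro U hU
  obtain ⟨W, hW⟩ := NonarchimedeanRing.is_nonarchimedean U hU
  obtain ⟨V, hV, H⟩ := hS W W.mem_nhds_zero
  refine ⟨V, hV, fun v hv s hs => hW ?_⟩
  have : AddSubgroup.closure S ≤ W.toAddSubgroup.comap (AddMonoidHom.mulLeft v) :=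
    (AddSubgroup.closure_le _).2 fun s hs => H v hv s hs
  exact this hs

theorem IsBoundedSubset.subring_closure {S : Set B} {M : Submonoid B}
    (hM : IsBoundedSubset (M : Set B)) (hS : S ⊆ M) :
    IsBoundedSubset (Subring.closure S : Set B) := by
  refine hM.addSubgroup_closure.mono fun x hx => ?_
  have h := Subring.mem_closure_iff.1 hx
  exact AddSubgroup.closure_mono (Submonoid.closure_le.2 hS) h

theorem isBoundedSubset_bot : IsBoundedSubset ((⊥ : Submonoid B) : Set B) := by
  rw [Submonoid.coe_bot]
  exact .singleton 1

theorem isBoundedSubset_subring_closure_finset (T : Finset B) (hT : ∀ t ∈ T, IsPowerBounded t)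
    (C : Subring B) (hC : IsBoundedSubset (C : Set B)) :
    IsBoundedSubset (Subring.closure ((C : Set B) ∪ T) : Set B) :=
  (isBoundedSubset_closure_finset T hT (M := C.toSubmonoid) hC).subring_closure <|
    Set.union_subset (fun _ hx => (le_sup_left : C.toSubmonoid ≤ _) hx)
      fun _ hx => (le_sup_right : Submonoid.closure (T : Set B) ≤ _)
        (Submonoid.subset_closure hx)

theorem exists_bounded_subring (T : Finset B) (hT : ∀ t ∈ T, IsPowerBounded t) :
    ∃ C : Subring B, (T : Set B) ⊆ C ∧ IsBoundedSubset (C : Set B) :=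
  ⟨Subring.closure T, Subring.subset_closure,
    (isBoundedSubset_closure_finset T hT isBoundedSubset_bot).subring_closure fun _ hx =>
      (le_sup_right : Submonoid.closure (T : Set B) ≤ _) (Submonoid.subset_closure hx)⟩

theorem isPowerBounded_of_mem_subring {C : Subring B} (hC : IsBoundedSubset (C : Set B)) {a : B}
    (ha : a ∈ C) : IsPowerBounded a :=
  isPowerBounded_of_mem (M := C.toSubmonoid) hC ha

variable (B) in
/-- The subring of power-bounded elements. -/
def powerBounded : Subring B where
  carrier := {a | IsPowerBounded a}
  mul_mem' {a b} ha hb := by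
    classical
    obtain ⟨C, hC, h⟩ := exists_bounded_subring {a, b} (by simp; exact ⟨ha, hb⟩)
    exact isPowerBounded_of_mem_subring h (mul_mem (hC (by simp)) (hC (by simp)))
  one_mem' := by
    obtain ⟨C, hC, h⟩ := exists_bounded_subring (∅ : Finset B) (by simp)
    exact isPowerBounded_of_mem_subring h (one_mem C)
  add_mem' {a b} ha hb := by
    classical
    obtain ⟨C, hC, h⟩ := exists_bounded_subring {a, b} (by simp; exact ⟨ha, hb⟩)
    exact isPowerBounded_of_mem_subring h (add_mem (hC (by simp)) (hC (by simp)))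
  zero_mem' := by
    obtain ⟨C, hC, h⟩ := exists_bounded_subring (∅ : Finset B) (by simp)
    exact isPowerBounded_of_mem_subring h (zero_mem C)
  neg_mem' {a} ha := by
    obtain ⟨C, hC, h⟩ := exists_bounded_subring {a} (by simpa using ha)
    exact isPowerBounded_of_mem_subring h (neg_mem (hC (by simp)))

/-- The power-bounded elements form an integrally closed subring: the powers of an element that is
integral over a bounded subring lie in a finitely generated module over this subring. -/
theorem IsPowerBounded.of_isIntegral {a : B} (ha : IsIntegral (powerBounded B) a) :
    IsPowerBounded a := by
  classical
  obtain ⟨P, hP, hPa⟩ := ha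
  obtain ⟨C, hC, hCb⟩ := exists_bounded_subring
    (Finset.image (fun i => (P.coeff i : B)) P.support) (by
      intro t ht
      obtain ⟨i, -, rfl⟩ := Finset.mem_image.1 ht
      exact (P.coeff i).2)
  have hcoef : ∀ i, (P.coeff i : B) ∈ C := by
    intro i
    by_cases hi : i ∈ P.support
    · exact hC (Finset.mem_coe.2 (Finset.mem_image_of_mem _ hi))
    · rw [Polynomial.notMem_support_iff.1 hi]; exact zero_mem C
  have hmem : ∀ k, a ^ k ∈ AddSubgroup.closure
      {x : B | ∃ c ∈ C, ∃ i ∈ Finset.range P.natDegree, c * a ^ i = x} := by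
    have hmul : ∀ c ∈ C, ∀ x ∈ AddSubgroup.closure
        {x : B | ∃ c ∈ C, ∃ i ∈ Finset.range P.natDegree, c * a ^ i = x}, c * x ∈
        AddSubgroup.closure
        {x : B | ∃ c ∈ C, ∃ i ∈ Finset.range P.natDegree, c * a ^ i = x} := by
      intro c hc
      have : AddSubgroup.closure
        {x : B | ∃ c ∈ C, ∃ i ∈ Finset.range P.natDegree, c * a ^ i = x} ≤
          (AddSubgroup.closure
        {x : B | ∃ c ∈ C, ∃ i ∈ Finset.range P.natDegree, c * a ^ i = x}).comap
            (AddMonoidHom.mulLeft c) := by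
        refine (AddSubgroup.closure_le _).2 ?_
        rintro _ ⟨d, hd, i, hi, rfl⟩
        refine AddSubgroup.subset_closure ⟨c * d, mul_mem hc hd, i, hi, ?_⟩
        simp [mul_assoc]
      exact fun x hx => this hx
    intro k
    induction k using Nat.strong_induction_on with
    | _ k ih =>
    by_cases hk : k < P.natDegree
    · exact AddSubgroup.subset_closure ⟨1, one_mem C, k, Finset.mem_range.2 hk, one_mul _⟩
    · have h1 : a ^ P.natDegree =
          -∑ i ∈ Finset.range P.natDegree, (P.coeff i : B) * a ^ i := by
        rw [Polynomial.eval₂_eq_sum_range, Finset.sum_range_succ, hP.coeff_natDegree, map_one,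
          one_mul, add_comm] at hPa
        exact eq_neg_of_add_eq_zero_left hPa
      have h2 : a ^ k = -∑ i ∈ Finset.range P.natDegree,
          (P.coeff i : B) * a ^ (i + (k - P.natDegree)) := by
        rw [show a ^ k = a ^ P.natDegree * a ^ (k - P.natDegree) by
          rw [← pow_add, Nat.add_sub_cancel' (not_lt.1 hk)], h1, neg_mul, Finset.sum_mul]
        simp [pow_add, mul_assoc]
      rw [h2]
      refine neg_mem (sum_mem fun i hi => hmul _ (hcoef i) _ (ih _ ?_))
      have := Finset.mem_range.1 hi
      omega
  have hfin : ∀ F : Finset ℕ, IsBoundedSubset {x : B | ∃ c ∈ C, ∃ i ∈ F, c * a ^ i = x} := by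
    intro F
    induction F using Finset.induction_on with
    | empty =>
      intro U hU
      exact ⟨U, hU, by rintro _ _ _ ⟨_, _, _, h, _⟩; simp at h⟩
    | insert j F _ ih =>
      refine (ih.union (hCb.mul (IsBoundedSubset.singleton (a ^ j))
        (R := {x : B | ∃ c ∈ C, c * a ^ j = x}) ?_)).mono ?_
      · rintro _ ⟨c, hc, rfl⟩
        exact ⟨c, hc, _, rfl, rfl⟩
      · rintro _ ⟨c, hc, i, hi, rfl⟩
        rcases Finset.mem_insert.1 hi with rfl | hi
        · exact Or.inr ⟨c, hc, rfl⟩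
        · exact Or.inl ⟨c, hc, i, hi, rfl⟩
  refine (hfin (Finset.range P.natDegree)).addSubgroup_closure.mono ?_
  rintro _ ⟨k, rfl⟩
  exact hmem k

end Boundedness

/-! ### Tate rings -/

/-- The topology of `B` is the `ϖ`-adic topology of the subring `B₀ ∋ ϖ`, where `ϖ` is a unit of
`B`: the sets `ϖⁿ B₀` form a basis of neighbourhoods of `0`. -/
structure IsTate {B : Type*} [CommRing B] [TopologicalSpace B] (ϖ : B) (B₀ : Subring B) :
    Prop where
  isUnit : IsUnit ϖ
  mem : ϖ ∈ B₀
  mem_nhds_iff : ∀ U : Set B, U ∈ 𝓝 (0 : B) ↔ ∃ n : ℕ, ∀ b ∈ B₀, ϖ ^ n * b ∈ U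

namespace IsTate
variable {B : Type*} [CommRing B] [TopologicalSpace B] {ϖ : B} {B₀ : Subring B}
  (h : IsTate ϖ B₀)
include h

theorem subring_mem_nhds : (B₀ : Set B) ∈ 𝓝 (0 : B) :=
  (h.mem_nhds_iff _).2 ⟨0, fun b hb => by simpa using hb⟩

theorem exists_pow_mul_mem [ContinuousMul B] (b : B) : ∃ n : ℕ, ϖ ^ n * b ∈ B₀ := by
  have hc : ContinuousAt (fun v : B => v * b) 0 := (continuous_mul_const b).continuousAt
  have := hc (by simpa using h.subring_mem_nhds)
  obtain ⟨n, hn⟩ := (h.mem_nhds_iff _).1 this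
  exact ⟨n, by simpa using hn 1 (one_mem _)⟩

theorem pow_mem (n : ℕ) : ϖ ^ n ∈ B₀ := Subring.pow_mem _ h.mem n

theorem image_pow_mem_nhds (n : ℕ) : {x : B | ∃ b ∈ B₀, ϖ ^ n * b = x} ∈ 𝓝 (0 : B) :=
  (h.mem_nhds_iff _).2 ⟨n, fun b hb => ⟨b, hb, rfl⟩⟩

theorem isBoundedSubset_iff [ContinuousMul B] (S : Set B) :
    IsBoundedSubset S ↔ ∃ m : ℕ, ∀ s ∈ S, ϖ ^ m * s ∈ B₀ := by
  constructor
  · intro hS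
    obtain ⟨V, hV, H⟩ := hS _ h.subring_mem_nhds
    obtain ⟨n, hn⟩ := (h.mem_nhds_iff _).1 hV
    exact ⟨n, fun s hs => H _ (by simpa using hn 1 (one_mem _)) s hs⟩
  · rintro ⟨m, hm⟩ U hU
    obtain ⟨n, hn⟩ := (h.mem_nhds_iff _).1 hU
    refine ⟨_, h.image_pow_mem_nhds (n + m), ?_⟩
    rintro _ ⟨b, hb, rfl⟩ s hs
    have := hn _ (mul_mem hb (hm s hs))
    rwa [show ϖ ^ n * (b * (ϖ ^ m * s)) = ϖ ^ (n + m) * b * s by ring] at this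

theorem isBoundedSubset_subring [ContinuousMul B] : IsBoundedSubset (B₀ : Set B) :=
  (h.isBoundedSubset_iff _).2 ⟨0, fun s hs => by simpa using hs⟩

theorem isPowerBounded_of_mem_subring [ContinuousMul B] {b : B} (hb : b ∈ B₀) :
    IsPowerBounded b :=
  isPowerBounded_of_mem (M := B₀.toSubmonoid) h.isBoundedSubset_subring hb

theorem nonarchimedeanRing [IsTopologicalRing B] : NonarchimedeanRing B where
  is_nonarchimedean U hU := by
    obtain ⟨n, hn⟩ := (h.mem_nhds_iff _).1 hU
    let W : AddSubgroup B := B₀.toAddSubgroup.map (AddMonoidHom.mulLeft (ϖ ^ n))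
    have hW : (W : Set B) ∈ 𝓝 (0 : B) :=
      (h.mem_nhds_iff _).2 ⟨n, fun b hb => ⟨b, hb, rfl⟩⟩
    refine ⟨⟨W, AddSubgroup.isOpen_of_mem_nhds W hW⟩, ?_⟩
    rintro _ ⟨b, hb, rfl⟩
    exact hn b hb

theorem tendsto_pow : Filter.Tendsto (fun n => ϖ ^ n) Filter.atTop (𝓝 (0 : B)) := by
  intro U hU
  obtain ⟨n, hn⟩ := (h.mem_nhds_iff _).1 hU
  refine Filter.mem_map.2 (Filter.mem_atTop_sets.2 ⟨n, fun m hm => ?_⟩)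
  have := hn _ (h.pow_mem (m - n))
  rwa [← pow_add, Nat.add_sub_cancel' hm] at this

theorem tendsto_pow_mul_of_isBounded [ContinuousMul B] {S : Set B} (hS : IsBoundedSubset S)
    {b : ℕ → B} (hb : ∀ n, b n ∈ S) :
    Filter.Tendsto (fun n => ϖ ^ n * b n) Filter.atTop (𝓝 0) := by
  intro U hU
  obtain ⟨V, hV, H⟩ := hS U hU
  refine Filter.mem_map.2 ?_
  filter_upwards [Filter.mem_map.1 (h.tendsto_pow hV)] with n hn
  exact H _ hn _ (hb n)

/-- A continuous ring homomorphism that maps `ϖ` to `ϖ'` preserves bounded sets. -/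
theorem isBoundedSubset_image [ContinuousMul B] {C : Type*} [CommRing C] [TopologicalSpace C]
    [ContinuousMul C] {ϖ' : C} {C₀ : Subring C} (h' : IsTate ϖ' C₀) (f : B →+* C)
    (hf : Continuous f) (hϖ : f ϖ = ϖ') {S : Set B} (hS : IsBoundedSubset S) :
    IsBoundedSubset (f '' S) := by
  rw [h'.isBoundedSubset_iff]
  obtain ⟨m, hm⟩ := (h.isBoundedSubset_iff S).1 hS
  have h1 : f ⁻¹' C₀ ∈ 𝓝 (0 : B) :=
    hf.continuousAt (by rw [map_zero]; exact h'.subring_mem_nhds)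
  obtain ⟨n, hn⟩ := (h.mem_nhds_iff _).1 h1
  refine ⟨n + m, ?_⟩
  rintro _ ⟨s, hs, rfl⟩
  have : f (ϖ ^ n * (ϖ ^ m * s)) ∈ C₀ := hn _ (hm s hs)
  rw [map_mul, map_mul, map_pow, map_pow, hϖ] at this
  rwa [pow_add, mul_assoc]

theorem isPowerBounded_map [ContinuousMul B] {C : Type*} [CommRing C] [TopologicalSpace C]
    [ContinuousMul C] {ϖ' : C} {C₀ : Subring C} (h' : IsTate ϖ' C₀) (f : B →+* C)
    (hf : Continuous f) (hϖ : f ϖ = ϖ') {b : B} (hb : IsPowerBounded b) :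
    IsPowerBounded (f b) := by
  refine (h.isBoundedSubset_image h' f hf hϖ hb).mono ?_
  rintro _ ⟨k, rfl⟩
  exact ⟨b ^ k, ⟨k, rfl⟩, map_pow f b k⟩

end IsTate

/-! ### Continuous valuations -/

section ContRel
variable {B : Type*} [CommRing B] [TopologicalSpace B]

/-- Continuity of an equivalence class of valuations, recorded by the relation `|a| ≤ |b|`: the
set `{|a| < |b|}` is a neighbourhood of `0` if `|b| ≠ 0`. -/
def IsContRel (r : ValuativeRel B) : Prop :=
  ∀ b, ¬ r.vle b 0 → {a | ¬ r.vle b a} ∈ 𝓝 (0 : B)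

theorem isContRel_ofValuation {Γ : Type*} [LinearOrderedCommGroupWithZero Γ] (v : Valuation B Γ)
    (hv : ∀ b, v b ≠ 0 → {a | v a < v b} ∈ 𝓝 (0 : B)) :
    IsContRel (ValuativeRel.ofValuation v) := by
  intro b hb
  have h0 : v b ≠ 0 := fun h => hb (h.trans_le zero_le)
  filter_upwards [hv b h0] with a ha
  exact not_le.2 ha

variable [IsTopologicalRing B]

theorem IsContRel.nhds {r : ValuativeRel B} (hr : IsContRel r) {b : B} (hb : ¬ r.vle b 0) (a : B) :
    {x | ¬ r.vle b (a - x)} ∈ 𝓝 a := by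
  have hc : ContinuousAt (fun x : B => a - x) a := (continuous_const.sub continuous_id).continuousAt
  exact hc (by simpa using hr b hb)

/-- Two continuous valuations which agree on a dense subring are equal. -/
theorem IsContRel.vle_of_dense {r r' : ValuativeRel B} (hr : IsContRel r) (hr' : IsContRel r')
    {C : Type*} [CommRing C] (ι : C →+* B) (hι : DenseRange ι)
    (H : ∀ c d, r.vle (ι c) (ι d) ↔ r'.vle (ι c) (ι d)) {a b : B} (hab : r.vle a b) :
    r'.vle a b := by
  by_contra hba
  let v := @ValuativeRel.valuation B _ r
  let v' := @ValuativeRel.valuation B _ r'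
  have hv : ∀ x y, r.vle x y ↔ v x ≤ v y := fun x y =>
    (letI := r; Valuation.Compatible.vle_iff_le (v := ValuativeRel.valuation B) x y)
  have hv' : ∀ x y, r'.vle x y ↔ v' x ≤ v' y := fun x y =>
    (letI := r'; Valuation.Compatible.vle_iff_le (v := ValuativeRel.valuation B) x y)
  simp only [hv, hv'] at H
  rw [hv] at hab
  rw [hv', not_le] at hba
  -- approximation of `x` by an element of the subring, within an open condition
  have key : ∀ x : B, ∀ s ∈ 𝓝 x, ∃ c, ι c ∈ s := fun x s hs => by
    obtain ⟨y, hy, c, rfl⟩ := mem_closure_iff_nhds.1 (hι x) s hs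
    exact ⟨c, hy⟩
  have near : ∀ x y, v y ≠ 0 → {z | v (x - z) < v y} ∈ 𝓝 x := fun x y hy => by
    have := hr.nhds (b := y) (by rw [hv, map_zero, not_le]; exact zero_lt_iff.2 hy) x
    simpa only [hv, not_le] using this
  have near' : ∀ x y, v' y ≠ 0 → {z | v' (x - z) < v' y} ∈ 𝓝 x := fun x y hy => by
    have := hr'.nhds (b := y) (by rw [hv', map_zero, not_le]; exact zero_lt_iff.2 hy) x
    simpa only [hv', not_le] using this
  have ha0 : v' a ≠ 0 := (zero_le.trans_lt hba).ne'
  have eq' : ∀ x z, v' (x - z) < v' a → v' x = v' a → v' z = v' a := fun x z h1 h2 => by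
    rw [← h2] at h1 ⊢
    rw [Valuation.map_sub_swap] at h1
    exact (Valuation.map_eq_of_sub_lt v' h1)
  have lt' : ∀ x z, v' (x - z) < v' a → v' x < v' a → v' z < v' a := fun x z h1 h2 => by
    have : v' z = v' (x - (x - z)) := by rw [sub_sub_cancel]
    rw [this]
    exact (Valuation.map_sub v' _ _).trans_lt (max_lt h2 h1)
  have lt : ∀ x z t, v (x - z) < v t → v x < v t → v z < v t := fun x z t h1 h2 => by
    have : v z = v (x - (x - z)) := by rw [sub_sub_cancel]
    rw [this]
    exact (Valuation.map_sub v _ _).trans_lt (max_lt h2 h1)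
  by_cases hb : v b = 0
  · have ha : v a = 0 := le_antisymm (hb ▸ hab) zero_le
    obtain ⟨a1, h1⟩ := key a _ (near' a a ha0)
    have e1 := eq' a _ h1 rfl
    have h0 : v (ι a1) ≠ 0 := by
      intro h
      have h2 : v (ι a1) ≤ v (ι 0) := by rw [h]; exact zero_le
      rw [H, map_zero, map_zero, e1] at h2
      exact ha0 (le_antisymm h2 zero_le)
    obtain ⟨a2, h2⟩ := key a _ (Filter.inter_mem (near' a a ha0) (near a (ι a1) h0))
    have e2 := eq' a _ h2.1 rfl
    have h3 := lt a _ _ h2.2 (by rw [ha]; exact zero_lt_iff.2 h0)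
    have h4 := (H a1 a2).2 (by rw [e1, e2])
    exact absurd h3 (not_lt.2 h4)
  · obtain ⟨a2, h2⟩ := key a _ (Filter.inter_mem (near' a a ha0) (near a b hb))
    obtain ⟨b2, h3⟩ := key b _ (Filter.inter_mem (near' b a ha0) (near b b hb))
    have e2 := eq' a _ h2.1 rfl
    have e3 := lt' b _ h3.1 hba
    have e4 : v (ι b2) = v b := by
      have := h3.2
      rw [Set.mem_ofPred_eq, Valuation.map_sub_swap] at this
      exact Valuation.map_eq_of_sub_lt v this
    have e5 : v (ι a2) ≤ v b := by
      have : v (ι a2) = v (a - (a - ι a2)) := by rw [sub_sub_cancel]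
      rw [this]
      exact (Valuation.map_sub v _ _).trans (max_le hab h2.2.le)
    rw [← e4, H, e2] at e5
    exact absurd e3 (not_lt.2 e5)

theorem IsContRel.vle_iff_of_dense {r r' : ValuativeRel B} (hr : IsContRel r) (hr' : IsContRel r')
    {C : Type*} [CommRing C] (ι : C →+* B) (hι : DenseRange ι)
    (H : ∀ c d, r.vle (ι c) (ι d) ↔ r'.vle (ι c) (ι d)) (a b : B) :
    r.vle a b ↔ r'.vle a b :=
  ⟨hr.vle_of_dense hr' ι hι H, hr'.vle_of_dense hr ι hι fun c d => (H c d).symm⟩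

end ContRel

/-! ### Existence of continuous valuations -/

namespace IsTate

section Exists
variable {B : Type*} [CommRing B] [TopologicalSpace B] [NonarchimedeanRing B] {ϖ : B}
  {B₀ : Subring B} (h : IsTate ϖ B₀)
include h

/-- If `v` is at most `1` on the power-bounded elements and takes a value `> 1`, then `|ϖ|` is
cofinal in the convex subgroup of values that it generates, which contains all values `≥ 1`.
Replacing all smaller values by `0` makes `v` continuous. -/
theorem exists_rel_of_valuation {Γ : Type*} [LinearOrderedCommGroupWithZero Γ]
    (v : Valuation B Γ) (hv : ∀ b, IsPowerBounded b → v b ≤ 1) (f : B) (hf : 1 < v f) :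
    ∃ r : ValuativeRel B, IsContRel r ∧ (∀ b, IsPowerBounded b → r.vle b 1) ∧
      (∀ b, v b = 0 → r.vle b 0) ∧ ¬ r.vle f 1 := by
  classical
  have h0 : v ϖ ≠ 0 := fun h0 => by
    obtain ⟨u, hu⟩ := h.isUnit
    have := congrArg v u.mul_inv
    rw [map_mul, hu, h0, zero_mul, map_one] at this
    exact zero_ne_one this
  have hB : ∀ b, ∃ n : ℕ, v ϖ ^ n * v b ≤ 1 := fun b => by
    obtain ⟨n, hn⟩ := h.exists_pow_mul_mem b
    refine ⟨n, ?_⟩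
    rw [← map_pow, ← map_mul]
    exact hv _ (h.isPowerBounded_of_mem_subring hn)
  have hϖ : v ϖ ≤ 1 := hv _ (h.isPowerBounded_of_mem_subring h.mem)
  have hϖ1 : v ϖ < 1 := by
    refine lt_of_le_of_ne hϖ fun h1 => ?_
    obtain ⟨n, hn⟩ := hB f
    rw [h1, one_pow, one_mul] at hn
    exact absurd hf (not_lt.2 hn)
  let P : B → Prop := fun b => ∃ n : ℕ, v ϖ ^ n ≤ v b
  have hP_mul : ∀ a b, P (a * b) → P a := by
    rintro a b ⟨n, hn⟩
    obtain ⟨m, hm⟩ := hB b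
    refine ⟨n + m, ?_⟩
    calc v ϖ ^ (n + m) = v ϖ ^ n * v ϖ ^ m := pow_add _ _ _
      _ ≤ v (a * b) * v ϖ ^ m := mul_le_mul' hn le_rfl
      _ = v a * (v ϖ ^ m * v b) := by rw [map_mul, mul_assoc, mul_comm (v b)]
      _ ≤ v a * 1 := mul_le_mul' le_rfl hm
      _ = v a := mul_one _
  have hP_iff : ∀ a b, P (a * b) ↔ P a ∧ P b := fun a b => by
    refine ⟨fun hab => ⟨hP_mul a b hab, hP_mul b a (by rwa [mul_comm])⟩, ?_⟩
    rintro ⟨⟨n, hn⟩, m, hm⟩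
    exact ⟨n + m, by rw [pow_add, map_mul]; exact mul_le_mul' hn hm⟩
  have hP_le : ∀ a b, P a → v a ≤ v b → P b := fun a b ⟨n, hn⟩ hab => ⟨n, hn.trans hab⟩
  have hP1 : P 1 := ⟨0, by simp⟩
  have hP0 : ¬ P 0 := by
    rintro ⟨n, hn⟩
    rw [map_zero] at hn
    exact pow_ne_zero n h0 (le_antisymm hn zero_le)
  let w : Valuation B Γ :=
    { toFun := fun b => if P b then v b else 0
      map_zero' := if_neg hP0
      map_one' := by rw [if_pos hP1, map_one]
      map_mul' := fun a b => by
        by_cases ha : P a <;> by_cases hb : P b <;> simp [hP_iff, ha, hb]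
      map_add_le_max' := fun a b => by
        by_cases hab : P (a + b)
        · rw [if_pos hab]
          rcases le_total (v a) (v b) with hle | hle
          · have h1 : v (a + b) ≤ v b := (map_add_le_max v a b).trans (max_le hle le_rfl)
            exact le_max_of_le_right (by rwa [if_pos (hP_le _ _ hab h1)])
          · have h1 : v (a + b) ≤ v a := (map_add_le_max v a b).trans (max_le le_rfl hle)
            exact le_max_of_le_left (by rwa [if_pos (hP_le _ _ hab h1)])
        · rw [if_neg hab]; exact zero_le }
  have hw : ∀ b, w b = if P b then v b else 0 := fun b => rfl
  have hwv : ∀ b, w b ≤ v b := fun b => by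
    rw [hw]; split_ifs
    · exact le_rfl
    · exact zero_le
  refine ⟨ValuativeRel.ofValuation w, isContRel_ofValuation w fun b hb => ?_, fun b hb => ?_,
    fun b hb => ?_, ?_⟩
  · have hPb : P b := by
      by_contra hPb
      exact hb (by rw [hw, if_neg hPb])
    obtain ⟨n, hn⟩ := id hPb
    refine Filter.mem_of_superset (h.image_pow_mem_nhds (n + 1)) ?_
    rintro _ ⟨c, hc, rfl⟩
    change w _ < w b
    rw [hw b, if_pos hPb]
    refine (hwv _).trans_lt (lt_of_lt_of_le ?_ hn)
    rw [map_mul, map_pow, pow_succ, mul_assoc]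
    refine mul_lt_of_lt_one_right (zero_lt_iff.2 (pow_ne_zero _ h0)) ?_
    exact (mul_le_of_le_one_right' (hv _ (h.isPowerBounded_of_mem_subring hc))).trans_lt hϖ1
  · change w b ≤ w 1
    rw [map_one]
    exact (hwv b).trans (hv b hb)
  · change w b ≤ w 0
    rw [map_zero]
    exact (hwv b).trans hb.le
  · change ¬ w f ≤ w 1
    rw [map_one, not_le, hw, if_pos ⟨0, by simpa using hf.le⟩]
    exact hf

theorem exists_rel_of_not_integral {k : Type*} [Field k] (q : B →+* k) (f : B)
    (hf : ∀ P : Polynomial (powerBounded B), P.Monic →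
      q (P.eval₂ (powerBounded B).subtype f) ≠ 0) :
    ∃ r : ValuativeRel B, IsContRel r ∧ (∀ b, IsPowerBounded b → r.vle b 1) ∧
      (∀ b, q b = 0 → r.vle b 0) ∧ ¬ r.vle f 1 := by
  let g : powerBounded B →+* k := q.comp (powerBounded B).subtype
  have h1 : q f ∉ (integralClosure (Subring.closure (Set.range g)) k).toSubring := by
    rintro ⟨P, hP, hP0⟩
    have hl : P.map (algebraMap (Subring.closure (Set.range g)) k) ∈ Polynomial.lifts g := by
      rw [Polynomial.lifts_iff_coeff_lifts]
      intro n
      rw [Polynomial.coeff_map]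
      have h2 : (P.coeff n : k) ∈ Subring.closure (Set.range g) := (P.coeff n).2
      have h3 : Subring.closure (Set.range g) ≤ g.range :=
        Subring.closure_le.2 (by rintro _ ⟨x, rfl⟩; exact ⟨x, rfl⟩)
      exact h3 h2
    obtain ⟨Q, hQ, -, hQm⟩ := Polynomial.lifts_and_degree_eq_and_monic hl (hP.map _)
    refine hf Q hQm ?_
    rw [Polynomial.hom_eval₂]
    change Q.eval₂ g (q f) = 0
    rw [← Polynomial.eval_map, hQ, Polynomial.eval_map]
    exact hP0
  rw [← iInf_valuationSubring_superset, Subring.mem_iInf] at h1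
  push Not at h1
  obtain ⟨⟨V, hV⟩, hfV⟩ := h1
  obtain ⟨r, hr, hr1, hr2, hr3⟩ := h.exists_rel_of_valuation (V.valuation.comap q)
    (fun b hb => (V.valuation_le_one_iff _).2 (hV ⟨⟨b, hb⟩, rfl⟩)) f
    (not_le.1 fun hle => hfV ((V.valuation_le_one_iff _).1 hle))
  exact ⟨r, hr, hr1, fun b hb => hr2 b (by simp [hb]), hr3⟩

/-- An element that is not power-bounded has absolute value `> 1` at some continuous valuation. -/
theorem exists_rel_of_not_isPowerBounded (f : B) (hf : ¬ IsPowerBounded f) :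
    ∃ r : ValuativeRel B, IsContRel r ∧ (∀ b, IsPowerBounded b → r.vle b 1) ∧ ¬ r.vle f 1 := by
  let M : Submonoid B :=
    { carrier := {x | ∃ P : Polynomial (powerBounded B), P.Monic ∧
        P.eval₂ (powerBounded B).subtype f = x}
      one_mem' := ⟨1, Polynomial.monic_one, by simp⟩
      mul_mem' := by
        rintro _ _ ⟨P, hP, rfl⟩ ⟨Q, hQ, rfl⟩
        exact ⟨P * Q, hP.mul hQ, Polynomial.eval₂_mul _ _⟩ }
  have hM : Disjoint ((⊥ : Ideal B) : Set B) M := by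
    rw [Set.disjoint_left]
    rintro x hx ⟨P, hP, hPx⟩
    rw [SetLike.mem_coe, Ideal.mem_bot] at hx
    exact hf (IsPowerBounded.of_isIntegral ⟨P, hP, by rw [← hx, ← hPx]; rfl⟩)
  obtain ⟨𝔮, h𝔮, -, hd⟩ := Ideal.exists_le_prime_disjoint ⊥ M hM
  obtain ⟨r, hr, hr1, -, hr3⟩ := h.exists_rel_of_not_integral
    ((algebraMap (B ⧸ 𝔮) (FractionRing (B ⧸ 𝔮))).comp (Ideal.Quotient.mk 𝔮)) f
    (fun P hP hP0 => by
      rw [RingHom.comp_apply, FaithfulSMul.algebraMap_eq_zero_iff, Ideal.Quotient.eq_zero_iff_mem]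
        at hP0
      exact Set.disjoint_left.1 hd hP0 ⟨P, hP, rfl⟩)
  exact ⟨r, hr, hr1, hr3⟩

end Exists

section Complete
variable {B : Type*} [CommRing B] [UniformSpace B] [IsUniformAddGroup B] [NonarchimedeanRing B]
  [CompleteSpace B] [T2Space B] {ϖ : B} {B₀ : Subring B} (h : IsTate ϖ B₀)
include h

theorem isUnit_one_sub_mul {c : B} (hc : IsPowerBounded c) : IsUnit (1 - ϖ * c) := by
  have h1 : Filter.Tendsto (fun n => (ϖ * c) ^ n) Filter.atTop (𝓝 0) := by
    simp only [mul_pow]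
    exact h.tendsto_pow_mul_of_isBounded hc fun n => ⟨n, rfl⟩
  have h2 : Summable fun n => (ϖ * c) ^ n :=
    NonarchimedeanAddGroup.summable_of_tendsto_cofinite_zero (by rwa [Nat.cofinite_eq_atTop])
  exact IsUnit.of_mul_eq_one _ (h2.one_sub_mul_tsum_pow)

/-- A non-unit of a complete Tate ring vanishes at some continuous valuation. -/
theorem exists_rel_of_not_isUnit (f : B) (hf : ¬ IsUnit f) :
    ∃ r : ValuativeRel B, IsContRel r ∧ (∀ b, IsPowerBounded b → r.vle b 1) ∧ r.vle f 0 := by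
  obtain ⟨𝔪, h𝔪, hf𝔪⟩ := exists_max_ideal_of_mem_nonunits hf
  let := Ideal.Quotient.field 𝔪
  obtain ⟨u, hu⟩ := h.isUnit
  obtain ⟨r, hr, hr1, hr2, -⟩ := h.exists_rel_of_not_integral (Ideal.Quotient.mk 𝔪) (↑u⁻¹ : B)
    (fun P hP hP0 => by
      -- `ϖ⁻¹` is not integral modulo `𝔪`, as otherwise `𝔪` would contain a unit `1 - ϖ c`
      refine h𝔪.ne_top (Ideal.eq_top_of_isUnit_mem 𝔪 (Ideal.Quotient.eq_zero_iff_mem.1 (?_ :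
        Ideal.Quotient.mk 𝔪 (1 - ϖ * -∑ i ∈ Finset.range P.natDegree,
          (P.coeff i : B) * ϖ ^ (P.natDegree - 1 - i)) = 0)) (h.isUnit_one_sub_mul ?_))
      · have : (1 - ϖ * -∑ i ∈ Finset.range P.natDegree,
          (P.coeff i : B) * ϖ ^ (P.natDegree - 1 - i)) =
            ϖ ^ P.natDegree * P.eval₂ (powerBounded B).subtype (↑u⁻¹ : B) := by
          rw [Polynomial.eval₂_eq_sum_range, Finset.sum_range_succ, hP.coeff_natDegree, map_one,
            one_mul, mul_add, ← mul_pow, ← hu, u.mul_inv, one_pow, mul_neg, sub_neg_eq_add,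
            add_comm, Finset.mul_sum, Finset.mul_sum]
          congr 1
          refine Finset.sum_congr rfl fun i hi => ?_
          have hi := Finset.mem_range.1 hi
          have e : (u : B) ^ P.natDegree = u * u ^ (P.natDegree - 1 - i) * u ^ i := by
            rw [← pow_succ', ← pow_add]; congr 1; omega
          have e2 : (u : B) ^ i * (↑u⁻¹ : B) ^ i = 1 := by rw [← mul_pow, u.mul_inv, one_pow]
          rw [e]
          calc _ = (u : B) * (u : B) ^ (P.natDegree - 1 - i) * (P.coeff i : B) * 1 := by ring
            _ = _ := by rw [← e2]; change _ = _ * ((P.coeff i : B) * _); ring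
        rw [this, map_mul, hP0, mul_zero]
      · refine neg_mem (S := Subring B) (s := powerBounded B) (sum_mem fun i _ =>
          mul_mem (P.coeff i).2 (_root_.pow_mem ?_ _))
        exact h.isPowerBounded_of_mem_subring h.mem)
  exact ⟨r, hr, hr1, hr2 f (Ideal.Quotient.eq_zero_iff_mem.2 hf𝔪)⟩

end Complete

end IsTate

/-! ### Completions and rational localizations of Tate rings -/

theorem IsTate.completion {C : Type*} [CommRing C] [UniformSpace C] [IsUniformAddGroup C]
    [IsTopologicalRing C] {ϖ : C} {C₀ : Subring C} (h : IsTate ϖ C₀) :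
    IsTate (ϖ : UniformSpace.Completion C)
      (C₀.map UniformSpace.Completion.coeRingHom).topologicalClosure where
  isUnit := h.isUnit.map UniformSpace.Completion.coeRingHom
  mem := Subring.le_topologicalClosure _ ⟨ϖ, h.mem, rfl⟩
  mem_nhds_iff U := by
    have hcoe : Continuous ((↑) : C → UniformSpace.Completion C) :=
      UniformSpace.Completion.continuous_coe C
    constructor
    · intro hU
      obtain ⟨Z, ⟨hZ, hZc⟩, hZU⟩ := (closed_nhds_basis (0 : UniformSpace.Completion C)).mem_iff.1 hU
      have h1 : ((↑) : C → UniformSpace.Completion C) ⁻¹' Z ∈ 𝓝 (0 : C) :=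
        hcoe.continuousAt (by rwa [UniformSpace.Completion.coe_zero])
      obtain ⟨n, hn⟩ := (h.mem_nhds_iff _).1 h1
      refine ⟨n, fun b hb => hZU ?_⟩
      have hc : IsClosed {b : UniformSpace.Completion C | (ϖ : UniformSpace.Completion C) ^ n * b ∈ Z} :=
        hZc.preimage (continuous_const_mul _)
      refine closure_minimal ?_ hc hb
      rintro _ ⟨c, hc, rfl⟩
      have := hn c hc
      change ((ϖ ^ n * c : C) : UniformSpace.Completion C) ∈ Z at this
      rw [UniformSpace.Completion.coe_mul] at this
      change UniformSpace.Completion.coeRingHom (ϖ ^ n) * _ ∈ Z at this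
      rwa [map_pow] at this
    · rintro ⟨n, hn⟩
      have h1 := UniformSpace.Completion.isDenseInducing_coe.closure_image_mem_nhds
        (h.image_pow_mem_nhds n)
      rw [UniformSpace.Completion.coe_zero] at h1
      refine Filter.mem_of_superset h1 fun x hx => ?_
      obtain ⟨u, hu⟩ := h.isUnit.map (UniformSpace.Completion.coeRingHom (α := C))
      have hux : (↑(u ^ n)⁻¹ : UniformSpace.Completion C) * x ∈
          (C₀.map UniformSpace.Completion.coeRingHom).topologicalClosure := by
        refine map_mem_closure (continuous_const_mul _) hx ?_
        rintro _ ⟨_, ⟨c, hc, rfl⟩, rfl⟩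
        refine ⟨c, hc, ?_⟩
        change (c : UniformSpace.Completion C) = ↑(u ^ n)⁻¹ *
          UniformSpace.Completion.coeRingHom (ϖ ^ n * c)
        rw [map_mul, map_pow, ← hu, ← mul_assoc, ← Units.val_pow_eq_pow_val, Units.inv_mul, one_mul]
        rfl
      have := hn _ hux
      have e : (ϖ : UniformSpace.Completion C) = u := hu.symm
      rwa [← mul_assoc, e, ← Units.val_pow_eq_pow_val, Units.mul_inv, one_mul] at this

namespace RationalDatum
variable {A : Type u} [CommRing A] [TopologicalSpace A] [IsTopologicalRing A]
  (D : RationalDatum A) {ϖ : A} {A₀ : Subring A}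

/-- The subring `A₀[T/g]` of `A[1/g]`. -/
noncomputable def locSubring (A₀ : Subring A) : Subring D.Loc :=
  Subring.closure (algebraMap A D.Loc '' A₀ ∪ D.frac '' D.T)

theorem algebraMap_mem_locSubring {a : A} (ha : a ∈ A₀) : algebraMap A D.Loc a ∈ D.locSubring A₀ :=
  Subring.subset_closure (Or.inl ⟨a, ha, rfl⟩)

theorem frac_mem_locSubring {t : A} (ht : t ∈ D.T) : D.frac t ∈ D.locSubring A₀ :=
  Subring.subset_closure (Or.inr ⟨t, ht, rfl⟩)

theorem exists_eq_mul_frac_one_pow (x : D.Loc) :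
    ∃ (a : A) (k : ℕ), x = algebraMap A D.Loc a * D.frac 1 ^ k := by
  obtain ⟨a, ⟨_, k, rfl⟩, rfl⟩ := IsLocalization.exists_mk'_eq (Submonoid.powers D.g) x
  refine ⟨a, k, ?_⟩
  rw [IsLocalization.mk'_eq_iff_eq_mul, mul_assoc]
  change _ = _ * (_ * algebraMap A D.Loc (D.g ^ k))
  rw [map_pow, ← mul_pow, frac_mul, map_one, one_pow, mul_one]

theorem frac_eq (t : A) : D.frac t = algebraMap A D.Loc t * D.frac 1 := by
  refine D.isUnit_g.mul_left_injective ?_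
  dsimp only
  rw [frac_mul, mul_assoc, frac_mul, map_one, mul_one]

theorem exists_pow_mul_mem_locSubring (h : IsTate ϖ A₀) (x : D.Loc) :
    ∃ n : ℕ, algebraMap A D.Loc ϖ ^ n * x ∈ D.locSubring A₀ := by
  have hadd : ∀ x y : D.Loc, (∃ n : ℕ, algebraMap A D.Loc ϖ ^ n * x ∈ D.locSubring A₀) →
      (∃ n : ℕ, algebraMap A D.Loc ϖ ^ n * y ∈ D.locSubring A₀) →
      ∃ n : ℕ, algebraMap A D.Loc ϖ ^ n * (x + y) ∈ D.locSubring A₀ := by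
    rintro x y ⟨n, hn⟩ ⟨m, hm⟩
    refine ⟨n + m, ?_⟩
    have hp := D.algebraMap_mem_locSubring h.mem
    rw [show algebraMap A D.Loc ϖ ^ (n + m) * (x + y) =
      algebraMap A D.Loc ϖ ^ m * (algebraMap A D.Loc ϖ ^ n * x) +
        algebraMap A D.Loc ϖ ^ n * (algebraMap A D.Loc ϖ ^ m * y) by ring]
    exact add_mem (mul_mem (pow_mem hp _) hn) (mul_mem (pow_mem hp _) hm)
  have hmul : ∀ x y : D.Loc, (∃ n : ℕ, algebraMap A D.Loc ϖ ^ n * x ∈ D.locSubring A₀) →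
      (∃ n : ℕ, algebraMap A D.Loc ϖ ^ n * y ∈ D.locSubring A₀) →
      ∃ n : ℕ, algebraMap A D.Loc ϖ ^ n * (x * y) ∈ D.locSubring A₀ := by
    rintro x y ⟨n, hn⟩ ⟨m, hm⟩
    refine ⟨n + m, ?_⟩
    rw [show algebraMap A D.Loc ϖ ^ (n + m) * (x * y) =
      (algebraMap A D.Loc ϖ ^ n * x) * (algebraMap A D.Loc ϖ ^ m * y) by ring]
    exact mul_mem hn hm
  have halg : ∀ a : A, ∃ n : ℕ, algebraMap A D.Loc ϖ ^ n * algebraMap A D.Loc a ∈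
      D.locSubring A₀ := fun a => by
    obtain ⟨n, hn⟩ := h.exists_pow_mul_mem a
    exact ⟨n, by rw [← map_pow, ← map_mul]; exact D.algebraMap_mem_locSubring hn⟩
  -- `1 / g` is a combination of the fractions `t / g`, as `T` generates the unit ideal
  have hone : ∀ y ∈ Ideal.span (D.T : Set A), ∃ n : ℕ, algebraMap A D.Loc ϖ ^ n * D.frac y ∈
      D.locSubring A₀ := fun y hy => by
    induction hy using Submodule.span_induction with
    | mem t ht => exact ⟨0, by simpa using D.frac_mem_locSubring ht⟩
    | zero => exact ⟨0, by rw [frac_eq, map_zero, zero_mul, mul_zero]; exact zero_mem _⟩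
    | add x y _ _ hx hy =>
      rw [frac_eq, map_add, add_mul, ← frac_eq, ← frac_eq]
      exact hadd _ _ hx hy
    | smul a x _ hx =>
      rw [frac_eq, smul_eq_mul, map_mul, mul_assoc, ← frac_eq]
      exact hmul _ _ (halg a) hx
  have hfrac := hone 1 (by rw [D.span_eq_top]; trivial)
  obtain ⟨a, k, rfl⟩ := D.exists_eq_mul_frac_one_pow x
  refine hmul _ _ (halg a) ?_
  induction k with
  | zero => exact ⟨0, by simp [one_mem]⟩
  | succ k ih => rw [pow_succ]; exact hmul _ _ ih hfrac

theorem isUnit_algebraMap (h : IsTate ϖ A₀) : IsUnit (algebraMap A D.Loc ϖ) := h.isUnit.map _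

/-- The localization topology of a Tate ring is the `ϖ`-adic topology of `A₀[T/g]`. -/
theorem isTate_loc (h : IsTate ϖ A₀) : IsTate (algebraMap A D.Loc ϖ) (D.locSubring A₀) := by
  let π := algebraMap A D.Loc ϖ
  have hπ : π ∈ D.locSubring A₀ := D.algebraMap_mem_locSubring h.mem
  let N : ℕ → AddSubgroup D.Loc := fun n =>
    (D.locSubring A₀).toAddSubgroup.map (AddMonoidHom.mulLeft (π ^ n))
  have hmem : ∀ n x, x ∈ N n ↔ ∃ b ∈ D.locSubring A₀, π ^ n * b = x := fun n x => Iff.rfl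
  have hanti : ∀ n m, n ≤ m → N m ≤ N n := by
    rintro n m hnm _ ⟨b, hb, rfl⟩
    refine (hmem _ _).2 ⟨π ^ (m - n) * b, mul_mem (pow_mem hπ _) hb, ?_⟩
    rw [← mul_assoc, ← pow_add, Nat.add_sub_cancel' hnm]
    rfl
  have hN : RingSubgroupsBasis N := by
    refine RingSubgroupsBasis.of_comm N (fun i j => ⟨max i j, ?_⟩) (fun i => ⟨i, ?_⟩)
      fun x i => ?_
    · exact le_inf (hanti _ _ (le_max_left _ _)) (hanti _ _ (le_max_right _ _))
    · rintro _ ⟨_, ⟨b, hb, rfl⟩, _, ⟨c, hc, rfl⟩, rfl⟩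
      refine (hmem _ _).2 ⟨b * (π ^ i * c), mul_mem hb (mul_mem (pow_mem hπ _) hc), ?_⟩
      change _ = (π ^ i * b) * (π ^ i * c)
      ring
    · obtain ⟨n, hn⟩ := D.exists_pow_mul_mem_locSubring h x
      refine ⟨n + i, ?_⟩
      rintro _ ⟨b, hb, rfl⟩
      refine (hmem _ _).2 ⟨(π ^ n * x) * b, mul_mem hn hb, ?_⟩
      change _ = x * (π ^ (n + i) * b)
      ring
  have key : ∀ U : Set D.Loc, U ∈ @nhds D.Loc hN.topology 0 ↔
      ∃ n : ℕ, ∀ b ∈ D.locSubring A₀, π ^ n * b ∈ U := fun U => by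
    rw [hN.hasBasis_nhds_zero.mem_iff]
    simp only [true_and]
    refine exists_congr fun n => ⟨fun H b hb => H ⟨b, hb, rfl⟩, ?_⟩
    rintro H _ ⟨b, hb, rfl⟩
    exact H b hb
  have heq : D.locTopology = hN.topology := by
    refine le_antisymm (sInf_le ⟨hN.nonarchimedean, ?_, ?_⟩) (le_sInf fun τ hτ => ?_)
    · let := hN.topology
      have := hN.nonarchimedean
      refine continuous_of_continuousAt_zero (algebraMap A D.Loc) fun U hU => ?_
      rw [map_zero, key] at hU
      obtain ⟨n, hn⟩ := hU
      refine (h.mem_nhds_iff _).2 ⟨n, fun b hb => ?_⟩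
      rw [Set.mem_preimage, map_mul, map_pow]
      exact hn _ (D.algebraMap_mem_locSubring hb)
    · let := hN.topology
      have := hN.nonarchimedean
      have hT : IsTate π (D.locSubring A₀) := ⟨D.isUnit_algebraMap h, hπ, key⟩
      exact fun t ht => hT.isPowerBounded_of_mem_subring (D.frac_mem_locSubring ht)
    · -- `A₀[T/g]` is bounded for every competing topology `τ`
      have hτ1 := hτ.1
      have hA₀ : IsBoundedSubset ((A₀.map (algebraMap A D.Loc) : Subring D.Loc) : Set D.Loc) := by
        intro U hU
        have hm : Filter.Tendsto (fun x : D.Loc × D.Loc => x.1 * x.2) (𝓝 0 ×ˢ 𝓝 0) (𝓝 0) := by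
          rw [← nhds_prod_eq]
          simpa using (continuous_mul (M := D.Loc)).tendsto (0, 0)
        obtain ⟨V, hV, W, hW, H⟩ := Filter.mem_prod_iff.1 (hm hU)
        have h1 : algebraMap A D.Loc ⁻¹' W ∈ 𝓝 (0 : A) :=
          hτ.2.1.continuousAt (by rwa [map_zero])
        obtain ⟨n, hn⟩ := (h.mem_nhds_iff _).1 h1
        obtain ⟨u, hu⟩ := D.isUnit_algebraMap h
        have hc : ContinuousAt (fun v : D.Loc => v * (↑(u ^ n)⁻¹ : D.Loc)) 0 :=
          (continuous_mul_const _).continuousAt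
        refine ⟨_, hc (by simpa using hV), ?_⟩
        rintro v hv _ ⟨a, ha, rfl⟩
        have h2 : algebraMap A D.Loc (ϖ ^ n * a) ∈ W := hn a ha
        have h3 := H (Set.mk_mem_prod hv h2)
        rw [Set.mem_preimage, map_mul, map_pow, ← hu, ← mul_assoc,
          mul_assoc v, ← Units.val_pow_eq_pow_val, Units.inv_mul, mul_one] at h3
        exact h3
      classical
      have hB := isBoundedSubset_subring_closure_finset (D.T.image D.frac) (by
        intro t ht
        obtain ⟨s, hs, rfl⟩ := Finset.mem_image.1 ht
        exact hτ.2.2 s hs) _ hA₀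
      have hB' : IsBoundedSubset (D.locSubring A₀ : Set D.Loc) := by
        refine hB.mono (Subring.closure_mono ?_)
        rw [Finset.coe_image, Subring.coe_map]
      have hc : @Continuous D.Loc D.Loc hN.topology τ (RingHom.id D.Loc) := by
        have i1 := hN.nonarchimedean
        refine @continuous_of_continuousAt_zero D.Loc hN.topology _ _ D.Loc
          (D.Loc →+* D.Loc) _ τ _ _ _ (RingHom.id _) ?_
        intro U hU
        rw [map_zero] at hU
        obtain ⟨V, hV, H⟩ := hB' U hU
        have h1 : algebraMap A D.Loc ⁻¹' V ∈ 𝓝 (0 : A) :=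
          hτ.2.1.continuousAt (by rwa [map_zero])
        obtain ⟨n, hn⟩ := (h.mem_nhds_iff _).1 h1
        refine (key _).2 ⟨n, fun b hb => H _ ?_ b hb⟩
        have := hn 1 (one_mem _)
        rwa [Set.mem_preimage, mul_one, map_pow] at this
      exact continuous_id_iff_le.1 hc
  refine ⟨D.isUnit_algebraMap h, hπ, fun U => ?_⟩
  refine Iff.trans ?_ (key U)
  rw [← heq]

/-- The closure of `A₀[T/g]` in `A⟨T/g⟩`. -/
noncomputable def completedSubring (A₀ : Subring A) : Subring D.Completed :=
  ((D.locSubring A₀).map UniformSpace.Completion.coeRingHom).topologicalClosure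

theorem isTate_completed (h : IsTate ϖ A₀) :
    IsTate (D.toCompleted ϖ) (D.completedSubring A₀) :=
  (D.isTate_loc h).completion

theorem nonarchimedeanRing_completed (h : IsTate ϖ A₀) : NonarchimedeanRing D.Completed :=
  (D.isTate_completed h).nonarchimedeanRing

theorem toCompleted_mem {a : A} (ha : a ∈ A₀) : D.toCompleted a ∈ D.completedSubring A₀ :=
  Subring.le_topologicalClosure _ ⟨_, D.algebraMap_mem_locSubring ha, rfl⟩

theorem coe_frac_mem {t : A} (ht : t ∈ D.T) : (D.frac t : D.Completed) ∈ D.completedSubring A₀ :=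
  Subring.le_topologicalClosure _ ⟨_, D.frac_mem_locSubring ht, rfl⟩

theorem isPowerBounded_toCompleted (h : IsTate ϖ A₀) {a : A} (ha : IsPowerBounded a) :
    IsPowerBounded (D.toCompleted a) :=
  h.isPowerBounded_map (D.isTate_completed h) D.toCompleted D.continuous_toCompleted rfl ha

/-- Two continuous valuations of `A⟨T/g⟩` which agree on `A` are equal. -/
theorem vle_iff_of_toCompleted {r r' : ValuativeRel D.Completed} (hr : IsContRel r)
    (hr' : IsContRel r') (H : ∀ a b, r.vle (D.toCompleted a) (D.toCompleted b) ↔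
      r'.vle (D.toCompleted a) (D.toCompleted b)) (x y : D.Completed) :
    r.vle x y ↔ r'.vle x y := by
  refine hr.vle_iff_of_dense hr' UniformSpace.Completion.coeRingHom
    UniformSpace.Completion.denseRange_coe (fun c d => ?_) x y
  obtain ⟨a, k, rfl⟩ := D.exists_eq_mul_frac_one_pow c
  obtain ⟨b, l, rfl⟩ := D.exists_eq_mul_frac_one_pow d
  -- clear denominators
  have hu : IsUnit (D.toCompleted D.g) := D.isUnit_g.map UniformSpace.Completion.coeRingHom
  have h0 : ∀ s : ValuativeRel D.Completed, ¬ s.vle (D.toCompleted D.g ^ (k + l)) 0 := by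
    intro s hs
    obtain ⟨u, hu⟩ := hu.pow (k + l)
    rw [← hu] at hs
    have := s.mul_vle_mul_left hs (↑u⁻¹)
    rw [u.mul_inv, zero_mul] at this
    exact s.not_vle_one_zero this
  have h1 : ∀ (s : ValuativeRel D.Completed) (x y : D.Completed), s.vle x y ↔
      s.vle (x * D.toCompleted D.g ^ (k + l)) (y * D.toCompleted D.g ^ (k + l)) :=
    fun s x y => ⟨fun hxy => s.mul_vle_mul_left hxy _, fun hxy => s.vle_mul_cancel (h0 s) hxy⟩
  have h2 : ∀ (a : A) (k l : ℕ), UniformSpace.Completion.coeRingHom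
      (algebraMap A D.Loc a * D.frac 1 ^ k) * D.toCompleted D.g ^ (k + l) =
        D.toCompleted (a * D.g ^ l) := by
    intro a k l
    change _ * (UniformSpace.Completion.coeRingHom (algebraMap A D.Loc D.g)) ^ (k + l) =
      UniformSpace.Completion.coeRingHom (algebraMap A D.Loc (a * D.g ^ l))
    rw [← map_pow, ← map_mul, map_mul (algebraMap A D.Loc), map_pow (algebraMap A D.Loc), pow_add,
      mul_assoc, ← mul_assoc (D.frac 1 ^ k), ← mul_pow, frac_mul, map_one, one_pow, one_mul]
  rw [h1 r, h1 r', h2, add_comm k l, h2]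
  exact H _ _

end RationalDatum

/-! ### Points of rational subsets -/

/-- The pullback of a valuation, recorded by its relation, along a ring homomorphism. -/
@[reducible]
def ValuativeRel.pullback {A B : Type*} [CommRing A] [CommRing B] (r : ValuativeRel B)
    (f : A →+* B) : ValuativeRel A where
  vle a b := r.vle (f a) (f b)
  vle_total a b := r.vle_total _ _
  vle_trans h h' := r.vle_trans h h'
  vle_add h h' := by rw [map_add]; exact r.vle_add h h'
  mul_vle_mul_left h z := by rw [map_mul, map_mul]; exact r.mul_vle_mul_left h _
  vle_mul_cancel h0 h := by
    rw [map_zero] at h0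
    rw [map_mul, map_mul] at h
    exact r.vle_mul_cancel h0 h
  not_vle_one_zero := by rw [map_one, map_zero]; exact r.not_vle_one_zero
  vle_mul_comm {x y} := by rw [map_mul, map_mul]; exact r.vle_mul_comm

theorem IsContRel.pullback {A B : Type*} [CommRing A] [CommRing B] [TopologicalSpace A]
    [TopologicalSpace B] {r : ValuativeRel B} (hr : IsContRel r) {f : A →+* B}
    (hf : Continuous f) : IsContRel (r.pullback f) := by
  intro b hb
  change ¬ r.vle (f b) (f 0) at hb
  rw [map_zero] at hb
  exact hf.continuousAt (by rw [map_zero]; exact hr _ hb)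

namespace SpaPoint
variable {A : Type u} [CommRing A] [TopologicalSpace A] {S : Set A}

@[ext]
theorem ext {x y : SpaPoint A S} (h : ∀ a b, x.rel.vle a b ↔ y.rel.vle a b) : x = y := by
  obtain ⟨rx, hx, hx'⟩ := x
  obtain ⟨ry, hy, hy'⟩ := y
  have : rx = ry := by
    obtain ⟨vx⟩ := rx
    obtain ⟨vy⟩ := ry
    have : vx = vy := funext fun a => funext fun b => propext (h a b)
    subst this
    rfl
  subst this
  rfl

theorem isContRel (x : SpaPoint A S) : IsContRel x.rel := by
  intro b hb
  have := (x.isOpen_lt (x.v b)).mem_nhds (x := 0) (by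
    change x.v 0 < _
    rw [← not_le, x.v_le_iff]
    exact hb)
  filter_upwards [this] with a ha
  rw [← x.v_le_iff, not_le]
  exact ha

/-- The point defined by a continuous valuation that is at most `1` on `S`. -/
def ofRel [IsTopologicalRing A] (r : ValuativeRel A) (hr : IsContRel r)
    (hS : ∀ a ∈ S, r.vle a 1) : SpaPoint A S where
  rel := r
  isOpen_lt γ := by
    let v := @ValuativeRel.valuation A _ r
    have hv : ∀ x y, r.vle x y ↔ v x ≤ v y := fun x y =>
      (letI := r; Valuation.Compatible.vle_iff_le (v := ValuativeRel.valuation A) x y)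
    have hγ : ∃ b c : A, v c ≠ 0 ∧ v b / v c = γ := by
      let := r
      obtain ⟨b, c, h⟩ := ValuativeRel.exists_valuation_div_valuation_eq γ
      exact ⟨b, c, ValuativeRel.valuation_posSubmonoid_ne_zero c, h⟩
    obtain ⟨b, c, hc, rfl⟩ := hγ
    rcases eq_or_ne (v b) 0 with hb | hb
    · rw [hb, zero_div]
      convert isOpen_empty
      ext a
      simp
    · have hset : {a : A | v a < v b / v c} = {a : A | v (a * c) < v b} := by
        ext a
        change v a < v b / v c ↔ v (a * c) < v b
        rw [map_mul, lt_div_iff₀ (zero_lt_iff.2 hc)]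
      change IsOpen {a : A | v a < v b / v c}
      rw [hset]
      rw [isOpen_iff_mem_nhds]
      intro a ha
      have h0 := hr b (by rw [hv, map_zero, not_le]; exact zero_lt_iff.2 hb)
      have hcont : ContinuousAt (fun y : A => (y - a) * c) a :=
        ((continuous_id.sub continuous_const).mul continuous_const).continuousAt
      filter_upwards [hcont (by simpa using h0)] with y hy
      replace hy : v ((y - a) * c) < v b := not_le.1 fun hle => hy ((hv _ _).2 hle)
      change v (y * c) < v b
      rw [show y * c = (y - a) * c + a * c by ring]
      exact (map_add_le_max v _ _).trans_lt (max_lt hy ha)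
  le_one := hS

end SpaPoint

/-- `(A, S)` is a pair as they occur in affinoid adic spaces: `A` is a Tate ring with ring of
definition `A₀`, and `S` is a set of power-bounded elements which contains `A₀`. -/
structure IsTatePair {A : Type*} [CommRing A] [TopologicalSpace A] (ϖ : A) (A₀ : Subring A)
    (S : Set A) : Prop extends IsTate ϖ A₀ where
  subset : (A₀ : Set A) ⊆ S
  isPowerBounded : ∀ a ∈ S, IsPowerBounded a

namespace RationalDatum
variable {A : Type u} [CommRing A] [TopologicalSpace A] [IsTopologicalRing A]
  (D : RationalDatum A) {ϖ : A} {A₀ : Subring A} {S : Set A}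

/-- The valuation of `A⟨T/g⟩` at a point of the rational subset. -/
noncomputable def evalVal {x : SpaPoint A S} (hx : x ∈ D.set S) :
    Valuation D.Completed (@ValuativeRel.ValueGroupWithZero A _ x.rel) :=
  (Valued.v : Valuation x.CompletedResidueField _).comap (D.eval hx)

theorem evalVal_toCompleted {x : SpaPoint A S} (hx : x ∈ D.set S) (a : A) :
    D.evalVal hx (D.toCompleted a) = x.v a := by
  change Valued.v (D.eval hx (D.toCompleted a)) = _
  rw [eval_toCompleted, Valued.valuedCompletion_apply]
  exact x.residueValuation_toResidue a

theorem evalVal_nhds {x : SpaPoint A S} (hx : x ∈ D.set S) (b : D.Completed)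
    (hb : D.evalVal hx b ≠ 0) : {a | D.evalVal hx a < D.evalVal hx b} ∈ 𝓝 (0 : D.Completed) := by
  have hc : Continuous (D.eval hx) := UniformSpace.Completion.continuous_map
  have h1 : {z : x.CompletedResidueField | Valued.v z < Valued.v (D.eval hx b)} ∈ 𝓝 (0 :
      x.CompletedResidueField) := by
    have hb' : (Valued.v : Valuation x.CompletedResidueField _) (D.eval hx b) ≠ 0 := hb
    have hγ : Valued.v.restrict (D.eval hx b) ≠ 0 := fun h0 => hb' (by
      simpa only [Valuation.restrict_eq_zero_iff] using h0)
    refine Valued.mem_nhds_zero.2 ⟨Units.mk0 _ hγ, fun z hz => ?_⟩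
    simpa [Valuation.restrict_lt_iff] using hz
  exact hc.continuousAt (by rw [map_zero]; exact h1)

/-- The valuation of `A⟨T/g⟩` at a point, as a relation. -/
@[reducible]
noncomputable def evalRel {x : SpaPoint A S} (hx : x ∈ D.set S) : ValuativeRel D.Completed :=
  ValuativeRel.ofValuation (D.evalVal hx)

theorem evalRel_vle {x : SpaPoint A S} (hx : x ∈ D.set S) (a b : D.Completed) :
    (D.evalRel hx).vle a b ↔ D.evalVal hx a ≤ D.evalVal hx b := Iff.rfl

theorem isContRel_evalRel {x : SpaPoint A S} (hx : x ∈ D.set S) : IsContRel (D.evalRel hx) :=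
  isContRel_ofValuation _ (D.evalVal_nhds hx)

theorem evalRel_toCompleted {x : SpaPoint A S} (hx : x ∈ D.set S) (a b : A) :
    (D.evalRel hx).vle (D.toCompleted a) (D.toCompleted b) ↔ x.rel.vle a b := by
  rw [evalRel_vle, evalVal_toCompleted, evalVal_toCompleted, x.v_le_iff]

theorem coe_frac_mul (t : A) :
    (D.frac t : D.Completed) * D.toCompleted D.g = D.toCompleted t := by
  have := congrArg UniformSpace.Completion.coeRingHom (D.frac_mul t)
  rwa [map_mul] at this

/-- A continuous valuation of `A⟨T/g⟩` that is at most `1` on power-bounded elements is a point of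
the rational subset. -/
theorem exists_point (h : IsTatePair ϖ A₀ S) (r : ValuativeRel D.Completed) (hr : IsContRel r)
    (hr1 : ∀ b, IsPowerBounded b → r.vle b 1) :
    ∃ (x : SpaPoint A S) (hx : x ∈ D.set S), ∀ a b, r.vle a b ↔ (D.evalRel hx).vle a b := by
  let x : SpaPoint A S := SpaPoint.ofRel (r.pullback D.toCompleted)
    (hr.pullback D.continuous_toCompleted) fun a ha => by
      change r.vle _ _
      rw [map_one]
      exact hr1 _ (D.isPowerBounded_toCompleted h.toIsTate (h.isPowerBounded a ha))
  have hx : x ∈ D.set S := fun t ht => by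
    change r.vle _ _
    rw [← coe_frac_mul]
    have h1 := hr1 _ ((D.isTate_completed h.toIsTate).isPowerBounded_of_mem_subring
      (D.coe_frac_mem (A₀ := A₀) ht))
    have h2 := r.mul_vle_mul_left h1 (D.toCompleted D.g)
    rwa [one_mul] at h2
  refine ⟨x, hx, fun a b => ?_⟩
  refine D.vle_iff_of_toCompleted hr (D.isContRel_evalRel hx) (fun a b => ?_) a b
  rw [evalRel_toCompleted]
  exact Iff.rfl

/-- A function on a rational subset that is bounded by `1` is power-bounded. -/
theorem isPowerBounded_of_forall_le_one (h : IsTatePair ϖ A₀ S) (f : D.Completed)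
    (hf : ∀ (x : SpaPoint A S) (hx : x ∈ D.set S), D.evalVal hx f ≤ 1) : IsPowerBounded f := by
  by_contra hf'
  have := D.nonarchimedeanRing_completed h.toIsTate
  obtain ⟨r, hr, hr1, hr2⟩ := (D.isTate_completed h.toIsTate).exists_rel_of_not_isPowerBounded f hf'
  obtain ⟨x, hx, hxr⟩ := D.exists_point h r hr hr1
  rw [hxr, evalRel_vle, map_one] at hr2
  exact hr2 (hf x hx)

/-- A function on a rational subset without zeros is a unit. -/
theorem isUnit_of_forall_ne_zero (h : IsTatePair ϖ A₀ S) (f : D.Completed)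
    (hf : ∀ (x : SpaPoint A S) (hx : x ∈ D.set S), D.evalVal hx f ≠ 0) : IsUnit f := by
  by_contra hf'
  have := D.nonarchimedeanRing_completed h.toIsTate
  obtain ⟨r, hr, hr1, hr2⟩ := (D.isTate_completed h.toIsTate).exists_rel_of_not_isUnit f hf'
  obtain ⟨x, hx, hxr⟩ := D.exists_point h r hr hr1
  rw [hxr, evalRel_vle, map_zero] at hr2
  exact hf x hx (le_antisymm hr2 zero_le)

theorem evalVal_le_one_of_mem (h : IsTatePair ϖ A₀ S) {x : SpaPoint A S} (hx : x ∈ D.set S)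
    {b : D.Completed} (hb : b ∈ D.completedSubring A₀) : D.evalVal hx b ≤ 1 := by
  have hcl : IsClosed ((D.evalVal hx).integer : Set D.Completed) := by
    refine AddSubgroup.isClosed_of_isOpen (D.evalVal hx).integer.toAddSubgroup
      (AddSubgroup.isOpen_of_mem_nhds _ (g := 0) ?_)
    refine Filter.mem_of_superset (D.evalVal_nhds hx 1 (by simp)) fun a ha => ?_
    rw [Set.mem_ofPred_eq, map_one] at ha
    exact ha.le
  have hle : D.locSubring A₀ ≤ (D.evalVal hx).integer.comap UniformSpace.Completion.coeRingHom := by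
    refine Subring.closure_le.2 ?_
    rintro _ (⟨a, ha, rfl⟩ | ⟨t, ht, rfl⟩)
    · change D.evalVal hx (D.toCompleted a) ≤ 1
      rw [evalVal_toCompleted, ← map_one x.v, x.v_le_iff]
      exact x.le_one a (h.subset ha)
    · change D.evalVal hx (D.frac t : D.Completed) ≤ 1
      have h1 : x.v t ≤ x.v D.g := (x.v_le_iff t D.g).2 (hx t ht)
      rw [← D.evalVal_toCompleted hx, ← D.evalVal_toCompleted hx, ← coe_frac_mul, map_mul] at h1
      refine le_of_mul_le_mul_right (by rwa [one_mul]) (zero_lt_iff.2 ?_)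
      rw [evalVal_toCompleted]
      exact D.v_g_ne_zero hx
  refine closure_minimal ?_ hcl hb
  rintro _ ⟨c, hc, rfl⟩
  exact hle hc

theorem v_pi_ne_zero (h : IsTate ϖ A₀) (x : SpaPoint A S) : x.v ϖ ≠ 0 := by
  obtain ⟨u, hu⟩ := h.isUnit
  intro h0
  have := congrArg x.v u.mul_inv
  rw [map_mul, hu, h0, zero_mul, map_one] at this
  exact zero_ne_one this

theorem v_pi_lt_one (h : IsTatePair ϖ A₀ S) (x : SpaPoint A S) : x.v ϖ < 1 := by
  obtain ⟨n, hn⟩ := (h.mem_nhds_iff _).1 (x.isContRel 1 (x.rel.not_vle_one_zero))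
  have h1 := hn 1 (one_mem _)
  rw [mul_one, Set.mem_ofPred_eq, ← x.v_le_iff, not_le, map_pow, map_one] at h1
  by_contra h2
  exact absurd h1 (not_lt.2 (one_le_pow₀ (not_lt.1 h2)))

theorem isOpen_set : IsOpen (D.set S) := TopologicalSpace.isOpen_generateFrom_of_mem ⟨D, rfl⟩

theorem exists_near (h : IsTate ϖ A₀) (f : D.Completed) (n : ℕ) :
    ∃ (c : D.Loc), ∃ b ∈ D.completedSubring A₀, f - c = D.toCompleted ϖ ^ n * b := by
  have h1 := (D.isTate_completed h).image_pow_mem_nhds n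
  have hcont : ContinuousAt (fun y : D.Completed => f - y) f :=
    (continuous_const.sub continuous_id).continuousAt
  obtain ⟨_, hy, c, rfl⟩ := mem_closure_iff_nhds.1
    (UniformSpace.Completion.denseRange_coe (α := D.Loc) f) _ (hcont (by simpa using h1))
  obtain ⟨b, hb, hbc⟩ := hy
  exact ⟨c, b, hb, hbc.symm⟩

/-- For functions `f`, `g` on a rational subset, `|f(x)| ≤ |g(x)| ≠ 0` is an open condition: near a
given point, `f` and `g` may be replaced by elements of `A[1/D.g]`. -/
theorem isOpen_evalVal_le (h : IsTatePair ϖ A₀ S) (f g : D.Completed) :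
    IsOpen {x : SpaPoint A S | ∃ hx : x ∈ D.set S, D.evalVal hx f ≤ D.evalVal hx g ∧
      D.evalVal hx g ≠ 0} := by
  classical
  rw [isOpen_iff_mem_nhds]
  rintro x ⟨hx, hfg, hg⟩
  have hT := D.isTate_completed h.toIsTate
  obtain ⟨n, hn⟩ := (hT.mem_nhds_iff _).1 (D.evalVal_nhds hx g hg)
  have hn := hn 1 (one_mem _)
  rw [mul_one, Set.mem_ofPred_eq, map_pow, evalVal_toCompleted] at hn
  obtain ⟨c, p, hp, hcp⟩ := D.exists_near h.toIsTate f (n + 1)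
  obtain ⟨d, q, hq, hdq⟩ := D.exists_near h.toIsTate g (n + 1)
  have small : ∀ (y : SpaPoint A S) (hy : y ∈ D.set S) (p : D.Completed),
      p ∈ D.completedSubring A₀ →
        D.evalVal hy (D.toCompleted ϖ ^ (n + 1) * p) < y.v ϖ ^ n := by
    intro y hy p hp
    rw [map_mul, map_pow, evalVal_toCompleted]
    refine (mul_le_of_le_one_right' (D.evalVal_le_one_of_mem h hy hp)).trans_lt ?_
    rw [pow_succ]
    exact mul_lt_of_lt_one_right (zero_lt_iff.2 (pow_ne_zero _ (v_pi_ne_zero h.toIsTate y)))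
      (v_pi_lt_one h y)
  obtain ⟨a, k, rfl⟩ := D.exists_eq_mul_frac_one_pow c
  obtain ⟨b, l, rfl⟩ := D.exists_eq_mul_frac_one_pow d
  set c : D.Completed := ((algebraMap A D.Loc a * D.frac 1 ^ k : D.Loc) : D.Completed) with hc
  set d : D.Completed := ((algebraMap A D.Loc b * D.frac 1 ^ l : D.Loc) : D.Completed) with hd
  have clear : ∀ (a : A) (k l : ℕ), ((algebraMap A D.Loc a * D.frac 1 ^ k : D.Loc) : D.Completed) *
      D.toCompleted D.g ^ (k + l) = D.toCompleted (a * D.g ^ l) := by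
    intro a k l
    change UniformSpace.Completion.coeRingHom _ *
      (UniformSpace.Completion.coeRingHom (algebraMap A D.Loc D.g)) ^ (k + l) =
      UniformSpace.Completion.coeRingHom (algebraMap A D.Loc (a * D.g ^ l))
    rw [← map_pow, ← map_mul, map_mul (algebraMap A D.Loc), map_pow (algebraMap A D.Loc), pow_add,
      mul_assoc, ← mul_assoc (D.frac 1 ^ k), ← mul_pow, frac_mul, map_one, one_pow, one_mul]
  have hval_c : ∀ (y : SpaPoint A S) (hy : y ∈ D.set S),
      D.evalVal hy c * y.v D.g ^ (k + l) = y.v (a * D.g ^ l) := fun y hy => by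
    rw [← D.evalVal_toCompleted hy, ← D.evalVal_toCompleted hy, ← clear, map_mul, map_pow]
  have hval_d : ∀ (y : SpaPoint A S) (hy : y ∈ D.set S),
      D.evalVal hy d * y.v D.g ^ (k + l) = y.v (b * D.g ^ k) := fun y hy => by
    rw [← D.evalVal_toCompleted hy, ← D.evalVal_toCompleted hy, ← clear b l k, map_mul, map_pow,
      add_comm]
  -- the conditions on `y` that cut out the neighbourhood
  have hpos : ∀ (y : SpaPoint A S) (hy : y ∈ D.set S), 0 < y.v D.g ^ (k + l) := fun y hy =>
    zero_lt_iff.2 (pow_ne_zero _ (D.v_g_ne_zero hy))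
  have hgd : D.evalVal hx d = D.evalVal hx g := by
    have h1 : D.evalVal hx (d - g) < D.evalVal hx g := by
      rw [Valuation.map_sub_swap, hdq]
      exact (small x hx q hq).trans hn
    exact (Valuation.map_eq_of_sub_lt _ h1)
  have hcd : D.evalVal hx c ≤ D.evalVal hx d := by
    rw [hgd, show c = f - (f - c) by ring]
    refine (Valuation.map_sub _ _ _).trans (max_le hfg ?_)
    rw [hcp]
    exact ((small x hx p hp).trans hn).le
  obtain ⟨M, hM⟩ := (h.mem_nhds_iff _).1 (x.isContRel (b * D.g ^ k) (by
    rw [← x.v_le_iff, map_zero, ← hval_d x hx, not_le, hgd]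
    exact mul_pos (zero_lt_iff.2 hg) (hpos x hx)))
  have hM := hM 1 (one_mem _)
  rw [mul_one, Set.mem_ofPred_eq, ← x.v_le_iff, not_le] at hM
  let E : RationalDatum A :=
    { T := {a * D.g ^ l, ϖ ^ n * D.g ^ (k + l), ϖ ^ M}
      g := b * D.g ^ k
      span_eq_top := Ideal.eq_top_of_isUnit_mem _ (Ideal.subset_span (by simp)) (h.isUnit.pow M) }
  refine Filter.mem_of_superset ((D.isOpen_set.inter E.isOpen_set).mem_nhds ⟨hx, fun t ht => ?_⟩)
    ?_
  · rw [← x.v_le_iff]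
    change _ ≤ x.v (b * D.g ^ k)
    simp only [E, Finset.mem_insert, Finset.mem_singleton] at ht
    rcases ht with rfl | rfl | rfl
    · rw [← hval_c x hx, ← hval_d x hx]
      exact mul_le_mul' hcd le_rfl
    · rw [← hval_d x hx, hgd, map_mul, map_pow, map_pow]
      exact mul_le_mul' hn.le le_rfl
    · exact hM.le
  · rintro y ⟨hy, hyE⟩
    have h1 : D.evalVal hy c ≤ D.evalVal hy d := by
      have := (y.v_le_iff _ _).2 (hyE (a * D.g ^ l) (by simp [E]))
      change _ ≤ y.v (b * D.g ^ k) at this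
      rw [← hval_c y hy, ← hval_d y hy] at this
      exact le_of_mul_le_mul_right this (hpos y hy)
    have h2 : y.v ϖ ^ n ≤ D.evalVal hy d := by
      have := (y.v_le_iff _ _).2 (hyE (ϖ ^ n * D.g ^ (k + l)) (by simp [E]))
      change _ ≤ y.v (b * D.g ^ k) at this
      rw [← hval_d y hy, map_mul, map_pow, map_pow] at this
      exact le_of_mul_le_mul_right this (hpos y hy)
    have h3 : D.evalVal hy g = D.evalVal hy d := by
      refine Valuation.map_eq_of_sub_lt _ ?_
      rw [hdq]
      exact (small y hy q hq).trans_le h2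
    refine ⟨hy, ?_, ?_⟩
    · rw [h3, show f = (f - c) + c by ring]
      refine (map_add_le_max (D.evalVal hy) _ _).trans (max_le ?_ h1)
      rw [hcp]
      exact ((small y hy p hp).trans_le h2).le
    · rw [h3]
      exact ((zero_lt_iff.2 (pow_ne_zero _ (v_pi_ne_zero h.toIsTate y))).trans_le h2).ne'

end RationalDatum

/-! ### Perfect Tate rings of characteristic `p` -/

theorem add_pow_prime_of_cast_eq_zero {B : Type*} [CommRing B] {p : ℕ} (hp : p.Prime)
    (h : (p : B) = 0) (x y : B) : (x + y) ^ p = x ^ p + y ^ p := by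
  obtain ⟨r, hr⟩ := exists_add_pow_prime_eq hp x y
  rw [hr, h]
  ring

/-- The Frobenius endomorphism of a ring in which `p = 0`. The zero ring is allowed. -/
def frobeniusHom {B : Type*} [CommRing B] {p : ℕ} (hp : p.Prime) (h : (p : B) = 0) : B →+* B where
  toFun x := x ^ p
  map_one' := one_pow p
  map_mul' x y := mul_pow x y p
  map_zero' := zero_pow hp.ne_zero
  map_add' := add_pow_prime_of_cast_eq_zero hp h

theorem sub_pow_prime_of_cast_eq_zero {B : Type*} [CommRing B] {p : ℕ} (hp : p.Prime)
    (h : (p : B) = 0) (x y : B) : (x - y) ^ p = x ^ p - y ^ p :=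
  map_sub (frobeniusHom hp h) x y

/-- A perfect Tate ring of characteristic `p`: the Frobenius endomorphism is surjective, and its
inverse is bounded. -/
structure IsPerfectTate {B : Type*} [CommRing B] [TopologicalSpace B] (p : ℕ) (ϖ : B)
    (B₀ : Subring B) : Prop extends IsTate ϖ B₀ where
  cast_eq_zero : (p : B) = 0
  surjective : ∀ y : B, ∃ c : B, c ^ p = y
  bound : ∃ m : ℕ, ∀ c : B, c ^ p ∈ B₀ → ϖ ^ m * c ∈ B₀

theorem IsTate.eq_zero_of_forall_mem {B : Type*} [CommRing B] [TopologicalSpace B] [T2Space B]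
    {ϖ : B} {B₀ : Subring B} (h : IsTate ϖ B₀) {b : B}
    (hb : ∀ n : ℕ, ∃ c ∈ B₀, ϖ ^ n * c = b) : b = 0 := by
  by_contra h0
  obtain ⟨n, hn⟩ := (h.mem_nhds_iff _).1 (isOpen_compl_singleton.mem_nhds (Ne.symm h0))
  obtain ⟨c, hc, rfl⟩ := hb n
  exact hn c hc rfl

namespace IsPerfectTate
variable {B : Type*} [CommRing B] {p : ℕ} {ϖ : B} {B₀ : Subring B}

theorem eq_zero_of_pow_eq_zero [TopologicalSpace B] [T2Space B] (h : IsPerfectTate p ϖ B₀)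
    {b : B} (hb : b ^ p = 0) : b = 0 := by
  obtain ⟨m, hm⟩ := h.bound
  obtain ⟨u, hu⟩ := h.isUnit
  refine h.toIsTate.eq_zero_of_forall_mem fun n => ?_
  refine ⟨ϖ ^ m * (↑(u ^ (n + m))⁻¹ * b), hm _ ?_, ?_⟩
  · rw [mul_pow _ b, hb, mul_zero]
    exact zero_mem _
  rw [← mul_assoc, ← mul_assoc, ← pow_add, ← hu, ← Units.val_pow_eq_pow_val, Units.mul_inv, one_mul]

theorem injective [TopologicalSpace B] [T2Space B] (h : IsPerfectTate p ϖ B₀)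
    (hp : p.Prime) {b c : B} (hb : b ^ p = c ^ p) : b = c :=
  sub_eq_zero.1 <| h.eq_zero_of_pow_eq_zero <| by
    rw [sub_pow_prime_of_cast_eq_zero hp h.cast_eq_zero, hb, sub_self]

/-- The power-bounded elements of a perfect Tate ring form a bounded set. -/
theorem isBoundedSubset_powerBounded [TopologicalSpace B] [ContinuousMul B]
    (h : IsPerfectTate p ϖ B₀) (hp : p.Prime) : IsBoundedSubset {b : B | IsPowerBounded b} := by
  obtain ⟨m, hm⟩ := h.bound
  have step : ∀ c : B, ϖ ^ (2 * m) * c ^ p ∈ B₀ → ϖ ^ (2 * m) * c ∈ B₀ := by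
    intro c hc
    have h1 : (ϖ ^ m * c) ^ p ∈ B₀ := by
      have h2 : (ϖ ^ m * c) ^ p = ϖ ^ (m * p - 2 * m) * (ϖ ^ (2 * m) * c ^ p) := by
        have := Nat.mul_le_mul_left m hp.two_le
        rw [mul_pow, ← pow_mul, ← mul_assoc, ← pow_add, Nat.sub_add_cancel (by omega)]
      rw [h2]
      exact mul_mem (h.pow_mem _) hc
    have h3 := hm _ h1
    rwa [← mul_assoc, ← pow_add, ← two_mul] at h3
  refine (h.isBoundedSubset_iff _).2 ⟨2 * m + 1, fun b hb => ?_⟩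
  have h1 : Filter.Tendsto (fun n => (ϖ * b) ^ n) Filter.atTop (𝓝 0) := by
    simp only [mul_pow]
    exact h.tendsto_pow_mul_of_isBounded hb fun n => ⟨n, rfl⟩
  obtain ⟨N, hN⟩ := Filter.mem_atTop_sets.1 (Filter.mem_map.1 (h1 h.subring_mem_nhds))
  have h2 : (ϖ * b) ^ p ^ N ∈ B₀ := hN _ (Nat.lt_pow_self hp.one_lt).le
  have h3 : ∀ k, ϖ ^ (2 * m) * (ϖ * b) ^ p ^ k ∈ B₀ → ϖ ^ (2 * m) * (ϖ * b) ∈ B₀ := by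
    intro k
    induction k with
    | zero => simp
    | succ k ih => exact fun hk => ih (step _ (by rwa [← pow_mul, ← pow_succ]))
  have h4 := h3 N (mul_mem (h.pow_mem _) h2)
  rwa [← mul_assoc, ← pow_succ] at h4

end IsPerfectTate

/-- Successive approximation: in a complete Tate ring of characteristic `p`, elements that are
`p`-th powers up to `ϖ ^ p`, in a bounded way, are `p`-th powers. -/
theorem IsTate.exists_pow_eq {B : Type*} [CommRing B] [UniformSpace B] [IsUniformAddGroup B]
    [NonarchimedeanRing B] [CompleteSpace B] [T2Space B] {p : ℕ} {ϖ : B} {B₀ : Subring B}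
    (h : IsTate ϖ B₀) (hp : p.Prime) (hc : (p : B) = 0) {S S' : Set B} (hS : IsBoundedSubset S)
    (hS' : IsBoundedSubset S') (H : ∀ y ∈ S', ∃ c ∈ S, ∃ y' ∈ S', y = c ^ p + ϖ ^ p * y')
    {y : B} (hy : y ∈ S') : ∃ c, c ^ p = y := by
  choose! c hcS r hr hyr using H
  let z : ℕ → B := fun n => r^[n] y
  have hz : ∀ n, z n ∈ S' := fun n => by
    induction n with
    | zero => exact hy
    | succ n ih =>
      change r^[n + 1] y ∈ S'
      rw [Function.iterate_succ_apply']
      exact hr _ ih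
  have hz' : ∀ n, z n = c (z n) ^ p + ϖ ^ p * z (n + 1) := fun n => by
    have : z (n + 1) = r (z n) := Function.iterate_succ_apply' r n y
    rw [this]
    exact hyr _ (hz n)
  have hsum : Summable fun n => ϖ ^ n * c (z n) :=
    NonarchimedeanAddGroup.summable_of_tendsto_cofinite_zero (by
      rw [Nat.cofinite_eq_atTop]
      exact h.tendsto_pow_mul_of_isBounded hS fun n => hcS _ (hz n))
  obtain ⟨s, hs⟩ := hsum
  refine ⟨s, ?_⟩
  have h1 := hs.tendsto_sum_nat
  have h2 : ∀ n, (∑ i ∈ Finset.range n, ϖ ^ i * c (z i)) ^ p = y - (ϖ ^ p) ^ n * z n := by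
    intro n
    induction n with
    | zero => simp [z, hp.ne_zero]
    | succ n ih =>
      rw [Finset.sum_range_succ, add_pow_prime_of_cast_eq_zero hp hc, ih]
      linear_combination (-(ϖ ^ p) ^ n) * hz' n
  have h3 : Filter.Tendsto (fun n => y - (ϖ ^ p) ^ n * z n) Filter.atTop (𝓝 y) := by
    have h4 : Filter.Tendsto (fun n => ϖ ^ (p * n) * z n) Filter.atTop (𝓝 0) := by
      intro U hU
      obtain ⟨V, hV, HV⟩ := hS' U hU
      have := (h.tendsto_pow.comp (Filter.tendsto_id.const_mul_atTop' hp.pos)) hV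
      refine Filter.mem_map.2 ?_
      filter_upwards [Filter.mem_map.1 this] with n hn
      exact HV _ hn _ (hz n)
    simpa [pow_mul] using tendsto_const_nhds.sub h4
  exact tendsto_nhds_unique (h1.pow p) (by simpa only [h2] using h3)

namespace RationalDatum
variable {A : Type u} [CommRing A] [TopologicalSpace A] [IsTopologicalRing A] [T2Space A]
  (D : RationalDatum A) {p : ℕ} {ϖ : A} {A₀ : Subring A}

theorem cast_loc_eq_zero (h : IsPerfectTate p ϖ A₀) : (p : D.Loc) = 0 := by
  rw [← map_natCast (algebraMap A D.Loc), h.cast_eq_zero, map_zero]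

theorem frobenius_loc_bijective (h : IsPerfectTate p ϖ A₀) (hp : p.Prime) :
    Function.Bijective (frobeniusHom hp (D.cast_loc_eq_zero h)) := by
  constructor
  · rw [injective_iff_map_eq_zero]
    intro x hx
    change x ^ p = 0 at hx
    obtain ⟨a, ⟨_, k, rfl⟩, rfl⟩ := IsLocalization.exists_mk'_eq (Submonoid.powers D.g) x
    rw [← IsLocalization.mk'_pow, IsLocalization.mk'_eq_zero_iff] at hx
    obtain ⟨⟨_, n, rfl⟩, hn⟩ := hx
    rw [IsLocalization.mk'_eq_zero_iff]
    refine ⟨⟨_, n, rfl⟩, h.eq_zero_of_pow_eq_zero ?_⟩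
    change D.g ^ n * a ^ p = 0 at hn
    change (D.g ^ n * a) ^ p = 0
    rw [mul_pow, ← pow_mul, ← Nat.sub_add_cancel (Nat.le_mul_of_pos_right n hp.pos), pow_add,
      mul_assoc, hn, mul_zero]
  · intro x
    obtain ⟨a, k, rfl⟩ := D.exists_eq_mul_frac_one_pow x
    obtain ⟨c, hc⟩ := h.surjective (a * D.g ^ (k * (p - 1)))
    refine ⟨algebraMap A D.Loc c * D.frac 1 ^ k, ?_⟩
    change (algebraMap A D.Loc c * D.frac 1 ^ k) ^ p = _
    have e : k * p = k * (p - 1) + k := by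
      rw [← Nat.mul_succ, Nat.succ_eq_add_one, Nat.sub_add_cancel hp.one_le]
    have e1 : algebraMap A D.Loc D.g ^ (k * (p - 1)) * D.frac 1 ^ (k * (p - 1)) = 1 := by
      rw [← mul_pow, mul_comm, frac_mul, map_one, one_pow]
    rw [mul_pow, ← map_pow, hc, map_mul, map_pow, ← pow_mul, mul_assoc, e, pow_add,
      ← mul_assoc (algebraMap A D.Loc D.g ^ _), e1, one_mul]

theorem exists_bound_loc (h : IsPerfectTate p ϖ A₀) (hp : p.Prime) :
    ∃ m : ℕ, ∀ c : D.Loc, c ^ p ∈ D.locSubring A₀ →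
      algebraMap A D.Loc ϖ ^ m * c ∈ D.locSubring A₀ := by
  classical
  have hT := D.isTate_loc h.toIsTate
  have := hT.nonarchimedeanRing
  let F := RingEquiv.ofBijective _ (D.frobenius_loc_bijective h hp)
  have hF : ∀ x, F x = x ^ p := fun x => rfl
  obtain ⟨m, hm⟩ := h.bound
  -- `A₀^{1/p}` is bounded
  let C : Subring D.Loc := (A₀.map (algebraMap A D.Loc)).map (F.symm : D.Loc →+* D.Loc)
  have hC : IsBoundedSubset (C : Set D.Loc) := by
    rw [hT.isBoundedSubset_iff]
    refine ⟨m, ?_⟩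
    rintro _ ⟨_, ⟨a, ha, rfl⟩, rfl⟩
    obtain ⟨c, rfl⟩ := h.surjective a
    change _ * F.symm _ ∈ _
    rw [map_pow (algebraMap A D.Loc), ← hF, RingEquiv.symm_apply_apply, ← map_pow, ← map_mul]
    exact D.algebraMap_mem_locSubring (hm c ha)
  have hT' : ∀ t ∈ D.T.image (fun t => F.symm (D.frac t)), IsPowerBounded t := by
    intro t ht
    obtain ⟨s, hs, rfl⟩ := Finset.mem_image.1 ht
    refine IsPowerBounded.of_isIntegral (IsIntegral.of_pow hp.pos ?_)
    rw [← hF, RingEquiv.apply_symm_apply]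
    exact isIntegral_algebraMap (A := D.Loc) (x := (⟨D.frac s, hT.isPowerBounded_of_mem_subring
      (D.frac_mem_locSubring hs)⟩ : powerBounded D.Loc))
  obtain ⟨n, hn⟩ := (hT.isBoundedSubset_iff _).1
    (isBoundedSubset_subring_closure_finset _ hT' C hC)
  refine ⟨n, fun c hc => hn _ ?_⟩
  have hle : D.locSubring A₀ ≤ (Subring.closure ((C : Set D.Loc) ∪
      (D.T.image (fun t => F.symm (D.frac t)) : Finset D.Loc))).comap
        (F.symm : D.Loc →+* D.Loc) := by
    refine Subring.closure_le.2 ?_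
    rintro _ (⟨a, ha, rfl⟩ | ⟨t, ht, rfl⟩)
    · exact Subring.subset_closure (Or.inl ⟨_, ⟨a, ha, rfl⟩, rfl⟩)
    · exact Subring.subset_closure (Or.inr (Finset.mem_coe.2 (Finset.mem_image_of_mem _ ht)))
  have := hle hc
  rw [Subring.mem_comap, ← hF] at this
  change F.symm (F c) ∈ _ at this
  rwa [RingEquiv.symm_apply_apply] at this

/-- Rational localizations of perfect Tate rings are perfect. -/
theorem isPerfectTate_completed (h : IsPerfectTate p ϖ A₀) (hp : p.Prime) :
    IsPerfectTate p (D.toCompleted ϖ) (D.completedSubring A₀) := by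
  have hT := D.isTate_completed h.toIsTate
  have hL := D.isTate_loc h.toIsTate
  have := D.nonarchimedeanRing_completed h.toIsTate
  have hcast : (p : D.Completed) = 0 := by
    rw [← map_natCast D.toCompleted, h.cast_eq_zero, map_zero]
  obtain ⟨m, hm⟩ := D.exists_bound_loc h hp
  have hclosed : IsClosed (D.locSubring A₀ : Set D.Loc) :=
    AddSubgroup.isClosed_of_isOpen (D.locSubring A₀).toAddSubgroup
      (AddSubgroup.isOpen_of_mem_nhds _ (g := 0) hL.subring_mem_nhds)
  have hcoe : ∀ c : D.Loc, (c : D.Completed) ∈ D.completedSubring A₀ → c ∈ D.locSubring A₀ := by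
    intro c hc
    have h1 := UniformSpace.Completion.isDenseInducing_coe.isInducing.closure_eq_preimage_closure_image
      (D.locSubring A₀ : Set D.Loc)
    rw [hclosed.closure_eq] at h1
    change c ∈ (D.locSubring A₀ : Set D.Loc)
    rw [h1]
    exact hc
  have hpi : ∀ n, D.toCompleted ϖ ^ n ∈ D.completedSubring A₀ := hT.pow_mem
  have bound : ∀ c : D.Completed, c ^ p ∈ D.completedSubring A₀ →
      D.toCompleted ϖ ^ m * c ∈ D.completedSubring A₀ := by
    intro c hc
    obtain ⟨d, b, hb, hd⟩ := D.exists_near h.toIsTate c 0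
    rw [pow_zero, one_mul] at hd
    have h1 : ((d ^ p : D.Loc) : D.Completed) ∈ D.completedSubring A₀ := by
      change UniformSpace.Completion.coeRingHom (d ^ p) ∈ _
      rw [map_pow, show UniformSpace.Completion.coeRingHom d = c - b by
          rw [← hd, sub_sub_cancel]; rfl,
        sub_pow_prime_of_cast_eq_zero hp hcast]
      exact sub_mem hc (pow_mem hb p)
    have h2 : UniformSpace.Completion.coeRingHom (algebraMap A D.Loc ϖ ^ m * d) ∈
        D.completedSubring A₀ :=
      Subring.le_topologicalClosure _ ⟨_, hm d (hcoe _ h1), rfl⟩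
    rw [map_mul, map_pow] at h2
    have h3 : c = UniformSpace.Completion.coeRingHom d + b := by
      rw [← hd]; exact (add_sub_cancel _ _).symm
    rw [h3, mul_add]
    exact add_mem h2 (mul_mem (hpi m) hb)
  refine ⟨hT, hcast, fun y => ?_, m, bound⟩
  have key : ∀ y ∈ D.completedSubring A₀, ∃ c, c ^ p = y := by
    intro y hy
    refine hT.exists_pow_eq hp hcast (S := {c | D.toCompleted ϖ ^ m * c ∈ D.completedSubring A₀})
      (S' := D.completedSubring A₀) ((hT.isBoundedSubset_iff _).2 ⟨m, fun s hs => hs⟩)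
      hT.isBoundedSubset_subring (fun y hy => ?_) hy
    obtain ⟨d, b, hb, hd⟩ := D.exists_near h.toIsTate y p
    obtain ⟨e, he⟩ := (D.frobenius_loc_bijective h hp).2 d
    change e ^ p = d at he
    have h1 : (UniformSpace.Completion.coeRingHom e : D.Completed) ^ p = d := by
      rw [← map_pow, he]; rfl
    refine ⟨UniformSpace.Completion.coeRingHom e, bound _ ?_, b, hb, ?_⟩
    · rw [h1, show (d : D.Completed) = y - D.toCompleted ϖ ^ p * b by rw [← hd]; ring]
      exact sub_mem hy (mul_mem (hpi p) hb)
    · rw [h1, ← hd]; ring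
  obtain ⟨n, hn⟩ := hT.exists_pow_mul_mem y
  obtain ⟨c, hc⟩ := key (D.toCompleted ϖ ^ (n * p) * y) (by
    have := Nat.le_mul_of_pos_right n hp.pos
    rw [← Nat.sub_add_cancel this, pow_add, mul_assoc]
    exact mul_mem (hpi _) hn)
  obtain ⟨u, hu⟩ := hT.isUnit
  refine ⟨↑(u ^ n)⁻¹ * c, ?_⟩
  rw [mul_pow, hc, ← hu, pow_mul, ← mul_assoc, ← mul_pow, ← Units.val_pow_eq_pow_val,
    Units.inv_mul, one_pow, one_mul]

end RationalDatum

/-! ### Perfectoid affinoid algebras in characteristic `p` -/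

namespace IsPerfectoidField
variable {p : ℕ} {K : Type u} [NormedField K]

theorem exists_pi (hK : IsPerfectoidField p K) : ∃ π : K, π ≠ 0 ∧ ‖π‖ < 1 := by
  obtain ⟨x, hx, hx1⟩ := hK.nondiscrete 0 zero_lt_one
  exact ⟨x, norm_pos_iff.1 hx, hx1⟩

theorem exists_pow_eq (hK : IsPerfectoidField p K) [CharP K p] (x : K) (hx : ‖x‖ ≤ 1) :
    ∃ y : K, y ^ p = x := by
  obtain ⟨y, hy⟩ := hK.frobenius x hx
  rw [CharP.cast_eq_zero, norm_zero, norm_le_zero_iff, sub_eq_zero] at hy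
  exact ⟨y, hy.symm⟩

end IsPerfectoidField

namespace PerfectoidAffinoidAlgebra
variable {p : ℕ} {K : Type u} [NormedField K] (P : PerfectoidAffinoidAlgebra p K)

theorem isTate (π : K) (h0 : π ≠ 0) (h1 : ‖π‖ < 1) : IsTate (algebraMap K P.R π) P.plus := by
  have hu : IsUnit (algebraMap K P.R π) := (isUnit_iff_ne_zero.2 h0).map _
  have hb : IsBoundedSubset (P.plus : Set P.R) :=
    P.isBounded_powerBounded.mono fun a ha => P.isPowerBounded_of_mem_plus a ha
  have ht : Filter.Tendsto (fun n => algebraMap K P.R π ^ n) Filter.atTop (𝓝 0) := by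
    have := (P.continuous_algebraMap.tendsto 0).comp (tendsto_pow_atTop_nhds_zero_of_norm_lt_one h1)
    simpa [Function.comp_def] using this
  refine ⟨hu, P.algebraMap_mem_plus π h1.le, fun U => ⟨fun hU => ?_, ?_⟩⟩
  · obtain ⟨V, hV, H⟩ := hb U hU
    obtain ⟨n, hn⟩ := Filter.mem_atTop_sets.1 (Filter.mem_map.1 (ht hV))
    exact ⟨n, fun b hb => H _ (hn n le_rfl) b hb⟩
  · rintro ⟨n, hn⟩
    obtain ⟨u, hu⟩ := hu
    have hc : ContinuousAt (fun x : P.R => (↑(u ^ n)⁻¹ : P.R) * x) 0 :=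
      (continuous_const_mul _).continuousAt
    have hm : (P.plus : Set P.R) ∈ 𝓝 ((↑(u ^ n)⁻¹ : P.R) * 0) := by
      rw [mul_zero]
      exact P.isOpen_plus.mem_nhds P.plus.zero_mem
    filter_upwards [hc hm] with x hx
    have := hn _ hx
    rwa [← hu, ← mul_assoc, ← Units.val_pow_eq_pow_val, Units.mul_inv, one_mul] at this

theorem isTatePair (π : K) (h0 : π ≠ 0) (h1 : ‖π‖ < 1) :
    IsTatePair (algebraMap K P.R π) P.plus (P.plus : Set P.R) where
  toIsTate := P.isTate π h0 h1
  subset := subset_rfl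
  isPowerBounded := P.isPowerBounded_of_mem_plus

theorem isPerfectTate [CharP K p] (hp : p.Prime) (hK : IsPerfectoidField p K) (π : K)
    (h0 : π ≠ 0) (h1 : ‖π‖ < 1) : IsPerfectTate p (algebraMap K P.R π) P.plus := by
  have := P.complete
  have := P.t2
  have hcast : (p : P.R) = 0 := by
    rw [← map_natCast (algebraMap K P.R), CharP.cast_eq_zero, map_zero]
  have hT := P.isTate π h0 h1
  refine ⟨hT, hcast, fun y => ?_, 0, fun c hc => ?_⟩
  · obtain ⟨ϖ, hϖ0, -, hϖ1, H⟩ := P.frobenius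
    obtain ⟨ρ, hρ⟩ := hK.exists_pow_eq ϖ hϖ1.le
    have hρ0 : ρ ≠ 0 := by
      rintro rfl
      exact hϖ0 (by rw [← hρ, zero_pow hp.ne_zero])
    have hρ1 : ‖ρ‖ < 1 := by
      rw [← hρ, norm_pow] at hϖ1
      exact (pow_lt_one_iff_of_nonneg (norm_nonneg _) hp.ne_zero).1 hϖ1
    have key : ∀ y : P.R, IsPowerBounded y → ∃ c, c ^ p = y := fun y hy =>
      (P.isTate ρ hρ0 hρ1).exists_pow_eq hp hcast (S := {a : P.R | IsPowerBounded a})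
        (S' := {a : P.R | IsPowerBounded a}) P.isBounded_powerBounded P.isBounded_powerBounded
        (fun y hy => by
          obtain ⟨b, c, hb, hc, rfl⟩ := H y hy
          exact ⟨b, hb, c, hc, by rw [← map_pow, hρ]⟩) hy
    obtain ⟨n, hn⟩ := hT.exists_pow_mul_mem y
    obtain ⟨c, hc⟩ := key (algebraMap K P.R π ^ (n * p) * y) (P.isPowerBounded_of_mem_plus _ (by
      have := Nat.le_mul_of_pos_right n hp.pos
      rw [← Nat.sub_add_cancel this, pow_add, mul_assoc]
      exact mul_mem (hT.pow_mem _) hn))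
    obtain ⟨u, hu⟩ := hT.isUnit
    refine ⟨↑(u ^ n)⁻¹ * c, ?_⟩
    rw [mul_pow, hc, ← hu, pow_mul, ← mul_assoc, ← mul_pow, ← Units.val_pow_eq_pow_val,
      Units.inv_mul, one_pow, one_mul]
  · rw [pow_zero, one_mul]
    refine P.mem_plus_of_isIntegral c (IsIntegral.of_pow hp.pos ?_)
    exact isIntegral_algebraMap (A := P.R) (x := (⟨c ^ p, hc⟩ : P.plus))

end PerfectoidAffinoidAlgebra

/-! ### Gauss norms and the rings of the charts -/

namespace AddMonoidAlgebra
variable {K : Type*} [NormedField K] [IsUltrametricDist K] {M : Type*} [AddCommMonoid M]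

theorem nnnorm_def (f : AddMonoidAlgebra K M) : ‖f‖₊ = f.gauss := rfl

theorem nnnorm_single (m : M) (a : K) : ‖(single m a : AddMonoidAlgebra K M)‖₊ = ‖a‖₊ := by
  classical
  rw [nnnorm_def]
  refine le_antisymm ((gauss_le_iff _ _).2 fun m' => ?_) ?_
  · rw [coeff_single, Finsupp.single_apply]
    split_ifs
    · exact le_rfl
    · simp
  · have := le_gauss (single m a : AddMonoidAlgebra K M) m
    rwa [coeff_single, Finsupp.single_eq_same] at this

theorem gauss_pos {f : AddMonoidAlgebra K M} (hf : f ≠ 0) : 0 < f.gauss := by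
  rw [← nnnorm_def]
  exact nnnorm_pos.2 hf

theorem exists_coeff_eq_gauss {f : AddMonoidAlgebra K M} (hf : f ≠ 0) :
    ∃ m ∈ f.coeff.support, ‖f.coeff m‖₊ = f.gauss := by
  have hne : f.coeff.support.Nonempty := by
    rw [Finset.nonempty_iff_ne_empty]
    intro h
    have := gauss_pos hf
    rw [gauss, h, Finset.sup_empty] at this
    exact lt_irrefl _ this
  obtain ⟨m, hm, h⟩ := Finset.exists_mem_eq_sup _ hne fun m => ‖f.coeff m‖₊
  exact ⟨m, hm, h.symm⟩

/-- The Gauss norm is multiplicative: among the terms of `f` and of `g` of maximal norm, two have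
a sum of exponents that no other two such terms have. -/
theorem gauss_mul [UniqueSums M] (f g : AddMonoidAlgebra K M) :
    (f * g).gauss = f.gauss * g.gauss := by
  classical
  rcases eq_or_ne f 0 with rfl | hf
  · simp [gauss]
  rcases eq_or_ne g 0 with rfl | hg
  · simp [gauss]
  have hf0 := gauss_pos hf
  have hg0 := gauss_pos hg
  refine le_antisymm (gauss_mul_le f g) ?_
  obtain ⟨mf, hmf, hmf'⟩ := exists_coeff_eq_gauss hf
  obtain ⟨mg, hmg, hmg'⟩ := exists_coeff_eq_gauss hg
  obtain ⟨a, ha, b, hb, hab⟩ := UniqueSums.uniqueAdd_of_nonempty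
    (A := f.coeff.support.filter fun m => ‖f.coeff m‖₊ = f.gauss)
    (B := g.coeff.support.filter fun m => ‖g.coeff m‖₊ = g.gauss)
    ⟨mf, Finset.mem_filter.2 ⟨hmf, hmf'⟩⟩ ⟨mg, Finset.mem_filter.2 ⟨hmg, hmg'⟩⟩
  rw [Finset.mem_filter] at ha hb
  let F : M × M → K := fun q => if q.1 + q.2 = a + b then f.coeff q.1 * g.coeff q.2 else 0
  have hsum : (f * g).coeff (a + b) = ∑ q ∈ f.coeff.support ×ˢ g.coeff.support, F q := by
    rw [coeff_mul, Finset.sum_product]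
    rfl
  have hmem : (a, b) ∈ f.coeff.support ×ˢ g.coeff.support :=
    Finset.mem_product.2 ⟨ha.1, hb.1⟩
  have hFab : ‖F (a, b)‖₊ = f.gauss * g.gauss := by
    change ‖if a + b = a + b then f.coeff a * g.coeff b else 0‖₊ = _
    rw [if_pos rfl, nnnorm_mul, ha.2, hb.2]
  have hrest : ‖∑ q ∈ (f.coeff.support ×ˢ g.coeff.support).erase (a, b), F q‖₊ <
      f.gauss * g.gauss := by
    refine (IsUltrametricDist.nnnorm_sum_le_of_forall_le (C := Finset.sup _ fun q => ‖F q‖₊)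
      fun q hq => Finset.le_sup (f := fun q => ‖F q‖₊) hq).trans_lt ?_
    rw [Finset.sup_lt_iff (mul_pos hf0 hg0)]
    rintro ⟨m, m'⟩ hq
    obtain ⟨hne, hq⟩ := Finset.mem_erase.1 hq
    obtain ⟨hm, hm'⟩ := Finset.mem_product.1 hq
    change ‖if m + m' = a + b then f.coeff m * g.coeff m' else 0‖₊ < _
    split_ifs with h
    · rw [nnnorm_mul]
      rcases (le_gauss f m).lt_or_eq with h1 | h1
      · exact (mul_le_mul' le_rfl (le_gauss g m')).trans_lt (mul_lt_mul_of_pos_right h1 hg0)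
      · rcases (le_gauss g m').lt_or_eq with h2 | h2
        · exact (mul_le_mul' (le_gauss f m) le_rfl).trans_lt (mul_lt_mul_of_pos_left h2 hf0)
        · obtain ⟨rfl, rfl⟩ := hab (Finset.mem_filter.2 ⟨hm, h1⟩) (Finset.mem_filter.2 ⟨hm', h2⟩) h
          exact absurd rfl hne
    · rw [nnnorm_zero]
      exact mul_pos hf0 hg0
  refine le_trans ?_ (le_gauss (f * g) (a + b))
  rw [hsum, ← Finset.add_sum_erase _ _ hmem]
  have := IsUltrametricDist.norm_add_eq_max_of_norm_ne_norm (S := K)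
    (x := F (a, b)) (y := ∑ q ∈ (f.coeff.support ×ˢ g.coeff.support).erase (a, b), F q)
    (by
      rw [← hFab, ← NNReal.coe_lt_coe] at hrest
      exact hrest.ne')
  have h2 : ‖F (a, b) + ∑ q ∈ (f.coeff.support ×ˢ g.coeff.support).erase (a, b), F q‖₊ =
      max ‖F (a, b)‖₊ ‖∑ q ∈ (f.coeff.support ×ˢ g.coeff.support).erase (a, b), F q‖₊ :=
    NNReal.eq (by simpa only [NNReal.coe_max, coe_nnnorm] using this)
  rw [h2, hFab]
  exact le_max_left _ _

end AddMonoidAlgebra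

/-- The completion of the algebra of finite sums of monomials for the Gauss norm. -/
abbrev GaussCompletion (K : Type*) [NormedField K] [IsUltrametricDist K] (M : Type*)
    [AddCommMonoid M] := UniformSpace.Completion (AddMonoidAlgebra K M)

namespace GaussCompletion
variable {K : Type*} [NormedField K] [IsUltrametricDist K] {M : Type*} [AddCommMonoid M]

theorem norm_add_le_max (x y : GaussCompletion K M) : ‖x + y‖ ≤ max ‖x‖ ‖y‖ := by
  induction x, y using UniformSpace.Completion.induction_on₂ with
  | hp => exact isClosed_le (by fun_prop) (by fun_prop)
  | ih f g =>
    rw [← UniformSpace.Completion.coe_add, UniformSpace.Completion.norm_coe,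
      UniformSpace.Completion.norm_coe, UniformSpace.Completion.norm_coe]
    change ((f + g).gauss : ℝ) ≤ max (f.gauss : ℝ) g.gauss
    norm_cast
    rw [AddMonoidAlgebra.gauss_le_iff]
    intro m
    exact (IsUltrametricDist.nnnorm_add_le_max _ _).trans
      (max_le_max (AddMonoidAlgebra.le_gauss f m) (AddMonoidAlgebra.le_gauss g m))

theorem norm_mul [UniqueSums M] (x y : GaussCompletion K M) : ‖x * y‖ = ‖x‖ * ‖y‖ := by
  induction x, y using UniformSpace.Completion.induction_on₂ with
  | hp => exact isClosed_eq (by fun_prop) (by fun_prop)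
  | ih f g =>
    rw [← UniformSpace.Completion.coe_mul, UniformSpace.Completion.norm_coe,
      UniformSpace.Completion.norm_coe, UniformSpace.Completion.norm_coe]
    exact (congrArg NNReal.toReal (AddMonoidAlgebra.gauss_mul f g)).trans (NNReal.coe_mul _ _)

variable (K M) in
/-- The ring of elements of norm at most `1`. -/
def unitBall : Subring (GaussCompletion K M) where
  carrier := {x | ‖x‖ ≤ 1}
  mul_mem' {x y} hx hy := (norm_mul_le x y).trans (mul_le_one₀ hx (norm_nonneg _) hy)
  one_mem' := by
    change ‖(1 : GaussCompletion K M)‖ ≤ 1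
    rw [← UniformSpace.Completion.coe_one, UniformSpace.Completion.norm_coe]
    have := AddMonoidAlgebra.nnnorm_single (K := K) (0 : M) 1
    rw [nnnorm_one] at this
    exact (congrArg NNReal.toReal this).le
  add_mem' {x y} hx hy := (norm_add_le_max x y).trans (max_le hx hy)
  zero_mem' := by simp
  neg_mem' {x} hx := by
    change ‖-x‖ ≤ 1
    rwa [norm_neg]

theorem norm_algebraMap_mul (a : K) (x : GaussCompletion K M) :
    ‖algebraMap K (GaussCompletion K M) a * x‖ = ‖a‖ * ‖x‖ := by
  rw [← Algebra.smul_def]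
  rcases eq_or_ne a 0 with rfl | ha
  · simp
  refine le_antisymm (norm_smul_le _ _) ?_
  have h1 := norm_smul_le a⁻¹ (a • x)
  rwa [smul_smul, inv_mul_cancel₀ ha, one_smul, norm_inv, inv_mul_eq_div,
    le_div_iff₀' (norm_pos_iff.2 ha)] at h1

theorem isTate {π : K} (h0 : π ≠ 0) (h1 : ‖π‖ < 1) :
    IsTate (algebraMap K (GaussCompletion K M) π) (unitBall K M) where
  isUnit := (isUnit_iff_ne_zero.2 h0).map _
  mem := by
    change ‖_‖ ≤ 1
    rw [← mul_one (algebraMap K (GaussCompletion K M) π), norm_algebraMap_mul]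
    exact mul_le_one₀ h1.le (norm_nonneg _) (unitBall K M).one_mem
  mem_nhds_iff U := by
    have key : ∀ (n : ℕ) (x : GaussCompletion K M),
        ‖algebraMap K (GaussCompletion K M) π ^ n * x‖ = ‖π‖ ^ n * ‖x‖ := fun n x => by
      rw [← map_pow, norm_algebraMap_mul, norm_pow]
    constructor
    · intro hU
      obtain ⟨ε, hε, h⟩ := Metric.mem_nhds_iff.1 hU
      obtain ⟨n, hn⟩ := exists_pow_lt_of_lt_one hε h1
      refine ⟨n, fun b hb => h ?_⟩
      rw [mem_ball_zero_iff, key]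
      exact (mul_le_of_le_one_right (by positivity) hb).trans_lt hn
    · rintro ⟨n, hn⟩
      have hpos : 0 < ‖π‖ ^ n := pow_pos (norm_pos_iff.2 h0) n
      refine Filter.mem_of_superset (Metric.ball_mem_nhds _ hpos) fun x hx => ?_
      rw [mem_ball_zero_iff] at hx
      have := hn (algebraMap K _ (π ^ n)⁻¹ * x) (by
        change ‖_‖ ≤ 1
        rw [norm_algebraMap_mul, norm_inv, norm_pow, inv_mul_le_one₀ hpos]
        exact hx.le)
      rwa [← map_pow, ← mul_assoc, ← map_mul, mul_inv_cancel₀ (pow_ne_zero _ h0), map_one,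
        one_mul] at this

theorem mem_unitBall_of_isPowerBounded [UniqueSums M] {π : K} (h0 : π ≠ 0) (h1 : ‖π‖ < 1)
    {x : GaussCompletion K M} (hx : IsPowerBounded x) : x ∈ unitBall K M := by
  by_contra h
  replace h : 1 < ‖x‖ := not_le.1 h
  obtain ⟨m, hm⟩ := ((isTate h0 h1).isBoundedSubset_iff _).1 hx
  have hpow : ∀ n : ℕ, ‖x ^ n‖ = ‖x‖ ^ n := by
    intro n
    induction n with
    | zero =>
      have e := norm_mul (1 : GaussCompletion K M) x
      rw [one_mul] at e
      rw [pow_zero, pow_zero]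
      exact (mul_eq_right₀ (by linarith : ‖x‖ ≠ 0)).1 e.symm
    | succ n ih => rw [pow_succ, norm_mul, ih, pow_succ]
  have hpos : 0 < ‖π‖ ^ m := pow_pos (norm_pos_iff.2 h0) m
  obtain ⟨n, hn⟩ := pow_unbounded_of_one_lt (‖π‖ ^ m)⁻¹ h
  have := hm _ ⟨n, rfl⟩
  change ‖_‖ ≤ 1 at this
  rw [← map_pow, norm_algebraMap_mul, norm_pow, hpow] at this
  have h2 := (mul_lt_mul_iff_right₀ hpos).2 hn
  rw [mul_inv_cancel₀ hpos.ne'] at h2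
  exact absurd this (not_le.2 h2)

theorem isTatePair [UniqueSums M] {π : K} (h0 : π ≠ 0) (h1 : ‖π‖ < 1) :
    IsTatePair (algebraMap K (GaussCompletion K M) π) (unitBall K M)
      {x : GaussCompletion K M | IsPowerBounded x} where
  toIsTate := isTate h0 h1
  subset _ hx := (isTate h0 h1).isPowerBounded_of_mem_subring hx
  isPowerBounded _ hx := hx

variable (K) in
/-- The monomial with exponent `m`. -/
noncomputable def mono (m : M) : GaussCompletion K M :=
  (AddMonoidAlgebra.single m 1 : AddMonoidAlgebra K M)

theorem mono_add (m m' : M) : mono K (m + m') = mono K m * mono K m' := by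
  rw [mono, mono, mono, ← UniformSpace.Completion.coe_mul, AddMonoidAlgebra.single_mul_single,
    mul_one]

theorem mono_zero : mono K (0 : M) = 1 := UniformSpace.Completion.coe_one _

variable (K M) in
/-- The multiplicative homomorphism which maps an exponent to its monomial. -/
noncomputable def monoHom : Multiplicative M →* GaussCompletion K M where
  toFun m := mono K m.toAdd
  map_one' := mono_zero
  map_mul' _ _ := mono_add _ _

theorem mono_sum {ι : Type*} (s : Finset ι) (f : ι → M) :
    mono K (∑ x ∈ s, f x) = ∏ x ∈ s, mono K (f x) := by
  have := map_prod (monoHom K M) (fun x => Multiplicative.ofAdd (f x)) s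
  rwa [← ofAdd_sum] at this

theorem coe_single (m : M) (a : K) :
    ((AddMonoidAlgebra.single m a : AddMonoidAlgebra K M) : GaussCompletion K M) =
      algebraMap K _ a * mono K m := by
  rw [← Algebra.smul_def, mono, ← UniformSpace.Completion.coe_smul, AddMonoidAlgebra.smul_single,
    smul_eq_mul, mul_one]

theorem norm_mono_le (m : M) : ‖mono K m‖ ≤ 1 := by
  rw [mono, UniformSpace.Completion.norm_coe]
  have := AddMonoidAlgebra.nnnorm_single (K := K) m 1
  rw [nnnorm_one] at this
  exact (congrArg NNReal.toReal this).le

theorem coe_eq_sum (f : AddMonoidAlgebra K M) : (f : GaussCompletion K M) =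
    ∑ m ∈ f.coeff.support, algebraMap K _ (f.coeff m) * mono K m := by
  conv_lhs => rw [← AddMonoidAlgebra.sum_coeff_single f]
  change UniformSpace.Completion.coeRingHom _ = _
  rw [Finsupp.sum, map_sum]
  exact Finset.sum_congr rfl fun m _ => coe_single m _

theorem unitBall_le (T : AddSubgroup (GaussCompletion K M)) (hT : IsClosed (T : Set (GaussCompletion K M)))
    (H : ∀ (a : K) (m : M), ‖a‖ ≤ 1 → algebraMap K _ a * mono K m ∈ T) {x : GaussCompletion K M}
    (hx : x ∈ unitBall K M) : x ∈ T := by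
  have hopen : IsOpen (unitBall K M : Set (GaussCompletion K M)) :=
    AddSubgroup.isOpen_of_mem_nhds (unitBall K M).toAddSubgroup (g := 0)
      (Filter.mem_of_superset (Metric.ball_mem_nhds _ one_pos) fun y hy =>
        (mem_ball_zero_iff.1 hy).le)
  have h1 : x ∈ closure ((unitBall K M : Set (GaussCompletion K M)) ∩
      Set.range ((↑) : AddMonoidAlgebra K M → GaussCompletion K M)) :=
    (UniformSpace.Completion.denseRange_coe.open_subset_closure_inter hopen) hx
  refine closure_minimal ?_ hT h1
  rintro _ ⟨hf, f, rfl⟩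
  change ‖(f : GaussCompletion K M)‖ ≤ 1 at hf
  rw [UniformSpace.Completion.norm_coe] at hf
  change (f : GaussCompletion K M) ∈ T
  rw [coe_eq_sum]
  refine T.sum_mem fun m _ => H _ _ ?_
  exact (NNReal.coe_le_coe.2 (AddMonoidAlgebra.le_gauss f m)).trans hf

theorem hom_ext {B : Type*} [CommRing B] [TopologicalSpace B] [T2Space B]
    {f g : GaussCompletion K M →+* B} (hf : Continuous f) (hg : Continuous g)
    (h : ∀ a, f (algebraMap K _ a) = g (algebraMap K _ a)) (h' : ∀ m, f (mono K m) = g (mono K m)) :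
    f = g := by
  refine RingHom.ext fun x => ?_
  refine congrFun (UniformSpace.Completion.denseRange_coe.equalizer hf hg (funext fun c => ?_)) x
  simp only [Function.comp_apply]
  rw [coe_eq_sum, map_sum, map_sum]
  exact Finset.sum_congr rfl fun m _ => by rw [map_mul, map_mul, h, h']

/-- A continuous homomorphism from the completed monoid algebra is given by a continuous
homomorphism on the coefficients and a bounded family of values of the monomials. -/
theorem exists_hom {B : Type*} [CommRing B] [TopologicalSpace B] [NonarchimedeanRing B]
    (hB : @CompleteSpace B (IsTopologicalAddGroup.rightUniformSpace B)) [T2Space B]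
    (κ : K →+* B) (hκ : Continuous κ) (w : Multiplicative M →* B)
    (hw : IsBoundedSubset (Set.range w)) :
    ∃ f : GaussCompletion K M →+* B, Continuous f ∧ (∀ a, f (algebraMap K _ a) = κ a) ∧
      ∀ m, f (mono K m) = w (.ofAdd m) := by
  let _ : UniformSpace B := IsTopologicalAddGroup.rightUniformSpace B
  have : IsUniformAddGroup B := isUniformAddGroup_of_addCommGroup
  let f₀ : AddMonoidAlgebra K M →+* B :=
    AddMonoidAlgebra.liftNCRingHom κ w fun _ _ => Commute.all _ _
  have hs : ∀ m a, f₀ (AddMonoidAlgebra.single m a) = κ a * w (.ofAdd m) := fun m a =>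
    AddMonoidAlgebra.liftNCRingHom_single _ _ _ _ _
  have hf₀ : Continuous f₀ := by
    refine continuous_of_continuousAt_zero f₀ fun U hU => ?_
    rw [map_zero] at hU
    obtain ⟨W, hW⟩ := NonarchimedeanRing.is_nonarchimedean U hU
    obtain ⟨V, hV, H⟩ := hw W (W.mem_nhds_zero)
    have hV' := hκ.continuousAt (x := 0) (by rwa [map_zero])
    obtain ⟨ε, hε, hεV⟩ := Metric.mem_nhds_iff.1 hV'
    refine Filter.mem_map.2 (Filter.mem_of_superset (Metric.ball_mem_nhds _ hε) fun g hg => hW ?_)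
    rw [mem_ball_zero_iff] at hg
    rw [← AddMonoidAlgebra.sum_coeff_single g, Finsupp.sum, map_sum]
    refine W.toAddSubgroup.sum_mem fun m _ => ?_
    rw [hs]
    refine H _ (hεV ?_) _ ⟨_, rfl⟩
    rw [mem_ball_zero_iff]
    exact (NNReal.coe_le_coe.2 (AddMonoidAlgebra.le_gauss g m)).trans_lt hg
  refine ⟨UniformSpace.Completion.extensionHom f₀ hf₀, UniformSpace.Completion.continuous_extension,
    fun a => ?_, fun m => ?_⟩
  · have h1 : algebraMap K (GaussCompletion K M) a =
        ((AddMonoidAlgebra.single (0 : M) a : AddMonoidAlgebra K M) : GaussCompletion K M) := by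
      rw [coe_single, mono_zero, mul_one]
    rw [h1, UniformSpace.Completion.extensionHom_coe, hs, ofAdd_zero, map_one, mul_one]
  · rw [mono, UniformSpace.Completion.extensionHom_coe, hs, map_one, one_mul]

/-- A continuous valuation that is at most `1` on the integers of `K` and on the monomials is at
most `1` on power-bounded elements. -/
theorem vle_one_of_isPowerBounded [UniqueSums M] {π : K} (h0 : π ≠ 0) (h1 : ‖π‖ < 1)
    {r : ValuativeRel (GaussCompletion K M)} (hr : IsContRel r)
    (hK : ∀ a : K, ‖a‖ ≤ 1 → r.vle (algebraMap K _ a) 1) (hm : ∀ m, r.vle (mono K m) 1)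
    {x : GaussCompletion K M} (hx : IsPowerBounded x) : r.vle x 1 := by
  have hx := mem_unitBall_of_isPowerBounded h0 h1 hx
  let T : AddSubgroup (GaussCompletion K M) :=
    { carrier := {x | r.vle x 1}
      add_mem' := fun ha hb => r.vle_add ha hb
      zero_mem' := (r.vle_total 0 1).resolve_right r.not_vle_one_zero
      neg_mem' := fun {y} hy => by
        let := r
        have e := fun a b : GaussCompletion K M =>
          Valuation.Compatible.vle_iff_le (v := ValuativeRel.valuation _) a b
        change r.vle y 1 at hy
        change r.vle (-y) 1
        rw [e] at hy ⊢
        rwa [Valuation.map_neg] }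
  have hT : IsClosed (T : Set (GaussCompletion K M)) := by
    refine AddSubgroup.isClosed_of_isOpen T (AddSubgroup.isOpen_of_mem_nhds _ (g := 0) ?_)
    refine Filter.mem_of_superset (hr 1 r.not_vle_one_zero) fun y hy => ?_
    exact (r.vle_total y 1).resolve_right hy
  refine unitBall_le T hT (fun a m ha => ?_) hx
  have h2 := r.mul_vle_mul_left (hK a ha) (mono K m)
  rw [one_mul] at h2
  exact r.vle_trans h2 (hm m)

end GaussCompletion

/-! ### Extension of homomorphisms to rational localizations -/

namespace RationalDatum
variable {A : Type u} [CommRing A] [TopologicalSpace A] [IsTopologicalRing A] (D : RationalDatum A)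

theorem exists_lift {B : Type*} [CommRing B] [TopologicalSpace B] [NonarchimedeanRing B]
    (hB : @CompleteSpace B (IsTopologicalAddGroup.rightUniformSpace B)) [T2Space B]
    (h : A →+* B) (hh : Continuous h) (hu : IsUnit (h D.g))
    (hT : ∀ t ∈ D.T, ∀ s, s * h D.g = h t → IsPowerBounded s) :
    ∃ ρ : D.Completed →+* B, Continuous ρ ∧ ∀ a, ρ (D.toCompleted a) = h a := by
  let _ : UniformSpace B := IsTopologicalAddGroup.rightUniformSpace B
  have : IsUniformAddGroup B := isUniformAddGroup_of_addCommGroup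
  let f : D.Loc →+* B := IsLocalization.Away.lift D.g hu
  have hf : ∀ a, f (algebraMap A D.Loc a) = h a := fun a => IsLocalization.Away.lift_eq _ _ _
  have hfc : Continuous f := by
    refine D.continuous_of_isPowerBounded f (hh.congr fun a => (hf a).symm) fun t ht =>
      hT t ht _ ?_
    rw [← hf, ← map_mul, frac_mul, hf]
  refine ⟨UniformSpace.Completion.extensionHom f hfc, UniformSpace.Completion.continuous_extension,
    fun a => ?_⟩
  exact (UniformSpace.Completion.extensionHom_coe f hfc _).trans (hf a)

variable {D} in
theorem hom_ext {B : Type*} [CommRing B] [TopologicalSpace B] [T2Space B]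
    {f g : D.Completed →+* B} (hf : Continuous f) (hg : Continuous g)
    (h : ∀ a, f (D.toCompleted a) = g (D.toCompleted a)) : f = g := by
  refine RingHom.ext fun x => congrFun
    (UniformSpace.Completion.denseRange_coe.equalizer hf hg (funext fun c => ?_)) x
  have : f.comp UniformSpace.Completion.coeRingHom = g.comp UniformSpace.Completion.coeRingHom :=
    IsLocalization.ringHom_ext (Submonoid.powers D.g) (RingHom.ext h)
  exact congrArg (fun F => F c) this

end RationalDatum

/-- Hypotheses on the exponents of the coordinates: `one` is cofinal, every exponent is
commensurable with `one`, and finite nonempty sets of exponents have sums that are attained only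
once. -/
structure IsExponentMonoid (E : Type) [AddCommMonoid E] (one : E) : Prop where
  exists_add : ∀ e : E, ∃ (N : ℕ) (e' : E), e + e' = N • one
  exists_nsmul : ∀ e : E, ∃ N M : ℕ, 0 < N ∧ N • e = M • one
  uniqueSums : UniqueSums E

namespace ProjectiveSpace
variable {K : Type u} [NormedField K] [IsUltrametricDist K] {n : ℕ} {E : Type} [AddCommMonoid E]

/-! ### Homogeneous coordinates -/

variable (K) in
/-- The function `(T_a / T_i)^e` on the chart `i`. -/
noncomputable abbrev ratio (i a : Fin (n + 1)) (e : E) : Chart K n E i :=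
  dehom K i (monomial K a e)

theorem dehom_single (i : Fin (n + 1)) (m : Fin (n + 1) → E) (a : K) :
    dehom K i (AddMonoidAlgebra.single m a) =
      algebraMap K (Chart K n E i) a * GaussCompletion.mono K fun b : {b // b ≠ i} => m b.1 := by
  rw [← GaussCompletion.coe_single]
  exact congrArg (fun f : AddMonoidAlgebra K ({b : Fin (n + 1) // b ≠ i} → E) => (f : Chart K n E i))
    (AddMonoidAlgebra.mapDomain_single ..)

theorem ratio_eq_mono (i a : Fin (n + 1)) (e : E) : ratio K i a e =
    GaussCompletion.mono K fun b : {b // b ≠ i} => (Pi.single a e : Fin (n + 1) → E) b.1 := by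
  rw [ratio, monomial, dehom_single, map_one, one_mul]

theorem ratio_self (i : Fin (n + 1)) (e : E) : ratio K i i e = 1 := dehom_monomial_self K i e

theorem ratio_add (i a : Fin (n + 1)) (e e' : E) :
    ratio K i a (e + e') = ratio K i a e * ratio K i a e' := by
  rw [ratio_eq_mono, ratio_eq_mono, ratio_eq_mono, ← GaussCompletion.mono_add]
  congr 1
  ext b
  rw [Pi.single_add]
  rfl

theorem ratio_zero (i a : Fin (n + 1)) : ratio K i a (0 : E) = 1 := by
  rw [ratio_eq_mono, ← GaussCompletion.mono_zero]
  congr 1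
  ext b
  rw [Pi.single_zero]
  rfl

theorem ratio_nsmul (i a : Fin (n + 1)) (N : ℕ) (e : E) :
    ratio K i a (N • e) = ratio K i a e ^ N := by
  induction N with
  | zero => rw [zero_smul, ratio_zero, pow_zero]
  | succ N ih => rw [succ_nsmul, ratio_add, ih, pow_succ]

theorem ratio_sum {ι : Type*} (s : Finset ι) (i a : Fin (n + 1)) (f : ι → E) :
    ratio K i a (∑ x ∈ s, f x) = ∏ x ∈ s, ratio K i a (f x) := by
  classical
  induction s using Finset.induction_on with
  | empty => rw [Finset.sum_empty, Finset.prod_empty, ratio_zero]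
  | insert x s hx ih => rw [Finset.sum_insert hx, Finset.prod_insert hx, ratio_add, ih]

theorem mono_eq_prod (i : Fin (n + 1)) (m : Fin (n + 1) → E) :
    (GaussCompletion.mono K fun b : {b // b ≠ i} => m b.1) = ∏ b, ratio K i b (m b) := by
  have h1 : (fun b : {b // b ≠ i} => m b.1) =
      ∑ c, fun b : {b // b ≠ i} => (Pi.single c (m c) : Fin (n + 1) → E) b.1 := by
    ext b
    rw [Finset.sum_apply, ← Finset.sum_apply b.1 Finset.univ fun c => Pi.single c (m c),
      Finset.univ_sum_single]
  rw [h1, GaussCompletion.mono_sum]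
  exact Finset.prod_congr rfl fun b _ => (ratio_eq_mono i b (m b)).symm

theorem norm_ratio_le (i a : Fin (n + 1)) (e : E) : ‖ratio K i a e‖ ≤ 1 := by
  rw [ratio_eq_mono]
  exact GaussCompletion.norm_mono_le _

/-- An arbitrary monomial in the chart `i` as a product of powers of coordinates. -/
theorem mono_eq_prod' (i : Fin (n + 1)) (m : {b : Fin (n + 1) // b ≠ i} → E) :
    GaussCompletion.mono K m =
      ∏ b, ratio K i b (if h : b ≠ i then m ⟨b, h⟩ else 0) := by
  rw [← mono_eq_prod]
  congr 1
  ext b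
  rw [dif_pos b.2]

theorem hom_ext {i : Fin (n + 1)} {B : Type*} [CommRing B] [TopologicalSpace B] [T2Space B]
    {f g : Chart K n E i →+* B} (hf : Continuous f) (hg : Continuous g)
    (h : ∀ a, f (algebraMap K _ a) = g (algebraMap K _ a))
    (h' : ∀ a e, f (ratio K i a e) = g (ratio K i a e)) : f = g := by
  refine GaussCompletion.hom_ext hf hg h fun m => ?_
  rw [mono_eq_prod', map_prod, map_prod]
  exact Finset.prod_congr rfl fun b _ => h' _ _

/-- A continuous homomorphism from the ring of a chart is given by a continuous homomorphism on
`K` and bounded systems of powers of the values of the coordinates. -/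
theorem exists_hom {B : Type*} [CommRing B] [TopologicalSpace B] [NonarchimedeanRing B]
    (hB : @CompleteSpace B (IsTopologicalAddGroup.rightUniformSpace B)) [T2Space B]
    (i : Fin (n + 1)) (κ : K →+* B) (hκ : Continuous κ)
    (χ : Fin (n + 1) → Multiplicative E →* B) (hχ : χ i = 1)
    (hb : IsBoundedSubset (Set.range fun m : Fin (n + 1) → E => ∏ b, χ b (.ofAdd (m b)))) :
    ∃ f : Chart K n E i →+* B, Continuous f ∧ (∀ a, f (algebraMap K _ a) = κ a) ∧
      ∀ a e, f (ratio K i a e) = χ a (.ofAdd e) := by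
  let w : Multiplicative ({b : Fin (n + 1) // b ≠ i} → E) →* B :=
    { toFun := fun m => ∏ b : {b // b ≠ i}, χ b.1 (.ofAdd (m.toAdd b))
      map_one' := Finset.prod_eq_one fun b _ => map_one _
      map_mul' := fun m m' => by
        rw [← Finset.prod_mul_distrib]
        exact Finset.prod_congr rfl fun b _ => map_mul _ _ _ }
  have hw : ∀ m : Fin (n + 1) → E, w (.ofAdd fun b => m b.1) = ∏ b, χ b (.ofAdd (m b)) := by
    intro m
    change ∏ b : {b // b ≠ i}, χ b.1 (.ofAdd (m b.1)) = _
    rw [← Fintype.prod_subtype_mul_prod_subtype (fun b => b ≠ i) fun b => χ b (.ofAdd (m b)),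
      Finset.prod_eq_one (s := (Finset.univ : Finset {b // ¬ b ≠ i})), mul_one]
    rintro ⟨b, hb⟩ -
    obtain rfl : b = i := not_not.1 hb
    rw [hχ, MonoidHom.one_apply]
  have hwb : IsBoundedSubset (Set.range w) := by
    refine hb.mono ?_
    rintro _ ⟨m, rfl⟩
    refine ⟨fun b => if h : b ≠ i then m.toAdd ⟨b, h⟩ else 0, ?_⟩
    dsimp only
    rw [← hw]
    congr 1
    refine congrArg Multiplicative.ofAdd (funext fun b => dif_pos b.2)
  obtain ⟨f, hf, hfK, hfm⟩ := GaussCompletion.exists_hom hB κ hκ w hwb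
  refine ⟨f, hf, hfK, fun a e => ?_⟩
  rw [ratio_eq_mono, hfm, hw, Finset.prod_eq_single a, Pi.single_eq_same]
  · intro b _ hb
    rw [Pi.single_eq_of_ne hb, ofAdd_zero, map_one]
  · exact fun h => absurd (Finset.mem_univ a) h

end ProjectiveSpace

theorem ValuativeRel.vle_mul_isUnit_iff {B : Type*} [CommRing B] (r : ValuativeRel B) {u : B}
    (hu : IsUnit u) {a b : B} : r.vle (a * u) (b * u) ↔ r.vle a b := by
  refine ⟨fun h => ?_, fun h => r.mul_vle_mul_left h u⟩
  obtain ⟨u, rfl⟩ := hu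
  have := r.mul_vle_mul_left h ↑u⁻¹
  rwa [mul_assoc, mul_assoc, u.mul_inv, mul_one, mul_one] at this

theorem RationalDatum.completeSpace_completed {A : Type u} [CommRing A] [TopologicalSpace A]
    (D : RationalDatum A) :
    @CompleteSpace D.Completed (IsTopologicalAddGroup.rightUniformSpace D.Completed) := by
  rw [IsUniformAddGroup.rightUniformSpace_eq]
  infer_instance

namespace ProjectiveSpace
variable {K : Type u} [NormedField K] [IsUltrametricDist K] {n : ℕ} {E : Type} [AddCommMonoid E]

theorem IsHomogeneous.add {F G : AddMonoidAlgebra K (Fin (n + 1) → E)} {d : E}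
    (hF : IsHomogeneous F d) (hG : IsHomogeneous G d) : IsHomogeneous (F + G) d := by
  classical
  intro m hm
  rcases Finset.mem_union.1 (Finsupp.support_add hm) with h | h
  exacts [hF m h, hG m h]

theorem isHomogeneous_single {m : Fin (n + 1) → E} {d : E} (h : ∑ a, m a = d) (c : K) :
    IsHomogeneous (AddMonoidAlgebra.single m c) d := by
  intro m' hm'
  rw [AddMonoidAlgebra.coeff_single] at hm'
  rw [Finset.mem_singleton.1 (Finsupp.support_single_subset hm'), h]

theorem isHomogeneous_monomial (a : Fin (n + 1)) (e : E) : IsHomogeneous (monomial K a e) e :=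
  isHomogeneous_single (Fintype.sum_pi_single' a e) 1

/-- Every polynomial in the coordinates of a chart is the dehomogenization of homogeneous
polynomials of all sufficiently large degrees. -/
theorem exists_homogeneous {one : E} (hE : IsExponentMonoid E one) (i : Fin (n + 1))
    (f : AddMonoidAlgebra K ({a : Fin (n + 1) // a ≠ i} → E)) :
    ∃ N₀ : ℕ, ∀ N, N₀ ≤ N → ∃ F : AddMonoidAlgebra K (Fin (n + 1) → E),
      IsHomogeneous F (N • one) ∧ dehom K i F = f := by
  induction f using AddMonoidAlgebra.induction_linear with
  | zero =>
    exact ⟨0, fun N _ => ⟨0, fun m hm => by simp at hm, by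
      rw [map_zero, UniformSpace.Completion.coe_zero]⟩⟩
  | add f g hf hg =>
    obtain ⟨N, hN⟩ := hf
    obtain ⟨N', hN'⟩ := hg
    refine ⟨max N N', fun k hk => ?_⟩
    obtain ⟨F, hF, rfl'⟩ := hN k ((le_max_left _ _).trans hk)
    obtain ⟨G, hG, rfl''⟩ := hN' k ((le_max_right _ _).trans hk)
    exact ⟨F + G, hF.add hG, by rw [map_add, UniformSpace.Completion.coe_add, rfl', rfl'']⟩
  | single m c =>
    obtain ⟨N, e, he⟩ := hE.exists_add (∑ b, m b)
    refine ⟨N, fun k hk => ⟨AddMonoidAlgebra.single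
      (fun b => if h : b ≠ i then m ⟨b, h⟩ else e + (k - N) • one) c,
      isHomogeneous_single ?_ c, ?_⟩⟩
    · rw [Fintype.sum_eq_add_sum_subtype_ne _ i, dif_neg (not_not.2 rfl), add_comm,
        Finset.sum_congr rfl fun b _ => dif_pos b.2, ← add_assoc]
      change ∑ b, m b + e + _ = _
      rw [he, ← add_smul, Nat.add_sub_cancel' hk]
    · rw [dehom_single, GaussCompletion.coe_single]
      congr 2
      exact funext fun b => dif_pos b.2

/-- A continuous valuation of the ring of a chart is determined by its values on fractions of
homogeneous polynomials of the same degree. -/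
theorem vle_iff_of_homogeneous {one : E} (hE : IsExponentMonoid E one) {i : Fin (n + 1)}
    {r r' : ValuativeRel (Chart K n E i)} (hr : IsContRel r) (hr' : IsContRel r')
    (H : ∀ (d : E) (F G : AddMonoidAlgebra K (Fin (n + 1) → E)), IsHomogeneous F d →
      IsHomogeneous G d → (r.vle (dehom K i F) (dehom K i G) ↔ r'.vle (dehom K i F) (dehom K i G)))
    (x y : Chart K n E i) : r.vle x y ↔ r'.vle x y := by
  refine hr.vle_iff_of_dense hr' UniformSpace.Completion.coeRingHom
    UniformSpace.Completion.denseRange_coe (fun f g => ?_) x y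
  obtain ⟨N, hN⟩ := exists_homogeneous hE i f
  obtain ⟨N', hN'⟩ := exists_homogeneous hE i g
  obtain ⟨F, hF, hFf⟩ := hN _ (le_max_left N N')
  obtain ⟨G, hG, hGg⟩ := hN' _ (le_max_right N N')
  have := H _ F G hF hG
  rwa [hFf, hGg] at this

/-- Homomorphisms from the rings of two charts which are related by the change of coordinates. -/
structure IsCoordChange {B : Type*} [CommRing B] {i j : Fin (n + 1)} (h : Chart K n E i →+* B)
    (h' : Chart K n E j →+* B) : Prop where
  map_algebraMap : ∀ c, h' (algebraMap K _ c) = h (algebraMap K _ c)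
  map_ratio : ∀ a e, h' (ratio K j a e) * h (ratio K i j e) = h (ratio K i a e)

namespace IsCoordChange
variable {B : Type*} [CommRing B] {i j : Fin (n + 1)} {h : Chart K n E i →+* B}
  {h' : Chart K n E j →+* B}

theorem mul_eq_one (H : IsCoordChange h h') (e : E) :
    h' (ratio K j i e) * h (ratio K i j e) = 1 := by
  rw [H.map_ratio, ratio_self, map_one]

theorem isUnit (H : IsCoordChange h h') (e : E) : IsUnit (h (ratio K i j e)) :=
  .of_mul_eq_one _ ((mul_comm _ _).trans (H.mul_eq_one e))

/-- The coordinate change for a homogeneous polynomial. -/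
theorem map_dehom (H : IsCoordChange h h') {F : AddMonoidAlgebra K (Fin (n + 1) → E)} {d : E}
    (hF : IsHomogeneous F d) : h' (dehom K j F) * h (ratio K i j d) = h (dehom K i F) := by
  have hsum : F = ∑ m ∈ F.coeff.support, AddMonoidAlgebra.single m (F.coeff m) :=
    (AddMonoidAlgebra.sum_coeff_single F).symm
  rw [hsum]
  simp only [map_sum]
  rw [Finset.sum_mul]
  refine Finset.sum_congr rfl fun m hm => ?_
  rw [dehom_single, dehom_single, map_mul, map_mul, H.map_algebraMap, mul_assoc, mono_eq_prod,
    mono_eq_prod, map_prod, map_prod, ← hF m hm, ratio_sum, map_prod, ← Finset.prod_mul_distrib]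
  congr 1
  exact Finset.prod_congr rfl fun b _ => H.map_ratio _ _

theorem vle_iff (H : IsCoordChange h h') (r : ValuativeRel B)
    {F G : AddMonoidAlgebra K (Fin (n + 1) → E)} {d : E} (hF : IsHomogeneous F d)
    (hG : IsHomogeneous G d) :
    r.vle (h (dehom K i F)) (h (dehom K i G)) ↔ r.vle (h' (dehom K j F)) (h' (dehom K j G)) := by
  rw [← H.map_dehom hF, ← H.map_dehom hG, r.vle_mul_isUnit_iff (H.isUnit d)]

end IsCoordChange

/-! ### Points of projective space -/

variable (K E) in
/-- The points of the chart `i`. -/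
abbrev ChartPoint (i : Fin (n + 1)) : Type u :=
  SpaPoint (Chart K n E i) {f | IsPowerBounded f}

variable (K n E) in
/-- The rational subsets of the charts of projective space. -/
abbrev Rat : Type u := Σ i : Fin (n + 1), RationalDatum (Chart K n E i)

variable (K n E) in
/-- The points of projective space. -/
abbrev Pt : Type u := (gluingData K n E).Points

/-- The point of projective space given by a point of a chart. -/
noncomputable def pt (i : Fin (n + 1)) (z : ChartPoint K E i) : Pt K n E :=
  Quotient.mk (gluingData K n E).glue ⟨i, z⟩

theorem pt_eq_iff {i j : Fin (n + 1)} {z : ChartPoint K E i} {w : ChartPoint K E j} :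
    pt i z = pt j w ↔ ∀ (d : E) (F G : AddMonoidAlgebra K (Fin (n + 1) → E)),
      IsHomogeneous F d → IsHomogeneous G d →
        (z.rel.vle (dehom K i F) (dehom K i G) ↔ w.rel.vle (dehom K j F) (dehom K j G)) :=
  Quotient.eq

theorem exists_pt (y : Pt K n E) : ∃ (i : Fin (n + 1)) (z : ChartPoint K E i), pt i z = y := by
  obtain ⟨⟨i, z⟩, h⟩ := Quotient.exists_rep y
  exact ⟨i, z, h⟩

theorem pt_injective {one : E} (hE : IsExponentMonoid E one) {i : Fin (n + 1)}
    {z w : ChartPoint K E i} (h : pt i z = pt i w) : z = w :=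
  SpaPoint.ext (vle_iff_of_homogeneous hE z.isContRel w.isContRel (pt_eq_iff.1 h))

/-- A rational subset of a chart as a subset of projective space. -/
def Rat.image (a : Rat K n E) : Set (Pt K n E) :=
  {y | ∃ z ∈ a.2.set {f | IsPowerBounded f}, pt a.1 z = y}

/-- The completed ring of a rational subset of a chart. -/
abbrev Rat.ring (a : Rat K n E) : Type u := a.2.Completed

/-- `ρ` is the restriction map from the rational subset `b` to the rational subset `a`. -/
abbrev IsRestr (a b : Rat K n E) (ρ : b.ring →+* a.ring) : Prop :=
  GluingData.IsRestriction (G := gluingData K n E) a b ρ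

theorem pt_mem_image {one : E} (hE : IsExponentMonoid E one) {i : Fin (n + 1)}
    {D : RationalDatum (Chart K n E i)} {z : ChartPoint K E i} :
    pt i z ∈ Rat.image ⟨i, D⟩ ↔
      z ∈ D.set {f | IsPowerBounded f} := by
  refine ⟨?_, fun h => ⟨z, h, rfl⟩⟩
  rintro ⟨w, hw, hwz⟩
  rwa [pt_injective hE hwz] at hw

/-- The hypotheses on the base field and on the exponents: `π` is a pseudo-uniformizer. -/
structure IsSetting (π : K) (one : E) : Prop where
  ne_zero : π ≠ 0
  lt_one : ‖π‖ < 1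
  exp : IsExponentMonoid E one

namespace IsSetting
variable {π : K} {one : E}

theorem isTatePair (hS : IsSetting π one) (i : Fin (n + 1)) :
    IsTatePair (algebraMap K (Chart K n E i) π)
      (GaussCompletion.unitBall K ({a : Fin (n + 1) // a ≠ i} → E))
      {f : Chart K n E i | IsPowerBounded f} :=
  have := hS.exp.uniqueSums
  GaussCompletion.isTatePair hS.ne_zero hS.lt_one

theorem isPowerBounded_ratio (hS : IsSetting π one) (i a : Fin (n + 1)) (e : E) :
    IsPowerBounded (ratio K i a e) :=
  (hS.isTatePair i).isPowerBounded_of_mem_subring (norm_ratio_le i a e)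

theorem ratio_vle_one (hS : IsSetting π one) {i : Fin (n + 1)} (z : ChartPoint K E i)
    (a : Fin (n + 1)) (e : E) : z.rel.vle (ratio K i a e) 1 :=
  z.le_one _ (hS.isPowerBounded_ratio i a e)

/-- A continuous valuation of the ring of a chart that is at most `1` on the integers of `K` and on
the coordinates is a point of the chart. -/
theorem vle_one (hS : IsSetting π one) {i : Fin (n + 1)} {r : ValuativeRel (Chart K n E i)}
    (hr : IsContRel r) (hK : ∀ a : K, ‖a‖ ≤ 1 → r.vle (algebraMap K _ a) 1)
    (hm : ∀ a e, r.vle (ratio K i a e) 1) {x : Chart K n E i} (hx : IsPowerBounded x) :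
    r.vle x 1 := by
  have := hS.exp.uniqueSums
  refine GaussCompletion.vle_one_of_isPowerBounded hS.ne_zero hS.lt_one hr hK (fun m => ?_) hx
  rw [mono_eq_prod']
  refine Finset.prod_induction _ (fun x => r.vle x 1) (fun x y hx hy => ?_)
    ((r.vle_total 1 1).elim id id) fun b _ => hm _ _
  have := r.mul_vle_mul_left hx y
  rw [one_mul] at this
  exact r.vle_trans this hy

theorem one_vle_ratio (hS : IsSetting π one) {i j : Fin (n + 1)} {z : ChartPoint K E i}
    (h : z.rel.vle 1 (ratio K i j one)) (e : E) : z.rel.vle 1 (ratio K i j e) := by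
  obtain ⟨N, e', he⟩ := hS.exp.exists_add e
  rw [← z.v_le_iff, map_one] at h ⊢
  have h1 : z.v (ratio K i j e) * z.v (ratio K i j e') = z.v (ratio K i j one) ^ N := by
    rw [← map_mul, ← ratio_add, he, ratio_nsmul, map_pow]
  have h2 : z.v (ratio K i j e') ≤ 1 := by
    rw [← map_one z.v, z.v_le_iff]
    exact hS.ratio_vle_one z j e'
  calc 1 ≤ z.v (ratio K i j one) ^ N := one_le_pow₀ h
    _ = z.v (ratio K i j e) * z.v (ratio K i j e') := h1.symm
    _ ≤ z.v (ratio K i j e) := mul_le_of_le_one_right' h2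

theorem one_vle_ratio_of_pt_eq (hS : IsSetting π one) {i j : Fin (n + 1)} {z : ChartPoint K E i}
    {w : ChartPoint K E j} (h : pt i z = pt j w) (e : E) : z.rel.vle 1 (ratio K i j e) := by
  have := (pt_eq_iff.1 h e _ _ (isHomogeneous_monomial i e) (isHomogeneous_monomial j e)).2
  rw [dehom_monomial_self, dehom_monomial_self] at this
  exact this (hS.ratio_vle_one w i e)

/-- On a rational subset of the chart `i` where `|T_j / T_i| ≥ 1`, the change of coordinates to
the chart `j` is defined. -/
theorem exists_coordChange (hS : IsSetting π one) {i : Fin (n + 1)} (j : Fin (n + 1))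
    (D : RationalDatum (Chart K n E i))
    (hD : ∀ z : ChartPoint K E i, z ∈ D.set _ → z.rel.vle 1 (ratio K i j one)) :
    ∃ h' : Chart K n E j →+* D.Completed, Continuous h' ∧ IsCoordChange D.toCompleted h' := by
  have hP := hS.isTatePair (n := n) i
  have hT := D.isTate_completed hP.toIsTate
  have := D.nonarchimedeanRing_completed hP.toIsTate
  have hu : IsUnit (D.toCompleted (ratio K i j one)) := by
    refine D.isUnit_of_forall_ne_zero hP _ fun z hz h0 => ?_
    rw [RationalDatum.evalVal_toCompleted] at h0
    have := (z.v_le_iff _ _).2 (hD z hz)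
    rw [h0, map_one] at this
    exact absurd this (not_le.2 zero_lt_one)
  obtain ⟨u, hu⟩ := hu
  have hpb : IsPowerBounded (↑u⁻¹ : D.Completed) := by
    refine D.isPowerBounded_of_forall_le_one hP _ fun z hz => ?_
    have h1 := (z.v_le_iff _ _).2 (hD z hz)
    rw [← D.evalVal_toCompleted hz, ← D.evalVal_toCompleted hz, ← hu, map_one, map_one] at h1
    have h2 := mul_le_mul_left h1 (D.evalVal hz ↑u⁻¹)
    rwa [one_mul, ← map_mul, u.mul_inv, map_one] at h2
  have hmem : ∀ a e, D.toCompleted (ratio K i a e) ∈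
      D.completedSubring (GaussCompletion.unitBall K ({a : Fin (n + 1) // a ≠ i} → E)) :=
    fun a e => D.toCompleted_mem (norm_ratio_le i a e)
  have hinv : ∀ e, ∃ x : D.Completed, D.toCompleted (ratio K i j e) * x = 1 ∧
      x ∈ Submonoid.powers (↑u⁻¹ : D.Completed) ⊔
        (D.completedSubring (GaussCompletion.unitBall K _)).toSubmonoid := by
    intro e
    obtain ⟨N, e', he⟩ := hS.exp.exists_add e
    refine ⟨↑u⁻¹ ^ N * D.toCompleted (ratio K i j e'), ?_,
      Submonoid.mul_mem_sup ⟨N, rfl⟩ (hmem j e')⟩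
    rw [mul_left_comm, ← map_mul, ← ratio_add, he, ratio_nsmul, map_pow, ← hu, ← mul_pow, u.inv_mul,
      one_pow]
  choose y hy hyM using hinv
  let U : Multiplicative E →* D.Completed :=
    { toFun := fun e => y e.toAdd
      map_one' := by
        have := hy 0
        rwa [ratio_zero, map_one, one_mul] at this
      map_mul' := fun e e' => by
        have h1 : IsUnit (D.toCompleted (ratio K i j (e.toAdd + e'.toAdd))) :=
          .of_mul_eq_one _ (hy _)
        refine h1.mul_left_cancel ?_
        have h2 := hy (e * e').toAdd
        rw [toAdd_mul] at h2 ⊢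
        rw [h2, ratio_add, map_mul, mul_mul_mul_comm, hy, hy, one_mul] }
  let V : Fin (n + 1) → Multiplicative E →* D.Completed := fun a =>
    { toFun := fun e => D.toCompleted (ratio K i a e.toAdd)
      map_one' := by rw [toAdd_one, ratio_zero, map_one]
      map_mul' := fun e e' => by rw [toAdd_mul, ratio_add, map_mul] }
  obtain ⟨h', hc, hK, hr⟩ := exists_hom (K := K) (n := n) (E := E) D.completeSpace_completed j
    (D.toCompleted.comp (algebraMap K _))
    (D.continuous_toCompleted.comp (algebraMapCLM K (Chart K n E i)).continuous)
    (fun a => V a * U) (MonoidHom.ext fun e => hy _) (by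
      have hb := ((isPowerBounded_iff_powers _).1 hpb).sup
        (N := (D.completedSubring (GaussCompletion.unitBall K
          ({a : Fin (n + 1) // a ≠ i} → E))).toSubmonoid) hT.isBoundedSubset_subring
      refine hb.mono ?_
      rintro _ ⟨m, rfl⟩
      exact Submonoid.prod_mem _ fun b _ => mul_mem (Submonoid.mem_sup_right (hmem _ _)) (hyM _))
  refine ⟨h', hc, hK, fun a e => ?_⟩
  rw [hr]
  change D.toCompleted (ratio K i a e) * y e * _ = _
  rw [mul_assoc, mul_comm (y e), hy, mul_one]

/-- The point of the chart `j` which is glued to a point of the chart `i` with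
`|T_j / T_i| ≥ 1`. -/
theorem exists_pt_eq (hS : IsSetting π one) {i j : Fin (n + 1)} (D : RationalDatum (Chart K n E i))
    {z : ChartPoint K E i} (hz : z ∈ D.set _) (hj : z.rel.vle 1 (ratio K i j one))
    {h' : Chart K n E j →+* D.Completed} (hc : Continuous h')
    (H : IsCoordChange D.toCompleted h') :
    ∃ w : ChartPoint K E j, pt j w = pt i z ∧
      ∀ a b, w.rel.vle a b ↔ (D.evalRel hz).vle (h' a) (h' b) := by
  have hcont := (D.isContRel_evalRel hz).pullback hc
  let w : ChartPoint K E j := SpaPoint.ofRel _ hcont fun a ha => by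
    refine hS.vle_one hcont (fun c hc => ?_) (fun a e => ?_) ha
    · change (D.evalRel hz).vle (h' _) (h' _)
      rw [H.map_algebraMap, map_one, ← map_one D.toCompleted, D.evalRel_toCompleted]
      exact z.le_one _ (isPowerBounded_algebraMap K i c hc)
    · change (D.evalRel hz).vle (h' _) (h' _)
      rw [← (D.evalRel hz).vle_mul_isUnit_iff (H.isUnit e), H.map_ratio, map_one, one_mul,
        D.evalRel_toCompleted]
      exact z.rel.vle_trans (hS.ratio_vle_one z a e) (hS.one_vle_ratio hj e)
  refine ⟨w, pt_eq_iff.2 fun d F G hF hG => ?_, fun a b => Iff.rfl⟩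
  refine (H.vle_iff (D.evalRel hz) hF hG).symm.trans ?_
  exact D.evalRel_toCompleted hz _ _

end IsSetting

end ProjectiveSpace

/-! ### Functions on projective space -/

/-- The rational subset `{x : 1 ≤ |g(x)|}`. -/
def RationalDatum.ge {A : Type u} [CommRing A] (g : A) : RationalDatum A where
  T := {1}
  g := g
  span_eq_top := by simp

theorem RationalDatum.mem_ge {A : Type u} [CommRing A] [TopologicalSpace A] {S : Set A}
    {x : SpaPoint A S} {g : A} : x ∈ (RationalDatum.ge g).set S ↔ x.rel.vle 1 g := by
  refine ⟨fun h => h 1 (Finset.mem_singleton_self _), fun h t ht => ?_⟩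
  rwa [Finset.mem_singleton.1 ht]

/-- The relation `|f(x)| ≤ |g(x)|` for functions on a rational subset. -/
def RationalDatum.EvalLE {A : Type u} [CommRing A] [TopologicalSpace A] [IsTopologicalRing A]
    (D : RationalDatum A) {S : Set A} {x : SpaPoint A S} (hx : x ∈ D.set S) (f g : D.Completed) :
    Prop :=
  (D.evalRel hx).vle f g

theorem GluingData.valAt_vle_iff {K : Type u} [NormedField K] {G : GluingData K}
    {U : Opens G.Points} {y : G.Points} (hy : y ∈ U) (D : RationalDatum (G.A (rep y).1))
    (hD : (rep y).2 ∈ D.set (G.S _)) (hDU : Rational.image (G := G) ⟨_, D⟩ ⊆ U)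
    (f g : G.sections U) : (valAt hy).vle f g ↔
      D.EvalLE hD (component ⟨⟨_, D⟩, hDU⟩ f) (component ⟨⟨_, D⟩, hDU⟩ g) := by
  change Valued.v (evalAt hy f) ≤ Valued.v (evalAt hy g) ↔ _
  rw [evalAt_eq hy D hD hDU, evalAt_eq hy D hD hDU]
  exact Iff.rfl

namespace ProjectiveSpace
variable {K : Type u} [NormedField K] [IsUltrametricDist K] {n : ℕ} {E : Type} [AddCommMonoid E]
  {π : K} {one : E}

theorem isCoordChange_of_isRestriction {c b : Rat K n E} {ρ : b.ring →+* c.ring}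
    (hρ : IsRestr c b ρ) :
    IsCoordChange c.2.toCompleted (ρ.comp b.2.toCompleted) where
  map_algebraMap := hρ.map_algebraMap
  map_ratio a e := map_dehom K hρ a e

theorem isRestriction_of_isCoordChange {c b : Rat K n E} {ρ : b.ring →+* c.ring}
    (hc : Continuous ρ) (H : IsCoordChange c.2.toCompleted (ρ.comp b.2.toCompleted)) :
    IsRestr c b ρ where
  continuous := hc
  map_algebraMap := H.map_algebraMap
  map_coord := by
    rintro _ ⟨⟨a, e⟩, rfl⟩
    exact H.map_ratio a e

theorem isRestriction_comp {c b a : Rat K n E} {ρ : b.ring →+* c.ring} {σ : a.ring →+* b.ring}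
    (hρ : IsRestr c b ρ) (hσ : IsRestr b a σ) :
    IsRestr c a (ρ.comp σ) := by
  have hc : Continuous ρ := hρ.continuous
  have hc' : Continuous σ := hσ.continuous
  have H := isCoordChange_of_isRestriction hρ
  have H' := isCoordChange_of_isRestriction hσ
  refine isRestriction_of_isCoordChange (hc.comp hc') ⟨fun k => ?_, fun l e => ?_⟩
  · exact (congrArg ρ (H'.map_algebraMap k)).trans (H.map_algebraMap k)
  · have h1 := congrArg ρ (H'.map_ratio l e)
    rw [map_mul] at h1
    have h2 := H.map_ratio l e
    change ρ (b.2.toCompleted (ratio K b.1 l e)) * _ = _ at h2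
    change ρ (σ (a.2.toCompleted (ratio K a.1 l e))) * _ = _
    rw [← h2, ← h1, mul_assoc]
    exact congrArg _ (H.map_ratio a.1 e).symm

/-- Restriction maps are unique. -/
theorem isRestriction_unique {c b : Rat K n E} {ρ σ : b.ring →+* c.ring}
    (hρ : IsRestr c b ρ) (hσ : IsRestr c b σ) : ρ = σ := by
  have H := isCoordChange_of_isRestriction hρ
  have H' := isCoordChange_of_isRestriction hσ
  have hc : Continuous ρ := hρ.continuous
  have hc' : Continuous σ := hσ.continuous
  have h1 : ρ.comp b.2.toCompleted = σ.comp b.2.toCompleted := by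
    refine hom_ext (hc.comp b.2.continuous_toCompleted) (hc'.comp b.2.continuous_toCompleted)
      (fun a => (H.map_algebraMap a).trans (H'.map_algebraMap a).symm) fun a e => ?_
    exact (H.isUnit e).mul_right_cancel ((H.map_ratio a e).trans (H'.map_ratio a e).symm)
  exact RationalDatum.hom_ext hc hc' fun a => congrArg (fun F => F a) h1

/-- Restriction maps are compatible with the valuations at the points. -/
theorem evalRel_of_isCoordChange (hE : IsExponentMonoid E one) {B : Type*} [CommRing B]
    [TopologicalSpace B] {r : ValuativeRel B} (hr : IsContRel r) {i : Fin (n + 1)} {b : Rat K n E}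
    {h : Chart K n E i →+* B} {ρ : b.ring →+* B} (hρ : Continuous ρ)
    (H : IsCoordChange h (ρ.comp b.2.toCompleted)) {z : ChartPoint K E i}
    (hz : ∀ x y, r.vle (h x) (h y) ↔ z.rel.vle x y) {w : ChartPoint K E b.1}
    (hw : w ∈ b.2.set _) (hzw : pt i z = pt b.1 w) (f g : b.ring) :
    r.vle (ρ f) (ρ g) ↔ (b.2.evalRel hw).vle f g := by
  refine RationalDatum.vle_iff_of_toCompleted b.2 (hr.pullback hρ) (b.2.isContRel_evalRel hw)
    (fun x y => ?_) f g
  rw [RationalDatum.evalRel_toCompleted]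
  refine vle_iff_of_homogeneous hE
    (r := r.pullback (ρ.comp b.2.toCompleted))
    (hr.pullback (hρ.comp b.2.continuous_toCompleted)) w.isContRel (fun d F G hF hG => ?_) x y
  refine (H.vle_iff r hF hG).symm.trans ((hz _ _).trans ?_)
  exact pt_eq_iff.1 hzw d F G hF hG

theorem evalRel_of_isRestriction (hE : IsExponentMonoid E one) {c b : Rat K n E}
    {ρ : b.ring →+* c.ring} (hρ : IsRestr c b ρ) {z : ChartPoint K E c.1}
    (hz : z ∈ c.2.set _) {w : ChartPoint K E b.1} (hw : w ∈ b.2.set _)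
    (h : pt c.1 z = pt b.1 w) (f g : b.ring) :
    c.2.EvalLE hz (ρ f) (ρ g) ↔ b.2.EvalLE hw f g :=
  evalRel_of_isCoordChange hE (c.2.isContRel_evalRel hz) hρ.continuous
    (isCoordChange_of_isRestriction hρ) (c.2.evalRel_toCompleted hz) hw h f g

namespace IsSetting

theorem isOpen_image (hS : IsSetting π one) (a : Rat K n E) : IsOpen a.image := by
  obtain ⟨i, D⟩ := a
  refine isOpen_coinduced.2 (isOpen_sigma_iff.2 fun (j : Fin (n + 1)) =>
    isOpen_iff_mem_nhds.2 fun (w : ChartPoint K E j) hw => ?_)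
  obtain ⟨z, hz, hzw⟩ := hw
  change pt i z = pt j w at hzw
  let D' := RationalDatum.ge (ratio K j i one)
  have hD' : ∀ y : ChartPoint K E j, y ∈ D'.set _ → y.rel.vle 1 (ratio K j i one) :=
    fun y hy => RationalDatum.mem_ge.1 hy
  obtain ⟨h', hc, H⟩ := hS.exists_coordChange i D' hD'
  let O : Set (ChartPoint K E j) := D'.set _ ∩ ⋂ t ∈ D.T, {y | ∃ hy : y ∈ D'.set _,
    D'.evalVal hy (h' t) ≤ D'.evalVal hy (h' D.g) ∧ D'.evalVal hy (h' D.g) ≠ 0}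
  have hO : IsOpen O := D'.isOpen_set.inter <| isOpen_biInter_finset fun t _ =>
    D'.isOpen_evalVal_le (hS.isTatePair j) _ _
  have hwD : w ∈ D'.set _ := RationalDatum.mem_ge.2 (hS.one_vle_ratio_of_pt_eq hzw.symm one)
  refine Filter.mem_of_superset (hO.mem_nhds ⟨hwD, ?_⟩) ?_
  · obtain ⟨z', hz', hrel⟩ := hS.exists_pt_eq D' hwD (hD' w hwD) hc H
    obtain rfl : z' = z := pt_injective hS.exp (hz'.trans hzw.symm)
    refine Set.mem_iInter₂.2 fun t ht => ⟨hwD, ?_, fun h0 => D.v_g_ne_zero hz ?_⟩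
    · exact (hrel t D.g).1 (hz t ht)
    · rw [← le_zero_iff, ← map_zero z'.v, z'.v_le_iff, hrel, map_zero, RationalDatum.evalRel_vle,
        h0]
      exact zero_le
  · rintro y ⟨hy, hyT⟩
    obtain ⟨z', hz', hrel⟩ := hS.exists_pt_eq D' hy (hD' y hy) hc H
    refine ⟨z', fun t ht => ?_, hz'⟩
    obtain ⟨_, h1, -⟩ := Set.mem_iInter₂.1 hyT t ht
    exact (hrel t D.g).2 h1

/-- The subset of projective space given by a rational subset of a chart, as an open set. -/
noncomputable def opens (hS : IsSetting π one) (a : Rat K n E) : Opens (Pt K n E) :=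
  ⟨a.image, hS.isOpen_image a⟩

theorem exists_isRestriction (hS : IsSetting π one) {c b : Rat K n E}
    (hcb : c.image ⊆ b.image) : ∃ ρ : b.ring →+* c.ring, IsRestr c b ρ := by
  obtain ⟨i, D⟩ := c
  obtain ⟨j, D'⟩ := b
  have hw : ∀ z : ChartPoint K E i, z ∈ D.set _ → ∃ w : ChartPoint K E j, w ∈ D'.set _ ∧
      pt j w = pt i z := fun z hz => hcb ⟨z, hz, rfl⟩
  have hone : ∀ z : ChartPoint K E i, z ∈ D.set _ → z.rel.vle 1 (ratio K i j one) := by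
    intro z hz
    obtain ⟨w, -, h⟩ := hw z hz
    exact hS.one_vle_ratio_of_pt_eq h.symm one
  obtain ⟨h', hc, H⟩ := hS.exists_coordChange j D hone
  have hP := hS.isTatePair (n := n) i
  have := D.nonarchimedeanRing_completed hP.toIsTate
  have key : ∀ (z : ChartPoint K E i) (hz : z ∈ D.set _), ∃ w : ChartPoint K E j, w ∈ D'.set _ ∧
      ∀ a b, w.rel.vle a b ↔ (D.evalRel hz).vle (h' a) (h' b) := by
    intro z hz
    obtain ⟨w, hwD, h⟩ := hw z hz
    obtain ⟨w', hw', hrel⟩ := hS.exists_pt_eq D hz (hone z hz) hc H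
    obtain rfl : w' = w := pt_injective hS.exp (hw'.trans h.symm)
    exact ⟨w', hwD, hrel⟩
  have hne : ∀ (z : ChartPoint K E i) (hz : z ∈ D.set _), D.evalVal hz (h' D'.g) ≠ 0 := by
    intro z hz h0
    obtain ⟨w, hwD, hrel⟩ := key z hz
    refine D'.v_g_ne_zero hwD ?_
    rw [← le_zero_iff, ← map_zero w.v, w.v_le_iff, hrel, map_zero, RationalDatum.evalRel_vle, h0]
    exact zero_le
  obtain ⟨ρ, hρc, hρ⟩ := D'.exists_lift D.completeSpace_completed h' hc
    (D.isUnit_of_forall_ne_zero hP _ hne) fun t ht s hs => by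
      refine D.isPowerBounded_of_forall_le_one hP _ fun z hz => ?_
      obtain ⟨w, hwD, hrel⟩ := key z hz
      have h1 : D.evalVal hz (h' t) ≤ D.evalVal hz (h' D'.g) := (hrel t D'.g).1 (hwD t ht)
      rw [← hs, map_mul] at h1
      exact le_of_mul_le_mul_right (by rwa [one_mul]) (zero_lt_iff.2 (hne z hz))
  refine ⟨ρ, isRestriction_of_isCoordChange hρc ⟨fun k => ?_, fun a e => ?_⟩⟩
  · exact (hρ _).trans (H.map_algebraMap k)
  · exact (congrArg (· * _) (hρ _)).trans (H.map_ratio a e)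

/-- The restriction map between rational subsets. -/
noncomputable def restr (hS : IsSetting π one) {c b : Rat K n E} (h : c.image ⊆ b.image) :
    b.ring →+* c.ring :=
  (hS.exists_isRestriction h).choose

theorem isRestriction_restr (hS : IsSetting π one) {c b : Rat K n E} (h : c.image ⊆ b.image) :
    IsRestr c b (hS.restr h) :=
  (hS.exists_isRestriction h).choose_spec

/-- The component of a function at a rational subset. -/
noncomputable def _root_.ProjectiveSpace.component {U : Opens (Pt K n E)} (a : Rat K n E)
    (h : a.image ⊆ U) : (gluingData K n E).sections U →+* a.ring :=
  GluingData.component (G := gluingData K n E) ⟨a, h⟩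

theorem restr_component (hS : IsSetting π one) {U : Opens (Pt K n E)} {c b : Rat K n E}
    (h : c.image ⊆ b.image) (hb : b.image ⊆ U) (f : (gluingData K n E).sections U) :
    hS.restr h (component b hb f) = component c (h.trans hb) f :=
  f.2 ⟨c, h.trans hb⟩ ⟨b, hb⟩ h _ (hS.isRestriction_restr h)

/-- The valuations of the functions on an open subset can be computed on every rational subset
that contains the point. -/
theorem valAt_iff (hS : IsSetting π one) {U : Opens (Pt K n E)} {i : Fin (n + 1)}
    {D : RationalDatum (Chart K n E i)}
    (hDU : Rat.image ⟨i, D⟩ ⊆ U) {z : ChartPoint K E i}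
    (hz : z ∈ D.set _) (hU : pt i z ∈ U) (f g : (gluingData K n E).sections U) :
    (GluingData.valAt hU).vle f g ↔
      D.EvalLE hz (component ⟨i, D⟩ hDU f) (component ⟨i, D⟩ hDU g) := by
  obtain ⟨D₀, hD₀, hD₀a⟩ := GluingData.exists_rational (G := gluingData K n E)
    (U := hS.opens ⟨i, D⟩) (y := pt i z) ⟨z, hz, rfl⟩
  let c : Rat K n E := ⟨(GluingData.rep (pt i z)).1, D₀⟩
  have hc : c.image ⊆ Rat.image ⟨i, D⟩ := hD₀a
  have h2 := evalRel_of_isRestriction (c := c) (b := ⟨i, D⟩) hS.exp (hS.isRestriction_restr hc)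
    (z := (GluingData.rep (pt i z)).2) hD₀ hz (GluingData.mk_rep (pt i z))
    (component ⟨i, D⟩ hDU f) (component ⟨i, D⟩ hDU g)
  rw [hS.restr_component, hS.restr_component] at h2
  exact (GluingData.valAt_vle_iff hU D₀ hD₀ (hD₀a.trans hDU) f g).trans h2

/-- The function on an open subset of a rational subset `a` given by an element of the ring of
`a`. -/
noncomputable def toSections (hS : IsSetting π one) (a : Rat K n E) (U : Opens (Pt K n E))
    (hU : (U : Set (Pt K n E)) ⊆ a.image) : a.ring →+* (gluingData K n E).sections U where
  toFun f := ⟨fun c => hS.restr (c := c.1) (c.2.trans hU) f, fun c b hcb ρ hρ => by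
    have := isRestriction_unique (c := c.1) (b := a)
      (isRestriction_comp (b := b.1) hρ (hS.isRestriction_restr (b.2.trans hU)))
      (hS.isRestriction_restr (c.2.trans hU))
    exact congrArg (fun F => F f) this⟩
  map_one' := Subtype.ext (funext fun c => map_one (hS.restr (c := c.1) (c.2.trans hU)))
  map_zero' := Subtype.ext (funext fun c => map_zero (hS.restr (c := c.1) (c.2.trans hU)))
  map_add' f g := Subtype.ext (funext fun c => map_add (hS.restr (c := c.1) (c.2.trans hU)) f g)
  map_mul' f g := Subtype.ext (funext fun c => map_mul (hS.restr (c := c.1) (c.2.trans hU)) f g)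

theorem continuous_toSections (hS : IsSetting π one) {a : Rat K n E} {U : Opens (Pt K n E)}
    (hU : (U : Set (Pt K n E)) ⊆ a.image) : Continuous (hS.toSections a U hU) :=
  Continuous.subtype_mk (continuous_pi fun c =>
    (hS.isRestriction_restr (c.2.trans hU)).continuous) _

theorem toSections_component (hS : IsSetting π one) {a : Rat K n E} {U V : Opens (Pt K n E)}
    (hU : (U : Set (Pt K n E)) ⊆ a.image) (hV : a.image ⊆ V)
    (f : (gluingData K n E).sections V) :
    hS.toSections a U hU (component a hV f) = GluingData.res (hU.trans hV) f :=
  Subtype.ext (funext fun c => hS.restr_component (c := c.1) (c.2.trans hU) hV f)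

end IsSetting

end ProjectiveSpace

/-! ### Rings of functions on small open subsets of perfectoid spaces -/

/-- Properties of the ring `B` of functions on a rational subset of a perfectoid space and, more
generally, on an open subset of an affinoid perfectoid space. The valuations at the points are
`V`. -/
structure IsFunctionRing (p : ℕ) {B : Type*} [CommRing B] [TopologicalSpace B]
    [IsTopologicalRing B] {ι : Type*} (V : ι → ValuativeRel B) : Prop where
  nonarchimedean : NonarchimedeanRing B
  complete : @CompleteSpace B (IsTopologicalAddGroup.rightUniformSpace B)
  t2 : T2Space B
  isUnit : ∀ f : B, (∀ x, ¬ (V x).vle f 0) → IsUnit f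
  isBounded : IsBoundedSubset {f : B | ∀ x, (V x).vle f 1}
  isContRel : ∀ x, IsContRel (V x)
  frobenius : ∀ b : B, ∃! c : B, c ^ p = b

theorem IsFunctionRing.congr {p : ℕ} {B C : Type*} [CommRing B] [TopologicalSpace B]
    [IsTopologicalRing B] [CommRing C] [TopologicalSpace C] [IsTopologicalRing C] {ι κ : Type*}
    {V : ι → ValuativeRel B} {W : κ → ValuativeRel C} (hC : IsFunctionRing p W) (e : B ≃+* C)
    (he : Continuous e) (he' : Continuous e.symm) (σ : κ → ι) (hσ : Function.Surjective σ)
    (H : ∀ x f g, (W x).vle (e f) (e g) ↔ (V (σ x)).vle f g) : IsFunctionRing p V where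
  nonarchimedean :=
    { is_nonarchimedean := fun U hU => by
        have := hC.nonarchimedean
        have h1 : e.symm ⁻¹' U ∈ 𝓝 (0 : C) := he'.continuousAt (by rwa [map_zero])
        obtain ⟨T, hT⟩ := NonarchimedeanRing.is_nonarchimedean _ h1
        refine ⟨T.comap (e : B →+* C).toAddMonoidHom he, fun x hx => ?_⟩
        have := hT hx
        change e.symm (e x) ∈ U at this
        rwa [e.symm_apply_apply] at this }
  complete := by
    let _ : UniformSpace B := IsTopologicalAddGroup.rightUniformSpace B
    let _ : UniformSpace C := IsTopologicalAddGroup.rightUniformSpace C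
    have : IsUniformAddGroup B := isUniformAddGroup_of_addCommGroup
    have : IsUniformAddGroup C := isUniformAddGroup_of_addCommGroup
    refine (completeSpace_congr (e := e.toEquiv) (e.toEquiv.isUniformEmbedding
      (uniformContinuous_addMonoidHom_of_continuous (f := (e : B →+* C)) he)
      (uniformContinuous_addMonoidHom_of_continuous (f := (e.symm : C →+* B)) he'))).2 hC.complete
  t2 := by
    have := hC.t2
    exact T2Space.of_injective_continuous e.injective he
  isUnit f hf := by
    have := hC.isUnit (e f) fun x hx => hf (σ x) (by rwa [← H, map_zero])
    simpa using this
  isBounded := fun U hU => by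
    have h1 : e.symm ⁻¹' U ∈ 𝓝 (0 : C) := he'.continuousAt (by rwa [map_zero])
    obtain ⟨T, hT, HT⟩ := hC.isBounded _ h1
    refine ⟨e ⁻¹' T, he.continuousAt (by rwa [map_zero]), fun v hv s hs => ?_⟩
    have := HT (e v) hv (e s) fun x => by
      rw [← map_one e, H]
      exact hs _
    rwa [← map_mul, Set.mem_preimage, e.symm_apply_apply] at this
  isContRel x := by
    obtain ⟨y, rfl⟩ := hσ x
    intro b hb
    have h1 := hC.isContRel y (e b) (by rwa [← map_zero e, H])
    have h2 := he.continuousAt (x := 0) (by rwa [map_zero])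
    filter_upwards [h2] with a ha h
    exact ha ((H _ _ _).2 h)
  frobenius b := by
    obtain ⟨c, hc, hc'⟩ := hC.frobenius (e b)
    refine ⟨e.symm c, by
      change e.symm c ^ p = b
      rw [← map_pow, RingEquiv.symm_apply_eq]; exact hc, fun d hd => ?_⟩
    rw [RingEquiv.eq_symm_apply]
    exact hc' _ (by change e d ^ p = e b; rw [← map_pow, hd])

theorem IsBoundedSubset.of_isInducing_pi {B : Type*} [CommRing B] [TopologicalSpace B]
    {κ : Type*} {R : κ → Type*} [∀ a, CommRing (R a)] [∀ a, TopologicalSpace (R a)]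
    (f : B →+* ∀ a, R a) (hf : IsInducing f) {S : Set B}
    (hS : ∀ a, IsBoundedSubset ((fun b => f b a) '' S)) : IsBoundedSubset S := by
  intro U hU
  rw [hf.nhds_eq_comap, map_zero] at hU
  obtain ⟨O, hO, hOU⟩ := hU
  rw [nhds_pi, Filter.mem_pi] at hO
  obtain ⟨I, hI, t, ht, htO⟩ := hO
  choose V hV HV using fun a => hS a (t a) (ht a)
  refine ⟨f ⁻¹' I.pi V, ?_, fun v hv s hs => hOU (htO fun a ha => ?_)⟩
  · rw [hf.nhds_eq_comap, map_zero, nhds_pi]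
    exact Filter.preimage_mem_comap (Filter.pi_mem_pi hI fun a _ => hV a)
  · rw [map_mul]
    exact HV a _ (hv a ha) _ ⟨s, hs, rfl⟩

theorem nonarchimedeanRing_of_isInducing_pi {B : Type*} [CommRing B] [TopologicalSpace B]
    [IsTopologicalRing B] {κ : Type*} {R : κ → Type*} [∀ a, CommRing (R a)]
    [∀ a, TopologicalSpace (R a)] [∀ a, NonarchimedeanRing (R a)]
    (f : B →+* ∀ a, R a) (hf : IsInducing f) : NonarchimedeanRing B where
  is_nonarchimedean U hU := by
    rw [hf.nhds_eq_comap, map_zero] at hU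
    obtain ⟨O, hO, hOU⟩ := hU
    rw [nhds_pi, Filter.mem_pi] at hO
    obtain ⟨I, hI, t, ht, htO⟩ := hO
    choose V hV using fun a => NonarchimedeanRing.is_nonarchimedean (t a) (ht a)
    let T : AddSubgroup B :=
      { carrier := {b | ∀ a ∈ I, f b a ∈ V a}
        add_mem' := fun {x y} hx hy a ha => by
          rw [map_add]; exact add_mem (hx a ha) (hy a ha)
        zero_mem' := fun a _ => by rw [map_zero]; exact zero_mem (V a)
        neg_mem' := fun {x} hx a ha => by rw [map_neg]; exact neg_mem (hx a ha) }
    refine ⟨⟨T, AddSubgroup.isOpen_of_mem_nhds T (g := 0) ?_⟩,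
      fun b hb => hOU (htO fun a ha => hV a (hb a ha))⟩
    rw [hf.nhds_eq_comap, map_zero, nhds_pi]
    exact Filter.mem_of_superset (Filter.preimage_mem_comap
      (Filter.pi_mem_pi hI fun a _ => (V a).mem_nhds_zero)) fun b hb a ha => hb a ha

namespace PerfectoidAffinoidAlgebra
variable {p : ℕ} {K : Type u} [NormedField K] (P : PerfectoidAffinoidAlgebra p K)

/-- The gluing data with the single chart `Spa(R, R⁺)`. -/
noncomputable abbrev gluing : GluingData K :=
  GluingData.single P.R P.continuous_algebraMap (P.plus : Set P.R) P.algebraMap_mem_plus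

/-- The point of the space `Spa(R, R⁺)` given by a valuation. -/
noncomputable def point (x : SpaPoint P.R P.plus) : P.gluing.Points :=
  Quotient.mk P.gluing.glue ⟨(), x⟩

/-- The points of the space are the points of its chart. -/
theorem rep_point (x : SpaPoint P.R P.plus) : GluingData.rep (P.point x) = ⟨(), x⟩ :=
  Quotient.exact (GluingData.mk_rep (P.point x))

theorem exists_point_eq (y : P.gluing.Points) : ∃ x, P.point x = y := by
  obtain ⟨⟨⟨⟩, x⟩, h⟩ := Quotient.exists_rep y
  exact ⟨x, h⟩

theorem continuous_point : Continuous P.point :=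
  GluingData.continuous_chart (G := P.gluing) ()

theorem isOpen_iff (T : Set P.gluing.Points) : IsOpen T ↔ IsOpen (P.point ⁻¹' T) :=
  ⟨fun h => h.preimage P.continuous_point, fun h =>
    isOpen_coinduced.2 (isOpen_sigma_iff.2 fun _ => h)⟩

/-- The open subset defined by a rational datum is contained in `U`. -/
abbrev SetIn (D : RationalDatum P.R) (U : Opens P.gluing.Points) : Prop :=
  GluingData.Rational.image (G := P.gluing) ⟨(), D⟩ ⊆ U

/-- The component of a function at a rational subset. -/
noncomputable def component {U : Opens P.gluing.Points} (D : RationalDatum P.R)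
    (h : P.SetIn D U) : P.gluing.sections U →+* D.Completed :=
  GluingData.component (G := P.gluing) ⟨⟨(), D⟩, h⟩

theorem continuous_component {U : Opens P.gluing.Points} (D : RationalDatum P.R)
    (h : P.SetIn D U) : Continuous (P.component D h) :=
  (continuous_apply (⟨⟨(), D⟩, h⟩ : GluingData.RationalIn U)).comp continuous_subtype_val

theorem exists_setIn {U : Opens P.gluing.Points} {x : SpaPoint P.R P.plus} (hx : P.point x ∈ U) :
    ∃ D : RationalDatum P.R, x ∈ D.set P.plus ∧ P.SetIn D U := by
  obtain ⟨D, hD, h⟩ := SpaPoint.exists_rational (U.isOpen.preimage P.continuous_point) hx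
  refine ⟨D, hD, ?_⟩
  rintro _ ⟨x, hx, rfl⟩
  exact h hx

theorem valAt_iff {U : Opens P.gluing.Points} {x : SpaPoint P.R P.plus} (hU : P.point x ∈ U)
    (D : RationalDatum P.R) (hD : x ∈ D.set P.plus) (h : P.SetIn D U)
    (f g : P.gluing.sections U) :
    (GluingData.valAt hU).vle f g ↔ D.EvalLE hD (P.component D h f) (P.component D h g) := by
  have key : ∀ (s : Σ i : Unit, SpaPoint P.R P.plus), GluingData.rep (P.point x) = s →
      ∀ (hs : s.2 ∈ D.set P.plus), (GluingData.valAt hU).vle f g ↔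
        D.EvalLE hs (P.component D h f) (P.component D h g) := by
    rintro s rfl hs
    exact GluingData.valAt_vle_iff hU D hs h f g
  exact key ⟨(), x⟩ (P.rep_point x) hD

theorem isOpen_vle {π : K} (h0 : π ≠ 0) (h1 : ‖π‖ < 1) (U : Opens P.gluing.Points)
    (f g : P.gluing.sections U) : IsOpen {y : P.gluing.Points | ∃ hy : y ∈ U,
      (GluingData.valAt hy).vle f g ∧ ¬ (GluingData.valAt hy).vle g 0} := by
  rw [isOpen_iff, isOpen_iff_mem_nhds]
  rintro x ⟨hx, hfg, hg⟩
  obtain ⟨D, hD, h⟩ := P.exists_setIn hx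
  rw [P.valAt_iff hx D hD h] at hfg hg
  rw [map_zero] at hg
  have hO := D.isOpen_evalVal_le (P.isTatePair π h0 h1) (P.component D h f) (P.component D h g)
  refine Filter.mem_of_superset (hO.mem_nhds ⟨hD, hfg, fun h => hg ?_⟩) ?_
  · change D.evalVal _ _ ≤ D.evalVal _ _
    rw [h]
    exact zero_le
  · rintro y ⟨hy, hyfg, hyg⟩
    have hyU : P.point y ∈ U := h ⟨y, hy, rfl⟩
    refine ⟨hyU, (P.valAt_iff hyU D hy h f g).2 hyfg, fun h0 => hyg ?_⟩
    rw [P.valAt_iff hyU D hy h, map_zero] at h0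
    change D.evalVal _ _ ≤ D.evalVal _ _ at h0
    rw [map_zero] at h0
    exact le_antisymm h0 zero_le

/-- The ring of functions on `U` inherits the properties from the rings of the rational subsets in
`U`, of whose product it is a closed subring. -/
theorem isFunctionRing [CharP K p] (hp : p.Prime) (hK : IsPerfectoidField p K) {π : K} (h0 : π ≠ 0)
    (h1 : ‖π‖ < 1) (U : Opens P.gluing.Points) :
    IsFunctionRing p (B := P.gluing.sections U)
      (fun y : {y // y ∈ U} => GluingData.valAt y.2) := by
  have := P.t2
  have hT := P.isTatePair π h0 h1
  have hPT := fun D : RationalDatum P.R =>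
    D.isPerfectTate_completed (P.isPerfectTate hp hK π h0 h1) hp
  have hna : ∀ a : GluingData.RationalIn U, NonarchimedeanRing a.1.ring := fun a =>
    a.1.2.nonarchimedeanRing_completed hT.toIsTate
  have hind : IsInducing (P.gluing.sections U).subtype := IsInducing.subtypeVal
  have hmem : ∀ (D : RationalDatum P.R) (h : P.SetIn D U) (x : SpaPoint P.R P.plus),
      x ∈ D.set P.plus → P.point x ∈ U := fun D h x hx => h ⟨x, hx, rfl⟩
  refine ⟨nonarchimedeanRing_of_isInducing_pi _ hind, ?_, inferInstance, fun f hf => ?_, ?_, ?_,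
    fun f => ?_⟩
  · have : IsUniformAddGroup (P.gluing.sections U) :=
      IsUniformAddGroup.comap (P.gluing.sections U).subtype
    rw [IsUniformAddGroup.rightUniformSpace_eq]
    refine IsComplete.completeSpace_coe (IsClosed.isComplete ?_)
    have : ((P.gluing.sections U : Subring _) : Set (∀ a : GluingData.RationalIn U, a.1.ring)) =
        ⋂ (a : GluingData.RationalIn U) (b : GluingData.RationalIn U)
          (_ : a.1.image ⊆ b.1.image) (ρ : b.1.ring →+* a.1.ring)
          (_ : GluingData.IsRestriction a.1 b.1 ρ), {f | ρ (f b) = f a} := by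
      ext f
      simp only [Set.mem_iInter]
      exact Iff.rfl
    rw [this]
    exact isClosed_iInter fun a => isClosed_iInter fun b => isClosed_iInter fun _ =>
      isClosed_iInter fun ρ => isClosed_iInter fun hρ =>
        isClosed_eq (hρ.continuous.comp (continuous_apply b)) (continuous_apply a)
  · have hu : ∀ a : GluingData.RationalIn U, IsUnit (f.1 a) := by
      intro a
      let D : RationalDatum P.R := a.1.2
      have h : P.SetIn D U := a.2
      refine D.isUnit_of_forall_ne_zero hT (P.component D h f) fun x hx h0 =>
        hf ⟨P.point x, hmem D h x hx⟩ ?_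
      rw [P.valAt_iff _ D hx h, map_zero]
      change D.evalVal _ _ ≤ D.evalVal _ _
      rw [map_zero]
      exact h0.le
    choose u hu using hu
    refine .of_mul_eq_one ⟨fun a => ↑(u a)⁻¹, fun a b hab ρ hρ => ?_⟩
      (Subtype.ext (funext fun a => ?_))
    · have h2 : ρ ↑(u b) = ↑(u a) := by rw [hu, hu]; exact f.2 a b hab ρ hρ
      have h3 : ρ ↑(u b)⁻¹ * ↑(u a) = 1 := by rw [← h2, ← map_mul, Units.inv_mul, map_one]
      exact Units.eq_inv_of_mul_eq_one_left ((mul_comm _ _).trans h3)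
    · change f.1 a * ↑(u a)⁻¹ = 1
      rw [← hu, Units.mul_inv]
  · refine IsBoundedSubset.of_isInducing_pi _ hind ?_
    intro a
    let D : RationalDatum P.R := a.1.2
    have h : P.SetIn D U := a.2
    refine ((hPT D).isBoundedSubset_powerBounded hp).mono ?_
    rintro _ ⟨f, hf, rfl⟩
    refine D.isPowerBounded_of_forall_le_one hT (P.component D h f) fun x hx => ?_
    have h2 := (P.valAt_iff (hmem D h x hx) D hx h f 1).1 (hf ⟨_, hmem D h x hx⟩)
    rw [map_one] at h2
    change D.evalVal _ _ ≤ D.evalVal _ _ at h2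
    rw [map_one] at h2
    exact h2
  · rintro ⟨y, hy⟩
    obtain ⟨x, rfl⟩ := P.exists_point_eq y
    obtain ⟨D, hD, h⟩ := P.exists_setIn hy
    intro b hb
    have h2 := (D.isContRel_evalRel hD).pullback (P.continuous_component D h) b
    have h3 : ∀ f g, (GluingData.valAt hy).vle f g ↔
      ((D.evalRel hD).pullback (P.component D h)).vle f g := fun f g => P.valAt_iff hy D hD h f g
    rw [h3] at hb
    filter_upwards [h2 hb] with a ha h
    exact ha ((h3 _ _).1 h)
  · have hsur' : ∀ (D : RationalDatum P.R) (f : D.Completed), ∃ c, c ^ p = f := fun D f =>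
      (hPT D).surjective f
    have hinj' : ∀ (D : RationalDatum P.R) (f g : D.Completed), f ^ p = g ^ p → f = g :=
      fun D f g h => (hPT D).injective hp h
    have hsur : ∀ a : GluingData.RationalIn U, ∃ c : a.1.ring, c ^ p = f.1 a := fun a =>
      hsur' a.1.2 (f.1 a)
    have hinj : ∀ (a : GluingData.RationalIn U) (f g : a.1.ring), f ^ p = g ^ p → f = g :=
      fun a => hinj' a.1.2
    choose c hc using hsur
    refine ⟨⟨c, fun a b hab ρ hρ => hinj a _ _ ?_⟩,
      Subtype.ext (funext fun a => hc a), fun d hd => Subtype.ext (funext fun a => ?_)⟩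
    · rw [← map_pow, hc, hc]
      exact f.2 a b hab ρ hρ
    · refine hinj a _ _ ?_
      rw [hc, ← hd]
      rfl

end PerfectoidAffinoidAlgebra

/-! ### Gluing -/

/-- The sheaf condition for a cover by the members of a downward closed family of open sets. -/
theorem existsUnique_glue {T : TopCat.{u}} {F : (Opens T)ᵒᵖ ⥤ Type*}
    (hF : Presieve.IsSheaf (Opens.grothendieckTopology T) F) (U : Opens T) (Q : Opens T → Prop)
    (mono : ∀ V W, V ≤ W → Q W → Q V) (cov : ∀ x ∈ U, ∃ W, W ≤ U ∧ Q W ∧ x ∈ W)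
    (s : ∀ W, W ≤ U → Q W → F.obj (op W))
    (compat : ∀ W V (hW : W ≤ U) (hQ : Q W) (h : V ≤ W),
      F.map (homOfLE h).op (s W hW hQ) = s V (h.trans hW) (mono V W h hQ)) :
    ∃! t : F.obj (op U), ∀ W (hW : W ≤ U) (hQ : Q W), F.map (homOfLE hW).op t = s W hW hQ := by
  let S : Sieve U :=
    { arrows := fun W _ => Q W
      downward_closed := fun {W V} _ hQ g => mono V W g.le hQ }
  have hS : S ∈ Opens.grothendieckTopology T U := fun x hx => by
    obtain ⟨W, hW, hQ, hxW⟩ := cov x hx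
    exact ⟨W, homOfLE hW, hQ, hxW⟩
  let fam : Presieve.FamilyOfElements F S.arrows := fun W f hf => s W f.le hf
  have hfam : fam.Compatible := by
    rw [Presieve.compatible_iff_sieveCompatible]
    intro W V f g hf
    exact (compat W V f.le hf g.le).symm
  obtain ⟨t, ht, huniq⟩ := hF S hS fam hfam
  exact ⟨t, fun W hW hQ => ht (homOfLE hW) hQ, fun t' ht' => huniq t' fun W f hf => ht' W f.le hf⟩

/-- Sections of a sheaf which agree on a cover are equal. -/
theorem eq_of_forall_map_eq {T : TopCat.{u}} {F : (Opens T)ᵒᵖ ⥤ Type*}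
    (hF : Presieve.IsSheaf (Opens.grothendieckTopology T) F) {U : Opens T} {t t' : F.obj (op U)}
    (h : ∀ x ∈ U, ∃ W, ∃ hW : W ≤ U, x ∈ W ∧
      F.map (homOfLE hW).op t = F.map (homOfLE hW).op t') : t = t' := by
  let Q : Opens T → Prop := fun W => ∃ hW : W ≤ U,
    F.map (homOfLE hW).op t = F.map (homOfLE hW).op t'
  have hmap : ∀ W V (hW : W ≤ U) (h : V ≤ W) (t : F.obj (op U)),
      F.map (homOfLE h).op (F.map (homOfLE hW).op t) = F.map (homOfLE (h.trans hW)).op t :=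
    fun W V hW h t => (Functor.map_comp_apply F (homOfLE hW).op (homOfLE h).op t).symm
  obtain ⟨s, -, hs⟩ := existsUnique_glue hF U Q
    (fun V W hVW ⟨hW, e⟩ => ⟨hVW.trans hW, by rw [← hmap W V hW hVW, ← hmap W V hW hVW, e]⟩)
    (fun x hx => by
      obtain ⟨W, hW, hxW, e⟩ := h x hx
      exact ⟨W, hW, ⟨hW, e⟩, hxW⟩)
    (fun W hW _ => F.map (homOfLE hW).op t) (fun W V hW _ h => hmap W V hW h t)
  exact (hs t fun _ _ _ => rfl).trans (hs t' fun W hW ⟨_, e⟩ => e.symm).symm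

namespace PreAdicSpace
variable {K : Type u} [NormedField K] (X : PreAdicSpace K)

/-- The ring of functions on an open subset. -/
abbrev Fn (W : Opens X.carrier) : Type u := X.presheaf.obj (op W)

variable {X}

/-- The restriction of functions. -/
def resHom {V W : Opens X.carrier} (h : V ≤ W) : X.Fn W →+* X.Fn V :=
  (X.presheaf.map (homOfLE h).op).1

theorem continuous_resHom {V W : Opens X.carrier} (h : V ≤ W) : Continuous (resHom h) :=
  (X.presheaf.map (homOfLE h).op).2

theorem resHom_self {W : Opens X.carrier} (f : X.Fn W) : resHom le_rfl f = f :=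
  congrArg (fun F : X.presheaf.obj (op W) ⟶ X.presheaf.obj (op W) => F.1 f)
    (X.presheaf.map_id (op W))

theorem resHom_resHom {U V W : Opens X.carrier} (h : V ≤ W) (h' : U ≤ V) (f : X.Fn W) :
    resHom h' (resHom h f) = resHom (h'.trans h) f :=
  (congrArg (fun F : X.presheaf.obj (op W) ⟶ X.presheaf.obj (op U) => F.1 f)
    (X.presheaf.map_comp (homOfLE h).op (homOfLE h').op)).symm

theorem val_resHom {V W : Opens X.carrier} (h : V ≤ W) {x : X.carrier} (hx : x ∈ V) (f g : X.Fn W) :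
    (X.val V x hx).vle (resHom h f) (resHom h g) ↔ (X.val W x (h hx)).vle f g :=
  X.val_res (homOfLE h) x hx f g

theorem isSheaf_coyoneda (hX : X.presheaf.IsSheaf) (R : TopCommRingCat.{u}) :
    Presieve.IsSheaf (Opens.grothendieckTopology X.carrier)
      (X.presheaf ⋙ coyoneda.obj (op R)) := hX R

/-- Gluing of continuous homomorphisms to rings of functions. -/
theorem exists_glue_hom (hX : X.presheaf.IsSheaf) (U : Opens X.carrier) (Q : Opens X.carrier → Prop)
    (mono : ∀ V W, V ≤ W → Q W → Q V) (cov : ∀ x ∈ U, ∃ W, W ≤ U ∧ Q W ∧ x ∈ W)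
    {R : Type u} [CommRing R] [TopologicalSpace R] [IsTopologicalRing R]
    (s : ∀ W, W ≤ U → Q W → (R →+* X.Fn W)) (hs : ∀ W hW hQ, Continuous (s W hW hQ))
    (compat : ∀ W V (hW : W ≤ U) (hQ : Q W) (h : V ≤ W) (r : R),
      resHom h (s W hW hQ r) = s V (h.trans hW) (mono V W h hQ) r) :
    ∃ t : R →+* X.Fn U, Continuous t ∧ ∀ W (hW : W ≤ U) (hQ : Q W) (r : R),
      resHom hW (t r) = s W hW hQ r := by
  obtain ⟨t, ht, -⟩ := existsUnique_glue (isSheaf_coyoneda hX (TopCommRingCat.of R)) U Q mono cov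
    (fun W hW hQ => (⟨s W hW hQ, hs W hW hQ⟩ : TopCommRingCat.of R ⟶ X.presheaf.obj (op W)))
    (fun W V hW hQ h => Subtype.ext (RingHom.ext (compat W V hW hQ h)))
  exact ⟨t.1, t.2, fun W hW hQ r =>
    congrArg (fun F : TopCommRingCat.of R ⟶ X.presheaf.obj (op W) => F.1 r) (ht W hW hQ)⟩

/-- The homomorphism from the ring of polynomials over `ℤ` which maps the variable to `f`. -/
noncomputable def polyHom {B : Type u} [CommRing B] (f : B) : Polynomial (ULift.{u} ℤ) →+* B :=
  Polynomial.eval₂RingHom ((Int.castRingHom B).comp (ULift.ringEquiv : ULift.{u} ℤ ≃+* ℤ)) f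

theorem polyHom_X {B : Type u} [CommRing B] (f : B) : polyHom f Polynomial.X = f :=
  Polynomial.eval₂_X _ _

theorem polyHom_ext {B : Type u} [CommRing B] {F G : Polynomial (ULift.{u} ℤ) →+* B}
    (h : F Polynomial.X = G Polynomial.X) : F = G := by
  refine Polynomial.ringHom_ext' ?_ h
  have : ∀ F : ULift.{u} ℤ →+* B, F = (F.comp (ULift.ringEquiv.symm : ℤ ≃+* ULift.{u} ℤ) :
      ℤ →+* B).comp (ULift.ringEquiv : ULift.{u} ℤ ≃+* ℤ) := fun F => RingHom.ext fun x => rfl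
  rw [this (F.comp _), this (G.comp _)]
  congr 1
  exact RingHom.ext_int _ _

/-- Functions which agree locally are equal. -/
theorem fn_ext (hX : X.presheaf.IsSheaf) {U : Opens X.carrier} {f g : X.Fn U}
    (h : ∀ x ∈ U, ∃ W, ∃ hW : W ≤ U, x ∈ W ∧ resHom hW f = resHom hW g) : f = g := by
  let _ : TopologicalSpace (Polynomial (ULift.{u} ℤ)) := ⊥
  have : DiscreteTopology (Polynomial (ULift.{u} ℤ)) := ⟨rfl⟩
  have key := eq_of_forall_map_eq (isSheaf_coyoneda hX (TopCommRingCat.of (Polynomial (ULift.{u} ℤ))))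
    (U := U) (t := ⟨polyHom f, continuous_of_discreteTopology⟩)
    (t' := ⟨polyHom g, continuous_of_discreteTopology⟩) fun x hx => by
      obtain ⟨W, hW, hxW, e⟩ := h x hx
      refine ⟨W, hW, hxW, Subtype.ext (polyHom_ext ?_)⟩
      change resHom hW (polyHom f Polynomial.X) = resHom hW (polyHom g Polynomial.X)
      rw [polyHom_X, polyHom_X, e]
  have := congrArg (fun F => F.1 Polynomial.X) key
  change polyHom f _ = polyHom g _ at this
  rwa [polyHom_X, polyHom_X] at this

/-- Gluing of functions. -/
theorem exists_glue (hX : X.presheaf.IsSheaf) (U : Opens X.carrier) (Q : Opens X.carrier → Prop)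
    (mono : ∀ V W, V ≤ W → Q W → Q V) (cov : ∀ x ∈ U, ∃ W, W ≤ U ∧ Q W ∧ x ∈ W)
    (s : ∀ W, W ≤ U → Q W → X.Fn W)
    (compat : ∀ W V (hW : W ≤ U) (hQ : Q W) (h : V ≤ W),
      resHom h (s W hW hQ) = s V (h.trans hW) (mono V W h hQ)) :
    ∃ t : X.Fn U, ∀ W (hW : W ≤ U) (hQ : Q W), resHom hW t = s W hW hQ := by
  let _ : TopologicalSpace (Polynomial (ULift.{u} ℤ)) := ⊥
  have : DiscreteTopology (Polynomial (ULift.{u} ℤ)) := ⟨rfl⟩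
  obtain ⟨t, -, ht⟩ := exists_glue_hom hX U Q mono cov (R := Polynomial (ULift.{u} ℤ))
    (fun W hW hQ => polyHom (s W hW hQ)) (fun _ _ _ => continuous_of_discreteTopology)
    (fun W V hW hQ h r => congrArg (fun F => F r)
      (polyHom_ext (F := (resHom h).comp (polyHom (s W hW hQ))) (G := polyHom _) (by
        change resHom h (polyHom _ _) = _
        rw [polyHom_X, polyHom_X, compat W V hW hQ h])))
  exact ⟨t Polynomial.X, fun W hW hQ => by rw [ht W hW hQ, polyHom_X]⟩

/-! ### Morphisms -/

namespace Hom
variable {Y : PreAdicSpace K}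

/-- The preimage of an open subset. -/
def preimage (φ : Hom X Y) (U : Opens Y.carrier) : Opens X.carrier := (Opens.map φ.hom.base).obj U

/-- The pullback of functions, followed by a restriction. -/
def pull (φ : Hom X Y) (U : Opens Y.carrier) (W : Opens X.carrier) (h : W ≤ φ.preimage U) :
    Y.Fn U →+* X.Fn W :=
  (resHom h).comp (φ.hom.c.app (op U)).1

theorem continuous_pull (φ : Hom X Y) {U : Opens Y.carrier} {W : Opens X.carrier}
    (h : W ≤ φ.preimage U) : Continuous (φ.pull U W h) :=
  (continuous_resHom h).comp (φ.hom.c.app (op U)).2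

theorem resHom_pull (φ : Hom X Y) {U : Opens Y.carrier} {V W : Opens X.carrier}
    (h : W ≤ φ.preimage U) (h' : V ≤ W) (f : Y.Fn U) :
    resHom h' (φ.pull U W h f) = φ.pull U V (h'.trans h) f :=
  resHom_resHom h h' _

theorem pull_resHom (φ : Hom X Y) {U U' : Opens Y.carrier} {W : Opens X.carrier} (hU : U' ≤ U)
    (h : W ≤ φ.preimage U') (f : Y.Fn U) :
    φ.pull U' W h (resHom hU f) = φ.pull U W (h.trans fun _ hx => hU hx) f := by
  have h1 := congrArg (fun F : Y.presheaf.obj (op U) ⟶ _ => F.1 f)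
    (φ.hom.c.naturality (homOfLE hU).op)
  change (φ.hom.c.app (op U')).1 (resHom hU f) = resHom _ ((φ.hom.c.app (op U)).1 f) at h1
  change resHom h ((φ.hom.c.app (op U')).1 (resHom hU f)) = resHom _ ((φ.hom.c.app (op U)).1 f)
  rw [h1]
  exact resHom_resHom _ _ _

theorem val_pull (φ : Hom X Y) {U : Opens Y.carrier} {W : Opens X.carrier}
    (h : W ≤ φ.preimage U) {x : X.carrier} (hx : x ∈ W) (f g : Y.Fn U) :
    (X.val W x hx).vle (φ.pull U W h f) (φ.pull U W h g) ↔ (Y.val U _ (h hx)).vle f g :=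
  (val_resHom h hx _ _).trans (φ.val_iff U x (h hx) f g)

theorem pull_comp {Z : PreAdicSpace K} (φ : Hom X Y) (ψ : Hom Y Z) {U : Opens Z.carrier}
    {V : Opens Y.carrier} {W : Opens X.carrier} (hV : V ≤ ψ.preimage U) (hW : W ≤ φ.preimage V)
    (f : Z.Fn U) : (φ.comp ψ).pull U W (hW.trans fun _ hx => hV hx) f =
      φ.pull V W hW (ψ.pull U V hV f) :=
  (φ.pull_resHom hV hW _).symm

/-- Morphisms to a space are determined by the map on points and by the pullback of functions to
the members of a cover. -/
theorem ext_of_pull (hX : X.presheaf.IsSheaf) {φ ψ : Hom X Y}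
    (hb : ∀ x, φ.hom.base x = ψ.hom.base x)
    (h : ∀ (U : Opens Y.carrier) (x : X.carrier), φ.hom.base x ∈ U → ∃ (W : Opens X.carrier)
      (hW : W ≤ φ.preimage U) (hW' : W ≤ ψ.preimage U), x ∈ W ∧
        ∀ f, φ.pull U W hW f = ψ.pull U W hW' f) : φ = ψ := by
  obtain ⟨⟨b, c⟩, hv, hm⟩ := φ
  obtain ⟨⟨b', c'⟩, hv', hm'⟩ := ψ
  obtain rfl : b = b' := by
    ext x
    exact hb x
  have hc : c = c' := by
    refine NatTrans.ext (funext fun U => Subtype.ext (RingHom.ext fun f => ?_))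
    refine fn_ext hX fun x hx => ?_
    obtain ⟨W, hW, _, hxW, e⟩ := h U.unop x hx
    exact ⟨W, hW, hxW, e f⟩
  subst hc
  rfl

end Hom

end PreAdicSpace

/-! ### Powers with exponents in a monoid -/

/-- Every element of `B` is the value at `one` of a unique system of powers with exponents in
`E`. -/
def HasUniquePowers (E : Type) [AddCommMonoid E] (one : E) (B : Type*) [CommRing B] : Prop :=
  ∀ g : B, ∃! χ : Multiplicative E →* B, χ (.ofAdd one) = g

theorem hasUniquePowers_nat (B : Type*) [CommRing B] : HasUniquePowers ℕ 1 B := fun g =>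
  ⟨powersHom B g, by simp, fun χ hχ => by
    ext
    simpa using hχ⟩

theorem isExponentMonoid_nat : IsExponentMonoid ℕ 1 where
  exists_add e := ⟨e, 0, by simp⟩
  exists_nsmul e := ⟨1, e, one_pos, by simp⟩
  uniqueSums := inferInstance

namespace PerfExponents
variable {p : ℕ}

theorem exists_nsmul_eq (hp : p ≠ 0) (e : PerfExponents p) :
    ∃ m k : ℕ, p ^ m • e = k • PerfExponents.one p := by
  have hp' : (p : ℚ≥0) ≠ 0 := Nat.cast_ne_zero.2 hp
  have key : ∀ x ∈ PerfExponents p, ∃ m k : ℕ, (p : ℚ≥0) ^ m * x = k := by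
    intro x hx
    induction hx using AddSubmonoid.closure_induction with
    | mem x hx =>
      obtain ⟨m, rfl⟩ := hx
      exact ⟨m, 1, by rw [mul_one_div_cancel (pow_ne_zero _ hp'), Nat.cast_one]⟩
    | zero => exact ⟨0, 0, by simp⟩
    | add x y _ _ hx hy =>
      obtain ⟨m, k, h⟩ := hx
      obtain ⟨m', k', h'⟩ := hy
      refine ⟨m + m', p ^ m' * k + p ^ m * k', ?_⟩
      push_cast
      rw [← h, ← h']
      ring
  obtain ⟨m, k, h⟩ := key e.1 e.2
  refine ⟨m, k, Subtype.ext ?_⟩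
  simpa [PerfExponents.one] using h

theorem nsmul_one_injective : Function.Injective fun k : ℕ => k • PerfExponents.one p := by
  intro k k' h
  have := congrArg Subtype.val h
  simpa [PerfExponents.one] using this

theorem isExponentMonoid (hp : p ≠ 0) :
    IsExponentMonoid (PerfExponents p) (PerfExponents.one p) where
  exists_add e := by
    obtain ⟨m, k, h⟩ := exists_nsmul_eq hp e
    refine ⟨k, (p ^ m - 1) • e, ?_⟩
    rw [← h, ← succ_nsmul', Nat.sub_add_cancel (Nat.pos_of_ne_zero (pow_ne_zero _ hp))]
  exists_nsmul e := by
    obtain ⟨m, k, h⟩ := exists_nsmul_eq hp e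
    exact ⟨p ^ m, k, Nat.pos_of_ne_zero (pow_ne_zero _ hp), h⟩
  uniqueSums := inferInstance

/-- If the Frobenius of `B` is bijective, the power `g^(k / p^m)` is the `p^m`-th root of `g^k`. -/
theorem hasUniquePowers (hp : p ≠ 0) {B : Type*} [CommRing B] (hB : ∀ b : B, ∃! c : B, c ^ p = b) :
    HasUniquePowers (PerfExponents p) (PerfExponents.one p) B := by
  have hinj : ∀ m (c d : B), c ^ p ^ m = d ^ p ^ m → c = d := by
    intro m
    induction m with
    | zero => intro c d h; simpa using h
    | succ m ih =>
      intro c d h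
      rw [pow_succ, pow_mul, pow_mul] at h
      obtain ⟨x, -, hx⟩ := hB ((d ^ p ^ m) ^ p)
      exact ih _ _ ((hx _ h).trans (hx _ rfl).symm)
  have hsurj : ∀ m (b : B), ∃ c, c ^ p ^ m = b := by
    intro m
    induction m with
    | zero => exact fun b => ⟨b, by simp⟩
    | succ m ih =>
      intro b
      obtain ⟨c, hc, -⟩ := hB b
      obtain ⟨d, hd⟩ := ih c
      exact ⟨d, by rw [pow_succ, pow_mul, hd]; exact hc⟩
  intro g
  -- `R e c` says that `c` is the power of `g` with the exponent `e`
  let R : PerfExponents p → B → Prop := fun e c =>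
    ∃ m k : ℕ, p ^ m • e = k • PerfExponents.one p ∧ c ^ p ^ m = g ^ k
  have hex : ∀ e, ∃ c, R e c := fun e => by
    obtain ⟨m, k, h⟩ := exists_nsmul_eq hp e
    obtain ⟨c, hc⟩ := hsurj m (g ^ k)
    exact ⟨c, m, k, h, hc⟩
  have huniq : ∀ e c d, R e c → R e d → c = d := by
    rintro e c d ⟨m, k, h, hc⟩ ⟨m', k', h', hd⟩
    have hk : p ^ m' * k = p ^ m * k' := by
      apply nsmul_one_injective (p := p)
      dsimp only
      rw [mul_nsmul', mul_nsmul', ← h, ← h', ← mul_nsmul', ← mul_nsmul', mul_comm]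
    apply hinj (m + m')
    rw [pow_add p, pow_mul c, hc, ← pow_mul, mul_comm k, hk, mul_comm (p ^ m) (p ^ m'),
      pow_mul d, hd, ← pow_mul, mul_comm k']
  have hmul : ∀ e e' c c', R e c → R e' c' → R (e + e') (c * c') := by
    rintro e e' c c' ⟨m, k, h, hc⟩ ⟨m', k', h', hd⟩
    refine ⟨m + m', p ^ m' * k + p ^ m * k', ?_, ?_⟩
    · rw [add_nsmul, mul_nsmul', mul_nsmul', ← h, ← h', ← mul_nsmul', ← mul_nsmul', nsmul_add,
        pow_add, mul_comm]
    · rw [mul_pow, pow_add p, pow_mul c, hc, mul_comm (p ^ m) (p ^ m'), pow_mul c', hd, ← pow_mul,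
        ← pow_mul, pow_add, mul_comm k, mul_comm k']
  choose f hf using hex
  refine ⟨⟨⟨fun e => f e.toAdd, huniq 0 _ _ (hf 0) ⟨0, 0, by simp, by simp⟩⟩, fun e e' =>
    huniq _ _ _ (hf _) (hmul _ _ _ _ (hf _) (hf _))⟩,
    huniq _ _ _ (hf _) ⟨0, 1, by simp, by simp⟩, fun χ hχ => MonoidHom.ext fun e => ?_⟩
  refine huniq e.toAdd _ _ ?_ (hf _)
  obtain ⟨m, k, h⟩ := exists_nsmul_eq hp e.toAdd
  refine ⟨m, k, h, ?_⟩
  rw [← hχ, ← map_pow, ← map_pow]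
  exact congrArg (fun x => χ (.ofAdd x)) h

end PerfExponents

theorem ValuativeRel.vle_one_of_pow {B : Type*} [CommRing B] (r : ValuativeRel B) {a : B} {N : ℕ}
    (hN : N ≠ 0) (h : r.vle (a ^ N) 1) : r.vle a 1 := by
  let := r
  have hv := fun a b => (Valuation.Compatible.vle_iff_le (v := ValuativeRel.valuation B) a b)
  rw [hv, map_pow, map_one] at h
  rw [hv, map_one]
  exact (pow_le_one_iff hN).1 h

theorem ValuativeRel.vle_one_pow {B : Type*} [CommRing B] (r : ValuativeRel B) {a : B} (N : ℕ)
    (h : r.vle a 1) : r.vle (a ^ N) 1 := by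
  let := r
  have hv := fun a b => (Valuation.Compatible.vle_iff_le (v := ValuativeRel.valuation B) a b)
  rw [hv, map_one] at h
  rw [hv, map_pow, map_one]
  exact pow_le_one' h N

theorem ValuativeRel.vle_one_prod {B ι : Type*} [CommRing B] (r : ValuativeRel B) (s : Finset ι)
    {f : ι → B} (h : ∀ i, r.vle (f i) 1) : r.vle (∏ i ∈ s, f i) 1 := by
  let := r
  have hv := fun a b => (Valuation.Compatible.vle_iff_le (v := ValuativeRel.valuation B) a b)
  rw [hv, map_prod, map_one]
  refine Finset.prod_le_one' fun i _ => ?_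
  rw [← map_one (ValuativeRel.valuation B), ← hv]
  exact h i

/-- A system of powers is bounded by `1` if its value at `one` is, as every exponent has a multiple
which is a multiple of `one`. -/
theorem IsExponentMonoid.vle_one {E : Type} [AddCommMonoid E] {one : E}
    (hE : IsExponentMonoid E one) {B : Type*} [CommRing B] (r : ValuativeRel B)
    {χ : Multiplicative E →* B} (h : r.vle (χ (.ofAdd one)) 1) (e : Multiplicative E) :
    r.vle (χ e) 1 := by
  obtain ⟨N, M, hN, hNM⟩ := hE.exists_nsmul e.toAdd
  refine r.vle_one_of_pow hN.ne' ?_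
  have : e ^ N = Multiplicative.ofAdd one ^ M := hNM
  rw [← map_pow, this, map_pow]
  exact r.vle_one_pow M h

/-! ### Functions on perfectoid spaces -/

namespace PerfectoidSpace
variable {p : ℕ} {K : Type u} [NormedField K] (X : PerfectoidSpace p K)

/-- The functions on an open subset of a perfectoid space. -/
abbrev Fn (W : Opens X.carrier) : Type u := X.toPreAdicSpace.Fn W

/-- An open subset is small if it is contained in an affinoid perfectoid open subspace. -/
def IsSmall (W : Opens X.carrier) : Prop :=
  ∃ (P : PerfectoidAffinoidAlgebra p K) (j : PreAdicSpace.Hom P.spa X.toPreAdicSpace),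
    PresheafedSpace.IsOpenImmersion j.hom ∧ (W : Set X.carrier) ⊆ Set.range j.hom.base

variable {X}

theorem IsSmall.mono {V W : Opens X.carrier} (h : V ≤ W) (hW : X.IsSmall W) : X.IsSmall V := by
  obtain ⟨P, j, hj, hW⟩ := hW
  exact ⟨P, j, hj, fun x hx => hW (h hx)⟩

variable (X) in
theorem exists_isSmall {U : Opens X.carrier} {x : X.carrier} (hx : x ∈ U) :
    ∃ W, W ≤ U ∧ X.IsSmall W ∧ x ∈ W := by
  obtain ⟨P, j, hj, hxj⟩ := X.exists_chart x
  exact ⟨⟨Set.range j.hom.base, hj.base_open.isOpen_range⟩ ⊓ U, inf_le_right,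
    ⟨P, j, hj, fun _ h => h.1⟩, hxj, hx⟩

theorem IsSmall.isFunctionRing [CharP K p] (hp : p.Prime) (hK : IsPerfectoidField p K) {π : K}
    (h0 : π ≠ 0) (h1 : ‖π‖ < 1) {W : Opens X.carrier} (hW : X.IsSmall W) :
    IsFunctionRing p (B := X.Fn W) fun x : {x // x ∈ W} => X.val W x x.2 := by
  obtain ⟨P, j, hj, hW⟩ := hW
  let V : Opens P.gluing.Points := j.preimage W
  have hiso : IsIso (j.hom.c.app (op W)) := by
    refine PresheafedSpace.IsOpenImmersion.c_iso' j.hom V (Opens.ext ?_)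
    exact (Set.image_preimage_eq_of_subset hW).symm
  let F := j.hom.c.app (op W)
  have e1 : ∀ f, (inv F).1 (F.1 f) = f := fun f =>
    congrArg (fun G : X.presheaf.obj (op W) ⟶ _ => G.1 f) (IsIso.hom_inv_id F)
  have e2 : ∀ f, F.1 ((inv F).1 f) = f := fun f =>
    congrArg (fun G : ((TopCat.Presheaf.pushforward _ j.hom.base).obj P.spa.presheaf).obj (op W)
      ⟶ _ => G.1 f) (IsIso.inv_hom_id F)
  let e : X.Fn W ≃+* P.gluing.sections V :=
    { F.1 with
      invFun := (inv F).1
      left_inv := e1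
      right_inv := e2 }
  refine (P.isFunctionRing hp hK h0 h1 V).congr e F.2 (inv F).2
    (fun y : {y // y ∈ V} => ⟨j.hom.base y.1, y.2⟩) ?_ fun y f g => j.val_iff W y.1 y.2 f g
  rintro ⟨x, hx⟩
  obtain ⟨y, rfl⟩ := hW hx
  exact ⟨⟨y, hx⟩, rfl⟩

theorem isOpen_vle {π : K} (h0 : π ≠ 0) (h1 : ‖π‖ < 1) (W : Opens X.carrier)
    (f g : X.Fn W) : IsOpen {x : X.carrier | ∃ hx : x ∈ W,
      (X.val W x hx).vle f g ∧ ¬ (X.val W x hx).vle g 0} := by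
  rw [isOpen_iff_mem_nhds]
  rintro x ⟨hx, hfg, hg⟩
  obtain ⟨P, j, hj, y, rfl⟩ := X.exists_chart x
  let V : Opens P.gluing.Points := j.preimage W
  let F : X.Fn W →+* P.gluing.sections V := (j.hom.c.app (op W)).1
  have hF : ∀ y (hy : y ∈ V) f g, (GluingData.valAt hy).vle (F f) (F g) ↔
      (X.val W (j.hom.base y) hy).vle f g := fun y hy f g => j.val_iff W y hy f g
  have hO := hj.base_open.isOpenMap _ (P.isOpen_vle h0 h1 V (F f) (F g))
  refine Filter.mem_of_superset (hO.mem_nhds ⟨y, ⟨hx, (hF y hx _ _).2 hfg, fun h => hg ?_⟩, rfl⟩) ?_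
  · rw [← map_zero F] at h
    exact (hF y hx _ _).1 h
  · rintro _ ⟨z, ⟨hz, h, h'⟩, rfl⟩
    refine ⟨hz, (hF z hz _ _).1 h, fun h0 => h' ?_⟩
    rw [← map_zero F]
    exact (hF z hz _ _).2 h0

end PerfectoidSpace

/-! ### Homogeneous coordinates on perfectoid spaces -/

namespace PreAdicSpace
variable {K : Type u} [NormedField K] (X : PreAdicSpace K)

/-- The map from `K` to the functions on an open subset. -/
def baseHom (W : Opens X.carrier) : K →+* X.Fn W := (resHom le_top).comp X.base

variable {X}

theorem continuous_baseHom (W : Opens X.carrier) : Continuous (X.baseHom W) :=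
  (continuous_resHom _).comp X.continuous_base

theorem resHom_baseHom {V W : Opens X.carrier} (h : V ≤ W) (a : K) :
    resHom h (X.baseHom W a) = X.baseHom V a :=
  resHom_resHom _ _ _

theorem baseHom_vle_one {W : Opens X.carrier} {x : X.carrier} (hx : x ∈ W) {a : K} (ha : ‖a‖ ≤ 1) :
    (X.val W x hx).vle (X.baseHom W a) 1 := by
  rw [← map_one (resHom (le_top : W ≤ ⊤))]
  exact (val_resHom le_top hx _ _).2 (X.base_le_one a ha x)

theorem Hom.pull_baseHom {Y : PreAdicSpace K} (φ : Hom X Y) {U : Opens Y.carrier}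
    {W : Opens X.carrier} (h : W ≤ φ.preimage U) (a : K) :
    φ.pull U W h (Y.baseHom U a) = X.baseHom W a :=
  (φ.pull_resHom le_top h _).trans (congrArg _ (φ.map_base a))

/-- Homogeneous coordinates on `X`: functions `f_{ij}` on the members `U_i` of an open cover which
are at most `1` and behave like `T_j / T_i`. -/
structure ProjData (X : PreAdicSpace K) (n : ℕ) where
  U : Fin (n + 1) → Opens X.carrier
  exists_mem : ∀ x, ∃ i, x ∈ U i
  f : ∀ i, Fin (n + 1) → X.Fn (U i)
  vle_one : ∀ i j x (hx : x ∈ U i), (X.val (U i) x hx).vle (f i j) 1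
  self : ∀ i, f i i = 1
  cocycle : ∀ i j k, resHom (inf_le_right : U i ⊓ U j ≤ U j) (f j k) *
    resHom inf_le_left (f i j) = resHom inf_le_left (f i k)

namespace ProjData
variable {n : ℕ} (d : ProjData X n)

/-- The restriction of `f_{ij}`. -/
def fn {W : Opens X.carrier} {i : Fin (n + 1)} (h : W ≤ d.U i) (j : Fin (n + 1)) : X.Fn W :=
  resHom h (d.f i j)

theorem resHom_fn {V W : Opens X.carrier} {i : Fin (n + 1)} (h : W ≤ d.U i) (hV : V ≤ W)
    (j : Fin (n + 1)) : resHom hV (d.fn h j) = d.fn (hV.trans h) j :=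
  resHom_resHom _ _ _

theorem fn_vle_one {W : Opens X.carrier} {i : Fin (n + 1)} (h : W ≤ d.U i) (j : Fin (n + 1))
    {x : X.carrier} (hx : x ∈ W) : (X.val W x hx).vle (d.fn h j) 1 := by
  rw [← map_one (resHom h)]
  exact (val_resHom h hx _ _).2 (d.vle_one i j x (h hx))

theorem fn_self {W : Opens X.carrier} {i : Fin (n + 1)} (h : W ≤ d.U i) : d.fn h i = 1 :=
  (congrArg _ (d.self i)).trans (map_one _)

theorem fn_mul_fn {W : Opens X.carrier} {i j : Fin (n + 1)} (hi : W ≤ d.U i) (hj : W ≤ d.U j)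
    (k : Fin (n + 1)) : d.fn hj k * d.fn hi j = d.fn hi k := by
  have := congrArg (resHom (le_inf hi hj)) (d.cocycle i j k)
  rw [map_mul] at this
  simp only [resHom_resHom] at this
  exact this

theorem isUnit_fn {W : Opens X.carrier} {i j : Fin (n + 1)} (hi : W ≤ d.U i) (hj : W ≤ d.U j) :
    IsUnit (d.fn hi j) :=
  .of_mul_eq_one _ ((mul_comm _ _).trans ((d.fn_mul_fn hi hj i).trans (d.fn_self hi)))

end ProjData
end PreAdicSpace

namespace ProjectiveSpace
variable {K : Type u} [NormedField K] [IsUltrametricDist K] {n : ℕ} {E : Type} [AddCommMonoid E]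
variable {π : K} {one : E}

/-- The system of powers of the coordinate `T_a / T_i`. -/
noncomputable def ratioHom {B : Type*} [CommRing B] {i : Fin (n + 1)} (h : Chart K n E i →+* B)
    (a : Fin (n + 1)) : Multiplicative E →* B where
  toFun e := h (ratio K i a e.toAdd)
  map_one' := by rw [toAdd_one, ratio_zero, map_one]
  map_mul' e e' := by rw [toAdd_mul, ratio_add, map_mul]

theorem vle_one_of_vle_one (hE : IsExponentMonoid E one) {B : Type*} [CommRing B]
    (r : ValuativeRel B) {i : Fin (n + 1)} (h : Chart K n E i →+* B) {a : Fin (n + 1)}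
    (ha : r.vle (h (ratio K i a one)) 1) (e : E) : r.vle (h (ratio K i a e)) 1 :=
  hE.vle_one r (χ := ratioHom h a) ha (.ofAdd e)

theorem isCoordChange_of_one {B : Type*} [CommRing B] (hB : HasUniquePowers E one B)
    {i j : Fin (n + 1)} {h : Chart K n E i →+* B} {h' : Chart K n E j →+* B}
    (hK : ∀ c, h' (algebraMap K _ c) = h (algebraMap K _ c))
    (H : ∀ a, h' (ratio K j a one) * h (ratio K i j one) = h (ratio K i a one)) :
    IsCoordChange h h' where
  map_algebraMap := hK
  map_ratio a e := by
    have : ratioHom h' a * ratioHom h j = ratioHom h a :=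
      (hB (h (ratio K i a one))).unique (H a) rfl
    exact congrArg (fun F => F (.ofAdd e)) this

theorem hom_ext_of_one {B : Type*} [CommRing B] [TopologicalSpace B] [T2Space B]
    (hB : HasUniquePowers E one B) {i : Fin (n + 1)} {h h' : Chart K n E i →+* B}
    (hc : Continuous h) (hc' : Continuous h')
    (hK : ∀ c, h (algebraMap K _ c) = h' (algebraMap K _ c))
    (H : ∀ a, h (ratio K i a one) = h' (ratio K i a one)) : h = h' := by
  refine hom_ext hc hc' hK fun a e => ?_
  have : ratioHom h a = ratioHom h' a := (hB (h' (ratio K i a one))).unique (H a) rfl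
  exact congrArg (fun F => F (.ofAdd e)) this

namespace IsSetting

/-- The open subset of projective space given by a chart. -/
noncomputable def chartOpen (hS : IsSetting π one) (i : Fin (n + 1)) : Opens (Pt K n E) :=
  hS.opens ⟨i, .univ _⟩

theorem pt_mem_chartOpen (hS : IsSetting π one) {i : Fin (n + 1)} (z : ChartPoint K E i) :
    pt i z ∈ hS.chartOpen i :=
  ⟨z, by rw [RationalDatum.univ_set]; trivial, rfl⟩

theorem mem_chartOpen (hS : IsSetting π one) {i : Fin (n + 1)} {y : Pt K n E} :
    y ∈ hS.chartOpen i ↔ ∃ z, pt i z = y :=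
  ⟨fun ⟨z, _, h⟩ => ⟨z, h⟩, fun ⟨z, h⟩ => h ▸ hS.pt_mem_chartOpen z⟩

theorem image_subset_chartOpen (hS : IsSetting π one) (a : Rat K n E) :
    a.image ⊆ hS.chartOpen a.1 := by
  rintro _ ⟨z, _, rfl⟩
  exact hS.pt_mem_chartOpen z

/-- The functions on an open subset of a chart given by the elements of the ring of the chart. -/
noncomputable def chartHom (hS : IsSetting π one) (i : Fin (n + 1)) (U : Opens (Pt K n E))
    (hU : U ≤ hS.chartOpen i) : Chart K n E i →+* (gluingData K n E).sections U :=
  (hS.toSections ⟨i, .univ _⟩ U hU).comp (RationalDatum.toCompleted _)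

theorem continuous_chartHom (hS : IsSetting π one) {i : Fin (n + 1)} {U : Opens (Pt K n E)}
    (hU : U ≤ hS.chartOpen i) : Continuous (hS.chartHom i U hU) :=
  (hS.continuous_toSections hU).comp (RationalDatum.continuous_toCompleted _)

theorem restr_toCompleted (hS : IsSetting π one) {i : Fin (n + 1)}
    {D D' : RationalDatum (Chart K n E i)} (h : Rat.image ⟨i, D⟩ ⊆ Rat.image ⟨i, D'⟩)
    (f : Chart K n E i) : hS.restr h (D'.toCompleted f) = D.toCompleted f := by
  have hr := hS.isRestriction_restr h
  have H := isCoordChange_of_isRestriction hr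
  have : (hS.restr h).comp D'.toCompleted = D.toCompleted := by
    refine hom_ext (B := D.Completed) (hr.continuous.comp D'.continuous_toCompleted) D.continuous_toCompleted
      H.map_algebraMap fun a e => ?_
    have := H.map_ratio a e
    rwa [ratio_self, map_one, mul_one] at this
  exact congrArg (fun F => F f) this

theorem component_chartHom (hS : IsSetting π one) {i : Fin (n + 1)} {U : Opens (Pt K n E)}
    (hU : U ≤ hS.chartOpen i) (D : RationalDatum (Chart K n E i)) (hD : Rat.image ⟨i, D⟩ ⊆ U)
    (f : Chart K n E i) :
    ProjectiveSpace.component ⟨i, D⟩ hD (hS.chartHom i U hU f) = D.toCompleted f :=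
  hS.restr_toCompleted (hD.trans hU) f

theorem toSections_toCompleted (hS : IsSetting π one) {i : Fin (n + 1)}
    {D : RationalDatum (Chart K n E i)} {U : Opens (Pt K n E)}
    (hU : (U : Set (Pt K n E)) ⊆ Rat.image ⟨i, D⟩) (f : Chart K n E i) :
    hS.toSections ⟨i, D⟩ U hU (D.toCompleted f) =
      hS.chartHom i U (hU.trans (hS.image_subset_chartOpen ⟨i, D⟩)) f := by
  refine Subtype.ext (funext fun c => ?_)
  have h := isRestriction_unique (isRestriction_comp (hS.isRestriction_restr (c.2.trans hU))
    (hS.isRestriction_restr (hS.image_subset_chartOpen ⟨i, D⟩)))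
    (hS.isRestriction_restr (c := c.1) (b := ⟨i, .univ _⟩)
      ((c.2.trans hU).trans (hS.image_subset_chartOpen ⟨i, D⟩)))
  have h' := congrArg (fun F => F ((RationalDatum.univ _).toCompleted f)) h
  rw [← hS.restr_toCompleted (hS.image_subset_chartOpen ⟨i, D⟩) f]
  exact h'

theorem chartHom_algebraMap (hS : IsSetting π one) {i : Fin (n + 1)} {U : Opens (Pt K n E)}
    (hU : U ≤ hS.chartOpen i) (a : K) :
    hS.chartHom i U hU (algebraMap K _ a) =
      GluingData.res le_top ((gluingData K n E).const a) :=
  Subtype.ext (funext fun c =>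
    (hS.isRestriction_restr (c := c.1) (b := ⟨i, .univ _⟩) (c.2.trans hU)).map_algebraMap a)

theorem exists_rational_image {i : Fin (n + 1)} {U : Opens (Pt K n E)} {z : ChartPoint K E i}
    (hz : pt i z ∈ U) : ∃ D : RationalDatum (Chart K n E i), z ∈ D.set _ ∧ Rat.image ⟨i, D⟩ ⊆ U := by
  have hO : IsOpen {w : ChartPoint K E i | pt i w ∈ U} :=
    U.isOpen.preimage (GluingData.continuous_chart (G := gluingData K n E) i)
  obtain ⟨D, hD, hDU⟩ := SpaPoint.exists_rational hO (x := z) hz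
  refine ⟨D, hD, ?_⟩
  rintro _ ⟨w, hw, rfl⟩
  exact hDU hw

theorem val_chartHom (hS : IsSetting π one) {i : Fin (n + 1)} {U : Opens (Pt K n E)}
    (hU : U ≤ hS.chartOpen i) {z : ChartPoint K E i} (hz : pt i z ∈ U) (f g : Chart K n E i) :
    (GluingData.valAt hz).vle (hS.chartHom i U hU f) (hS.chartHom i U hU g) ↔
      z.rel.vle f g := by
  obtain ⟨D, hD, hD'⟩ := exists_rational_image hz
  refine (hS.valAt_iff hD' hD hz _ _).trans ?_
  rw [hS.component_chartHom, hS.component_chartHom]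
  exact D.evalRel_toCompleted hD f g

end IsSetting

/-! ### Morphisms to projective space -/

section Morphisms
variable {X : PreAdicSpace K} (φ : PreAdicSpace.Hom X (space K n E))

/-- The map on points of a morphism to projective space. -/
noncomputable def mapPt (x : X.carrier) : Pt K n E := φ.hom.base x

/-- The preimage of an open subset of projective space. -/
noncomputable def preim (U : Opens (Pt K n E)) : Opens X.carrier := φ.preimage U

theorem preim_mono {U V : Opens (Pt K n E)} (h : U ≤ V) : preim φ U ≤ preim φ V := fun _ hx => h hx

/-- The pullback of functions along a morphism to projective space. -/
noncomputable def pullFn (U : Opens (Pt K n E)) (W : Opens X.carrier) (h : W ≤ preim φ U) :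
    (gluingData K n E).sections U →+* X.Fn W := φ.pull U W h

theorem continuous_pullFn {U : Opens (Pt K n E)} {W : Opens X.carrier} (h : W ≤ preim φ U) :
    Continuous (pullFn φ U W h) := φ.continuous_pull h

theorem resHom_pullFn {U : Opens (Pt K n E)} {V W : Opens X.carrier} (h : W ≤ preim φ U)
    (h' : V ≤ W) (f : (gluingData K n E).sections U) :
    PreAdicSpace.resHom h' (pullFn φ U W h f) = pullFn φ U V (h'.trans h) f := φ.resHom_pull h h' f

theorem pullFn_res {U U' : Opens (Pt K n E)} {W : Opens X.carrier} (hU : U' ≤ U)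
    (h : W ≤ preim φ U') (f : (gluingData K n E).sections U) :
    pullFn φ U' W h (GluingData.res hU f) = pullFn φ U W (h.trans (preim_mono φ hU)) f :=
  φ.pull_resHom hU h f

theorem val_pullFn {U : Opens (Pt K n E)} {W : Opens X.carrier} (h : W ≤ preim φ U)
    {x : X.carrier} (hx : x ∈ W) (f g : (gluingData K n E).sections U) {y : Pt K n E} (hy : y ∈ U)
    (hxy : mapPt φ x = y) :
    (X.val W x hx).vle (pullFn φ U W h f) (pullFn φ U W h g) ↔ (GluingData.valAt hy).vle f g := by
  subst hxy
  exact φ.val_pull h hx f g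

theorem pullFn_const {U : Opens (Pt K n E)} {W : Opens X.carrier} (h : W ≤ preim φ U) (a : K) :
    pullFn φ U W h (GluingData.res le_top ((gluingData K n E).const a)) = X.baseHom W a :=
  φ.pull_baseHom h a

theorem ext_of_pullFn (hX : X.presheaf.IsSheaf) {φ ψ : PreAdicSpace.Hom X (space K n E)}
    (hb : ∀ x, mapPt φ x = mapPt ψ x)
    (h : ∀ (U : Opens (Pt K n E)) (x : X.carrier), mapPt φ x ∈ U → ∃ (W : Opens X.carrier)
      (hW : W ≤ preim φ U) (hW' : W ≤ preim ψ U), x ∈ W ∧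
        ∀ f, pullFn φ U W hW f = pullFn ψ U W hW' f) : φ = ψ :=
  PreAdicSpace.Hom.ext_of_pull hX hb h

end Morphisms

end ProjectiveSpace

namespace PerfectoidSpace
variable {p : ℕ} {K : Type u} [NormedField K]

/-- The properties of the functions on a perfectoid space on which the study of its morphisms to
projective space is based. -/
structure HasGoodFunctions (X : PerfectoidSpace p K) {E : Type} [AddCommMonoid E] (one : E) :
    Prop where
  isOpen_vle : ∀ (W : Opens X.carrier) (f g : X.Fn W), IsOpen {x : X.carrier | ∃ hx : x ∈ W,
    (X.val W x hx).vle f g ∧ ¬ (X.val W x hx).vle g 0}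
  isFunctionRing : ∀ {W : Opens X.carrier}, X.IsSmall W →
    IsFunctionRing p (B := X.Fn W) fun x : {x // x ∈ W} => X.val W x x.2
  hasUniquePowers : ∀ {W : Opens X.carrier}, X.IsSmall W → HasUniquePowers E one (X.Fn W)

end PerfectoidSpace

/-! ### Morphisms to projective space and homogeneous coordinates -/

namespace PreAdicSpace.ProjData
open ProjectiveSpace PreAdicSpace
variable {p : ℕ} {K : Type u} [NormedField K] [IsUltrametricDist K] {n : ℕ} {E : Type}
  [AddCommMonoid E] {π : K} {one : E} {X : PreAdicSpace K} (d : ProjData X n)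

/-- The morphism `φ` to projective space has the homogeneous coordinates `d`. -/
def IsRealizedBy (hS : IsSetting π one) (φ : Hom X (space K n E)) : Prop :=
  ∀ i, ∃ h : d.U i ≤ preim φ (hS.chartOpen i), ∀ j,
    pullFn φ (hS.chartOpen i) (d.U i) h (hS.chartHom i _ le_rfl (ratio K i j one)) = d.f i j

/-- `h` is the pullback of functions from the chart `i` along a morphism with the homogeneous
coordinates `d`. -/
structure IsChartHom (one : E) {i : Fin (n + 1)} {W : Opens X.carrier} (hW : W ≤ d.U i)
    (h : Chart K n E i →+* X.Fn W) : Prop where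
  continuous : Continuous h
  map_algebraMap : ∀ a, h (algebraMap K _ a) = X.baseHom W a
  map_ratio_one : ∀ a, h (ratio K i a one) = d.fn hW a

variable {d}

theorem IsChartHom.res {i : Fin (n + 1)} {V W : Opens X.carrier} {hW : W ≤ d.U i}
    {h : Chart K n E i →+* X.Fn W} (H : d.IsChartHom one hW h) (hV : V ≤ W) :
    d.IsChartHom one (hV.trans hW) ((resHom hV).comp h) where
  continuous := (continuous_resHom hV).comp H.continuous
  map_algebraMap a := (congrArg _ (H.map_algebraMap a)).trans (resHom_baseHom hV a)
  map_ratio_one a := (congrArg _ (H.map_ratio_one a)).trans (d.resHom_fn hW hV a)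

theorem IsRealizedBy.isChartHom {hS : IsSetting π one} {φ : Hom X (space K n E)}
    (hφ : d.IsRealizedBy hS φ) {i : Fin (n + 1)} {W : Opens X.carrier} (hW : W ≤ d.U i)
    {U : Opens (Pt K n E)} (hU : U ≤ hS.chartOpen i) (h : W ≤ preim φ U) :
    d.IsChartHom one hW ((pullFn φ U W h).comp (hS.chartHom i U hU)) where
  continuous := (continuous_pullFn φ h).comp (hS.continuous_chartHom hU)
  map_algebraMap a := (congrArg _ (hS.chartHom_algebraMap hU a)).trans (pullFn_const φ h a)
  map_ratio_one a := by
    obtain ⟨h', H⟩ := hφ i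
    rw [fn, ← H, resHom_pullFn]
    exact pullFn_res φ hU h (hS.chartHom i _ le_rfl (ratio K i a one))

/-- On `U_i ∩ U_j`, the pullbacks from two charts differ by the change of coordinates: both sides of
the relation are systems of powers, which agree at the exponent `one`. -/
theorem IsChartHom.isCoordChange {i j : Fin (n + 1)} {W : Opens X.carrier}
    (hW : HasUniquePowers E one (X.Fn W)) {hi : W ≤ d.U i} {hj : W ≤ d.U j}
    {h : Chart K n E i →+* X.Fn W} (H : d.IsChartHom one hi h)
    {h' : Chart K n E j →+* X.Fn W} (H' : d.IsChartHom one hj h') : IsCoordChange h h' := by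
  refine isCoordChange_of_one hW (fun c => (H'.map_algebraMap c).trans (H.map_algebraMap c).symm)
    fun a => ?_
  rw [H.map_ratio_one, H.map_ratio_one, H'.map_ratio_one, d.fn_mul_fn]

theorem IsChartHom.unique {i : Fin (n + 1)} {W : Opens X.carrier} [T2Space (X.Fn W)]
    (hW : HasUniquePowers E one (X.Fn W)) {hi : W ≤ d.U i}
    {h h' : Chart K n E i →+* X.Fn W} (H : d.IsChartHom one hi h) (H' : d.IsChartHom one hi h') :
    h = h' :=
  hom_ext_of_one hW H.continuous H'.continuous
    (fun a => (H.map_algebraMap a).trans (H'.map_algebraMap a).symm)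
    fun a => (H.map_ratio_one a).trans (H'.map_ratio_one a).symm

variable {X : PerfectoidSpace p K} {d : ProjData X.toPreAdicSpace n}

/-- A morphism is determined by its homogeneous coordinates. -/
theorem IsRealizedBy.unique (hS : IsSetting π one) (hX : X.HasGoodFunctions one)
    {φ ψ : Hom X.toPreAdicSpace (space K n E)} (hφ : d.IsRealizedBy hS φ)
    (hψ : d.IsRealizedBy hS ψ) : φ = ψ := by
  -- the maps on points agree, as a point of a chart is determined by its valuation
  have hb : ∀ x, mapPt φ x = mapPt ψ x := by
    intro x
    obtain ⟨i, hx⟩ := d.exists_mem x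
    obtain ⟨W, hW, hWs, hxW⟩ := X.exists_isSmall hx
    have := (hX.isFunctionRing hWs).t2
    have h1 : W ≤ preim φ (hS.chartOpen i) := hW.trans (hφ i).1
    have h2 : W ≤ preim ψ (hS.chartOpen i) := hW.trans (hψ i).1
    have e := (hφ.isChartHom hW le_rfl h1).unique (hX.hasUniquePowers hWs)
      (hψ.isChartHom hW le_rfl h2)
    obtain ⟨z, hz⟩ := hS.mem_chartOpen.1 (h1 hxW)
    obtain ⟨w, hw⟩ := hS.mem_chartOpen.1 (h2 hxW)
    have hzv : ∀ f g, z.rel.vle f g ↔ (X.val W x hxW).vle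
        (((pullFn φ _ W h1).comp (hS.chartHom i _ le_rfl)) f)
        (((pullFn φ _ W h1).comp (hS.chartHom i _ le_rfl)) g) := fun f g =>
      (hS.val_chartHom le_rfl (hS.pt_mem_chartOpen z) f g).symm.trans
        (val_pullFn φ h1 hxW _ _ (hS.pt_mem_chartOpen z) hz.symm).symm
    have hwv : ∀ f g, w.rel.vle f g ↔ (X.val W x hxW).vle
        (((pullFn ψ _ W h2).comp (hS.chartHom i _ le_rfl)) f)
        (((pullFn ψ _ W h2).comp (hS.chartHom i _ le_rfl)) g) := fun f g =>
      (hS.val_chartHom le_rfl (hS.pt_mem_chartOpen w) f g).symm.trans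
        (val_pullFn ψ h2 hxW _ _ (hS.pt_mem_chartOpen w) hw.symm).symm
    obtain rfl : z = w := SpaPoint.ext fun f g => by rw [hzv, hwv, e]
    exact hz.symm.trans hw
  -- the pullbacks of functions agree after restriction to a rational subset of a chart
  refine ext_of_pullFn X.isSheaf hb fun U x hxU => ?_
  obtain ⟨i, hx⟩ := d.exists_mem x
  obtain ⟨z, hz⟩ := hS.mem_chartOpen.1 ((hφ i).1 hx)
  obtain ⟨D, hzD, hDU⟩ := IsSetting.exists_rational_image (U := U) (z := z) (by rw [hz]; exact hxU)
  have hxφ : x ∈ preim φ (hS.opens ⟨i, D⟩) := ⟨z, hzD, hz⟩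
  have hxψ : x ∈ preim ψ (hS.opens ⟨i, D⟩) := ⟨z, hzD, hz.trans (hb x)⟩
  obtain ⟨W, hW, hWs, hxW⟩ := X.exists_isSmall
    (U := d.U i ⊓ (preim φ (hS.opens ⟨i, D⟩) ⊓ preim ψ (hS.opens ⟨i, D⟩))) ⟨hx, hxφ, hxψ⟩
  have h1 : W ≤ preim φ (hS.opens ⟨i, D⟩) := fun _ h => (hW h).2.1
  have h2 : W ≤ preim ψ (hS.opens ⟨i, D⟩) := fun _ h => (hW h).2.2
  refine ⟨W, fun _ h => hDU (h1 h), fun _ h => hDU (h2 h), hxW, fun f => ?_⟩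
  have := (hX.isFunctionRing hWs).t2
  have hD : hS.opens ⟨i, D⟩ ≤ hS.chartOpen i := hS.image_subset_chartOpen ⟨i, D⟩
  have e := (hφ.isChartHom (fun _ h => (hW h).1) hD h1).unique (hX.hasUniquePowers hWs)
    (hψ.isChartHom _ hD h2)
  have e' : (pullFn φ _ W h1).comp (hS.toSections ⟨i, D⟩ (hS.opens ⟨i, D⟩) subset_rfl) =
      (pullFn ψ _ W h2).comp (hS.toSections ⟨i, D⟩ (hS.opens ⟨i, D⟩) subset_rfl) := by
    refine RationalDatum.hom_ext (B := X.Fn W)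
      ((continuous_pullFn φ h1).comp (hS.continuous_toSections _))
      ((continuous_pullFn ψ h2).comp (hS.continuous_toSections _)) fun a => ?_
    rw [RingHom.comp_apply, RingHom.comp_apply, hS.toSections_toCompleted subset_rfl]
    exact congrArg (fun F => F a) e
  have key : ∀ (χ : Hom X.toPreAdicSpace (space K n E)) (h : W ≤ preim χ (hS.opens ⟨i, D⟩)),
      pullFn χ U W (fun _ hy => hDU (h hy)) f = ((pullFn χ _ W h).comp
        (hS.toSections ⟨i, D⟩ (hS.opens ⟨i, D⟩) subset_rfl))
          (ProjectiveSpace.component ⟨i, D⟩ hDU f) := by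
    intro χ h
    refine (pullFn_res χ hDU h f).symm.trans (congrArg (pullFn χ _ W h) ?_)
    exact (hS.toSections_component (a := ⟨i, D⟩) subset_rfl hDU f).symm
  rw [key φ h1, key ψ h2, e']

end PreAdicSpace.ProjData

/-! ### The morphism with given homogeneous coordinates -/

namespace PreAdicSpace.ProjData
open ProjectiveSpace PreAdicSpace
variable {p : ℕ} {K : Type u} [NormedField K] [IsUltrametricDist K] {n : ℕ} {E : Type}
  [AddCommMonoid E] {π : K} {one : E} {X : PerfectoidSpace p K}
  {d : ProjData X.toPreAdicSpace n}

/-- The homogeneous coordinates extend to the ring of the chart: each has a unique system of powers,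
and products of these powers are at most `1`, hence bounded. -/
theorem exists_isChartHom (hE : IsExponentMonoid E one) (hX : X.HasGoodFunctions one)
    {i : Fin (n + 1)} {W : Opens X.carrier} (hWs : X.IsSmall W) (hW : W ≤ d.U i) :
    ∃ h : Chart K n E i →+* X.Fn W, d.IsChartHom one hW h := by
  have hF := hX.isFunctionRing hWs
  have := hF.nonarchimedean
  have := hF.t2
  choose χ hχ hχ' using fun a => hX.hasUniquePowers hWs (d.fn hW a)
  obtain ⟨h, hc, hK, hr⟩ := exists_hom (E := E) hF.complete i (X.baseHom W) (continuous_baseHom W)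
    χ (hχ' i 1 (d.fn_self hW).symm).symm (hF.isBounded.mono (by
      rintro _ ⟨m, rfl⟩ x
      refine ValuativeRel.vle_one_prod _ _ fun b => hE.vle_one _ ?_ _
      rw [hχ]
      exact d.fn_vle_one hW b x.2))
  exact ⟨h, hc, hK, fun a => (hr a one).trans (hχ a)⟩

/-- The point of the chart `i` which is the image of a point of `U_i`. -/
theorem IsChartHom.exists_point (hS : IsSetting π one) (hX : X.HasGoodFunctions one)
    {i : Fin (n + 1)} {W : Opens X.carrier} (hWs : X.IsSmall W) {hW : W ≤ d.U i}
    {h : Chart K n E i →+* X.Fn W} (H : d.IsChartHom one hW h) {x : X.carrier} (hx : x ∈ W) :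
    ∃ z : ChartPoint K E i, ∀ f g, z.rel.vle f g ↔ (X.val W x hx).vle (h f) (h g) := by
  have hcont := ((hX.isFunctionRing hWs).isContRel ⟨x, hx⟩).pullback H.continuous
  refine ⟨SpaPoint.ofRel _ hcont fun a ha => ?_, fun f g => Iff.rfl⟩
  refine hS.vle_one hcont (fun c hc => ?_) (fun a e => ?_) ha
  · change (X.val W x hx).vle (h _) (h _)
    rw [H.map_algebraMap, map_one]
    exact baseHom_vle_one hx hc
  · change (X.val W x hx).vle (h _) (h _)
    rw [map_one]
    refine vle_one_of_vle_one hS.exp _ h ?_ e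
    rw [H.map_ratio_one]
    exact d.fn_vle_one hW a hx

variable (d) in
/-- `y` is the image of `x` under a morphism with the homogeneous coordinates `d`. -/
def IsImage (one : E) (x : X.carrier) (y : Pt K n E) : Prop :=
  ∀ (i : Fin (n + 1)) (W : Opens X.carrier) (hW : W ≤ d.U i) (hx : x ∈ W), X.IsSmall W →
    ∀ h : Chart K n E i →+* X.Fn W, d.IsChartHom one hW h →
      ∃ z : ChartPoint K E i, pt i z = y ∧
        ∀ f g, z.rel.vle f g ↔ (X.val W x hx).vle (h f) (h g)

/-- Every point has an image; the points obtained from two charts are glued, as the homomorphisms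
differ by a change of coordinates. -/
theorem exists_isImage (hS : IsSetting π one) (hX : X.HasGoodFunctions one) (x : X.carrier) :
    ∃ y, d.IsImage one x y := by
  obtain ⟨i, hxi⟩ := d.exists_mem x
  obtain ⟨W, hW, hWs, hx⟩ := X.exists_isSmall hxi
  obtain ⟨h, H⟩ := exists_isChartHom hS.exp hX hWs hW
  obtain ⟨z, hz⟩ := H.exists_point hS hX hWs hx
  refine ⟨pt i z, fun j V hV hxV hVs h' H' => ?_⟩
  obtain ⟨w, hw⟩ := H'.exists_point hS hX hVs hxV
  refine ⟨w, pt_eq_iff.2 fun e F G hF hG => ?_, hw⟩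
  have hC := (H'.res (inf_le_left : V ⊓ W ≤ V)).isCoordChange
    (hX.hasUniquePowers (hVs.mono inf_le_left)) (H.res (inf_le_right : V ⊓ W ≤ W))
  have := hC.vle_iff (X.val (V ⊓ W) x ⟨hxV, hx⟩) hF hG
  rw [hw, hz, ← val_resHom inf_le_left (⟨hxV, hx⟩ : x ∈ V ⊓ W),
    ← val_resHom inf_le_right (⟨hxV, hx⟩ : x ∈ V ⊓ W)]
  exact this

/-- The preimage of a rational subset is defined by inequalities between functions on `X`, so it is
open. -/
theorem isOpen_preimage_of_isImage (hS : IsSetting π one) (hX : X.HasGoodFunctions one)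
    {b : X.carrier → Pt K n E} (hb : ∀ x, d.IsImage one x (b x)) {O : Set (Pt K n E)}
    (hO : IsOpen O) : IsOpen (b ⁻¹' O) := by
  rw [isOpen_iff_mem_nhds]
  intro x hxO
  obtain ⟨i, hxi⟩ := d.exists_mem x
  obtain ⟨W, hW, hWs, hx⟩ := X.exists_isSmall hxi
  obtain ⟨h, H⟩ := exists_isChartHom hS.exp hX hWs hW
  obtain ⟨z, hz, hzv⟩ := hb x i W hW hx hWs h H
  obtain ⟨D, hzD, hDO⟩ := IsSetting.exists_rational_image (U := ⟨O, hO⟩) (z := z)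
    (by rw [hz]; exact hxO)
  have hopen : IsOpen ((W : Set X.carrier) ∩ ⋂ t ∈ D.T, {y : X.carrier | ∃ hy : y ∈ W,
      (X.val W y hy).vle (h t) (h D.g) ∧ ¬ (X.val W y hy).vle (h D.g) 0}) :=
    W.isOpen.inter (isOpen_biInter_finset fun t _ => hX.isOpen_vle W _ _)
  refine Filter.mem_of_superset (hopen.mem_nhds ⟨hx, Set.mem_iInter₂.2 fun t ht => ⟨hx,
    (hzv _ _).1 (hzD t ht), fun h0 => D.v_g_ne_zero hzD ?_⟩⟩) ?_
  · rw [← le_zero_iff, ← map_zero z.v, z.v_le_iff, hzv, map_zero]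
    exact h0
  · rintro y ⟨hy, hyT⟩
    obtain ⟨w, hw, hwv⟩ := hb y i W hW hy hWs h H
    refine hDO ⟨w, fun t ht => ?_, hw⟩
    obtain ⟨_, h1, -⟩ := Set.mem_iInter₂.1 hyT t ht
    exact (hwv _ _).2 h1

/-- The pullback of functions from a rational subset of a chart. -/
structure IsRatHom (d : ProjData X.toPreAdicSpace n) (one : E) (a : Rat K n E)
    {W : Opens X.carrier} (hW : W ≤ d.U a.1) (ρ : a.ring →+* X.Fn W) : Prop where
  continuous : Continuous ρ
  isChartHom : d.IsChartHom one hW (ρ.comp a.2.toCompleted)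

theorem IsRatHom.res {a : Rat K n E} {V W : Opens X.carrier} {hW : W ≤ d.U a.1}
    {ρ : a.ring →+* X.Fn W} (H : IsRatHom d one a hW ρ) (hV : V ≤ W) :
    IsRatHom d one a (hV.trans hW) ((resHom hV).comp ρ) where
  continuous := (continuous_resHom hV).comp H.continuous
  isChartHom := H.isChartHom.res hV

theorem IsRatHom.unique (hX : X.HasGoodFunctions one) {a : Rat K n E} {W : Opens X.carrier}
    (hWs : X.IsSmall W) {hW : W ≤ d.U a.1} {ρ ρ' : a.ring →+* X.Fn W}
    (H : IsRatHom d one a hW ρ) (H' : IsRatHom d one a hW ρ') : ρ = ρ' := by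
  have := (hX.isFunctionRing hWs).t2
  exact RationalDatum.hom_ext (B := X.Fn W) H.continuous H'.continuous fun f =>
    congrArg (fun F => F f) (H.isChartHom.unique (hX.hasUniquePowers hWs) H'.isChartHom)

/-- The pullback of functions extends from the chart to a rational subset: its denominator is mapped
to a function without zeros, and its fractions to functions which are at most `1`. -/
theorem exists_isRatHom (hS : IsSetting π one) (hX : X.HasGoodFunctions one)
    {b : X.carrier → Pt K n E} (hb : ∀ x, d.IsImage one x (b x)) (a : Rat K n E)
    {W : Opens X.carrier} (hWs : X.IsSmall W) (hW : W ≤ d.U a.1) (hWa : ∀ x ∈ W, b x ∈ a.image) :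
    ∃ ρ, IsRatHom d one a hW ρ := by
  obtain ⟨i, D⟩ := a
  obtain ⟨h, H⟩ := exists_isChartHom hS.exp hX hWs hW
  have hF := hX.isFunctionRing hWs
  have := hF.nonarchimedean
  have := hF.t2
  have key : ∀ x (hx : x ∈ W), ∃ z ∈ D.set {f | IsPowerBounded f},
      ∀ f g, z.rel.vle f g ↔ (X.val W x hx).vle (h f) (h g) := by
    intro x hx
    obtain ⟨z, hz, hzv⟩ := hb x i W hW hx hWs h H
    have := hWa x hx
    rw [← hz, pt_mem_image hS.exp] at this
    exact ⟨z, this, hzv⟩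
  have hne : ∀ x : {x // x ∈ W}, ¬ (X.val W x x.2).vle (h D.g) 0 := by
    rintro ⟨x, hx⟩ h0
    obtain ⟨z, hz, hzv⟩ := key x hx
    refine D.v_g_ne_zero hz ?_
    rw [← le_zero_iff, ← map_zero z.v, z.v_le_iff, hzv, map_zero]
    exact h0
  have hu := hF.isUnit _ hne
  obtain ⟨ρ, hρc, hρ⟩ := D.exists_lift hF.complete h H.continuous hu fun t ht s hs => by
    refine hF.isBounded.mono ?_
    rintro _ ⟨k, rfl⟩ ⟨x, hx⟩
    refine ValuativeRel.vle_one_pow _ k ?_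
    obtain ⟨z, hz, hzv⟩ := key x hx
    have := (hzv _ _).1 (hz t ht)
    rwa [← hs, ← one_mul (h D.g), ← mul_assoc, mul_one,
      (X.val W x hx).vle_mul_isUnit_iff hu] at this
  refine ⟨ρ, hρc, ?_⟩
  have : ρ.comp D.toCompleted = h := RingHom.ext hρ
  change d.IsChartHom one hW (ρ.comp D.toCompleted)
  rwa [this]

/-- The pullbacks of functions from rational subsets are compatible with the restriction maps. -/
theorem IsRatHom.comp_restr (hS : IsSetting π one) {c a : Rat K n E}
    (hca : c.image ⊆ a.image) {W : Opens X.carrier} {hc : W ≤ d.U c.1}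
    (ha : W ≤ d.U a.1) {ρ : c.ring →+* X.Fn W} (H : IsRatHom d one c hc ρ) :
    IsRatHom d one a ha (ρ.comp (hS.restr hca)) := by
  have hr := hS.isRestriction_restr hca
  have hC := isCoordChange_of_isRestriction hr
  refine ⟨H.continuous.comp hr.continuous,
    (H.continuous.comp hr.continuous).comp a.2.continuous_toCompleted, fun k => ?_, fun j => ?_⟩
  · exact (congrArg ρ (hC.map_algebraMap k)).trans (H.isChartHom.map_algebraMap k)
  · have h1 := congrArg ρ (hC.map_ratio j one)
    rw [map_mul] at h1
    refine (d.isUnit_fn hc ha).mul_right_cancel ?_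
    rw [d.fn_mul_fn, ← H.isChartHom.map_ratio_one, ← H.isChartHom.map_ratio_one]
    exact h1

end PreAdicSpace.ProjData

namespace PreAdicSpace.ProjData
open ProjectiveSpace PreAdicSpace
variable {p : ℕ} {K : Type u} [NormedField K] [IsUltrametricDist K] {n : ℕ} {E : Type}
  [AddCommMonoid E] {π : K} {one : E} {X : PerfectoidSpace p K}
  {d : ProjData X.toPreAdicSpace n}

/-- Near every point of the preimage of `O`, functions are pulled back from a rational subset
of `O` in a given chart. -/
theorem exists_local (hS : IsSetting π one) (hX : X.HasGoodFunctions one)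
    {b : X.carrier → Pt K n E} (hb : ∀ x, d.IsImage one x (b x)) {i : Fin (n + 1)}
    {V : Opens X.carrier} (hV : V ≤ d.U i) {x : X.carrier} (hxV : x ∈ V) {O : Opens (Pt K n E)}
    (hxO : b x ∈ O) : ∃ (D : RationalDatum (Chart K n E i)) (W : Opens X.carrier) (hW : W ≤ V)
      (ρ : D.Completed →+* X.Fn W), Rat.image ⟨i, D⟩ ⊆ O ∧ X.IsSmall W ∧ x ∈ W ∧
        (∀ y ∈ W, b y ∈ Rat.image ⟨i, D⟩) ∧ IsRatHom d one ⟨i, D⟩ (hW.trans hV) ρ := by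
  obtain ⟨W, hW, hWs, hx⟩ := X.exists_isSmall hxV
  obtain ⟨h, H⟩ := exists_isChartHom hS.exp hX hWs (hW.trans hV)
  obtain ⟨z, hz, -⟩ := hb x i W (hW.trans hV) hx hWs h H
  obtain ⟨D, hzD, hDO⟩ := IsSetting.exists_rational_image (U := O) (z := z) (by rw [hz]; exact hxO)
  obtain ⟨W', hW', hWs', hx'⟩ := X.exists_isSmall
    (U := W ⊓ ⟨b ⁻¹' Rat.image ⟨i, D⟩, isOpen_preimage_of_isImage hS hX hb (hS.isOpen_image ⟨i, D⟩)⟩)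
    (x := x) ⟨hx, z, hzD, hz⟩
  have hWD : ∀ y ∈ W', b y ∈ Rat.image ⟨i, D⟩ := fun y hy => (hW' hy).2
  obtain ⟨ρ, hρ⟩ := exists_isRatHom hS hX hb ⟨i, D⟩ hWs'
    (fun y hy => hV (hW (hW' hy).1)) hWD
  exact ⟨D, W', fun y hy => hW (hW' hy).1, ρ, hDO, hWs', hx', hWD, hρ⟩

/-- The pullbacks of a function on `O` through two rational subsets agree, as both agree locally
with the pullback through a rational subset of their intersection. -/
theorem IsRatHom.component_eq (hS : IsSetting π one) (hX : X.HasGoodFunctions one)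
    {b : X.carrier → Pt K n E} (hb : ∀ x, d.IsImage one x (b x)) {O : Opens (Pt K n E)}
    {a a' : Rat K n E} (ha : a.image ⊆ O) (ha' : a'.image ⊆ O) {W : Opens X.carrier}
    {hW : W ≤ d.U a.1} {hW' : W ≤ d.U a'.1}
    (hWa : ∀ x ∈ W, b x ∈ a.image) (hWa' : ∀ x ∈ W, b x ∈ a'.image)
    {ρ : a.ring →+* X.Fn W} {ρ' : a'.ring →+* X.Fn W} (H : IsRatHom d one a hW ρ)
    (H' : IsRatHom d one a' hW' ρ') (f : (gluingData K n E).sections O) :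
    ρ (ProjectiveSpace.component a ha f) = ρ' (ProjectiveSpace.component a' ha' f) := by
  refine fn_ext X.isSheaf fun x hx => ?_
  obtain ⟨D, V, hV, σ, hD, hVs, hxV, -, hσ⟩ := exists_local hS hX hb hW hx
    (O := hS.opens a ⊓ hS.opens a') ⟨hWa x hx, hWa' x hx⟩
  refine ⟨V, hV, hxV, ?_⟩
  let c : Rat K n E := ⟨a.1, D⟩
  have hca : c.image ⊆ a.image := fun y hy => (hD hy).1
  have hca' : c.image ⊆ a'.image := fun y hy => (hD hy).2
  have h1 := (H.res hV).unique hX hVs (hσ.comp_restr hS hca (hV.trans hW))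
  have h2 := (H'.res hV).unique hX hVs (hσ.comp_restr hS hca' (hV.trans hW'))
  refine (congrArg (fun F => F (ProjectiveSpace.component a ha f)) h1).trans
    (Eq.trans ?_ (congrArg (fun F => F (ProjectiveSpace.component a' ha' f)) h2).symm)
  exact congrArg σ ((hS.restr_component hca ha f).trans (hS.restr_component hca' ha' f).symm)

/-- The pullbacks through rational subsets glue to a homomorphism on the functions on `O`. -/
theorem exists_sectionHom (hS : IsSetting π one) (hX : X.HasGoodFunctions one)
    {b : X.carrier → Pt K n E} (hb : ∀ x, d.IsImage one x (b x)) (O : Opens (Pt K n E))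
    (O' : Opens X.carrier) (hO' : ∀ x, x ∈ O' → b x ∈ O) :
    ∃ t : (gluingData K n E).sections O →+* X.Fn O', Continuous t ∧
      ∀ (a : Rat K n E) (ha : a.image ⊆ O) (W : Opens X.carrier) (hW : W ≤ d.U a.1)
        (hWO : W ≤ O') (ρ : a.ring →+* X.Fn W), X.IsSmall W → (∀ x ∈ W, b x ∈ a.image) →
        IsRatHom d one a hW ρ → ∀ f, resHom hWO (t f) = ρ (ProjectiveSpace.component a ha f) := by
  let Q : Opens X.carrier → Prop := fun W => X.IsSmall W ∧ ∃ a : Rat K n E, a.image ⊆ O ∧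
    W ≤ d.U a.1 ∧ ∀ x ∈ W, b x ∈ a.image
  have hQ : ∀ W, Q W → ∃ (a : Rat K n E) (_ : a.image ⊆ O) (hW : W ≤ d.U a.1)
      (ρ : a.ring →+* X.Fn W), (∀ x ∈ W, b x ∈ a.image) ∧ IsRatHom d one a hW ρ := by
    rintro W ⟨hWs, a, ha, hW, hWa⟩
    obtain ⟨ρ, hρ⟩ := exists_isRatHom hS hX hb a hWs hW hWa
    exact ⟨a, ha, hW, ρ, hWa, hρ⟩
  choose a ha hW ρ hWa hρ using hQ
  obtain ⟨t, ht, H⟩ := exists_glue_hom X.isSheaf O' Q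
    (fun V W hVW ⟨hWs, a, ha, hW, hWa⟩ => ⟨hWs.mono hVW, a, ha, hVW.trans hW,
      fun x hx => hWa x (hVW hx)⟩)
    (fun x hx => by
      obtain ⟨i, hxi⟩ := d.exists_mem x
      obtain ⟨D, W, hW, σ, hD, hWs, hxW, hWD, hσ⟩ := exists_local hS hX hb
        (V := d.U i ⊓ O') inf_le_left (x := x) ⟨hxi, hx⟩ (hO' x hx)
      exact ⟨W, fun y hy => (hW hy).2, ⟨hWs, ⟨i, D⟩, hD, fun y hy => (hW hy).1, hWD⟩, hxW⟩)
    (fun W _ hQ => (ρ W hQ).comp (ProjectiveSpace.component (a W hQ) (ha W hQ)))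
    (fun W _ hQ => (hρ W hQ).continuous.comp
      ((continuous_apply (⟨a W hQ, ha W hQ⟩ : GluingData.RationalIn O)).comp
        continuous_subtype_val))
    (fun W V _ hQ hVW f => IsRatHom.component_eq hS hX hb (ha W hQ) (ha V _)
      (fun x hx => hWa W hQ x (hVW hx)) (hWa V _) ((hρ W hQ).res hVW) (hρ V _) f)
  refine ⟨t, ht, fun a' ha' W hW' hWO ρ' hWs hWa' hρ' f => ?_⟩
  have hQW : Q W := ⟨hWs, a', ha', hW', hWa'⟩
  rw [H W hWO hQW]
  exact IsRatHom.component_eq hS hX hb (ha W hQW) ha' (hWa W hQW) hWa' (hρ W hQW) hρ' f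

/-- The pullback through a rational subset respects the valuations at the points. -/
theorem IsRatHom.val_iff (hS : IsSetting π one) (hX : X.HasGoodFunctions one)
    {O : Opens (Pt K n E)} {a : Rat K n E} {ha : a.image ⊆ O} {W : Opens X.carrier}
    (hWs : X.IsSmall W) {hW : W ≤ d.U a.1} {ρ : a.ring →+* X.Fn W} (H : IsRatHom d one a hW ρ)
    {x : X.carrier} (hx : x ∈ W) {z : ChartPoint K E a.1} {y : Pt K n E} (hz : pt a.1 z = y)
    (hzv : ∀ f g, z.rel.vle f g ↔
      (X.val W x hx).vle (ρ.comp a.2.toCompleted f) (ρ.comp a.2.toCompleted g))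
    (hya : y ∈ a.image) (hy : y ∈ O) (f g : (gluingData K n E).sections O) :
    (X.val W x hx).vle (ρ (ProjectiveSpace.component a ha f))
      (ρ (ProjectiveSpace.component a ha g)) ↔ (GluingData.valAt hy).vle f g := by
  subst hz
  obtain ⟨i, D⟩ := a
  have hzD : z ∈ D.set {f | IsPowerBounded f} := (pt_mem_image hS.exp).1 hya
  have h1 : _ ↔ D.EvalLE hzD (ProjectiveSpace.component ⟨i, D⟩ ha f)
      (ProjectiveSpace.component ⟨i, D⟩ ha g) := evalRel_of_isCoordChange (b := ⟨i, D⟩) hS.exp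
    ((hX.isFunctionRing hWs).isContRel ⟨x, hx⟩) H.continuous
    (h := ρ.comp D.toCompleted) ⟨fun _ => rfl, fun a e => by rw [ratio_self, map_one, mul_one]⟩
    (fun x y => (hzv x y).symm) hzD rfl _ _
  exact h1.trans (hS.valAt_iff ha hzD hy f g).symm

/-- There is a morphism with given homogeneous coordinates. -/
theorem exists_isRealizedBy (hS : IsSetting π one) (hX : X.HasGoodFunctions one) :
    ∃ φ : Hom X.toPreAdicSpace (space K n E), d.IsRealizedBy hS φ := by
  choose b hb using exists_isImage (d := d) hS hX
  let β : X.carrier ⟶ TopCat.of (Pt K n E) :=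
    TopCat.ofHom ⟨b, ⟨fun O hO => isOpen_preimage_of_isImage hS hX hb hO⟩⟩
  let pre : Opens (Pt K n E) → Opens X.carrier := fun O => (Opens.map β).obj O
  choose t ht H using fun O : Opens (Pt K n E) =>
    exists_sectionHom hS hX hb O (pre O) fun x hx => hx
  have hloc : ∀ (O : Opens (Pt K n E)) (x : X.carrier), b x ∈ O → ∃ (a : Rat K n E)
      (ha : a.image ⊆ O) (W : Opens X.carrier) (hW : W ≤ d.U a.1) (hWO : W ≤ pre O)
      (ρ : a.ring →+* X.Fn W), X.IsSmall W ∧ x ∈ W ∧ (∀ x ∈ W, b x ∈ a.image) ∧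
        IsRatHom d one a hW ρ := by
    intro O x hx
    obtain ⟨i, hxi⟩ := d.exists_mem x
    obtain ⟨D, W, hW, σ, hD, hWs, hxW, hWD, hσ⟩ := exists_local hS hX hb
      (V := d.U i ⊓ pre O) inf_le_left (x := x) ⟨hxi, hx⟩ hx
    exact ⟨⟨i, D⟩, hD, W, fun y hy => (hW hy).1, fun y hy => (hW hy).2, σ, hWs, hxW, hWD, hσ⟩
  have hres : ∀ (O O' : Opens (Pt K n E)) (h : O' ≤ O) (h' : pre O' ≤ pre O)
      (f : (gluingData K n E).sections O), t O' (GluingData.res h f) = resHom h' (t O f) := by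
    intro O O' h h' f
    refine fn_ext X.isSheaf fun x hx => ?_
    obtain ⟨a, ha, W, hW, hWO, ρ, hWs, hxW, hWa, hρ⟩ := hloc O' x hx
    refine ⟨W, hWO, hxW, ?_⟩
    rw [H O' a ha W hW hWO ρ hWs hWa hρ, resHom_resHom,
      H O a (ha.trans h) W hW (hWO.trans h') ρ hWs hWa hρ]
    rfl
  have hval : ∀ (O : Opens (Pt K n E)) (x : X.carrier) (hx : b x ∈ O)
      (f g : (gluingData K n E).sections O),
      (X.val (pre O) x hx).vle (t O f) (t O g) ↔ (GluingData.valAt hx).vle f g := by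
    intro O x hx f g
    obtain ⟨a, ha, W, hW, hWO, ρ, hWs, hxW, hWa, hρ⟩ := hloc O x hx
    obtain ⟨z, hz, hzv⟩ := hb x a.1 W hW hxW hWs _ hρ.isChartHom
    rw [← hρ.val_iff hS hX hWs (ha := ha) hxW hz hzv (hWa x hxW) hx f g,
      ← H O a ha W hW hWO ρ hWs hWa hρ, ← H O a ha W hW hWO ρ hWs hWa hρ]
    exact (val_resHom hWO hxW _ _).symm
  have hbase : ∀ k, t ⊤ ((gluingData K n E).const k) = X.base k := by
    intro k
    refine fn_ext X.isSheaf (U := pre ⊤) fun x hx => ?_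
    obtain ⟨a, ha, W, hW, hWO, ρ, hWs, hxW, hWa, hρ⟩ := hloc ⊤ x hx
    refine ⟨W, hWO, hxW, (H ⊤ a ha W hW hWO ρ hWs hWa hρ _).trans ?_⟩
    exact hρ.isChartHom.map_algebraMap k
  have hmem : ∀ i, d.U i ≤ pre (hS.chartOpen i) := fun i x hx => by
    obtain ⟨W, hW, hWs, hxW⟩ := X.exists_isSmall hx
    obtain ⟨h, hh⟩ := exists_isChartHom hS.exp hX hWs hW
    obtain ⟨z, hz, -⟩ := hb x i W hW hxW hWs h hh
    change b x ∈ hS.chartOpen i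
    exact hz ▸ hS.pt_mem_chartOpen z
  have hreal : ∀ i j, resHom (hmem i)
      (t (hS.chartOpen i) (hS.chartHom i _ le_rfl (ratio K i j one))) = d.f i j := by
    intro i j
    refine fn_ext X.isSheaf fun x hx => ?_
    obtain ⟨W, hW, hWs, hxW⟩ := X.exists_isSmall hx
    refine ⟨W, hW, hxW, (resHom_resHom _ _ _).trans ?_⟩
    obtain ⟨ρ, hρ⟩ := exists_isRatHom hS hX hb ⟨i, .univ _⟩ hWs hW fun y hy => hmem i (hW hy)
    refine (H _ ⟨i, .univ _⟩ subset_rfl W hW (hW.trans (hmem i)) ρ hWs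
      (fun y hy => hmem i (hW hy)) hρ _).trans ?_
    refine (congrArg ρ (hS.component_chartHom (i := i) le_rfl (.univ _) subset_rfl _)).trans ?_
    exact hρ.isChartHom.map_ratio_one j
  let α : X.toPresheafedSpace ⟶ (space K n E).toPresheafedSpace :=
    { base := β
      c :=
        { app := fun O => ⟨t O.unop, ht O.unop⟩
          naturality := fun O O' i => Subtype.ext (RingHom.ext fun f =>
            hres O.unop O'.unop i.unop.le (fun x hx => i.unop.le hx) f) } }
  exact ⟨⟨α, hval, hbase⟩, fun i => ⟨hmem i, hreal i⟩⟩

end PreAdicSpace.ProjData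

/-! ### Sheaves of modules -/

namespace PreAdicSpace
variable {K : Type u} [NormedField K] {X Y Z : PreAdicSpace K}

/-- The sections of a presheaf of modules. -/
def Sec (M : PresheafOfModules.{u} X.ringPresheaf) (W : Opens X.carrier) : Type u := M.obj (op W)

namespace Sec
variable (M : PresheafOfModules.{u} X.ringPresheaf)

noncomputable instance (W : Opens X.carrier) : AddCommGroup (Sec M W) :=
  inferInstanceAs (AddCommGroup (M.obj (op W)))

noncomputable instance (W : Opens X.carrier) : Module (X.Fn W) (Sec M W) :=
  inferInstanceAs (Module (X.ringPresheaf.obj (op W)) (M.obj (op W)))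

variable {M}

theorem congr_smul {W : Opens X.carrier} {a b : X.Fn W} (h : a = b) (m : Sec M W) :
    a • m = b • m := congrArg (fun c => c • m) h

/-- The restriction of sections. -/
noncomputable def res {V W : Opens X.carrier} (h : V ≤ W) : Sec M W →+ Sec M V where
  toFun m := M.map (homOfLE h).op m
  map_zero' := map_zero (M.map (homOfLE h).op).hom
  map_add' := map_add (M.map (homOfLE h).op).hom

theorem res_smul {V W : Opens X.carrier} (h : V ≤ W) (a : X.Fn W) (m : Sec M W) :
    res h (a • m) = resHom h a • res h m :=
  M.map_smul (homOfLE h).op a m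

theorem res_self {W : Opens X.carrier} (m : Sec M W) : res le_rfl m = m := by
  change M.map (𝟙 _) m = m
  rw [M.map_id]
  rfl

theorem res_res {U V W : Opens X.carrier} (h : V ≤ W) (h' : U ≤ V) (m : Sec M W) :
    res h' (res h m) = res (h'.trans h) m :=
  (M.map_comp_apply (homOfLE h).op (homOfLE h').op m).symm

theorem isSheaf_forget (hM : TopCat.Presheaf.IsSheaf M.presheaf) :
    Presieve.IsSheaf (Opens.grothendieckTopology X.carrier) (M.presheaf ⋙ forget Ab) :=
  (isSheaf_iff_isSheaf_of_type _ _).1 ((TopCat.Presheaf.isSheaf_iff_isSheaf_comp' (forget Ab) _).1 hM)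

/-- Sections which agree locally are equal. -/
theorem ext_of_local (hM : TopCat.Presheaf.IsSheaf M.presheaf) {U : Opens X.carrier}
    {m m' : Sec M U} (h : ∀ x ∈ U, ∃ W, ∃ hW : W ≤ U, x ∈ W ∧ res hW m = res hW m') : m = m' :=
  eq_of_forall_map_eq (isSheaf_forget hM) h

/-- Gluing of sections. -/
theorem exists_glue (hM : TopCat.Presheaf.IsSheaf M.presheaf) (U : Opens X.carrier)
    (Q : Opens X.carrier → Prop) (mono : ∀ V W, V ≤ W → Q W → Q V)
    (cov : ∀ x ∈ U, ∃ W, W ≤ U ∧ Q W ∧ x ∈ W) (s : ∀ W, W ≤ U → Q W → Sec M W)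
    (compat : ∀ W V (hW : W ≤ U) (hQ : Q W) (h : V ≤ W),
      res h (s W hW hQ) = s V (h.trans hW) (mono V W h hQ)) :
    ∃ t : Sec M U, ∀ W (hW : W ≤ U) (hQ : Q W), res hW t = s W hW hQ := by
  obtain ⟨t, ht, -⟩ := existsUnique_glue (isSheaf_forget hM) U Q mono cov s compat
  exact ⟨t, ht⟩

/-- The section `e` over `B` is a basis over every open subset of `B`. -/
def IsBasis {B : Opens X.carrier} (e : Sec M B) : Prop :=
  ∀ (V : Opens X.carrier) (h : V ≤ B), Function.Bijective fun a : X.Fn V => a • res h e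

theorem IsBasis.res {B V : Opens X.carrier} {e : Sec M B} (he : IsBasis e) (h : V ≤ B) :
    IsBasis (Sec.res h e) := by
  intro W hW
  simp only [res_res]
  exact he W _

theorem IsBasis.ext {B V : Opens X.carrier} {e : Sec M B} (he : IsBasis e) (h : V ≤ B)
    {a b : X.Fn V} (hab : a • Sec.res h e = b • Sec.res h e) : a = b :=
  (he V h).1 hab

/-- Being a basis is a local property. -/
theorem isBasis_of_local (hX : X.presheaf.IsSheaf) (hM : TopCat.Presheaf.IsSheaf M.presheaf)
    {B : Opens X.carrier} {e : Sec M B}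
    (h : ∀ x ∈ B, ∃ W, ∃ hW : W ≤ B, x ∈ W ∧ IsBasis (res hW e)) : IsBasis e := by
  intro V hV
  refine ⟨fun a b hab => fn_ext hX fun x hx => ?_, fun m => ?_⟩
  · obtain ⟨W, hW, hxW, he⟩ := h x (hV hx)
    refine ⟨W ⊓ V, inf_le_right, ⟨hxW, hx⟩, he.ext inf_le_left ?_⟩
    have := congrArg (res (inf_le_right : W ⊓ V ≤ V)) hab
    simp only [res_smul, res_res] at this
    simpa only [res_res] using this
  · let Q : Opens X.carrier → Prop := fun W => ∃ hW : W ≤ B, IsBasis (res hW e)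
    have hQ : ∀ W, W ≤ V → Q W → ∃ a : X.Fn W, ∀ hV' : W ≤ V, ∀ hW : W ≤ B,
        a • res hW e = res hV' m := by
      rintro W hWV ⟨hW, he⟩
      obtain ⟨a, ha⟩ := (he W le_rfl).2 (res hWV m)
      refine ⟨a, fun _ _ => ?_⟩
      simpa only [res_res] using ha
    choose s hs using hQ
    obtain ⟨a, ha⟩ := PreAdicSpace.exists_glue hX V Q
      (fun V W hVW ⟨hW, he⟩ => ⟨hVW.trans hW, by rw [← res_res hW hVW]; exact he.res hVW⟩)
      (fun x hx => by
        obtain ⟨W, hW, hxW, he⟩ := h x (hV hx)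
        refine ⟨W ⊓ V, inf_le_right, ⟨inf_le_left.trans hW, ?_⟩, hxW, hx⟩
        rw [← res_res hW inf_le_left]
        exact he.res inf_le_left)
      s (fun W U hWV hQ hU => by
        obtain ⟨hW, he⟩ := hQ
        refine he.ext hU ?_
        rw [res_res, hs U (hU.trans hWV) _ (hU.trans hWV) (hU.trans hW), ← res_res hW hU,
          ← res_smul, hs W hWV ⟨hW, he⟩ hWV hW, res_res])
    refine ⟨a, ext_of_local hM fun x hx => ?_⟩
    obtain ⟨W, hW, hxW, he⟩ := h x (hV hx)
    have hQW : Q (W ⊓ V) := ⟨inf_le_left.trans hW, by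
      rw [← res_res hW inf_le_left]; exact he.res inf_le_left⟩
    refine ⟨W ⊓ V, inf_le_right, ⟨hxW, hx⟩, ?_⟩
    rw [res_smul, ha _ inf_le_right hQW, res_res]
    exact hs _ inf_le_right hQW _ _

end Sec

theorem Hom.preimage_mono (φ : Hom X Y) {U V : Opens Y.carrier} (h : V ≤ U) :
    φ.preimage V ≤ φ.preimage U := fun _ hx => h hx

theorem Hom.pull_self (φ : Hom X Y) {U : Opens Y.carrier} (f : Y.Fn U) :
    φ.pull U (φ.preimage U) le_rfl f = (φ.hom.c.app (op U)).1 f := resHom_self _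

/-! ### Semilinear maps -/

/-- Maps from the sections of a presheaf of modules on `Y` to the sections of a presheaf of modules
on `X` which are linear along a morphism `φ : X ⟶ Y`. -/
structure SemilinearMap (φ : Hom X Y) (N : PresheafOfModules.{u} Y.ringPresheaf)
    (M : PresheafOfModules.{u} X.ringPresheaf) where
  app : ∀ U : Opens Y.carrier, Sec N U →+ Sec M (φ.preimage U)
  app_smul : ∀ U a n, app U (a • n) = φ.pull U _ le_rfl a • app U n
  app_res : ∀ U V (h : V ≤ U) (h' : φ.preimage V ≤ φ.preimage U) n,
    app V (Sec.res h n) = Sec.res h' (app U n)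

namespace SemilinearMap
variable {φ : Hom X Y} {N : PresheafOfModules.{u} Y.ringPresheaf}
  {M M' : PresheafOfModules.{u} X.ringPresheaf}

/-- Semilinear maps as maps to the pushforward. -/
noncomputable def toHom (t : SemilinearMap φ N M) : N ⟶ (pushforward φ).obj M where
  app U := ModuleCat.ofHom (Y := ((pushforward φ).obj M).obj U)
    { toFun := t.app U.unop
      map_add' := map_add (t.app U.unop)
      map_smul' := fun (a : Y.Fn U.unop) (n : Sec N U.unop) =>
        (t.app_smul U.unop a n).trans
          (Sec.congr_smul (φ.pull_self a) (t.app U.unop n)) }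
  naturality {U V} i := by
    ext n
    exact t.app_res U.unop V.unop i.unop.le (fun x hx => i.unop.le hx) n

/-- Maps to the pushforward as semilinear maps. -/
noncomputable def ofHom (η : N ⟶ (pushforward φ).obj M) : SemilinearMap φ N M where
  app U :=
    { toFun := fun n => η.app (op U) n
      map_zero' := map_zero (η.app (op U)).hom
      map_add' := map_add (η.app (op U)).hom }
  app_smul U a n := ((η.app (op U)).hom.map_smul a n).trans
    (Sec.congr_smul (M := M) (φ.pull_self a).symm (η.app (op U) n))
  app_res _ _ h _ n := PresheafOfModules.naturality_apply η (homOfLE h).op n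

theorem ext' {t t' : SemilinearMap φ N M} (h : ∀ U n, t.app U n = t'.app U n) : t = t' := by
  obtain ⟨a, _, _⟩ := t
  obtain ⟨b, _, _⟩ := t'
  obtain rfl : a = b := funext fun U => AddMonoidHom.ext (h U)
  rfl

end SemilinearMap

/-- The identity morphism. -/
def Hom.id (X : PreAdicSpace K) : Hom X X where
  hom := 𝟙 _
  val_iff _ _ _ _ _ := Iff.rfl
  map_base _ := rfl

namespace SemilinearMap
variable {φ : Hom X Y} {N : PresheafOfModules.{u} Y.ringPresheaf}
  {M M' : PresheafOfModules.{u} X.ringPresheaf}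

/-- Linear maps as morphisms. -/
noncomputable def toMor (t : SemilinearMap (Hom.id X) M M') : M ⟶ M' where
  app U := ModuleCat.ofHom
    { toFun := fun m : M.obj U => (t.app U.unop m : M'.obj U)
      map_add' := map_add (t.app U.unop)
      map_smul' := fun (a : X.Fn U.unop) (n : Sec M U.unop) =>
        (t.app_smul U.unop a n).trans
          (Sec.congr_smul (M := M') (resHom_self a) (t.app U.unop n)) }
  naturality {U V} i := by
    ext n
    exact t.app_res U.unop V.unop i.unop.le (fun x hx => i.unop.le hx) n

/-- Morphisms as linear maps. -/
noncomputable def ofMor (f : M ⟶ M') : SemilinearMap (Hom.id X) M M' where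
  app U :=
    { toFun := fun n => (f.app (op U) n : M'.obj (op U))
      map_zero' := map_zero (f.app (op U)).hom
      map_add' := map_add (f.app (op U)).hom }
  app_smul U a n := ((f.app (op U)).hom.map_smul a n).trans
    (Sec.congr_smul (M := M') (resHom_self a).symm (f.app (op U) n))
  app_res _ _ h _ n := PresheafOfModules.naturality_apply f (homOfLE h).op n

/-- Restrictions of the values of a semilinear map at multiples of a section. -/
theorem res_app_eq (t : SemilinearMap φ N M) {U B V : Opens Y.carrier} {W : Opens X.carrier}
    (hU : V ≤ U) (hB : V ≤ B) (hW : W ≤ φ.preimage V) (hWU : W ≤ φ.preimage U)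
    (hWB : W ≤ φ.preimage B) {n : Sec N U} {e : Sec N B} {a : Y.Fn V}
    (h : Sec.res hU n = a • Sec.res hB e) :
    Sec.res hWU (t.app U n) = φ.pull V W hW a • Sec.res hWB (t.app B e) := by
  have h1 := congrArg (fun m => Sec.res hW (t.app V m)) h
  rw [t.app_res U V hU (φ.preimage_mono hU), Sec.res_res, t.app_smul, Sec.res_smul,
    t.app_res B V hB (φ.preimage_mono hB), Sec.res_res, φ.resHom_pull] at h1
  exact h1

/-- Semilinear maps to a sheaf are determined by the images of local bases. -/
theorem ext_of_basis (hM : TopCat.Presheaf.IsSheaf M.presheaf) {ι : Type*}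
    {B : ι → Opens Y.carrier} (hB : ∀ y, ∃ i, y ∈ B i) {e : ∀ i, Sec N (B i)}
    (he : ∀ i, Sec.IsBasis (e i)) {t t' : SemilinearMap φ N M}
    (h : ∀ i, t.app (B i) (e i) = t'.app (B i) (e i)) : t = t' := by
  refine ext' fun U n => Sec.ext_of_local hM fun x hx => ?_
  obtain ⟨i, hi⟩ := hB (φ.hom.base x)
  obtain ⟨a, ha⟩ := (he i (U ⊓ B i) inf_le_right).2 (Sec.res inf_le_left n)
  have hWU : φ.preimage (U ⊓ B i) ≤ φ.preimage U := fun y hy => hy.1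
  have hWB : φ.preimage (U ⊓ B i) ≤ φ.preimage (B i) := fun y hy => hy.2
  refine ⟨φ.preimage (U ⊓ B i), hWU, ⟨hx, hi⟩, ?_⟩
  rw [t.res_app_eq inf_le_left inf_le_right le_rfl hWU hWB ha.symm,
    t'.res_app_eq inf_le_left inf_le_right le_rfl hWU hWB ha.symm, h]

/-- A semilinear map to a sheaf is given by compatible images of local bases. -/
theorem exists_of_basis (hM : TopCat.Presheaf.IsSheaf M.presheaf) {ι : Type*}
    {B : ι → Opens Y.carrier} (hB : ∀ y, ∃ i, y ∈ B i) {e : ∀ i, Sec N (B i)}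
    (he : ∀ i, Sec.IsBasis (e i)) (m : ∀ i, Sec M (φ.preimage (B i)))
    (hm : ∀ i j (V : Opens Y.carrier) (hi : V ≤ B i) (hj : V ≤ B j) (a : Y.Fn V),
      Sec.res hj (e j) = a • Sec.res hi (e i) → ∀ (W : Opens X.carrier) (hW : W ≤ φ.preimage V)
        (hWi : W ≤ φ.preimage (B i)) (hWj : W ≤ φ.preimage (B j)),
        Sec.res hWj (m j) = φ.pull V W hW a • Sec.res hWi (m i)) :
    ∃ t : SemilinearMap φ N M, ∀ i, t.app (B i) (e i) = m i := by
  -- `IsVal U n v` says that `v` is the value at `n`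
  let IsVal : ∀ U : Opens Y.carrier, Sec N U → Sec M (φ.preimage U) → Prop := fun U n v =>
    ∀ (i : ι) (V : Opens Y.carrier) (hU : V ≤ U) (hi : V ≤ B i) (a : Y.Fn V),
      Sec.res hU n = a • Sec.res hi (e i) → ∀ (W : Opens X.carrier) (hW : W ≤ φ.preimage V)
        (hWU : W ≤ φ.preimage U) (hWi : W ≤ φ.preimage (B i)),
        Sec.res hWU v = φ.pull V W hW a • Sec.res hWi (m i)
  have huniq : ∀ U n v v', IsVal U n v → IsVal U n v' → v = v' := by
    intro U n v v' h h'
    refine Sec.ext_of_local hM fun x hx => ?_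
    obtain ⟨i, hi⟩ := hB (φ.hom.base x)
    obtain ⟨a, ha⟩ := (he i (U ⊓ B i) inf_le_right).2 (Sec.res inf_le_left n)
    have hWU : φ.preimage (U ⊓ B i) ≤ φ.preimage U := fun y hy => hy.1
    have hWB : φ.preimage (U ⊓ B i) ≤ φ.preimage (B i) := fun y hy => hy.2
    exact ⟨_, hWU, ⟨hx, hi⟩, (h i _ inf_le_left inf_le_right a ha.symm _ le_rfl hWU hWB).trans
      (h' i _ inf_le_left inf_le_right a ha.symm _ le_rfl hWU hWB).symm⟩
  -- a value can be checked on one member of the cover near every point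
  have hlocal : ∀ U n v, (∀ x ∈ φ.preimage U, ∃ (i : ι) (V : Opens Y.carrier) (hU : V ≤ U)
      (hi : V ≤ B i) (a : Y.Fn V), φ.hom.base x ∈ V ∧ Sec.res hU n = a • Sec.res hi (e i) ∧
        ∀ (W : Opens X.carrier) (hW : W ≤ φ.preimage V) (hWU : W ≤ φ.preimage U)
        (hWi : W ≤ φ.preimage (B i)), Sec.res hWU v = φ.pull V W hW a • Sec.res hWi (m i)) →
      IsVal U n v := by
    intro U n v h j V hU hj b hb W hW hWU hWj
    refine Sec.ext_of_local hM fun x hx => ?_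
    obtain ⟨i, V', hU', hi, a, hxV, ha, H⟩ := h x (hWU hx)
    refine ⟨W ⊓ φ.preimage V', inf_le_left, ⟨hx, hxV⟩, ?_⟩
    have hW' : W ⊓ φ.preimage V' ≤ φ.preimage (V ⊓ V') := fun y hy => ⟨hW hy.1, hy.2⟩
    have hWi : W ⊓ φ.preimage V' ≤ φ.preimage (B i) := fun y hy => hi hy.2
    obtain ⟨c, hc⟩ := (he i (V ⊓ V') (inf_le_right.trans hi)).2 (Sec.res (inf_le_left.trans hj) (e j))
    have hc' := hm i j (V ⊓ V') (inf_le_right.trans hi) (inf_le_left.trans hj) c hc.symm _ hW' hWi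
      (inf_le_left.trans hWj)
    -- on the intersection, `n = b • e j = b • c • e i` and `n = a • e i`
    have hac : resHom inf_le_right a = resHom (inf_le_left : V ⊓ V' ≤ V) b * c := by
      refine (he i).ext (inf_le_right.trans hi) ?_
      have h1 := congrArg (Sec.res (inf_le_right : V ⊓ V' ≤ V')) ha
      have h2 := congrArg (Sec.res (inf_le_left : V ⊓ V' ≤ V)) hb
      rw [Sec.res_res, Sec.res_smul, Sec.res_res] at h1 h2
      rw [mul_smul, ← h1, h2]
      exact congrArg _ hc.symm
    rw [Sec.res_res, H _ inf_le_right _ hWi, Sec.res_smul, φ.resHom_pull, Sec.res_res, hc',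
      ← mul_smul, ← φ.pull_resHom inf_le_left hW' b, ← map_mul, ← hac, φ.pull_resHom]
  have hex : ∀ U n, ∃ v, IsVal U n v := by
    intro U n
    choose a ha using fun i => (he i (U ⊓ B i) inf_le_right).2 (Sec.res inf_le_left n)
    let Q : Opens X.carrier → Prop := fun W => ∃ i, W ≤ φ.preimage (B i)
    choose i hi using fun (W : Opens X.carrier) (hQ : Q W) => hQ
    have hW : ∀ (W : Opens X.carrier) (j : ι), W ≤ φ.preimage U → W ≤ φ.preimage (B j) →
        W ≤ φ.preimage (U ⊓ B j) := fun W j hU hi y hy => ⟨hU hy, hi hy⟩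
    -- the local definition does not depend on the member of the cover
    have hind : ∀ (W : Opens X.carrier) (hU : W ≤ φ.preimage U) (i j : ι)
        (hi : W ≤ φ.preimage (B i)) (hj : W ≤ φ.preimage (B j)),
        φ.pull _ W (hW W i hU hi) (a i) • Sec.res hi (m i) =
          φ.pull _ W (hW W j hU hj) (a j) • Sec.res hj (m j) := by
      intro W hU i j hi hj
      have hW' : W ≤ φ.preimage (U ⊓ (B i ⊓ B j)) := fun y hy => ⟨hU hy, hi hy, hj hy⟩
      have hVi : U ⊓ (B i ⊓ B j) ≤ B i := fun y hy => hy.2.1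
      have hVj : U ⊓ (B i ⊓ B j) ≤ B j := fun y hy => hy.2.2
      have hVi' : U ⊓ (B i ⊓ B j) ≤ U ⊓ B i := fun y hy => ⟨hy.1, hy.2.1⟩
      have hVj' : U ⊓ (B i ⊓ B j) ≤ U ⊓ B j := fun y hy => ⟨hy.1, hy.2.2⟩
      obtain ⟨c, hc⟩ := (he i _ hVi).2 (Sec.res hVj (e j))
      rw [hm i j _ hVi hVj c hc.symm W hW' hi hj, ← mul_smul, ← φ.pull_resHom hVj' hW', ← map_mul,
        ← φ.pull_resHom hVi' hW']
      congr 2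
      refine (he i).ext hVi ?_
      have h1 := congrArg (Sec.res hVi') (ha i)
      have h2 := congrArg (Sec.res hVj') (ha j)
      simp only [Sec.res_smul, Sec.res_res] at h1 h2 hc
      rw [h1, mul_smul, hc, h2]
    obtain ⟨v, hv⟩ := Sec.exists_glue hM (φ.preimage U) Q
      (fun V W hVW ⟨i, hi⟩ => ⟨i, hVW.trans hi⟩)
      (fun x hx => by
        obtain ⟨i, hi⟩ := hB (φ.hom.base x)
        exact ⟨φ.preimage (U ⊓ B i), fun y hy => hy.1, ⟨i, fun y hy => hy.2⟩, hx, hi⟩)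
      (fun W hU hQ => φ.pull _ W (hW W _ hU (hi W hQ)) (a _) • Sec.res (hi W hQ) (m _))
      (fun W V hU hQ hV => by
        rw [Sec.res_smul, φ.resHom_pull, Sec.res_res]
        exact hind V (hV.trans hU) _ _ _ _)
    refine ⟨v, hlocal U n v fun x hx => ?_⟩
    obtain ⟨j, hj⟩ := hB (φ.hom.base x)
    refine ⟨j, U ⊓ B j, inf_le_left, inf_le_right, a j, ⟨hx, hj⟩, (ha j).symm,
      fun W _ hWU hWi => ?_⟩
    have hQ : Q W := ⟨j, hWi⟩
    rw [hv W hWU hQ]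
    exact hind W hWU _ _ _ _
  choose v hv using hex
  have hloc : ∀ U n x, x ∈ φ.preimage U → ∃ (i : ι) (V : Opens Y.carrier) (hU : V ≤ U)
      (hi : V ≤ B i) (a : Y.Fn V), φ.hom.base x ∈ V ∧ Sec.res hU n = a • Sec.res hi (e i) := by
    intro U n x hx
    obtain ⟨i, hi⟩ := hB (φ.hom.base x)
    obtain ⟨a, ha⟩ := (he i (U ⊓ B i) inf_le_right).2 (Sec.res inf_le_left n)
    exact ⟨i, _, inf_le_left, inf_le_right, a, ⟨hx, hi⟩, ha.symm⟩
  have hadd : ∀ U n n', v U (n + n') = v U n + v U n' := by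
    intro U n n'
    refine huniq U _ _ _ (hv U _) (hlocal U _ _ fun x hx => ?_)
    obtain ⟨i, V, hU, hi, a, hxV, ha⟩ := hloc U n x hx
    obtain ⟨b, hb⟩ := (he i V hi).2 (Sec.res hU n')
    refine ⟨i, V, hU, hi, a + b, hxV, ?_, fun W hW hWU hWi => ?_⟩
    · rw [map_add, ha, add_smul]
      exact congrArg _ hb.symm
    · rw [map_add, map_add, add_smul, hv U n i V hU hi a ha W hW hWU hWi,
        hv U n' i V hU hi b hb.symm W hW hWU hWi]
  refine ⟨⟨fun U => AddMonoidHom.mk' (v U) (hadd U), fun U b n => ?_, fun U V h h' n => ?_⟩,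
    fun i => ?_⟩
  · refine huniq U _ _ _ (hv U _) (hlocal U _ _ fun x hx => ?_)
    obtain ⟨i, V, hU, hi, a, hxV, ha⟩ := hloc U n x hx
    refine ⟨i, V, hU, hi, resHom hU b * a, hxV, ?_, fun W hW hWU hWi => ?_⟩
    · rw [Sec.res_smul, ha, mul_smul]
    · change Sec.res hWU (_ • v U n) = _
      rw [Sec.res_smul, hv U n i V hU hi a ha W hW hWU hWi, φ.resHom_pull, map_mul,
        φ.pull_resHom hU hW, mul_smul]
  · refine huniq V _ _ _ (hv V _) (hlocal V _ _ fun x hx => ?_)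
    obtain ⟨i, V', hU, hi, a, hxV, ha⟩ := hloc V (Sec.res h n) x hx
    refine ⟨i, V', hU, hi, a, hxV, ha, fun W hW hWU hWi => ?_⟩
    change Sec.res hWU (Sec.res h' (v U n)) = _
    rw [Sec.res_res]
    rw [Sec.res_res] at ha
    exact hv U n i V' (hU.trans h) hi a ha W hW (hWU.trans h') hWi
  · have hval := hv (B i) (e i) i (B i) le_rfl le_rfl 1 (by rw [one_smul]) _ le_rfl le_rfl le_rfl
    rwa [map_one, one_smul, Sec.res_self, Sec.res_self] at hval

end SemilinearMap
end PreAdicSpace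

/-! ### Homogeneous coordinates of a line bundle with generating sections -/

theorem ValuativeRel.exists_forall_vle {B ι : Type*} [CommRing B] [Finite ι] [Nonempty ι]
    (r : ValuativeRel B) (b : ι → B) : ∃ i, ∀ j, r.vle (b j) (b i) := by
  let := r
  obtain ⟨i, hi⟩ := Finite.exists_max fun i => ValuativeRel.valuation B (b i)
  exact ⟨i, fun j => (Valuation.Compatible.vle_iff_le (v := ValuativeRel.valuation B) _ _).2 (hi j)⟩

theorem ValuativeRel.sum_mul_vle_zero {B ι : Type*} [CommRing B] (r : ValuativeRel B)
    (s : Finset ι) (a b : ι → B) (h : ∀ i, r.vle (b i) 0) : r.vle (∑ i ∈ s, a i * b i) 0 := by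
  let := r
  have hv := fun a b => (Valuation.Compatible.vle_iff_le (v := ValuativeRel.valuation B) a b)
  rw [hv, map_zero]
  refine Valuation.map_sum_le _ fun i _ => ?_
  have := (hv _ _).1 (h i)
  rw [map_zero, le_zero_iff] at this
  rw [map_mul, this, mul_zero]

namespace PreAdicSpace
variable {K : Type u} [NormedField K] {n : ℕ}

/-- The restrictions of the given sections. -/
noncomputable def ModuleWithSections.sec {X : PreAdicSpace K} (L : ModuleWithSections n X)
    (W : Opens X.carrier) (j : Fin (n + 1)) : Sec L.M W := Sec.res le_top (L.s j)

theorem ModuleWithSections.res_sec {X : PreAdicSpace K} (L : ModuleWithSections n X)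
    {V W : Opens X.carrier} (h : V ≤ W) (j : Fin (n + 1)) :
    Sec.res h (L.sec W j) = L.sec V j :=
  Sec.res_res _ _ _

namespace GeneratedLineBundle
variable {X : PreAdicSpace K} (L : GeneratedLineBundle n X)

theorem exists_isBasis (x : X.carrier) :
    ∃ (U : Opens X.carrier) (e : Sec L.M U), x ∈ U ∧ Sec.IsBasis e := by
  obtain ⟨U, hx, e, he⟩ := L.locallyFree x
  exact ⟨U, e, hx, fun V h => he V (homOfLE h)⟩

theorem exists_eq_sum {U : Opens X.carrier} (m : Sec L.M U) {x : X.carrier} (hx : x ∈ U) :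
    ∃ (V : Opens X.carrier) (h : V ≤ U), x ∈ V ∧ ∃ a : Fin (n + 1) → X.Fn V,
      Sec.res h m = ∑ j, a j • L.sec V j := by
  obtain ⟨V, i, hxV, a, ha⟩ := L.generated U m x hx
  exact ⟨V, i.le, hxV, a, ha⟩

/-- If all sections are multiples of the section `i` over `B`, this section is a basis. -/
theorem isBasis_of_forall_eq_smul (hX : X.presheaf.IsSheaf) {B : Opens X.carrier}
    {i : Fin (n + 1)} {f : Fin (n + 1) → X.Fn B} (hf : ∀ j, L.sec B j = f j • L.sec B i) :
    Sec.IsBasis (L.sec B i) := by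
  refine Sec.isBasis_of_local hX L.isSheaf fun x hx => ?_
  obtain ⟨U, e, hxU, he⟩ := L.exists_isBasis x
  obtain ⟨V, hV, hxV, a, ha⟩ := L.exists_eq_sum (Sec.res (inf_le_left : U ⊓ B ≤ U) e) ⟨hxU, hx⟩
  rw [Sec.res_res] at ha
  have hVB : V ≤ B := fun y hy => (hV hy).2
  refine ⟨V, hVB, hxV, ?_⟩
  rw [L.res_sec]
  -- `L.sec V i = b • e` and `e = c • L.sec V i`
  obtain ⟨b, hb⟩ := (he V (hV.trans inf_le_left)).2 (L.sec V i)
  have hc : Sec.res (hV.trans inf_le_left) e = (∑ j, a j * resHom hVB (f j)) • L.sec V i := by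
    rw [ha, Finset.sum_smul]
    refine Finset.sum_congr rfl fun j _ => ?_
    rw [mul_smul, ← L.res_sec hVB i, ← Sec.res_smul, ← hf, L.res_sec]
  have hbc : b * (∑ j, a j * resHom hVB (f j)) = 1 := by
    refine he.ext (hV.trans inf_le_left) ?_
    rw [mul_comm, mul_smul, one_smul]
    exact (congrArg _ hb).trans hc.symm
  generalize (∑ j, a j * resHom hVB (f j)) = c at hc hbc
  dsimp only at hb
  intro W hW
  have hbc' : resHom hW b * resHom hW c = 1 := by rw [← map_mul, hbc, map_one]
  have hW' : W ≤ U := (hW.trans hV).trans inf_le_left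
  have e1 : Sec.res hW (L.sec V i) = resHom hW b • Sec.res hW' e := by
    rw [← hb, Sec.res_smul, Sec.res_res]
  refine ⟨fun s t hst => ?_, fun m => ?_⟩
  · rw [e1] at hst
    dsimp only at hst
    rw [← mul_smul, ← mul_smul] at hst
    have := he.ext hW' hst
    have h2 := congrArg (· * resHom hW c) this
    rwa [mul_assoc, mul_assoc, hbc', mul_one, mul_one] at h2
  · obtain ⟨t, ht⟩ := (he W hW').2 m
    refine ⟨t * resHom hW c, ?_⟩
    dsimp only at ht ⊢
    rw [e1, ← mul_smul, mul_assoc, mul_comm (resHom hW c), hbc', mul_one, ht]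

/-- Over `W`, the section `i` is a basis, and the other sections are multiples of it by functions
which are bounded by `1`. -/
def IsLarge (i : Fin (n + 1)) (W : Opens X.carrier) : Prop :=
  Sec.IsBasis (L.sec W i) ∧ ∀ (j : Fin (n + 1)) (f : X.Fn W), L.sec W j = f • L.sec W i →
    ∀ x (hx : x ∈ W), (X.val W x hx).vle f 1

variable {L}

variable (L) in
/-- The largest open subset over which the section `i` is largest. -/
def largeOpen (i : Fin (n + 1)) : Opens X.carrier := sSup {W | L.IsLarge i W}

theorem IsLarge.le {i : Fin (n + 1)} {W : Opens X.carrier} (H : L.IsLarge i W) :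
    W ≤ L.largeOpen i := le_sSup H

theorem isLarge_largeOpen (hX : X.presheaf.IsSheaf) (i : Fin (n + 1)) :
    L.IsLarge i (L.largeOpen i) := by
  refine ⟨Sec.isBasis_of_local hX L.isSheaf fun x hx => ?_, fun j f hf x hx => ?_⟩
  · obtain ⟨W, hW, hxW⟩ := Opens.mem_sSup.1 hx
    refine ⟨W, IsLarge.le hW, hxW, ?_⟩
    rw [L.res_sec]
    exact hW.1
  · obtain ⟨W, hW, hxW⟩ := Opens.mem_sSup.1 hx
    have hW' := IsLarge.le hW
    rw [← val_resHom hW' hxW, map_one]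
    refine hW.2 j _ ?_ x hxW
    rw [← L.res_sec hW', hf, Sec.res_smul, L.res_sec]

/-- Every point has a neighbourhood over which one of the sections is largest. -/
theorem exists_isLarge {p : ℕ} {X : PerfectoidSpace p K} {E : Type} [AddCommMonoid E] {one : E}
    (hX : X.HasGoodFunctions one) (L : GeneratedLineBundle n X.toPreAdicSpace) (x : X.carrier) :
    ∃ i W, x ∈ W ∧ L.IsLarge i W := by
  obtain ⟨U, e, hxU, he⟩ := L.exists_isBasis x
  obtain ⟨V, hV, hxV, a, ha⟩ := L.exists_eq_sum e hxU
  choose b hb using fun j => (he V hV).2 (L.sec V j)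
  dsimp only at hb
  have hab : ∑ j, a j * b j = 1 := by
    refine he.ext hV ?_
    rw [Finset.sum_smul, one_smul]
    refine Eq.trans (Finset.sum_congr rfl fun j _ => ?_) ha.symm
    rw [mul_smul, hb]
  -- `i` is the index of a largest section at `x`, which stays largest on a neighbourhood
  obtain ⟨i, hi⟩ := (X.val V x hxV).exists_forall_vle b
  -- the largest of the `b j` does not vanish at `x`, as the `b j` generate the unit ideal
  have hbi : ¬ (X.val V x hxV).vle (b i) 0 := fun h => by
    have := (X.val V x hxV).sum_mul_vle_zero Finset.univ a b fun j => (X.val V x hxV).vle_trans (hi j) h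
    rw [hab] at this
    exact (X.val V x hxV).not_vle_one_zero this
  have hopen : IsOpen (⋂ j, {y : X.carrier | ∃ hy : y ∈ V,
      (X.val V y hy).vle (b j) (b i) ∧ ¬ (X.val V y hy).vle (b i) 0}) :=
    isOpen_iInter_of_finite fun j => hX.isOpen_vle V _ _
  obtain ⟨W, hW, hWs, hxW⟩ := X.exists_isSmall (U := ⟨_, hopen⟩) (x := x)
    (Set.mem_iInter.2 fun j => ⟨hxV, hi j, hbi⟩)
  have hWj : ∀ j y (hy : y ∈ W), ∃ hy : y ∈ V,
      (X.val V y hy).vle (b j) (b i) ∧ ¬ (X.val V y hy).vle (b i) 0 := fun j y hy =>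
    Set.mem_iInter.1 (hW hy) j
  have hWV : W ≤ V := fun y hy => (hWj i y hy).1
  have hu : IsUnit (resHom hWV (b i)) := by
    refine (hX.isFunctionRing hWs).isUnit _ fun y hy => ?_
    rw [← map_zero (resHom hWV), val_resHom] at hy
    obtain ⟨_, -, h⟩ := hWj i y.1 y.2
    exact h hy
  obtain ⟨c, hc⟩ := hu.exists_right_inv
  have hs : ∀ j, L.sec W j = resHom hWV (b j) • Sec.res (hWV.trans hV) e := fun j => by
    rw [← L.res_sec hWV, ← hb, Sec.res_smul, Sec.res_res]
  have hsi : ∀ j, L.sec W j = (resHom hWV (b j) * c) • L.sec W i := fun j => by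
    rw [hs i, hs j, ← mul_smul, mul_assoc, mul_comm c, hc, mul_one]
  have hB := L.isBasis_of_forall_eq_smul X.isSheaf hsi
  refine ⟨i, W, hxW, hB, fun j f hf y hy => ?_⟩
  have hf' : f = resHom hWV (b j) * c := by
    refine hB.ext le_rfl ?_
    rw [Sec.res_self, ← hf, hsi]
  rw [← (X.val W y hy).vle_mul_isUnit_iff hu, one_mul, hf', mul_assoc, mul_comm c, hc, mul_one,
    val_resHom]
  exact (hWj j y hy).2.1

/-- The quotients of the sections, where they are bounded by `1`. -/
theorem exists_projData {p : ℕ} {X : PerfectoidSpace p K} {E : Type} [AddCommMonoid E] {one : E}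
    (hX : X.HasGoodFunctions one) (L : GeneratedLineBundle n X.toPreAdicSpace) :
    ∃ d : ProjData X.toPreAdicSpace n, d.U = L.largeOpen ∧
      ∀ i j, L.sec (d.U i) j = d.f i j • L.sec (d.U i) i := by
  have hL := fun i => isLarge_largeOpen (L := L) X.isSheaf i
  have hex : ∀ i j, ∃ f : X.Fn (L.largeOpen i),
      L.sec (L.largeOpen i) j = f • L.sec (L.largeOpen i) i := fun i j => by
    obtain ⟨f, hf⟩ := ((hL i).1 _ le_rfl).2 (L.sec _ j)
    rw [Sec.res_self] at hf
    exact ⟨f, hf.symm⟩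
  choose f hf using hex
  have hf' : ∀ i j (W : Opens X.carrier) (hW : W ≤ L.largeOpen i),
      L.sec W j = resHom hW (f i j) • L.sec W i := fun i j W hW => by
    rw [← L.res_sec hW, hf, Sec.res_smul, L.res_sec]
  refine ⟨⟨L.largeOpen, fun x => ?_, f, fun i j x hx => (hL i).2 j _ (hf i j) x hx, fun i => ?_,
    fun i j k => ?_⟩, rfl, hf⟩
  · obtain ⟨i, W, hxW, hW⟩ := exists_isLarge hX L x
    exact ⟨i, hW.le hxW⟩
  · refine (hL i).1.ext le_rfl ?_
    rw [Sec.res_self, one_smul, ← hf]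
  · refine (hL i).1.ext inf_le_left ?_
    rw [L.res_sec, mul_smul, ← hf', ← hf', ← hf']

end GeneratedLineBundle
end PreAdicSpace

/-! ### The line bundle `O(1)` -/

/-- If the components of a section of a twisted sheaf are units, the section is a basis. -/
theorem GluingData.bijective_smul {K : Type u} [NormedField K] {G : GluingData K}
    {c : ∀ i, G.ι → G.A i} {V : Opens G.Points} (e : G.twisted c V) (he : ∀ a, IsUnit (e.1 a)) :
    Function.Bijective fun f : G.sections V => f • e := by
  refine ⟨fun f g h => Subtype.ext (funext fun a => (he a).mul_right_cancel
    (congrFun (congrArg Subtype.val h) a)), fun m => ?_⟩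
  choose b hb using fun a => (he a).exists_left_inv
  have hm : ∀ a, m.1 a * b a * e.1 a = m.1 a := fun a => by rw [mul_assoc, hb, mul_one]
  refine ⟨⟨fun a => m.1 a * b a, fun a a' h ρ hρ => (he a).mul_right_cancel ?_⟩,
    Subtype.ext (funext hm)⟩
  rw [hm, ← e.2 a a' h ρ hρ, ← mul_assoc, ← map_mul, hm]
  exact m.2 a a' h ρ hρ

namespace ProjectiveSpace
open PreAdicSpace
variable {K : Type u} [NormedField K] [IsUltrametricDist K] {n : ℕ} {E : Type} [AddCommMonoid E]
variable {π : K} {one : E}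

namespace IsSetting

/-- The open cover of projective space by the charts. -/
noncomputable def cover (hS : IsSetting π one) (i : Fin (n + 1)) :
    Opens (space K n E).carrier := hS.chartOpen i

theorem exists_mem_cover (hS : IsSetting π one) (y : (space K n E).carrier) :
    ∃ i, y ∈ hS.cover i := by
  obtain ⟨i, z, h⟩ := exists_pt y
  exact ⟨i, hS.mem_chartOpen.2 ⟨z, h⟩⟩

/-- The function `T_j / T_i` on the chart `i`. -/
noncomputable def coordFn (hS : IsSetting π one) (i j : Fin (n + 1)) :
    (space K n E).Fn (hS.cover i) := hS.chartHom i (hS.chartOpen i) le_rfl (ratio K i j one)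

theorem isCoordChange_restr (hS : IsSetting π one) (i : Fin (n + 1)) {c : Rat K n E}
    (hc : c.image ⊆ hS.chartOpen (E := E) (n := n) i) :
    IsCoordChange c.2.toCompleted
      ((hS.restr (b := ⟨i, .univ _⟩) hc).comp (RationalDatum.toCompleted _)) :=
  isCoordChange_of_isRestriction (hS.isRestriction_restr (b := ⟨i, .univ _⟩) hc)

theorem coordFn_self (hS : IsSetting π one) (i : Fin (n + 1)) :
    hS.coordFn (E := E) (n := n) i i = 1 := by
  rw [coordFn, ratio_self]
  exact map_one (hS.chartHom i _ le_rfl)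

theorem coordFn_mul (hS : IsSetting π one) (i j k : Fin (n + 1)) :
    resHom (inf_le_right : hS.cover (E := E) i ⊓ hS.cover j ≤ hS.cover j) (hS.coordFn j k) *
      resHom inf_le_left (hS.coordFn i j) = resHom inf_le_left (hS.coordFn i k) := by
  refine Subtype.ext (funext fun c => ?_)
  have hci := hS.isCoordChange_restr (c := c.1) i fun y hy => (c.2 hy).1
  have hcj := hS.isCoordChange_restr (c := c.1) j fun y hy => (c.2 hy).2
  refine (hci.isUnit one).mul_right_cancel ?_
  have h1 := hci.map_ratio j one
  have h2 := hci.map_ratio k one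
  have h3 := hcj.map_ratio k one
  rw [← h1, ← mul_assoc] at h3
  exact h3.trans h2.symm

theorem coordFn_vle_one (hS : IsSetting π one) (i j : Fin (n + 1)) (y : (space K n E).carrier)
    (hy : y ∈ hS.cover i) : ((space K n E).val _ y hy).vle (hS.coordFn i j) 1 := by
  obtain ⟨z, rfl⟩ := hS.mem_chartOpen.1 hy
  have := (hS.val_chartHom le_rfl hy (ratio K i j one) 1).2 (hS.ratio_vle_one z j one)
  rw [map_one] at this
  exact this

theorem mem_cover_of_one_vle (hS : IsSetting π one) {k i : Fin (n + 1)}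
    {y : (space K n E).carrier} (hy : y ∈ hS.cover k)
    (h : ((space K n E).val _ y hy).vle 1 (hS.coordFn k i)) : y ∈ hS.cover i := by
  obtain ⟨z, rfl⟩ := hS.mem_chartOpen.1 hy
  have hz : z.rel.vle 1 (ratio K k i one) := by
    refine (hS.val_chartHom le_rfl hy 1 (ratio K k i one)).1 ?_
    rw [map_one]
    exact h
  have hD : ∀ w : ChartPoint K E k, w ∈ (RationalDatum.ge (ratio K k i one)).set _ →
      w.rel.vle 1 (ratio K k i one) := fun w hw => RationalDatum.mem_ge.1 hw
  obtain ⟨h', hc, H⟩ := hS.exists_coordChange i _ hD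
  obtain ⟨w, hw, -⟩ := hS.exists_pt_eq _ (RationalDatum.mem_ge.2 hz) hz hc H
  exact hS.mem_chartOpen.2 ⟨w, hw⟩

theorem O1_sec (hS : IsSetting π one) (i j : Fin (n + 1)) :
    (O1 K n one).sec (hS.cover i) j = hS.coordFn i j • (O1 K n one).sec (hS.cover i) i :=
  Subtype.ext (funext fun c => ((hS.isCoordChange_restr (c := c.1) i c.2).map_ratio j one).symm)

theorem isBasis_O1_sec (hS : IsSetting π one) (i : Fin (n + 1)) :
    Sec.IsBasis ((O1 K n one).sec (hS.cover i) i) :=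
  fun V hV => GluingData.bijective_smul (G := gluingData K n E) (V := V)
    (Sec.res hV ((O1 K n one).sec (hS.cover i) i))
    fun c => (hS.isCoordChange_restr (c := c.1) i (c.2.trans hV)).isUnit one

end IsSetting
end ProjectiveSpace

/-! ### Pullbacks of modules with local bases -/

namespace PreAdicSpace
variable {K : Type u} [NormedField K] {X Y : PreAdicSpace K} {n : ℕ}

/-- A semilinear map which maps local bases to local bases is universal. -/
theorem SemilinearMap.bijective_comp {φ : Hom X Y} {N : PresheafOfModules.{u} Y.ringPresheaf}
    {M : PresheafOfModules.{u} X.ringPresheaf} (t : SemilinearMap φ N M) {ι : Type*}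
    {B : ι → Opens Y.carrier} (hB : ∀ y, ∃ i, y ∈ B i) {e : ∀ i, Sec N (B i)}
    (he : ∀ i, Sec.IsBasis (e i)) (ht : ∀ i, Sec.IsBasis (t.app (B i) (e i)))
    (M' : PresheafOfModules.{u} X.ringPresheaf) (hM' : TopCat.Presheaf.IsSheaf M'.presheaf) :
    Function.Bijective fun f : M ⟶ M' => t.toHom ≫ (pushforward φ).map f := by
  have hB' : ∀ x, ∃ i, x ∈ φ.preimage (B i) := fun x => hB _
  refine ⟨fun f f' hff => ?_, fun g => ?_⟩
  · have : ofMor f = ofMor f' := ext_of_basis hM' hB' ht fun i =>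
      congrArg (fun F => (ofHom F).app (B i) (e i)) hff
    exact congrArg toMor this
  · obtain ⟨s, hs⟩ := exists_of_basis (φ := Hom.id X) (M := M') hM' hB' ht
      (fun i => (ofHom g).app (B i) (e i)) (by
        intro i j V hi hj a ha W hW hWi hWj
        have hW' : W ≤ φ.preimage (B i ⊓ B j) := fun x hx => ⟨hWi hx, hWj hx⟩
        obtain ⟨b, hb⟩ := (he i (B i ⊓ B j) inf_le_left).2 (Sec.res inf_le_right (e j))
        have h1 := t.res_app_eq inf_le_right inf_le_left hW' hWj hWi hb.symm
        have h2 := (ofHom g).res_app_eq inf_le_right inf_le_left hW' hWj hWi hb.symm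
        have hWV : W ≤ V := hW
        have h3 := congrArg (Sec.res hWV) ha
        rw [Sec.res_res, Sec.res_smul, Sec.res_res] at h3
        exact h2.trans (Sec.congr_smul ((ht i).ext hWi (h1.symm.trans h3)) _))
    refine ⟨s.toMor, ?_⟩
    have : ofHom (t.toHom ≫ (pushforward φ).map s.toMor) = ofHom g :=
      ext_of_basis hM' hB he hs
    exact congrArg toHom this

/-- Pullbacks of line bundles with generating sections are unique up to isomorphism. -/
theorem IsPullback.mk_eq_mk {φ : Hom X Y} {N : ModuleWithSections n Y}
    {L L' : GeneratedLineBundle n X} (h : IsPullback φ N L.toModuleWithSections)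
    (h' : IsPullback φ N L'.toModuleWithSections) :
    LineBundleClasses.mk L = LineBundleClasses.mk L' := by
  obtain ⟨hL, η, hη, hs⟩ := h
  obtain ⟨hL', η', hη', hs'⟩ := h'
  obtain ⟨f, hf⟩ := (hη L'.M hL').2 η'
  obtain ⟨g, hg⟩ := (hη' L.M hL).2 η
  dsimp only at hf hg
  refine Quotient.sound ⟨⟨f, g, (hη L.M hL).1 ?_, (hη' L'.M hL').1 ?_⟩, fun j => ?_⟩
  · dsimp only
    rw [Functor.map_comp, ← Category.assoc, hf, hg, CategoryTheory.Functor.map_id, Category.comp_id]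
  · dsimp only
    rw [Functor.map_comp, ← Category.assoc, hg, hf, CategoryTheory.Functor.map_id, Category.comp_id]
  · rw [← hs j, ← hs' j]
    exact congrArg (fun F => PresheafOfModules.Hom.app F (op ⊤) (N.s j)) hf

end PreAdicSpace

/-! ### Morphisms to projective space and line bundles -/

namespace ProjectiveSpace
open PreAdicSpace
variable {K : Type u} [NormedField K] [IsUltrametricDist K] {n : ℕ} {E : Type} [AddCommMonoid E]
variable {π : K} {one : E}

namespace IsSetting
variable {X Y : PreAdicSpace K}

/-- The inverse image of a chart. -/
noncomputable def preimageCover (hS : IsSetting π one) (φ : Hom X (space K n E)) (i : Fin (n + 1)) :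
    Opens X.carrier := φ.preimage (hS.cover i)

/-- The pullback of the function `T_j / T_i`. -/
noncomputable def pullCoord (hS : IsSetting π one) (φ : Hom X (space K n E)) (i j : Fin (n + 1))
    (W : Opens X.carrier) (h : W ≤ hS.preimageCover φ i) : X.Fn W :=
  φ.pull (hS.cover i) W h (hS.coordFn i j)

section Coord
variable (hS : IsSetting π one) (φ : Hom X (space K n E))

theorem exists_mem_preimageCover (x : X.carrier) : ∃ i, x ∈ hS.preimageCover φ i :=
  hS.exists_mem_cover (φ.hom.base x)

theorem resHom_pullCoord (i j : Fin (n + 1)) {V W : Opens X.carrier}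
    (h : W ≤ hS.preimageCover φ i) (hV : V ≤ W) :
    resHom hV (hS.pullCoord φ i j W h) = hS.pullCoord φ i j V (hV.trans h) :=
  φ.resHom_pull _ _ _

theorem pullCoord_self (i : Fin (n + 1)) {W : Opens X.carrier} (h : W ≤ hS.preimageCover φ i) :
    hS.pullCoord φ i i W h = 1 :=
  (congrArg (φ.pull (hS.cover i) W h) (hS.coordFn_self i)).trans (map_one _)

theorem pullCoord_mul (i j k : Fin (n + 1)) {W : Opens X.carrier} (hi : W ≤ hS.preimageCover φ i)
    (hj : W ≤ hS.preimageCover φ j) :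
    hS.pullCoord φ j k W hj * hS.pullCoord φ i j W hi = hS.pullCoord φ i k W hi := by
  have hW : W ≤ φ.preimage (hS.cover i ⊓ hS.cover j) := fun x hx => ⟨hi hx, hj hx⟩
  have h := congrArg (φ.pull _ W hW) (hS.coordFn_mul i j k)
  rw [map_mul, φ.pull_resHom, φ.pull_resHom, φ.pull_resHom] at h
  exact h

theorem pullCoord_vle_one (i j : Fin (n + 1)) {W : Opens X.carrier}
    (h : W ≤ hS.preimageCover φ i) (x : X.carrier) (hx : x ∈ W) :
    (X.val W x hx).vle (hS.pullCoord φ i j W h) 1 := by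
  have := (φ.val_pull h hx (hS.coordFn i j) 1).2 (hS.coordFn_vle_one i j _ (h hx))
  rwa [map_one] at this

theorem mem_preimageCover {k i : Fin (n + 1)} {W : Opens X.carrier} (h : W ≤ hS.preimageCover φ k)
    {x : X.carrier} (hx : x ∈ W) (H : (X.val W x hx).vle 1 (hS.pullCoord φ k i W h)) :
    x ∈ hS.preimageCover φ i := by
  refine hS.mem_cover_of_one_vle (h hx) ((φ.val_pull h hx 1 (hS.coordFn k i)).1 ?_)
  rwa [map_one]

/-- The homogeneous coordinates of a morphism to projective space. -/
noncomputable def projData : ProjData X n where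
  U := hS.preimageCover φ
  exists_mem := hS.exists_mem_preimageCover φ
  f i j := hS.pullCoord φ i j _ le_rfl
  vle_one i j x hx := hS.pullCoord_vle_one φ i j le_rfl x hx
  self i := hS.pullCoord_self φ i le_rfl
  cocycle i j k := by
    rw [hS.resHom_pullCoord, hS.resHom_pullCoord, hS.resHom_pullCoord]
    exact hS.pullCoord_mul φ i j k _ _

end Coord

/-- The sections of `L` are related like the pullbacks of the coordinates. -/
def IsCompatible (hS : IsSetting π one) (φ : Hom X (space K n E)) (L : ModuleWithSections n X) :
    Prop :=
  ∀ i j, L.sec (hS.preimageCover φ i) j =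
    hS.pullCoord φ i j _ le_rfl • L.sec (hS.preimageCover φ i) i

variable {hS : IsSetting π one}

theorem IsCompatible.sec_eq {φ : Hom X (space K n E)} {L : ModuleWithSections n X}
    (h : hS.IsCompatible φ L) (i j : Fin (n + 1)) {W : Opens X.carrier}
    (hW : W ≤ hS.preimageCover φ i) : L.sec W j = hS.pullCoord φ i j W hW • L.sec W i := by
  rw [← L.res_sec hW, h i j, Sec.res_smul, L.res_sec, hS.resHom_pullCoord]

/-- Over the preimage of the chart `i` all sections are multiples of `s_i`, and they generate
`L`. -/
theorem IsCompatible.isBasis (hX : X.presheaf.IsSheaf) {φ : Hom X (space K n E)}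
    {L : GeneratedLineBundle n X} (h : hS.IsCompatible φ L.toModuleWithSections)
    (i : Fin (n + 1)) : Sec.IsBasis (L.sec (hS.preimageCover φ i) i) :=
  L.isBasis_of_forall_eq_smul hX (h i)

/-- The semilinear map from `O(1)` to `L` which takes `T_i` on the chart `i` to `s_i` takes local
bases to local bases, so it is universal. -/
theorem IsCompatible.isPullback (hX : X.presheaf.IsSheaf) {φ : Hom X (space K n E)}
    {L : GeneratedLineBundle n X} (h : hS.IsCompatible φ L.toModuleWithSections) :
    IsPullback φ (O1 K n one) L.toModuleWithSections := by
  obtain ⟨t, ht⟩ := SemilinearMap.exists_of_basis (φ := φ) L.isSheaf hS.exists_mem_cover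
    hS.isBasis_O1_sec (fun i => L.sec (hS.preimageCover φ i) i) (by
      intro i j V hi hj a ha W hW hWi hWj
      have ha' : a = resHom hi (hS.coordFn i j) := by
        refine (hS.isBasis_O1_sec i).ext hi (ha.symm.trans ?_)
        rw [← Sec.res_smul, ← hS.O1_sec, ModuleWithSections.res_sec, ModuleWithSections.res_sec]
      have hpull : hS.pullCoord φ i j W hWi = φ.pull V W hW a := by
        rw [ha', φ.pull_resHom]
        rfl
      exact ((L.res_sec hWj j).trans (h.sec_eq i j hWi)).trans
        ((Sec.congr_smul hpull _).trans (congrArg _ (L.res_sec hWi i).symm)))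
  refine ⟨L.isSheaf, t.toHom, fun M' hM' => t.bijective_comp hS.exists_mem_cover
    hS.isBasis_O1_sec (fun i => ?_) M' hM', fun j => ?_⟩
  · rw [ht]
    exact h.isBasis hX i
  · refine Sec.ext_of_local (M := L.M) (U := φ.preimage ⊤) (m := t.app ⊤ ((O1 K n one).s j))
      (m' := L.s j) L.isSheaf fun x _ => ?_
    obtain ⟨i, hi⟩ := hS.exists_mem_preimageCover φ x
    refine ⟨hS.preimageCover φ i, le_top, hi, ?_⟩
    have h1 := t.res_app_eq (U := ⊤) (V := hS.cover i) (W := hS.preimageCover φ i) le_top le_rfl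
      le_rfl le_top le_rfl (n := (O1 K n one).s j) (e := (O1 K n one).sec (hS.cover i) i)
      (a := hS.coordFn i j) ((hS.O1_sec i j).trans (by rw [Sec.res_self]))
    rw [ht] at h1
    exact h1.trans ((congrArg _ (Sec.res_self _)).trans (h i j).symm)

/-- The relation `T_j = (T_j / T_i) T_i` is pulled back to the sections of `L`. -/
theorem isCompatible_of_isPullback {φ : Hom X (space K n E)} {L : ModuleWithSections n X}
    (h : IsPullback φ (O1 K n one) L) : hS.IsCompatible φ L := by
  obtain ⟨-, η, -, hη⟩ := h
  intro i j
  have h1 := (SemilinearMap.ofHom η).res_app_eq (U := ⊤) (B := ⊤) (V := hS.cover i)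
    (W := hS.preimageCover φ i) le_top le_top le_rfl le_top le_top (n := (O1 K n one).s j)
    (e := (O1 K n one).s i) (a := hS.coordFn i j) (hS.O1_sec i j)
  have h2 : ∀ k, (SemilinearMap.ofHom η).app ⊤ ((O1 K n one).s k) = L.s k := hη
  rw [h2, h2] at h1
  exact h1

theorem IsCompatible.comp {φ : Hom X (space K n E)} {L : ModuleWithSections n X}
    (h : hS.IsCompatible φ L) {f : Hom Y X} {L' : ModuleWithSections n Y}
    (hf : IsPullback f L L') : hS.IsCompatible (f.comp φ) L' := by
  obtain ⟨-, η, -, hη⟩ := hf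
  intro i j
  have h1 := (SemilinearMap.ofHom η).res_app_eq (U := ⊤) (B := ⊤) (V := hS.preimageCover φ i)
    (W := hS.preimageCover (f.comp φ) i) le_top le_top le_rfl le_top le_top (n := L.s j)
    (e := L.s i) (h i j)
  have h2 : ∀ k, (SemilinearMap.ofHom η).app ⊤ (L.s k) = L'.s k := hη
  rw [h2, h2] at h1
  exact h1.trans (Sec.congr_smul (f.pull_comp φ le_rfl le_rfl _).symm _)

theorem IsCompatible.congr {φ : Hom X (space K n E)} {L L' : GeneratedLineBundle n X}
    (h : hS.IsCompatible φ L.toModuleWithSections)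
    (hL : LineBundleClasses.mk L = LineBundleClasses.mk L') :
    hS.IsCompatible φ L'.toModuleWithSections := by
  obtain ⟨f, hf⟩ := Quotient.exact hL
  intro i j
  have h1 := (SemilinearMap.ofMor f.hom).res_app_eq (U := ⊤) (B := ⊤) (V := hS.preimageCover φ i)
    (W := hS.preimageCover φ i) le_top le_top le_rfl le_top le_top (n := L.s j)
    (e := L.s i) (h i j)
  have h2 : ∀ k, (SemilinearMap.ofMor f.hom).app ⊤ (L.s k) = L'.s k := hf
  rw [h2, h2] at h1
  exact h1.trans (Sec.congr_smul (resHom_self _) _)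

/-- A line bundle with generating sections belongs to a morphism if and only if the quotients of
its sections, where they are bounded by `1`, are the homogeneous coordinates of the morphism. -/
theorem isCompatible_iff_isRealizedBy (hX : X.presheaf.IsSheaf) {φ : Hom X (space K n E)}
    {L : GeneratedLineBundle n X} {d : ProjData X n} (hU : d.U = L.largeOpen)
    (hd : ∀ i j, L.sec (d.U i) j = d.f i j • L.sec (d.U i) i) :
    hS.IsCompatible φ L.toModuleWithSections ↔ d.IsRealizedBy hS φ := by
  have hd' : ∀ i j (W : Opens X.carrier) (hW : W ≤ d.U i),
      L.sec W j = resHom hW (d.f i j) • L.sec W i := fun i j W hW => by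
    rw [← L.res_sec hW, hd, Sec.res_smul, L.res_sec]
  constructor
  · intro h
    -- `s_i` is largest exactly on the preimage of the chart `i`, where `|T_j / T_i| ≤ 1` for
    -- all `j`
    have hle : ∀ i, hS.preimageCover φ i ≤ d.U i := fun i => by
      rw [hU]
      refine GeneratedLineBundle.IsLarge.le ⟨h.isBasis hX i, fun j f hf x hx => ?_⟩
      have : f = hS.pullCoord φ i j _ le_rfl := by
        refine (h.isBasis hX i).ext le_rfl ?_
        rw [Sec.res_self, ← hf, h i j]
      rw [this]
      exact hS.pullCoord_vle_one φ i j le_rfl x hx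
    have hge : ∀ i, d.U i ≤ hS.preimageCover φ i := fun i x hx => by
      obtain ⟨k, hk⟩ := hS.exists_mem_preimageCover φ x
      let W := d.U i ⊓ hS.preimageCover φ k
      have hWx : x ∈ W := ⟨hx, hk⟩
      have hW1 : W ≤ d.U i := inf_le_left
      have hW2 : W ≤ hS.preimageCover φ k := inf_le_right
      have h1 : resHom hW1 (d.f i k) * hS.pullCoord φ k i W hW2 = 1 := by
        refine (h.isBasis hX k).ext hW2 ?_
        rw [L.res_sec, mul_smul, one_smul, ← h.sec_eq k i hW2, ← hd']
      refine hS.mem_preimageCover φ hW2 hWx ?_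
      have h2 : (X.val W x hWx).vle (resHom hW1 (d.f i k)) 1 := by
        rw [← map_one (resHom hW1)]
        exact (val_resHom hW1 hWx _ _).2 (d.vle_one i k x hx)
      have h3 := (X.val W x hWx).mul_vle_mul_left h2 (hS.pullCoord φ k i W hW2)
      rwa [h1, one_mul] at h3
    intro i
    refine ⟨hge i, fun j => ?_⟩
    have hb : Sec.IsBasis (L.sec (d.U i) i) := by
      rw [← L.res_sec (hge i)]
      exact (h.isBasis hX i).res _
    refine hb.ext le_rfl ?_
    rw [Sec.res_self]
    exact (h.sec_eq i j (hge i)).symm.trans (hd i j)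
  · intro h i j
    choose hU' hf using h
    have hf' : ∀ k l (W : Opens X.carrier) (hW : W ≤ d.U k),
        hS.pullCoord φ k l W (hW.trans (hU' k)) = resHom hW (d.f k l) := fun k l W hW => by
      rw [← hf k l]
      exact (φ.resHom_pull _ _ _).symm
    refine Sec.ext_of_local L.isSheaf fun x hx => ?_
    obtain ⟨k, hk⟩ := d.exists_mem x
    refine ⟨hS.preimageCover φ i ⊓ d.U k, inf_le_left, ⟨hx, hk⟩, ?_⟩
    rw [Sec.res_smul, L.res_sec, L.res_sec, hd' k i _ inf_le_right, hd' k j _ inf_le_right,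
      hS.resHom_pullCoord, ← mul_smul, ← hf', ← hf', hS.pullCoord_mul]

end IsSetting
end ProjectiveSpace

/-! ### The line bundle with given homogeneous coordinates -/

namespace PreAdicSpace.ProjData
variable {K : Type u} [NormedField K] {X : PreAdicSpace K} {n : ℕ} (d : ProjData X n)

/-- The sections over `W` of the line bundle with homogeneous coordinates `d`: families of
functions `m_i` on `W ⊓ U_i` with `m_j f_{ij} = m_i`. The section with these components is
`m_i s_i` over `W ⊓ U_i`. -/
def bundleSections (W : Opens X.carrier) : AddSubgroup (∀ i, X.Fn (W ⊓ d.U i)) where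
  carrier := {m | ∀ i j (V : Opens X.carrier) (hi : V ≤ W ⊓ d.U i) (hj : V ≤ W ⊓ d.U j),
    resHom hj (m j) * d.fn (hi.trans inf_le_right) j = resHom hi (m i)}
  zero_mem' i j V hi hj := by simp
  add_mem' h h' i j V hi hj := by
    rw [Pi.add_apply, Pi.add_apply, map_add, map_add, add_mul, h i j V hi hj, h' i j V hi hj]
  neg_mem' h i j V hi hj := by
    rw [Pi.neg_apply, Pi.neg_apply, map_neg, map_neg, neg_mul, h i j V hi hj]

variable {d} in
theorem bundleSections_ext {W : Opens X.carrier} {m m' : d.bundleSections W}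
    (h : ∀ i, m.1 i = m'.1 i) : m = m' := Subtype.ext (funext h)

noncomputable instance (W : Opens X.carrier) : SMul (X.Fn W) (d.bundleSections W) where
  smul a m := ⟨fun i => resHom inf_le_left a * m.1 i, fun i j V hi hj => by
    rw [map_mul, map_mul, mul_assoc, m.2 i j V hi hj, resHom_resHom, resHom_resHom]⟩

noncomputable instance bundleModule (W : Opens X.carrier) :
    Module (X.Fn W) (d.bundleSections W) where
  one_smul m := bundleSections_ext fun i =>
    (congrArg (· * m.1 i) (map_one (resHom _))).trans (one_mul _)
  mul_smul a b m := bundleSections_ext fun i =>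
    (congrArg (· * m.1 i) (map_mul (resHom _) a b)).trans (mul_assoc _ _ _)
  smul_zero _ := bundleSections_ext fun _ => mul_zero _
  smul_add _ _ _ := bundleSections_ext fun _ => mul_add _ _ _
  add_smul a b m := bundleSections_ext fun i =>
    (congrArg (· * m.1 i) (map_add (resHom _) a b)).trans (add_mul _ _ _)
  zero_smul m := bundleSections_ext fun i =>
    (congrArg (· * m.1 i) (map_zero (resHom _))).trans (zero_mul _)

/-- Restriction of sections. -/
def bundleRes {V W : Opens X.carrier} (h : V ≤ W) : d.bundleSections W →+ d.bundleSections V where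
  toFun m := ⟨fun i => resHom (inf_le_inf_right _ h) (m.1 i), fun i j V' hi hj => by
    rw [resHom_resHom, resHom_resHom]
    exact m.2 i j V' _ _⟩
  map_zero' := bundleSections_ext fun i => map_zero (resHom _)
  map_add' m m' := bundleSections_ext fun i => map_add (resHom _) _ _

theorem bundleRes_smul {V W : Opens X.carrier} (h : V ≤ W) (a : X.Fn W) (m : d.bundleSections W) :
    d.bundleRes h (a • m) = resHom h a • d.bundleRes h m :=
  bundleSections_ext fun i => by
    change resHom _ (resHom _ a * m.1 i) = resHom _ (resHom h a) * resHom _ (m.1 i)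
    rw [map_mul, resHom_resHom, resHom_resHom]

/-- The module of sections over `U`. -/
noncomputable def bundleObj (U : (Opens X.carrier)ᵒᵖ) : ModuleCat.{u} (X.ringPresheaf.obj U) :=
  @ModuleCat.of (X.ringPresheaf.obj U) _ (d.bundleSections U.unop) _ (d.bundleModule U.unop)

/-- The line bundle with given homogeneous coordinates, as a presheaf of modules. -/
noncomputable def bundle : PresheafOfModules.{u} X.ringPresheaf where
  obj U := d.bundleObj U
  map {U V} i := ModuleCat.ofHom (X := d.bundleObj U)
    (Y := (ModuleCat.restrictScalars (X.ringPresheaf.map i).hom).obj (d.bundleObj V))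
    { toFun := d.bundleRes i.unop.le
      map_add' := map_add (d.bundleRes i.unop.le)
      map_smul' := d.bundleRes_smul i.unop.le }
  map_id U := by
    ext m
    exact bundleSections_ext (d := d) (W := U.unop) fun i => resHom_self _
  map_comp {U V W} f g := by
    ext m
    exact bundleSections_ext (d := d) (W := W.unop) fun i => (resHom_resHom _ _ _).symm

theorem existsUnique_bundle_glue (hX : X.presheaf.IsSheaf) {ι : Type*} (U : ι → Opens X.carrier)
    (s : ∀ a, d.bundleSections (U a))
    (hs : ∀ a b, d.bundleRes inf_le_left (s a) = d.bundleRes (inf_le_right : U a ⊓ U b ≤ U b) (s b)) :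
    ∃! m : d.bundleSections (iSup U), ∀ a, d.bundleRes (le_iSup U a) m = s a := by
  have hs' : ∀ a b i (V : Opens X.carrier) (ha : V ≤ U a ⊓ d.U i) (hb : V ≤ U b ⊓ d.U i),
      resHom ha ((s a).1 i) = resHom hb ((s b).1 i) := fun a b i V ha hb => by
    have hV : V ≤ U a ⊓ U b ⊓ d.U i := fun x hx => ⟨⟨(ha hx).1, (hb hx).1⟩, (ha hx).2⟩
    have h : resHom (inf_le_inf_right _ inf_le_left) ((s a).1 i) =
        resHom (inf_le_inf_right _ inf_le_right) ((s b).1 i) :=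
      congrFun (congrArg Subtype.val (hs a b)) i
    have h' := congrArg (resHom hV) h
    rwa [resHom_resHom, resHom_resHom] at h'
  have hex : ∀ i, ∃ t : X.Fn (iSup U ⊓ d.U i), ∀ a (W : Opens X.carrier) (hW : W ≤ iSup U ⊓ d.U i)
      (ha : W ≤ U a ⊓ d.U i), resHom hW t = resHom ha ((s a).1 i) := fun i => by
    let Q : Opens X.carrier → Prop := fun W => ∃ a, W ≤ U a ⊓ d.U i
    choose a ha using fun (W : Opens X.carrier) (hQ : Q W) => hQ
    obtain ⟨t, ht⟩ := exists_glue hX (iSup U ⊓ d.U i) Q (fun V W h ⟨a, ha⟩ => ⟨a, h.trans ha⟩)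
      (fun x hx => by
        obtain ⟨b, hb⟩ := Opens.mem_iSup.1 hx.1
        exact ⟨U b ⊓ d.U i, inf_le_inf_right _ (le_iSup U b), ⟨b, le_rfl⟩, hb, hx.2⟩)
      (fun W _ hQ => resHom (ha W hQ) ((s (a W hQ)).1 i))
      (fun W V _ hQ h => by
        rw [resHom_resHom]
        exact hs' _ _ i V _ _)
    exact ⟨t, fun b W hW hb => (ht W hW ⟨b, hb⟩).trans (hs' _ _ i W _ _)⟩
  choose t ht using hex
  refine ⟨⟨t, fun i j V hi hj => fn_ext hX fun x hx => ?_⟩, fun a => bundleSections_ext fun i => ?_,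
    fun m hm => bundleSections_ext fun i => fn_ext hX fun x hx => ?_⟩
  · obtain ⟨a, ha⟩ := Opens.mem_iSup.1 (hi hx).1
    have hi' : V ⊓ U a ≤ U a ⊓ d.U i := fun y hy => ⟨hy.2, (hi hy.1).2⟩
    have hj' : V ⊓ U a ≤ U a ⊓ d.U j := fun y hy => ⟨hy.2, (hj hy.1).2⟩
    refine ⟨V ⊓ U a, inf_le_left, ⟨hx, ha⟩, ?_⟩
    rw [map_mul, resHom_resHom, resHom_resHom, ht j a _ _ hj', ht i a _ _ hi', resHom_fn]
    exact (s a).2 i j _ hi' hj'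
  · exact (ht i a _ _ le_rfl).trans (resHom_self _)
  · obtain ⟨a, ha⟩ := Opens.mem_iSup.1 hx.1
    have hW : U a ⊓ d.U i ≤ iSup U ⊓ d.U i := inf_le_inf_right _ (le_iSup U a)
    refine ⟨U a ⊓ d.U i, hW, ⟨ha, hx.2⟩, ?_⟩
    rw [ht i a _ hW le_rfl, resHom_self]
    exact congrFun (congrArg Subtype.val (hm a)) i

theorem isSheaf_bundle (hX : X.presheaf.IsSheaf) :
    TopCat.Presheaf.IsSheaf d.bundle.presheaf :=
  (TopCat.Presheaf.isSheaf_iff_isSheafUniqueGluing _).2 fun _ U s hs =>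
    d.existsUnique_bundle_glue hX U s fun a b => hs a b

/-- The section of the line bundle which belongs to the homogeneous coordinate `T_k`. -/
def coordSection (W : Opens X.carrier) (k : Fin (n + 1)) : d.bundleSections W :=
  ⟨fun _ => d.fn inf_le_right k, fun i j V hi hj => by
    rw [resHom_fn, resHom_fn, d.fn_mul_fn]⟩

/-- The line bundle with given homogeneous coordinates, with its sections. -/
noncomputable def bundleWithSections : ModuleWithSections n X where
  M := d.bundle
  s k := (d.coordSection ⊤ k : Sec d.bundle ⊤)

theorem sec_bundleWithSections (W : Opens X.carrier) (k : Fin (n + 1)) :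
    d.bundleWithSections.sec W k = d.coordSection W k :=
  bundleSections_ext (d := d) fun _ => d.resHom_fn _ (inf_le_inf_right _ le_top) k

theorem sec_bundle_eq_smul (i j : Fin (n + 1)) : d.bundleWithSections.sec (d.U i) j =
    d.f i j • d.bundleWithSections.sec (d.U i) i := by
  rw [sec_bundleWithSections, sec_bundleWithSections]
  exact bundleSections_ext (d := d) fun k =>
    (d.fn_mul_fn (W := d.U i ⊓ d.U k) inf_le_right inf_le_left j).symm

theorem isBasis_sec_bundle (i : Fin (n + 1)) :
    Sec.IsBasis (d.bundleWithSections.sec (d.U i) i) := by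
  intro V hV
  rw [ModuleWithSections.res_sec, sec_bundleWithSections]
  refine ⟨fun a b hab => ?_, fun (m : d.bundleSections V) => ?_⟩
  · have h : resHom inf_le_left a * d.fn inf_le_right i =
        resHom inf_le_left b * d.fn (inf_le_right : V ⊓ d.U i ≤ d.U i) i :=
      congrFun (congrArg Subtype.val hab) i
    rw [fn_self, mul_one, mul_one] at h
    have h' := congrArg (resHom (le_inf le_rfl hV)) h
    rwa [resHom_resHom, resHom_resHom, resHom_self, resHom_self] at h'
  · refine ⟨resHom (le_inf le_rfl hV) (m.1 i), bundleSections_ext (d := d) fun k => ?_⟩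
    have h := m.2 k i (V ⊓ d.U k) le_rfl (le_inf inf_le_left (inf_le_left.trans hV))
    rw [resHom_self] at h
    refine Eq.trans ?_ h
    exact congrArg (· * _) (resHom_resHom _ _ _)

/-- The line bundle with given homogeneous coordinates, with its generating sections. -/
noncomputable def lineBundle (hX : X.presheaf.IsSheaf) : GeneratedLineBundle n X where
  toModuleWithSections := d.bundleWithSections
  isSheaf := d.isSheaf_bundle hX
  locallyFree x := by
    obtain ⟨i, hi⟩ := d.exists_mem x
    exact ⟨d.U i, hi, d.bundleWithSections.sec (d.U i) i,
      fun V h => d.isBasis_sec_bundle i V h.le⟩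
  generated U m x hx := by
    obtain ⟨i, hi⟩ := d.exists_mem x
    have hV : U ⊓ d.U i ≤ U := inf_le_left
    obtain ⟨a, ha⟩ := (d.isBasis_sec_bundle i (U ⊓ d.U i) inf_le_right).2
      (Sec.res (M := d.bundle) hV m)
    dsimp only at ha
    rw [ModuleWithSections.res_sec] at ha
    have h : Sec.res (M := d.bundle) hV m =
        ∑ j, (Pi.single i a : Fin (n + 1) → X.Fn (U ⊓ d.U i)) j •
          d.bundleWithSections.sec (U ⊓ d.U i) j := by
      rw [Finset.sum_eq_single i, Pi.single_eq_same]
      · exact ha.symm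
      · intro j _ hj
        rw [Pi.single_eq_of_ne hj, zero_smul]
      · exact fun h => (h (Finset.mem_univ i)).elim
    exact ⟨U ⊓ d.U i, homOfLE hV, ⟨hx, hi⟩, _, h⟩

end PreAdicSpace.ProjData

/-! ### The classification of morphisms to projective space -/

namespace PerfectoidSpace
variable {p : ℕ} {K : Type u} [NormedField K]

theorem hasGoodFunctions [CharP K p] (hp : p.Prime) (hK : IsPerfectoidField p K) {π : K}
    (h0 : π ≠ 0) (h1 : ‖π‖ < 1) (X : PerfectoidSpace p K) {E : Type} [AddCommMonoid E] {one : E}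
    (hE : ∀ B : Type u, [CommRing B] → (∀ b : B, ∃! c : B, c ^ p = b) → HasUniquePowers E one B) :
    X.HasGoodFunctions one where
  isOpen_vle := isOpen_vle h0 h1
  isFunctionRing hW := hW.isFunctionRing hp hK h0 h1
  hasUniquePowers hW := hE _ (hW.isFunctionRing hp hK h0 h1).frobenius

end PerfectoidSpace

namespace ProjectiveSpace.IsSetting
open PreAdicSpace
variable {p : ℕ} {K : Type u} [NormedField K] [IsUltrametricDist K] {n : ℕ} {E : Type}
  [AddCommMonoid E] {π : K} {one : E} {X : PerfectoidSpace p K}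

/-- The isomorphism class of the pullback of `O(1)` along a morphism to projective space. -/
noncomputable def pullbackClass (hS : IsSetting π one) (φ : Hom X.toPreAdicSpace (space K n E)) :
    LineBundleClasses n X.toPreAdicSpace :=
  LineBundleClasses.mk ((hS.projData φ).lineBundle X.isSheaf)

theorem pullbackClass_eq_iff_isCompatible (hS : IsSetting π one)
    {φ : Hom X.toPreAdicSpace (space K n E)} {L : GeneratedLineBundle n X.toPreAdicSpace} :
    hS.pullbackClass φ = LineBundleClasses.mk L ↔ hS.IsCompatible φ L.toModuleWithSections := by
  have h : hS.IsCompatible φ ((hS.projData φ).lineBundle X.isSheaf).toModuleWithSections :=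
    (hS.projData φ).sec_bundle_eq_smul
  exact ⟨h.congr, fun h' => (h.isPullback X.isSheaf).mk_eq_mk (h'.isPullback X.isSheaf)⟩

/-- The class of a morphism consists of the pullbacks of `O(1)` with its sections. -/
theorem pullbackClass_eq_iff (hS : IsSetting π one)
    {φ : Hom X.toPreAdicSpace (space K n E)} {L : GeneratedLineBundle n X.toPreAdicSpace} :
    hS.pullbackClass φ = LineBundleClasses.mk L ↔
      IsPullback φ (O1 K n one) L.toModuleWithSections :=
  hS.pullbackClass_eq_iff_isCompatible.trans
    ⟨fun h => h.isPullback X.isSheaf, isCompatible_of_isPullback⟩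

/-- Both for injectivity and for surjectivity, a class of line bundles is replaced by the
homogeneous coordinates of a representative, which come from exactly one morphism. -/
theorem bijective_pullbackClass (hS : IsSetting π one) (hX : X.HasGoodFunctions one) :
    Function.Bijective (hS.pullbackClass (X := X) (n := n)) := by
  refine ⟨fun φ ψ h => ?_, fun c => ?_⟩
  · obtain ⟨d, hU, hd⟩ :=
      GeneratedLineBundle.exists_projData hX ((hS.projData ψ).lineBundle X.isSheaf)
    exact ((isCompatible_iff_isRealizedBy X.isSheaf hU hd).1
      (hS.pullbackClass_eq_iff_isCompatible.1 h)).unique hS hX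
        ((isCompatible_iff_isRealizedBy X.isSheaf hU hd).1
          (hS.pullbackClass_eq_iff_isCompatible.1 rfl))
  · obtain ⟨L, rfl⟩ := Quotient.exists_rep c
    obtain ⟨d, hU, hd⟩ := GeneratedLineBundle.exists_projData hX L
    obtain ⟨φ, hφ⟩ := d.exists_isRealizedBy hS hX
    exact ⟨φ, hS.pullbackClass_eq_iff_isCompatible.2
      ((isCompatible_iff_isRealizedBy X.isSheaf hU hd).2 hφ)⟩

theorem pullbackClass_comp (hS : IsSetting π one) {Y : PerfectoidSpace p K}
    {f : Hom Y.toPreAdicSpace X.toPreAdicSpace} {L : GeneratedLineBundle n X.toPreAdicSpace}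
    {L' : GeneratedLineBundle n Y.toPreAdicSpace}
    (h : IsPullback f L.toModuleWithSections L'.toModuleWithSections)
    {φ : Hom X.toPreAdicSpace (space K n E)} (hφ : hS.pullbackClass φ = LineBundleClasses.mk L) :
    hS.pullbackClass (f.comp φ) = LineBundleClasses.mk L' :=
  hS.pullbackClass_eq_iff_isCompatible.2 ((hS.pullbackClass_eq_iff_isCompatible.1 hφ).comp h)

end ProjectiveSpace.IsSetting

theorem mainTheorem7 (p : ℕ) [Fact p.Prime] (K : Type u) [NormedField K] [IsUltrametricDist K]
    [CharP K p] (hK : IsPerfectoidField p K) (n : ℕ) :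
    ∃ (Φ : ∀ X : PerfectoidSpace p K,
        PreAdicSpace.Hom X.toPreAdicSpace (ProjectivoidSpace p K n) ≃
          PreAdicSpace.LineBundleClasses n X.toPreAdicSpace)
      (Ψ : ∀ X : PerfectoidSpace p K,
        PreAdicSpace.Hom X.toPreAdicSpace (RigidProjectiveSpace K n) ≃
          PreAdicSpace.LineBundleClasses n X.toPreAdicSpace),
      (∀ (X : PerfectoidSpace p K)
        (φ : PreAdicSpace.Hom X.toPreAdicSpace (ProjectivoidSpace p K n))
        (L : PreAdicSpace.GeneratedLineBundle n X.toPreAdicSpace),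
        Φ X φ = PreAdicSpace.LineBundleClasses.mk L ↔
          PreAdicSpace.IsPullback φ (ProjectivoidSpace.O1 p K n) L.toModuleWithSections) ∧
      (∀ (X : PerfectoidSpace p K)
        (φ : PreAdicSpace.Hom X.toPreAdicSpace (RigidProjectiveSpace K n))
        (L : PreAdicSpace.GeneratedLineBundle n X.toPreAdicSpace),
        Ψ X φ = PreAdicSpace.LineBundleClasses.mk L ↔
          PreAdicSpace.IsPullback φ (RigidProjectiveSpace.O1 K n) L.toModuleWithSections) ∧
      (∀ (X Y : PerfectoidSpace p K) (f : PreAdicSpace.Hom Y.toPreAdicSpace X.toPreAdicSpace)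
        (L : PreAdicSpace.GeneratedLineBundle n X.toPreAdicSpace)
        (L' : PreAdicSpace.GeneratedLineBundle n Y.toPreAdicSpace),
        PreAdicSpace.IsPullback f L.toModuleWithSections L'.toModuleWithSections →
          (∀ φ : PreAdicSpace.Hom X.toPreAdicSpace (ProjectivoidSpace p K n),
            Φ X φ = PreAdicSpace.LineBundleClasses.mk L →
              Φ Y (f.comp φ) = PreAdicSpace.LineBundleClasses.mk L') ∧
          (∀ φ : PreAdicSpace.Hom X.toPreAdicSpace (RigidProjectiveSpace K n),
            Ψ X φ = PreAdicSpace.LineBundleClasses.mk L →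
              Ψ Y (f.comp φ) = PreAdicSpace.LineBundleClasses.mk L')) := by
  have hp : p.Prime := Fact.out
  obtain ⟨π, h0, h1⟩ := hK.exists_pi
  have hS : ProjectiveSpace.IsSetting π (PerfExponents.one p) :=
    ⟨h0, h1, PerfExponents.isExponentMonoid hp.ne_zero⟩
  have hS' : ProjectiveSpace.IsSetting π (1 : ℕ) := ⟨h0, h1, isExponentMonoid_nat⟩
  have hX : ∀ X : PerfectoidSpace p K, X.HasGoodFunctions (PerfExponents.one p) := fun X =>
    X.hasGoodFunctions hp hK h0 h1 fun _ _ hB => PerfExponents.hasUniquePowers hp.ne_zero hB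
  have hX' : ∀ X : PerfectoidSpace p K, X.HasGoodFunctions (1 : ℕ) := fun X =>
    X.hasGoodFunctions hp hK h0 h1 fun B _ _ => hasUniquePowers_nat B
  exact ⟨fun X => .ofBijective _ (hS.bijective_pullbackClass (hX X)),
    fun X => .ofBijective _ (hS'.bijective_pullbackClass (hX' X)),
    fun X φ L => hS.pullbackClass_eq_iff, fun X φ L => hS'.pullbackClass_eq_iff,
    fun X Y f L L' h => ⟨fun φ hφ => hS.pullbackClass_comp h hφ,
      fun φ hφ => hS'.pullbackClass_comp h hφ⟩⟩
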